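/- Let $\Bbbk$ be an algebraically closed field of characteristic $p\ge 0$ and let $n\ge 2$. **The algebras.** The periplectic Brauer category $\mathcal A$ has objects $\mathbb N$, and $\mathrm{Hom}_{\mathcal A}(i,j)$ has as a basis the $(i,j)$-Brauer diagrams, that is, the partitions into pairs of $i$ dots on a lower line and $j$ dots on an upper line. A line of a diagram is a *cup* if it joins two upper dots, a *cap* if it joins two lower dots, and *propagating* otherwise. Marking each cup by a diamond and each cap by an arrow, at pairwise different heights, the *standard marking* of a diagram has all diamonds above all arrows, the diamonds of the cups in descending height from left to right according to the left ends of the cups, the arrows of the caps in ascending height from left to right according to the left ends of the caps, and all arrows pointing from the left end to the right end. The composition $d_1\circ d_2$ is $0$ if the concatenation $d_1*d_2$ ($d_1$ on top) contains a closed loop, and otherwise it is $(-1)^{\gamma}\,d_1*d_2$, where $\gamma$ is the number of signs picked up when the standard markings of $d_1$ and $d_2$ are turned into the standard marking of $d_1*d_2$ by exchanging the heights of adjacent markers (one sign each) and by cancelling a diamond with an arrow on the same line at adjacent height (one sign if the arrow points away from the diamond). Put $$\mathscr J(n)=\{n-2i\mid 0\le i\le n/2\},\qquad A_n=\mathrm{End}_{\mathcal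 A}(n),\qquad C_n=\bigoplus_{i,j\in\mathscr J(n)}\mathrm{Hom}_{\mathcal A}(i,j).$$ Let $e_n^*\in C_n$ be the idempotent given by the identity of $n$. Then $A_n=e_n^*C_ne_n^*$, and there is the exact functor $$F=e_n^*(-):\ C_n\text{-mod}\to A_n\text{-mod}.$$ **The modules.** Let $\Lambda_C$ be the set of pairs $\lambda=(i,[L])$ with $i\in\mathscr J(n)$ and $[L]$ an isomorphism class of simple $\Bbbk\mathbb S_i$-modules (they correspond to the $p$-restricted partitions of $i$); write $|\lambda|=i$ and $L^0(\lambda)=L$. Let $\Lambda_A=\{\lambda\in\Lambda_C\mid|\lambda|\neq 0\}$. Both sets carry the partial order with $\mu<\lambda$ if and only if $|\mu|>|\lambda|$. Let $B\subset C_n$ be the subalgebra spanned by the diagrams without cups. It acts on $L^0(\lambda)$: permutation diagrams in $\mathrm{End}_{\mathcal A}(|\lambda|)$ act as elements of $\mathbb S_{|\lambda|}$, and all other diagrams without cups act by zero. Put $$\overline\Delta(\lambda)=C_n\otimes_BL^0(\lambda),\qquad \overline\Delta=\bigoplus_{\lambda\in\Lambda_C}\overline\Delta(\lambda),$$ let $L_C(\lambda)=\overline\Delta(\lambda)/\mathrm{rad}\,\overline\Delta(\lambda)$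 for $\lambda\in\Lambda_C$, and $L_A(\lambda)=FL_C(\lambda)$ for $\lambda\in\Lambda_A$. Let $\mathcal F(\overline\Delta)$ be the class of all $C_n$-modules with a finite filtration whose sections are direct summands of $\overline\Delta$. **Terminology.** An algebra $R$ with modules $L(\lambda),\Delta(\lambda)$ indexed by a poset $\Lambda$ is *quasi-hereditary with simple modules $L(\lambda)$ and standard modules $\Delta(\lambda)$* if the $L(\lambda)$ form a complete irredundant set of simple modules; $[\Delta(\lambda):L(\lambda)]=1$, and $[\Delta(\lambda):L(\mu)]=0$ unless $\mu\le\lambda$; and the projective cover $P(\lambda)$ of $L(\lambda)$ has a surjection onto $\Delta(\lambda)$ whose kernel has a finite filtration with sections of the form $\Delta(\nu)$, $\nu>\lambda$. For a family $X=(X(\lambda))_\lambda$ of modules, let $\mathcal F(X)$ be the class of modules with a finite filtration whose sections are isomorphic to modules $X(\lambda)$. The family is a *standard system* if $\mathrm{End}(X(\lambda))=\Bbbk$, $\mathrm{Hom}(X(\lambda),X(\mu))=0$ unless $\lambda\le\mu$, and $\mathrm{Ext}^1(X(\lambda),X(\mu))=0$ unless $\lambda<\mu$. **Theorem.** 1.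 Let $n$ be odd. Then $A_n$ and $C_n$ are Morita equivalent through $F$: the functor $F$ is a $\Bbbk$-linear equivalence between the categories of modules. If moreover $p\notin[2,n]$, then $(A_n,\le)$ is quasi-hereditary, with simple modules $L_A(\lambda)$ and standard modules $F\overline\Delta(\lambda)$, $\lambda\in\Lambda_A$. 2. Let $n$ be even and $n\notin\{2,4\}$ ($p$ arbitrary). Then $F$ induces isomorphisms $$\mathrm{Ext}^i_{C_n}(M,N)\ \stackrel{\sim}{\to}\ \mathrm{Ext}^i_{A_n}(FM,FN)\qquad\text{for all }M,N\in\mathcal F(\overline\Delta)\text{ and }i\in\{0,1\}.$$ 3. Let $n\notin\{2,4\}$ and $p\notin[2,n]$. Then $(C_n,\le)$ is quasi-hereditary, with simple modules $L_C(\lambda)$ and standard modules $\Delta(\lambda)=\overline\Delta(\lambda)$, $\lambda\in\Lambda_C$, and - it is a $1$-cover of $A_n$: $A_n=e_n^*C_ne_n^*$, the functor $F$ is fully faithful on finitely generated projective $C_n$-modules, and it induces isomorphisms $\mathrm{Ext}^i_{C_n}(M,N)\to\mathrm{Ext}^i_{A_n}(FM,FN)$ for all $M,N\in\mathcal F(\Delta)$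 and $i\in\{0,1\}$; - it is a Schur algebra of $A_n$: the modules $F\Delta(\lambda)$, $\lambda\in\Lambda_C$, form a standard system for $A_n$, and $F$ restricts to an equivalence $\mathcal F(\Delta)\to\mathcal F(F\Delta)$ under which the short exact sequences with all terms in $\mathcal F(\Delta)$ correspond to those with all terms in $\mathcal F(F\Delta)$. -/

import Mathlib

open CategoryTheory

universe u

namespace Periplectic

/-- An `(i, j)`-Brauer diagram: a partition into pairs of `i` dots on a bottom line
(`Sum.inl`, numbered from left to right) and `j` dots on a top line (`Sum.inr`), given by the
fixed-point-free involution that sends a dot to the other end of its line. -/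
structure Diagram (i j : ℕ) where
  /-- the other end of the line through a dot -/
  partner : Fin i ⊕ Fin j → Fin i ⊕ Fin j
  partner_partner : ∀ x, partner (partner x) = x
  partner_ne : ∀ x, partner x ≠ x

/-- The dots of an `(i, j)`-diagram. -/
abbrev Dot (i j : ℕ) := Fin i ⊕ Fin j

/-- The horizontal position of a dot on its line. -/
def Dot.pos {i j : ℕ} : Dot i j → ℕ := Sum.elim Fin.val Fin.val

/-- A choice of dots; `true` means that the dot is coloured. -/
abbrev Colouring (i j : ℕ) := Dot i j → Bool

namespace Diagram

variable {i j k : ℕ}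

theorem ext' {d d' : Diagram i j} (h : ∀ x, d.partner x = d'.partner x) : d = d' := by
  cases d; cases d'; congr; exact funext h

/-- The line through `x` is a cup (both ends on top) or a cap (both ends at the bottom), that is,
it is not a propagating line. -/
def Turns (d : Diagram i j) (x : Dot i j) : Prop := (d.partner x).isLeft = x.isLeft

instance (d : Diagram i j) (x : Dot i j) : Decidable (d.Turns x) :=
  inferInstanceAs (Decidable (_ = _))

/-- `x` is the left end of a cup or a cap. -/
def IsLeftEnd (d : Diagram i j) (x : Dot i j) : Prop :=
  d.Turns x ∧ Dot.pos x < Dot.pos (d.partner x)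

instance (d : Diagram i j) (x : Dot i j) : Decidable (d.IsLeftEnd x) :=
  inferInstanceAs (Decidable (_ ∧ _))

/-- The order in which the lines of a diagram are met from the outside, seen from the top or from
the bottom: cups (resp. caps) come first, ordered by their left ends from left to right, as in the
standard marking, and then come the propagating lines, ordered by their bottom dots. -/
def rank (d : Diagram i j) (x : Dot i j) : ℕ :=
  if d.Turns x then min (Dot.pos x) (Dot.pos (d.partner x))
  else i + j + (if x.isLeft then Dot.pos x else Dot.pos (d.partner x))

/-- `x` and `y` lie on the same side, `x` to the left of `y`, while the line of `y` comes before the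
line of `x`. -/
def Crosses (d : Diagram i j) (x y : Dot i j) : Prop :=
  x.isLeft = y.isLeft ∧ Dot.pos x < Dot.pos y ∧ d.rank y < d.rank x

instance (d : Diagram i j) (x y : Dot i j) : Decidable (d.Crosses x y) :=
  inferInstanceAs (Decidable (_ ∧ _ ∧ _))

/-- Exactly one end of each cup and each cap is coloured, and the two ends of a propagating line
have the same colour. -/
def Adapted (d : Diagram i j) (c : Colouring i j) : Prop :=
  ∀ x, c (d.partner x) = if d.Turns x then !c x else c x

instance (d : Diagram i j) (c : Colouring i j) : Decidable (d.Adapted c) :=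
  inferInstanceAs (Decidable (∀ _, _))

/-- The sign of a coloured diagram. For an adapted colouring it is the matrix coefficient of the
standardly marked diagram for the action of the category on the tensor powers of the superspace
of dimension `1|1` with an odd supersymmetric form, the coloured dots being the odd basis vectors:
`-1` for every exchange of two odd vectors, and `-1` for each cap whose left end is odd. -/
def weight (d : Diagram i j) (c : Colouring i j) : ℤ :=
  (-1) ^ (Finset.univ.filter fun p : Dot i j × Dot i j =>
      c p.1 ∧ c p.2 ∧ d.Crosses p.1 p.2).card *
  (-1) ^ (Finset.univ.filter fun x : Dot i j =>
      c x ∧ x.isLeft ∧ d.IsLeftEnd x).card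

/-! Signs of diagrams. -/

/-- `-1` if `P` holds and `1` otherwise. -/
def sg (P : Prop) [Decidable P] : ℤ := if P then -1 else 1

theorem sg_congr {P Q : Prop} [Decidable P] [Decidable Q] (h : P ↔ Q) : sg P = sg Q := by
  unfold sg; simp only [h]

theorem sg_sq (P : Prop) [Decidable P] : sg P * sg P = 1 := by unfold sg; split_ifs <;> norm_num

theorem weight_eq (d : Diagram i j) (c : Colouring i j) :
    d.weight c = (∏ x, ∏ y, sg (c x ∧ c y ∧ d.Crosses x y)) *
      ∏ x, sg (c x ∧ x.isLeft ∧ d.IsLeftEnd x) := by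
  unfold weight sg
  rw [Finset.prod_ite, Finset.prod_const_one, mul_one, Finset.prod_const]
  rw [← Finset.prod_product', Finset.prod_ite, Finset.prod_const_one, mul_one, Finset.prod_const]
  rfl

theorem weight_sq (d : Diagram i j) (c : Colouring i j) : d.weight c * d.weight c = 1 := by
  unfold weight
  rw [mul_mul_mul_comm, ← pow_add, ← pow_add, ← two_mul, ← two_mul]
  simp

def flip (p : Dot i j) (c : Colouring i j) : Colouring i j := Function.update c p (!c p)

theorem flip_self (p : Dot i j) (c : Colouring i j) : flip p c p = !c p := by simp [flip]

theorem flip_ne {p x : Dot i j} (h : x ≠ p) (c : Colouring i j) : flip p c x = c x := by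
  simp [flip, h]

theorem flip_flip (p : Dot i j) (c : Colouring i j) : flip p (flip p c) = c := by
  funext x; by_cases h : x = p
  · subst h; simp [flip]
  · simp [flip, h]

theorem not_crosses_self (d : Diagram i j) (x : Dot i j) : ¬ d.Crosses x x := by
  unfold Crosses; omega

/-- effect of switching one colour -/
theorem weight_flip (d : Diagram i j) (c : Colouring i j) (p : Dot i j) :
    d.weight c * d.weight (flip p c) =
      (∏ y, sg (y ≠ p ∧ c y ∧ (d.Crosses p y ∨ d.Crosses y p))) *
        sg (p.isLeft ∧ d.IsLeftEnd p) := by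
  rw [weight_eq, weight_eq, mul_mul_mul_comm, ← Finset.prod_mul_distrib, ← Finset.prod_mul_distrib]
  congr 1
  · have h1 : ∀ x, (∏ y, sg (c x ∧ c y ∧ d.Crosses x y)) *
        (∏ y, sg (flip p c x ∧ flip p c y ∧ d.Crosses x y)) =
        (if x = p then ∏ y, sg (y ≠ p ∧ c y ∧ d.Crosses p y) else 1) *
          sg (x ≠ p ∧ c x ∧ d.Crosses x p) := by
      intro x
      rw [← Finset.prod_mul_distrib]
      by_cases hx : x = p
      · subst hx
        rw [if_pos rfl]
        have : sg (x ≠ x ∧ (c x = true) ∧ d.Crosses x x) = 1 := by simp [sg]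
        rw [this, mul_one]
        refine Finset.prod_congr rfl fun y _ => ?_
        by_cases hy : y = x
        · subst hy; simp [sg, not_crosses_self]
        · rw [flip_self, flip_ne hy]
          cases c x <;> cases c y <;> simp [sg, hy]
      · rw [if_neg hx, one_mul]
        rw [Finset.prod_eq_single p]
        · rw [flip_self, flip_ne hx]
          cases c x <;> cases c p <;> simp [sg, hx]
        · intro y _ hy
          rw [flip_ne hy, flip_ne hx, sg_sq]
        · simp
    rw [Finset.prod_congr rfl fun x _ => h1 x, Finset.prod_mul_distrib, Finset.prod_ite_eq',
      if_pos (Finset.mem_univ _), ← Finset.prod_mul_distrib]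
    refine Finset.prod_congr rfl fun y _ => ?_
    have : ¬ (d.Crosses p y ∧ d.Crosses y p) := by unfold Crosses; omega
    unfold sg
    by_cases h1 : d.Crosses p y <;> by_cases h2 : d.Crosses y p <;> simp_all
  · rw [Finset.prod_eq_single p]
    · rw [flip_self]; cases c p <;> simp [sg]
    · intro y _ hy
      rw [flip_ne hy, sg_sq]
    · simp

/-- sign of an oddOp operator at `p` -/
def jw (c : Colouring i j) (p : Dot i j) : ℤ :=
  ∏ y : Dot i j, sg (c y ∧ y.isLeft = p.isLeft ∧ Dot.pos p < Dot.pos y)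

theorem pos_inj {x y : Dot i j} (h : x.isLeft = y.isLeft) (h' : Dot.pos x = Dot.pos y) : x = y := by
  rcases x with x | x <;> rcases y with y | y <;> simp_all [Dot.pos, Fin.ext_iff]

theorem pos_lt (x : Dot i j) : Dot.pos x < i + j := by
  rcases x with x | x <;> simp [Dot.pos] <;> omega

theorem turns_partner (d : Diagram i j) (x : Dot i j) : d.Turns (d.partner x) ↔ d.Turns x := by
  unfold Turns; rw [d.partner_partner]; exact eq_comm

theorem rank_partner (d : Diagram i j) (x : Dot i j) : d.rank (d.partner x) = d.rank x := by
  unfold rank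
  simp only [turns_partner, d.partner_partner]
  by_cases h : d.Turns x
  · rw [if_pos h, if_pos h, min_comm]
  · rw [if_neg h, if_neg h]
    unfold Turns at h
    cases h1 : (d.partner x).isLeft <;> cases h2 : x.isLeft <;> simp_all

theorem rank_eq (d : Diagram i j) {x y : Dot i j} (h : d.rank x = d.rank y)
    (hs : x.isLeft = y.isLeft) : y = x ∨ y = d.partner x := by
  unfold rank at h
  have a1 := pos_lt x
  have a2 := pos_lt y
  have a3 := pos_lt (d.partner x)
  have a4 := pos_lt (d.partner y)
  by_cases hx : d.Turns x <;> by_cases hy : d.Turns y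
  · rw [if_pos hx, if_pos hy] at h
    unfold Turns at hx hy
    rcases min_choice (Dot.pos x) (Dot.pos (d.partner x)) with e1 | e1 <;>
    rcases min_choice (Dot.pos y) (Dot.pos (d.partner y)) with e2 | e2 <;> rw [e1, e2] at h
    · exact Or.inl (pos_inj hs h).symm
    · right
      have := pos_inj (hs.trans hy.symm) h
      rw [this, d.partner_partner]
    · exact Or.inr (pos_inj (hx.trans hs) h).symm
    · left
      have := pos_inj (hx.trans (hs.trans hy.symm)) h
      rw [← d.partner_partner y, ← this, d.partner_partner]
  · rw [if_pos hx, if_neg hy] at h; split_ifs at h <;> omega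
  · rw [if_neg hx, if_pos hy] at h; split_ifs at h <;> omega
  · rw [if_neg hx, if_neg hy] at h
    unfold Turns at hx hy
    left
    cases h1 : x.isLeft
    · have h2 : y.isLeft = false := by rw [← hs, h1]
      have : d.partner x = d.partner y := by
        apply pos_inj
        · rw [h1] at hx; rw [h2] at hy; simp_all
        · simpa [h1, h2] using h
      rw [← d.partner_partner y, ← this, d.partner_partner]
    · have h2 : y.isLeft = true := by rw [← hs, h1]
      exact (pos_inj hs (by simpa [h1, h2] using h)).symm

def zz (c : Colouring i j) (p : Dot i j) : ℤ := if c p = p.isLeft then 1 else -1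

theorem rank_lt_turns (d : Diagram i j) {p y : Dot i j} (hp : ¬ d.Turns p)
    (h : d.rank p < d.rank y) : ¬ d.Turns y := by
  intro hy
  have := pos_lt y
  unfold rank at h
  rw [if_neg hp, if_pos hy] at h
  have := min_le_left (Dot.pos y) (Dot.pos (d.partner y))
  omega

/-- product of the signs of the strands that lie beyond the strand of `p` -/
def beyond (d : Diagram i j) (c : Colouring i j) (p : Dot i j) : ℤ :=
  ∏ y, sg (c y ∧ y.isLeft = p.isLeft ∧ d.rank p < d.rank y)

theorem reduce (d : Diagram i j) (c : Colouring i j) (p : Dot i j) :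
    (∏ y, sg (y ≠ p ∧ c y ∧ (d.Crosses p y ∨ d.Crosses y p))) * jw c p =
      d.beyond c p * sg (c (d.partner p) ∧ d.Turns p ∧ Dot.pos p < Dot.pos (d.partner p)) := by
  have e : sg (c (d.partner p) ∧ d.Turns p ∧ Dot.pos p < Dot.pos (d.partner p)) =
      ∏ y, if y = d.partner p then
        sg (c (d.partner p) ∧ d.Turns p ∧ Dot.pos p < Dot.pos (d.partner p)) else 1 := by
    rw [Finset.prod_ite_eq', if_pos (Finset.mem_univ _)]
  rw [e]
  unfold jw beyond
  rw [← Finset.prod_mul_distrib, ← Finset.prod_mul_distrib]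
  refine Finset.prod_congr rfl fun y _ => ?_
  by_cases hyp : y = p
  · subst hyp
    rw [if_neg (d.partner_ne y).symm]
    simp [sg]
  by_cases hyq : y = d.partner p
  · subst hyq
    rw [if_pos rfl]
    have h1 : ¬ (d.Crosses p (d.partner p)) := by
      unfold Crosses; rw [rank_partner]; omega
    have h2 : ¬ (d.Crosses (d.partner p) p) := by
      unfold Crosses; rw [rank_partner]; omega
    have e1 : sg (d.partner p ≠ p ∧ c (d.partner p) ∧
        (d.Crosses p (d.partner p) ∨ d.Crosses (d.partner p) p)) = 1 := by simp [sg, h1, h2]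
    have e2 : sg (c (d.partner p) ∧ (d.partner p).isLeft = p.isLeft ∧
        d.rank p < d.rank (d.partner p)) = 1 := by simp [sg, rank_partner]
    rw [e1, e2, one_mul, one_mul]
    exact sg_congr (by unfold Turns; rfl)
  · rw [if_neg hyq, mul_one]
    by_cases hs : y.isLeft = p.isLeft
    · have hr : d.rank p ≠ d.rank y := fun h => by
        rcases d.rank_eq h hs.symm with h | h
        · exact hyp h
        · exact hyq h
      have hpos : Dot.pos p ≠ Dot.pos y := fun h => hyp (pos_inj hs h.symm)
      have hc : (d.Crosses p y ∨ d.Crosses y p) ↔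
          ¬ (Dot.pos p < Dot.pos y ↔ d.rank p < d.rank y) := by
        unfold Crosses
        simp only [hs, true_and]
        omega
      unfold sg
      simp only [hc]
      by_cases h1 : Dot.pos p < Dot.pos y <;> by_cases h2 : d.rank p < d.rank y <;>
        cases c y <;> simp [h1, h2, hs, hyp]
    · have hs' : ¬ p.isLeft = y.isLeft := fun h => hs h.symm
      simp [sg, Crosses, hs, hs']

theorem beyond_partner (d : Diagram i j) (c : Colouring i j) (p : Dot i j)
    (h : ∀ x, x ≠ p → x ≠ d.partner p → c (d.partner x) = if d.Turns x then !c x else c x) :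
    d.beyond c (d.partner p) = d.beyond c p := by
  unfold beyond
  by_cases ht : d.Turns p
  · refine Finset.prod_congr rfl fun y _ => ?_
    unfold Turns at ht
    rw [rank_partner, ht]
  · symm
    refine Finset.prod_bij (fun y _ => d.partner y) (fun _ _ => Finset.mem_univ _) ?_ ?_ ?_
    · intro a _ b _ hab
      rw [← d.partner_partner a, ← d.partner_partner b]
      exact congrArg _ hab
    · intro b _
      exact ⟨d.partner b, Finset.mem_univ _, d.partner_partner b⟩
    · intro y _
      rw [rank_partner, rank_partner]
      by_cases hr : d.rank p < d.rank y
      · have hy := d.rank_lt_turns ht hr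
        have hyp : y ≠ p := by rintro rfl; omega
        have hyq : y ≠ d.partner p := by rintro rfl; rw [rank_partner] at hr; omega
        have := h y hyp hyq
        rw [if_neg hy] at this
        unfold Turns at ht hy
        rw [this]
        have : (y.isLeft = p.isLeft) ↔ ((d.partner y).isLeft = (d.partner p).isLeft) := by
          cases h1 : y.isLeft <;> cases h2 : p.isLeft <;> cases h3 : (d.partner y).isLeft <;>
            cases h4 : (d.partner p).isLeft <;> simp_all
        unfold sg
        simp only [this]
      · simp [sg, hr]

theorem weight_rel (d : Diagram i j) (c : Colouring i j) (p : Dot i j)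
    (h : ∀ x, x ≠ p → x ≠ d.partner p → c (d.partner x) = if d.Turns x then !c x else c x)
    (hp : c (d.partner p) = if d.Turns p then c p else !c p) :
    jw c p * d.weight (flip p c) =
      (if d.Turns p then zz c p else 1) * (jw c (d.partner p) * d.weight (flip (d.partner p) c)) := by
  -- reduce to products of signs
  suffices H : (∏ y, sg (y ≠ p ∧ c y ∧ (d.Crosses p y ∨ d.Crosses y p))) * jw c p *
        sg (p.isLeft ∧ d.IsLeftEnd p) = (if d.Turns p then zz c p else 1) *
        ((∏ y, sg (y ≠ d.partner p ∧ c y ∧ (d.Crosses (d.partner p) y ∨ d.Crosses y (d.partner p))))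
        * jw c (d.partner p) * sg ((d.partner p).isLeft ∧ d.IsLeftEnd (d.partner p))) by
    have e1 := d.weight_flip c p
    have e2 := d.weight_flip c (d.partner p)
    have e3 := d.weight_sq c
    have e1' : d.weight (flip p c) = d.weight c * (d.weight c * d.weight (flip p c)) := by
      rw [← mul_assoc, e3, one_mul]
    have e2' : d.weight (flip (d.partner p) c) =
        d.weight c * (d.weight c * d.weight (flip (d.partner p) c)) := by
      rw [← mul_assoc, e3, one_mul]
    rw [e1', e2', e1, e2]
    linear_combination d.weight c * H
  rw [reduce, reduce, beyond_partner d c p h, d.partner_partner]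
  simp only [turns_partner]
  suffices H2 : sg (c (d.partner p) ∧ d.Turns p ∧ Dot.pos p < Dot.pos (d.partner p)) *
        sg (p.isLeft ∧ d.IsLeftEnd p) = (if d.Turns p then zz c p else 1) *
        (sg (c p ∧ d.Turns p ∧ Dot.pos (d.partner p) < Dot.pos p) *
        sg ((d.partner p).isLeft ∧ d.IsLeftEnd (d.partner p))) by
    linear_combination d.beyond c p * H2
  by_cases ht : d.Turns p
  · have hne : Dot.pos p ≠ Dot.pos (d.partner p) := fun e =>
      d.partner_ne p (pos_inj ht e.symm)
    rw [if_pos ht] at hp ⊢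
    have ht' : (d.partner p).isLeft = p.isLeft := ht
    have ht2 := (d.turns_partner p).2 ht
    have i1 : d.IsLeftEnd p ↔ Dot.pos p < Dot.pos (d.partner p) := by
      unfold IsLeftEnd; simp only [ht, true_and]
    have i2 : d.IsLeftEnd (d.partner p) ↔ Dot.pos (d.partner p) < Dot.pos p := by
      unfold IsLeftEnd; simp only [ht2, true_and, d.partner_partner]
    unfold sg zz
    simp only [ht, ht', hp, i1, i2, true_and]
    rcases lt_or_gt_of_ne hne with h1 | h1 <;> have h2 := not_lt.2 h1.le <;>
      cases c p <;> cases p.isLeft <;> simp [h1, h2]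
  · rw [if_neg ht]
    have ht2 := mt (d.turns_partner p).1 ht
    simp [sg, IsLeftEnd, ht, ht2]

def PreAdapted (d : Diagram i j) (c : Colouring i j) (p : Dot i j) : Prop :=
  (∀ x, x ≠ p → x ≠ d.partner p → c (d.partner x) = if d.Turns x then !c x else c x) ∧
    c (d.partner p) = if d.Turns p then c p else !c p

instance (d : Diagram i j) (c : Colouring i j) (p : Dot i j) : Decidable (d.PreAdapted c p) :=
  inferInstanceAs (Decidable (_ ∧ _))

theorem adapted_flip_iff (d : Diagram i j) (c : Colouring i j) (p : Dot i j) :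
    d.Adapted (flip p c) ↔ d.PreAdapted c p := by
  have hq := d.partner_ne p
  constructor
  · intro h
    refine ⟨fun x h1 h2 => ?_, ?_⟩
    · have := h x
      have h3 : d.partner x ≠ p := fun e => h2 (by rw [← e, d.partner_partner])
      rwa [flip_ne h1, flip_ne h3] at this
    · have := h p
      rw [flip_self, flip_ne hq] at this
      rw [this]; split_ifs <;> simp
  · rintro ⟨h, hp⟩ x
    by_cases h1 : x = p
    · subst h1
      rw [flip_self, flip_ne hq, hp]; split_ifs <;> simp
    by_cases h2 : x = d.partner p
    · subst h2
      rw [d.partner_partner, flip_self, flip_ne hq, hp]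
      simp only [turns_partner]
      split_ifs <;> simp
    · have h3 : d.partner x ≠ p := fun e => h2 (by rw [← e, d.partner_partner])
      rw [flip_ne h1, flip_ne h3, h x h1 h2]

theorem preAdapted_partner (d : Diagram i j) (c : Colouring i j) (p : Dot i j) :
    d.PreAdapted c (d.partner p) ↔ d.PreAdapted c p := by
  unfold PreAdapted
  simp only [turns_partner, d.partner_partner]
  refine and_congr ⟨fun h x h1 h2 => h x h2 h1, fun h x h1 h2 => h x h2 h1⟩ ?_
  split_ifs
  · exact eq_comm
  · cases c p <;> cases c (d.partner p) <;> simp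

def coeff (d : Diagram i j) (c : Colouring i j) : ℤ := if d.Adapted c then d.weight c else 0

def opc (c : Colouring i j) (s : Bool) (p : Dot i j) : ℤ := jw c p * if s then zz c p else 1

theorem zz_sq (c : Colouring i j) (p : Dot i j) : zz c p * zz c p = 1 := by
  unfold zz; split_ifs <;> norm_num

theorem jw_sq (c : Colouring i j) (p : Dot i j) : jw c p * jw c p = 1 := by
  unfold jw
  rw [← Finset.prod_mul_distrib]
  exact Finset.prod_eq_one fun y _ => sg_sq _

theorem opc_sq (c : Colouring i j) (s : Bool) (p : Dot i j) : opc c s p * opc c s p = 1 := by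
  unfold opc
  rw [mul_mul_mul_comm, jw_sq, one_mul]
  split_ifs
  · exact zz_sq c p
  · norm_num

theorem coeff_rel (d : Diagram i j) (c : Colouring i j) (s : Bool) (p : Dot i j) :
    opc c s p * d.coeff (flip p c) =
      opc c (xor s (decide (d.Turns p))) (d.partner p) * d.coeff (flip (d.partner p) c) := by
  unfold coeff
  simp only [adapted_flip_iff, preAdapted_partner]
  by_cases h : d.PreAdapted c p
  · rw [if_pos h, if_pos h]
    have k := d.weight_rel c p h.1 h.2
    have zq : zz c (d.partner p) = zz c p := by
      have h2 := h.2
      unfold zz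
      unfold Turns at h2
      cases h1 : (d.partner p).isLeft <;> cases h3 : p.isLeft <;> cases h4 : c p <;> simp_all
    unfold opc
    rw [zq]
    have z2 := zz_sq c p
    by_cases ht : d.Turns p <;> cases s <;> simp only [ht, if_true, if_false, decide_true,
      decide_false, Bool.xor_false, Bool.xor_true, Bool.not_true, Bool.not_false,
      Bool.false_eq_true] at k ⊢
    · linear_combination k
    · linear_combination zz c p * k + (jw c (d.partner p) * d.weight (flip (d.partner p) c)) * z2
    · linear_combination k
    · linear_combination zz c p * k
  · rw [if_neg h, if_neg h, mul_zero, mul_zero]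

/-! The integral matrix of the coefficients of a diagram. -/

abbrev Mat (i j : ℕ) := Matrix (Fin j → Bool) (Fin i → Bool) ℤ

def ev (N : Mat i j) (c : Colouring i j) : ℤ := N (c ∘ Sum.inr) (c ∘ Sum.inl)

theorem ev_ext {N N' : Mat i j} (h : ∀ c, ev N c = ev N' c) : N = N' := by
  ext u v
  exact h (Sum.elim v u)

def mat (d : Diagram i j) : Mat i j := fun u v => d.coeff (Sum.elim v u)

theorem ev_mat (d : Diagram i j) (c : Colouring i j) : ev d.mat c = d.coeff c := by
  unfold ev mat
  rw [Sum.elim_comp_inl_inr]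

def flipL {n : ℕ} (p : Fin n) (v : Fin n → Bool) : Fin n → Bool := Function.update v p (!v p)

def jwL {n : ℕ} (p : Fin n) (v : Fin n → Bool) : ℤ := ∏ q, sg (v q ∧ p < q)

def oc {n : ℕ} (s : Bool) (p : Fin n) (v : Fin n → Bool) : ℤ :=
  jwL p v * if s then (if v p then 1 else -1) else 1

def oddOp {n : ℕ} (s : Bool) (p : Fin n) : Mat n n := fun u v =>
  if u = flipL p v then oc s p v else 0

theorem flipL_flipL {n : ℕ} (p : Fin n) (v : Fin n → Bool) : flipL p (flipL p v) = v := by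
  funext x; by_cases h : x = p
  · subst h; simp [flipL]
  · simp [flipL, h]

theorem flipL_comm {n : ℕ} (p q : Fin n) (v : Fin n → Bool) :
    flipL p (flipL q v) = flipL q (flipL p v) := by
  by_cases h : p = q
  · rw [h]
  · funext x
    by_cases h1 : x = p <;> by_cases h2 : x = q <;> simp_all [flipL, Function.update_apply]

theorem jwL_flip {n : ℕ} (p q : Fin n) (v : Fin n → Bool) :
    jwL p (flipL q v) = jwL p v * sg (p < q) := by
  unfold jwL
  have : sg (p < q) = ∏ x, if x = q then sg (p < q) else 1 := by
    rw [Finset.prod_ite_eq', if_pos (Finset.mem_univ _)]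
  rw [this, ← Finset.prod_mul_distrib]
  refine Finset.prod_congr rfl fun x _ => ?_
  by_cases h : x = q
  · subst h
    by_cases hp : p < x <;> cases hv : v x <;> simp [sg, flipL, hp, hv]
  · simp [flipL, h]

theorem odd_mul_apply {n : ℕ} (s t : Bool) (p q : Fin n) (u v : Fin n → Bool) :
    (oddOp s p * oddOp t q) u v =
      if u = flipL p (flipL q v) then oc s p (flipL q v) * oc t q v else 0 := by
  rw [Matrix.mul_apply, Finset.sum_eq_single (flipL q v)]
  · unfold oddOp; rw [if_pos rfl, ite_mul, zero_mul]
  · intro w _ hw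
    unfold oddOp; rw [if_neg hw, mul_zero]
  · simp

theorem jwL_sq {n : ℕ} (p : Fin n) (v : Fin n → Bool) : jwL p v * jwL p v = 1 := by
  unfold jwL
  rw [← Finset.prod_mul_distrib]
  exact Finset.prod_eq_one fun y _ => sg_sq _

theorem odd_sq {n : ℕ} (p : Fin n) : oddOp false p * oddOp false p = 1 := by
  ext u v
  rw [odd_mul_apply, flipL_flipL, Matrix.one_apply]
  congr 1
  unfold oc
  rw [jwL_flip]
  have := jwL_sq p v
  simpa [sg] using this

theorem odd_anticomm {n : ℕ} (s t : Bool) (p q : Fin n) (h : p ≠ q ∨ s ≠ t) :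
    oddOp s p * oddOp t q = - (oddOp t q * oddOp s p) := by
  ext u v
  rw [Matrix.neg_apply, odd_mul_apply, odd_mul_apply, flipL_comm q p]
  by_cases hu : u = flipL p (flipL q v)
  · rw [if_pos hu, if_pos hu]
    unfold oc
    rw [jwL_flip, jwL_flip]
    by_cases hpq : p = q
    · subst hpq
      cases s <;> cases t <;> simp_all [flipL, sg] <;> cases v p <;> simp
    · have e1 : flipL q v p = v p := by simp [flipL, hpq]
      have e2 : flipL p v q = v q := by simp [flipL, Ne.symm hpq]
      rw [e1, e2]
      have : sg (p < q) = - sg (q < p) := by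
        rcases lt_or_gt_of_ne hpq with h | h <;> simp [sg, h, h.not_gt]
      rw [this]; ring
  · rw [if_neg hu, if_neg hu, neg_zero]

def act (s : Bool) (p : Dot i j) (N : Mat i j) : Mat i j :=
  match p with
  | Sum.inl a => N * oddOp s a
  | Sum.inr b => oddOp s b * N

theorem ev_act (s : Bool) (p : Dot i j) (N : Mat i j) (c : Colouring i j) :
    ev (act s p N) c = opc c s p * ev N (flip p c) := by
  have hl : ∀ a : Fin i, (flip (Sum.inl a : Dot i j) c) ∘ Sum.inl = flipL a (c ∘ Sum.inl) := by
    intro a; funext x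
    by_cases h : x = a
    · subst h; simp [flip, flipL]
    · simp [flip, flipL, h]
  have hl' : ∀ a : Fin i, (flip (Sum.inl a : Dot i j) c) ∘ Sum.inr = c ∘ Sum.inr := by
    intro a; funext x; simp [flip]
  have hr : ∀ a : Fin j, (flip (Sum.inr a : Dot i j) c) ∘ Sum.inr = flipL a (c ∘ Sum.inr) := by
    intro a; funext x
    by_cases h : x = a
    · subst h; simp [flip, flipL]
    · simp [flip, flipL, h]
  have hr' : ∀ a : Fin j, (flip (Sum.inr a : Dot i j) c) ∘ Sum.inl = c ∘ Sum.inl := by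
    intro a; funext x; simp [flip]
  unfold ev
  rcases p with a | b
  · rw [hl, hl']
    show (N * oddOp s a) _ _ = _
    rw [Matrix.mul_apply, Finset.sum_eq_single (flipL a (c ∘ Sum.inl))]
    · unfold oddOp
      rw [if_pos rfl, mul_comm]
      congr 1
      unfold oc opc jwL jw zz
      rw [Fintype.prod_sum_type]
      simp only [Dot.pos, sg, Sum.isLeft_inl, Sum.isLeft_inr, Sum.elim_inl, Function.comp]
      by_cases h : c (Sum.inl a) = true <;> cases s <;> simp [h]
    · intro w _ hw
      unfold oddOp; rw [if_neg hw, mul_zero]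
    · simp
  · rw [hr, hr']
    show (oddOp s b * N) _ _ = _
    rw [Matrix.mul_apply, Finset.sum_eq_single (flipL b (c ∘ Sum.inr))]
    · unfold oddOp
      rw [flipL_flipL, if_pos rfl]
      congr 1
      unfold oc opc jwL jw zz
      rw [Fintype.prod_sum_type]
      have : ∀ q : Fin j, sg (flipL b (c ∘ Sum.inr) q ∧ b < q) = sg (c (Sum.inr q) ∧ b < q) := by
        intro q
        by_cases h : q = b
        · subst h; simp [sg]
        · simp [flipL, h]
      rw [Finset.prod_congr rfl fun q _ => this q]
      simp [Dot.pos, sg, flipL]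
      cases c (Sum.inr b) <;> simp
    · intro w _ hw
      unfold oddOp
      rw [if_neg, zero_mul]
      intro e
      rw [e, flipL_flipL] at hw
      exact hw rfl
    · simp

theorem act_mat (d : Diagram i j) (s : Bool) (p : Dot i j) :
    act s p d.mat = act (xor s (decide (d.Turns p))) (d.partner p) d.mat := by
  refine ev_ext fun c => ?_
  rw [ev_act, ev_act, ev_mat, ev_mat, coeff_rel]

theorem flip_comm (p q : Dot i j) (c : Colouring i j) : flip p (flip q c) = flip q (flip p c) := by
  by_cases h : p = q
  · rw [h]
  · funext x
    by_cases h1 : x = p <;> by_cases h2 : x = q <;> simp_all [flip, Function.update_apply]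

theorem ev_rel (d : Diagram i j) (N : Mat i j)
    (hN : ∀ s p, act s p N = act (xor s (decide (d.Turns p))) (d.partner p) N)
    (c : Colouring i j) (s : Bool) (p : Dot i j) :
    opc (flip p c) s p * ev N c = opc (flip p c) (xor s (decide (d.Turns p))) (d.partner p) *
      ev N (flip (d.partner p) (flip p c)) := by
  have := congrArg (fun N => ev N (flip p c)) (hN s p)
  simpa only [ev_act, flip_flip] using this

theorem ev_eq_zero (d : Diagram i j) (N : Mat i j)
    (hN : ∀ s p, act s p N = act (xor s (decide (d.Turns p))) (d.partner p) N)
    (c : Colouring i j) (hc : ¬ d.Adapted c) : ev N c = 0 := by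
  unfold Adapted at hc
  push Not at hc
  obtain ⟨p, hp⟩ := hc
  have h0 := ev_rel d N hN c false p
  have h1 := ev_rel d N hN c true p
  have j1 := jw_sq (flip p c) p
  have j2 := jw_sq (flip p c) (d.partner p)
  have hz : zz (flip p c) (d.partner p) = - zz (flip p c) p := by
    unfold zz
    rw [flip_self, flip_ne (d.partner_ne p)]
    unfold Turns at hp
    cases h1 : (d.partner p).isLeft <;> cases h2 : p.isLeft <;> cases h3 : c p <;>
      cases h4 : c (d.partner p) <;> simp_all
  have z2 := zz_sq (flip p c) p
  unfold opc at h0 h1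
  rw [hz] at h0 h1
  by_cases ht : d.Turns p <;> simp only [ht, if_true, if_false, decide_true,
      decide_false, Bool.xor_false, Bool.xor_true, Bool.not_true, Bool.not_false,
      Bool.false_eq_true] at h0 h1
  · have : 2 * ev N c = 0 := by
      linear_combination (jw (flip p c) p) * h0 + (jw (flip p c) p * zz (flip p c) p) * h1
        - 2 * ev N c * j1 + (- jw (flip p c) p * jw (flip p c) p * ev N c) * z2
    linarith
  · have : 2 * ev N c = 0 := by
      linear_combination (jw (flip p c) p) * h0 + (jw (flip p c) p * zz (flip p c) p) * h1
        - 2 * ev N c * j1 + (- jw (flip p c) p * jw (flip p c) p * ev N c -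
          jw (flip p c) p * (jw (flip p c) (d.partner p)) *
          ev N (flip (d.partner p) (flip p c))) * z2
    linarith

theorem ev_flip_flip (d : Diagram i j) (N : Mat i j)
    (hN : ∀ s p, act s p N = act (xor s (decide (d.Turns p))) (d.partner p) N)
    (c : Colouring i j) (p : Dot i j) :
    ev N c * d.coeff c = ev N (flip (d.partner p) (flip p c)) *
      d.coeff (flip (d.partner p) (flip p c)) := by
  have h0 := ev_rel d N hN c false p
  have h1 := ev_rel d d.mat d.act_mat c false p
  rw [ev_mat, ev_mat] at h1
  have j1 := opc_sq (flip p c) false p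
  have j2 := opc_sq (flip p c) (xor false (decide (d.Turns p))) (d.partner p)
  generalize opc (flip p c) (xor false (decide (d.Turns p))) (d.partner p) = K at *
  generalize opc (flip p c) false p = L at *
  generalize ev N c = a at *
  generalize d.coeff c = b at *
  generalize ev N (flip (d.partner p) (flip p c)) = a' at *
  generalize d.coeff (flip (d.partner p) (flip p c)) = b' at *
  linear_combination (L * b) * h0 + (K * a') * h1 + a' * b' * j2 - a * b * j1

theorem ev_mul_coeff (d : Diagram i j) (N : Mat i j)
    (hN : ∀ s p, act s p N = act (xor s (decide (d.Turns p))) (d.partner p) N)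
    (c₀ : Colouring i j) (h₀ : d.Adapted c₀) (n : ℕ) : ∀ (c : Colouring i j),
    d.Adapted c → (Finset.univ.filter fun x => c x ≠ c₀ x).card = n →
    ev N c * d.coeff c = ev N c₀ * d.coeff c₀ := by
  induction n using Nat.strong_induction_on with
  | _ n ih =>
    intro c hc hn
    by_cases h : ∃ p, c p ≠ c₀ p
    · obtain ⟨p, hp⟩ := h
      rw [ev_flip_flip d N hN c p]
      have hq : c (d.partner p) ≠ c₀ (d.partner p) := by
        rw [hc p, h₀ p]; split_ifs
        · simpa using hp
        · exact hp
      refine ih _ ?_ _ ?_ rfl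
      · rw [← hn]
        apply Finset.card_lt_card
        refine ⟨fun x hx => ?_, fun hs => ?_⟩
        · rw [Finset.mem_filter] at hx ⊢
          refine ⟨hx.1, ?_⟩
          by_cases h1 : x = p
          · rw [h1]; exact hp
          · by_cases h2 : x = d.partner p
            · rw [h2]; exact hq
            · have := hx.2
              rwa [flip_ne h2, flip_ne h1] at this
        · have := hs (x := p) (by simp [hp])
          rw [Finset.mem_filter, flip_ne (d.partner_ne p).symm, flip_self] at this
          have := this.2
          cases h1 : c p <;> cases h2 : c₀ p <;> simp_all
      · have := (d.adapted_flip_iff (flip p c) p).1 (by rwa [flip_flip])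
        rw [adapted_flip_iff, preAdapted_partner]
        exact this
    · push Not at h
      rw [funext h]

theorem eq_smul_mat (d : Diagram i j) (N : Mat i j)
    (hN : ∀ s p, act s p N = act (xor s (decide (d.Turns p))) (d.partner p) N)
    (c₀ : Colouring i j) (h₀ : d.Adapted c₀) :
    N = (ev N c₀ * d.weight c₀) • d.mat := by
  refine ev_ext fun c => ?_
  have e : ev ((ev N c₀ * d.weight c₀) • d.mat) c = (ev N c₀ * d.weight c₀) * d.coeff c := by
    rw [← ev_mat]; rfl
  rw [e]
  by_cases hc : d.Adapted c
  · have := ev_mul_coeff d N hN c₀ h₀ _ c hc rfl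
    unfold coeff at this ⊢
    rw [if_pos hc, if_pos h₀] at this
    rw [if_pos hc, ← this, mul_assoc, weight_sq, mul_one]
  · rw [ev_eq_zero d N hN c hc]
    unfold coeff
    rw [if_neg hc, mul_zero]

/-- The colouring of the left ends of all cups and caps; on a single standardly marked diagram it
serves as the reference colouring. -/
def canon (d : Diagram i j) : Colouring i j := fun x => decide (d.IsLeftEnd x)

theorem adapted_canon (d : Diagram i j) : d.Adapted d.canon := by
  intro x
  have ht := d.turns_partner x
  unfold canon IsLeftEnd
  simp only [d.partner_partner]
  by_cases h : d.Turns x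
  · have hne : Dot.pos x ≠ Dot.pos (d.partner x) := fun e => d.partner_ne x (pos_inj h e.symm)
    simp only [ht, h, true_and, if_true]
    rcases lt_or_gt_of_ne hne with h1 | h1 <;> simp [h1, h1.not_gt]
  · simp [ht, h]

theorem coeff_ne_zero (d : Diagram i j) (c : Colouring i j) : d.coeff c ≠ 0 ↔ d.Adapted c := by
  unfold coeff
  by_cases h : d.Adapted c
  · have := d.weight_sq c
    simp only [h, if_true, iff_true]
    intro h0; rw [h0] at this; simp at this
  · simp [h]

theorem eq_of_adapted {d d' : Diagram i j} (h : ∀ c, d.Adapted c ↔ d'.Adapted c) : d = d' := by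
  refine ext' fun x => ?_
  by_contra hne
  have h1 := (h _).1 d.adapted_canon
  have h2 : d.Adapted (flip (d.partner x) (flip x d.canon)) := by
    rw [adapted_flip_iff, preAdapted_partner, ← adapted_flip_iff, flip_flip]
    exact d.adapted_canon
  have h3 := (h _).1 h2 x
  have h4 := h1 x
  rw [flip_ne (Ne.symm hne), flip_ne (d'.partner_ne x), flip_ne (d.partner_ne x).symm, flip_self,
    h4] at h3
  split_ifs at h3 <;> simp at h3

theorem mat_inj {d d' : Diagram i j} {a b : ℤ} (ha : a ≠ 0) (hb : b ≠ 0)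
    (h : a • d.mat = b • d'.mat) : d = d' := by
  refine eq_of_adapted fun c => ?_
  have := congrArg (fun N => ev N c) h
  have e : a * d.coeff c = b * d'.coeff c := by
    rw [← ev_mat, ← ev_mat]; exact this
  rw [← coeff_ne_zero, ← coeff_ne_zero]
  constructor
  · intro h1 h2; rw [h2, mul_zero] at e; exact (mul_ne_zero ha h1) e
  · intro h1 h2; rw [h2, mul_zero] at e; exact (mul_ne_zero hb h1) e.symm

theorem mat_ne_zero (d : Diagram i j) : d.mat ≠ 0 := by
  intro h
  have := d.ev_mat d.canon
  rw [h] at this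
  exact (d.coeff_ne_zero _).2 d.adapted_canon this.symm

end Diagram

/-- The dots of the picture in which a `(j, k)`-diagram is put on top of an `(i, j)`-diagram, before
the `j` dots in the middle (which occur twice) are identified. -/
abbrev StackDot (i j k : ℕ) := Dot i j ⊕ Dot j k

namespace StackDot

variable {i j k : ℕ}

/-- Interchange the two copies of each middle dot and fix the outer dots. -/
def glue : StackDot i j k → StackDot i j k
  | Sum.inl (Sum.inr m) => Sum.inr (Sum.inl m)
  | Sum.inr (Sum.inl m) => Sum.inl (Sum.inr m)
  | p => p

/-- The outer dots, which are the dots of the composed diagram. -/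
def outer : Dot i k → StackDot i j k
  | Sum.inl a => Sum.inl (Sum.inl a)
  | Sum.inr c => Sum.inr (Sum.inr c)

/-- Whether a dot is a bottom dot of the diagram it belongs to. -/
def side (p : StackDot i j k) : Bool := Sum.elim Sum.isLeft Sum.isLeft p

theorem glue_glue (p : StackDot i j k) : glue (glue p) = p := by
  rcases p with (a | m) | (m | c) <;> rfl

theorem glue_outer (x : Dot i k) : glue (outer (j := j) x) = outer x := by
  rcases x with a | c <;> rfl

theorem side_outer (x : Dot i k) : side (outer (j := j) x) = x.isLeft := by
  rcases x with a | c <;> rfl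

theorem outer_inj {x y : Dot i k} (h : outer (j := j) x = outer y) : x = y := by
  rcases x with a | c <;> rcases y with a' | c' <;> simp_all [outer]

theorem outer_or (p : StackDot i j k) : (∃ x, p = outer x) ∨ (glue p ≠ p ∧ side (glue p) = !side p) := by
  rcases p with (a | m) | (m | c)
  · exact Or.inl ⟨Sum.inl a, rfl⟩
  · right; simp [glue, side]
  · right; simp [glue, side]
  · exact Or.inl ⟨Sum.inr c, rfl⟩

theorem side_glue {p : StackDot i j k} (h : glue p ≠ p) : side (glue p) = !side p := by
  rcases outer_or p with ⟨x, rfl⟩ | h'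
  · exact absurd (glue_outer x) h
  · exact h'.2

end StackDot

open StackDot

namespace Diagram

variable {i j k : ℕ} (d₁ : Diagram j k) (d₂ : Diagram i j)

/-- Follow a line of one of the two diagrams to its other end. -/
def along : StackDot i j k → StackDot i j k := Sum.map d₂.partner d₁.partner

theorem along_along (p : StackDot i j k) : along d₁ d₂ (along d₁ d₂ p) = p := by
  rcases p with x | x <;> simp [along, partner_partner]

theorem along_ne (p : StackDot i j k) : along d₁ d₂ p ≠ p := by
  rcases p with x | x <;> simp [along, partner_ne]

/-- Following the line through `p`, starting into the diagram of `p` and crossing the middle as often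
as needed, one ends at the outer dot `y`. -/
inductive Exits : StackDot i j k → Dot i k → Prop
  | leave {p : StackDot i j k} {y : Dot i k} (h : along d₁ d₂ p = outer y) : Exits p y
  | cross {p : StackDot i j k} {y : Dot i k} (h : glue (along d₁ d₂ p) ≠ along d₁ d₂ p)
      (h' : Exits (glue (along d₁ d₂ p)) y) : Exits p y

variable {d₁ d₂}

theorem Exits.of_mid {p : StackDot i j k} {y : Dot i k} (h : Exits d₁ d₂ p y)
    (hp : glue (along d₁ d₂ p) ≠ along d₁ d₂ p) : Exits d₁ d₂ (glue (along d₁ d₂ p)) y := by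
  cases h with
  | leave h => rw [h] at hp; exact absurd (glue_outer y) hp
  | cross _ h => exact h

theorem Exits.unique {p : StackDot i j k} {y z : Dot i k} (h : Exits d₁ d₂ p y)
    (h' : Exits d₁ d₂ p z) : y = z := by
  induction h with
  | leave h =>
    cases h' with
    | leave h' => exact outer_inj (h.symm.trans h')
    | cross h' _ => rw [h] at h'; exact absurd (glue_outer _) h'
  | cross h _ ih => exact ih (h'.of_mid h)

theorem Exits.back {p : StackDot i j k} {x z : Dot i k} (h : Exits d₁ d₂ p x)
    (hp : glue p ≠ p) (h' : Exits d₁ d₂ (glue p) z) : Exits d₁ d₂ (outer x) z := by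
  induction h generalizing z with
  | @leave p y h =>
    have e : along d₁ d₂ (outer y) = p := by rw [← h, along_along]
    exact .cross (by rwa [e]) (by rwa [e])
  | @cross p y h _ ih =>
    refine ih (by rw [glue_glue]; exact h.symm) ?_
    rw [glue_glue]
    exact .cross (by rwa [along_along]) (by rwa [along_along])

theorem Exits.forth {p : StackDot i j k} {x z : Dot i k} (h : Exits d₁ d₂ p x)
    (hp : glue p ≠ p) (h' : Exits d₁ d₂ (outer x) z) : Exits d₁ d₂ (glue p) z := by
  induction h with
  | @leave p y h =>
    have e : along d₁ d₂ (outer y) = p := by rw [← h, along_along]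
    have := h'.of_mid (by rwa [e])
    rwa [e] at this
  | @cross p y h _ ih =>
    have := ih (by rw [glue_glue]; exact h.symm) h'
    rw [glue_glue] at this
    have := this.of_mid (by rwa [along_along])
    rwa [along_along] at this

variable (d₁ d₂)

theorem exits_along_outer (x : Dot i k) : Exits d₁ d₂ (along d₁ d₂ (outer x)) x :=
  .leave (along_along _ _ _)

def alongPerm : Equiv.Perm (StackDot i j k) :=
  ⟨along d₁ d₂, along d₁ d₂, along_along d₁ d₂, along_along d₁ d₂⟩

def gluePerm : Equiv.Perm (StackDot i j k) := ⟨glue, glue, glue_glue, glue_glue⟩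

def step : Equiv.Perm (StackDot i j k) := gluePerm * alongPerm d₁ d₂

theorem step_apply (p : StackDot i j k) : step d₁ d₂ p = glue (along d₁ d₂ p) := rfl

theorem exits_of_pow (n : ℕ) : ∀ p : StackDot i j k,
    glue (along d₁ d₂ ((step d₁ d₂ ^ n) p)) = along d₁ d₂ ((step d₁ d₂ ^ n) p) →
      ∃ y, Exits d₁ d₂ p y := by
  induction n with
  | zero =>
    intro p h
    rcases outer_or (along d₁ d₂ p) with ⟨x, hx⟩ | h'
    · exact ⟨x, .leave hx⟩
    · exact absurd h h'.1
  | succ n ih =>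
    intro p h
    rcases outer_or (along d₁ d₂ p) with ⟨x, hx⟩ | h'
    · exact ⟨x, .leave hx⟩
    · rw [pow_succ, Equiv.Perm.mul_apply] at h
      obtain ⟨y, hy⟩ := ih _ h
      exact ⟨y, .cross h'.1 hy⟩

theorem Exits.exists_pow {p : StackDot i j k} {y : Dot i k} (h : Exits d₁ d₂ p y) :
    ∃ n, along d₁ d₂ ((step d₁ d₂ ^ n) p) = outer y ∧ ∀ m < n,
      glue (along d₁ d₂ ((step d₁ d₂ ^ m) p)) ≠ along d₁ d₂ ((step d₁ d₂ ^ m) p) := by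
  induction h with
  | leave h => exact ⟨0, h, by simp⟩
  | cross h _ ih =>
    obtain ⟨n, h1, h2⟩ := ih
    refine ⟨n + 1, ?_, ?_⟩
    · rw [pow_succ, Equiv.Perm.mul_apply]; exact h1
    · intro m hm
      cases m with
      | zero => exact h
      | succ m =>
        rw [pow_succ, Equiv.Perm.mul_apply]
        exact h2 m (by omega)

theorem exists_exits (x : Dot i k) : ∃ y, Exits d₁ d₂ (outer x) y := by
  have hN := orderOf_pos (step d₁ d₂)
  refine exits_of_pow d₁ d₂ (orderOf (step d₁ d₂) - 1) _ ?_
  have h : glue (along d₁ d₂ ((step d₁ d₂ ^ (orderOf (step d₁ d₂) - 1)) (outer x))) = outer x := by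
    rw [← step_apply, ← Equiv.Perm.mul_apply, ← pow_succ', Nat.sub_add_cancel hN, pow_orderOf_eq_one]
    rfl
  have h2 := congrArg glue h
  rw [glue_glue, glue_outer] at h2
  rw [h2, glue_outer]

theorem along_pow (n : ℕ) (p : StackDot i j k) :
    along d₁ d₂ ((step d₁ d₂ ^ n) p) = ((step d₁ d₂)⁻¹ ^ n) (along d₁ d₂ p) := by
  induction n generalizing p with
  | zero => rfl
  | succ n ih =>
    rw [pow_succ, Equiv.Perm.mul_apply, ih, pow_succ, Equiv.Perm.mul_apply]
    congr 1

theorem Exits.ne {x y : Dot i k} (h : Exits d₁ d₂ (outer x) y) : y ≠ x := by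
  rintro rfl
  obtain ⟨n, h1, h2⟩ := h.exists_pow
  have h3 : along d₁ d₂ (outer y) = (step d₁ d₂ ^ n) (outer y) := by
    have := congrArg (along d₁ d₂) h1
    rw [along_along] at this
    exact this.symm
  obtain ⟨m, rfl | rfl⟩ := Nat.even_or_odd' n
  · apply along_ne d₁ d₂ ((step d₁ d₂ ^ m) (outer y))
    rw [along_pow, h3, two_mul, pow_add, Equiv.Perm.mul_apply, inv_pow]
    exact Equiv.symm_apply_apply _ _
  · apply h2 m (by omega)
    rw [← step_apply, ← Equiv.Perm.mul_apply, ← pow_succ', along_pow, h3]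
    rw [show step d₁ d₂ ^ (2 * m + 1) = step d₁ d₂ ^ m * step d₁ d₂ ^ (m + 1) by
      rw [← pow_add]; congr 1; ring, Equiv.Perm.mul_apply, inv_pow]
    exact (Equiv.symm_apply_apply _ _).symm

theorem Exits.symm {x y : Dot i k} (h : Exits d₁ d₂ (outer x) y) : Exits d₁ d₂ (outer y) x := by
  cases h with
  | leave h => exact .leave (by rw [← h, along_along])
  | cross h h' =>
    refine h'.back (by rw [glue_glue]; exact h.symm) ?_
    rw [glue_glue]
    exact exits_along_outer d₁ d₂ x

/-- The diagram obtained by concatenation, `d₁` on top of `d₂`; closed loops are ignored. -/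
noncomputable def comp : Diagram i k where
  partner x := (exists_exits d₁ d₂ x).choose
  partner_partner x := by
    have h := (exists_exits d₁ d₂ x).choose_spec
    exact (exists_exits d₁ d₂ _).choose_spec.unique h.symm
  partner_ne x := (exists_exits d₁ d₂ x).choose_spec.ne

theorem exits_comp (x : Dot i k) : Exits d₁ d₂ (outer x) ((comp d₁ d₂).partner x) :=
  (exists_exits d₁ d₂ x).choose_spec

/-- The concatenation contains a closed loop: some middle dot is not connected to an outer dot. -/
def HasLoop : Prop := ∃ m : Fin j, ¬ ∃ y, Exits d₁ d₂ (Sum.inl (Sum.inr m)) y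

open Classical in
/-- The colour that a middle dot must have if the outer dots are coloured by the reference colouring
of the concatenation and both diagrams are to be adapted: follow the line down through `d₂`. -/
noncomputable def midColour (m : Fin j) : Bool :=
  decide (∃ y, Exits d₁ d₂ (Sum.inl (Sum.inr m)) y ∧ xor ((comp d₁ d₂).canon y) y.isRight)

open Classical in
/-- The sign in `d₁ ∘ d₂ = sign d₁ d₂ • (concatenation)`: it is `0` if there is a closed loop, and
otherwise `(-1) ^ γ`, where `γ` is the number of signs picked up when the two standard markings are
transformed into the standard marking of the concatenation by exchanging adjacent markers (each
exchange gives `-1`) and by cancelling a diamond with an adjacent arrow on the same line (which gives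
`-1` if the arrow points away from the diamond). It is written here in closed form: colour the left
ends of the cups and caps of the concatenation, extend this along all lines, and compare the sign of
the two coloured diagrams with the sign of the coloured concatenation. That is, the sign is
determined by `mat_mul_mat` below. -/
noncomputable def sign : ℤ :=
  if HasLoop d₁ d₂ then 0
  else d₁.weight (Sum.elim (midColour d₁ d₂) ((comp d₁ d₂).canon ∘ Sum.inr)) *
    d₂.weight (Sum.elim ((comp d₁ d₂).canon ∘ Sum.inl) (midColour d₁ d₂)) *
    (comp d₁ d₂).weight (comp d₁ d₂).canon

/-! The product of the matrices of two diagrams. -/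

def tr (s : Bool) (p : StackDot i j k) : Mat i k :=
  match p with
  | Sum.inl x => d₁.mat * act s x d₂.mat
  | Sum.inr y => act s y d₁.mat * d₂.mat

theorem tr_glue (s : Bool) (p : StackDot i j k) : tr d₁ d₂ s (glue p) = tr d₁ d₂ s p := by
  rcases p with (a | m) | (m | c)
  · rfl
  · exact Matrix.mul_assoc _ _ _
  · exact (Matrix.mul_assoc _ _ _).symm
  · rfl

theorem tr_along (s : Bool) (p : StackDot i j k) : tr d₁ d₂ s p =
    tr d₁ d₂ (xor s (decide (side (along d₁ d₂ p) = side p))) (along d₁ d₂ p) := by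
  rcases p with x | x
  · exact congrArg (d₁.mat * ·) (d₂.act_mat s x)
  · exact congrArg (· * d₂.mat) (d₁.act_mat s x)

theorem tr_outer (s : Bool) (x : Dot i k) :
    tr d₁ d₂ s (outer x) = act s x (d₁.mat * d₂.mat) := by
  rcases x with a | c
  · exact (Matrix.mul_assoc _ _ _).symm
  · exact Matrix.mul_assoc _ _ _

theorem Exits.tr_eq {p : StackDot i j k} {y : Dot i k} (h : Exits d₁ d₂ p y) (s : Bool) :
    tr d₁ d₂ s p = tr d₁ d₂ (xor s (decide (y.isLeft = side p))) (outer y) := by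
  induction h generalizing s with
  | @leave p y h => rw [tr_along, h, side_outer]
  | @cross p y h _ ih =>
    rw [tr_along, ← tr_glue, ih, side_glue h]
    congr 1
    cases s <;> cases side p <;> cases side (along d₁ d₂ p) <;> cases y.isLeft <;> rfl

theorem act_mul (s : Bool) (x : Dot i k) : act s x (d₁.mat * d₂.mat) =
    act (xor s (decide ((comp d₁ d₂).Turns x))) ((comp d₁ d₂).partner x) (d₁.mat * d₂.mat) := by
  rw [← tr_outer, ← tr_outer, (exits_comp d₁ d₂ x).tr_eq, side_outer]
  rfl

theorem mat_mul : d₁.mat * d₂.mat = (ev (d₁.mat * d₂.mat) (comp d₁ d₂).canon *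
    (comp d₁ d₂).weight (comp d₁ d₂).canon) • (comp d₁ d₂).mat :=
  eq_smul_mat _ _ (act_mul d₁ d₂) _ (adapted_canon _)

theorem mul_eq_zero_of_loop (h : HasLoop d₁ d₂) : d₁.mat * d₂.mat = 0 := by
  obtain ⟨m₀, h⟩ := h
  set p₀ : StackDot i j k := Sum.inl (Sum.inr m₀) with hp₀
  have hmid : ∀ n, glue (along d₁ d₂ ((step d₁ d₂ ^ n) p₀)) ≠ along d₁ d₂ ((step d₁ d₂ ^ n) p₀) :=
    fun n hn => h (exits_of_pow d₁ d₂ n p₀ hn)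
  let Q : Fin j → Mat i k := fun m => d₁.mat * (oddOp false m₀ * oddOp false m) * d₂.mat
  have hQ0 : Q m₀ = d₁.mat * d₂.mat := by
    show d₁.mat * (oddOp false m₀ * oddOp false m₀) * d₂.mat = _
    rw [odd_sq, Matrix.mul_one]
  -- one turn around the loop
  have key : ∀ m : Fin j, ∀ n, (step d₁ d₂ ^ n) p₀ = Sum.inl (Sum.inr m) →
      ∃ m', (step d₁ d₂ ^ (n + 2)) p₀ = Sum.inl (Sum.inr m') ∧
        Q m = - (d₁.mat * (oddOp false m' * oddOp false m₀) * d₂.mat) := by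
    intro m n hn
    have h1 := hmid n
    have h2 := hmid (n + 1)
    rw [pow_succ', Equiv.Perm.mul_apply, step_apply] at h2
    have e3 : (step d₁ d₂ ^ (n + 2)) p₀ =
        glue (along d₁ d₂ (glue (along d₁ d₂ ((step d₁ d₂ ^ n) p₀)))) := by
      rw [pow_succ', Equiv.Perm.mul_apply, pow_succ', Equiv.Perm.mul_apply]; rfl
    rw [hn] at h1 h2 e3
    have a1 : along d₁ d₂ (Sum.inl (Sum.inr m)) = Sum.inl (d₂.partner (Sum.inr m)) := rfl
    rw [a1] at h1 h2 e3
    rcases hd : d₂.partner (Sum.inr m) with a | m1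
    · rw [hd] at h1; exact absurd rfl h1
    rw [hd] at h1 h2 e3
    have a2 : along d₁ d₂ (glue (Sum.inl (Sum.inr m1))) = Sum.inr (d₁.partner (Sum.inl m1)) := rfl
    rw [a2] at h2 e3
    rcases hd' : d₁.partner (Sum.inl m1) with m2 | c
    · rw [hd'] at h2 e3
      refine ⟨m2, e3, ?_⟩
      have r1 : oddOp false m * d₂.mat = oddOp true m1 * d₂.mat := by
        have := d₂.act_mat false (Sum.inr m)
        simpa [Turns, hd, act] using this
      have r2 : d₁.mat * oddOp true m1 = d₁.mat * oddOp false m2 := by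
        have := d₁.act_mat true (Sum.inl m1)
        simpa [Turns, hd', act] using this
      show d₁.mat * (oddOp false m₀ * oddOp false m) * d₂.mat = _
      rw [Matrix.mul_assoc, Matrix.mul_assoc, r1, ← Matrix.mul_assoc (oddOp false m₀),
        odd_anticomm false true _ _ (Or.inr (by simp)), Matrix.neg_mul, Matrix.mul_neg,
        ← Matrix.mul_assoc, ← Matrix.mul_assoc, r2, Matrix.mul_assoc d₁.mat]
    · rw [hd'] at h2; exact absurd rfl h2
  -- the first return
  have hex : ∃ n, (step d₁ d₂ ^ (2 * (n + 1))) p₀ = p₀ := by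
    refine ⟨orderOf (step d₁ d₂) - 1, ?_⟩
    rw [Nat.sub_add_cancel (orderOf_pos _), mul_comm, pow_mul, pow_orderOf_eq_one, one_pow]
    rfl
  classical
  have claim : ∀ n, n ≤ Nat.find hex → ∃ m, (step d₁ d₂ ^ (2 * n)) p₀ = Sum.inl (Sum.inr m) ∧
      Q m = d₁.mat * d₂.mat := by
    intro n
    induction n with
    | zero => intro _; exact ⟨m₀, rfl, hQ0⟩
    | succ n ih =>
      intro hn
      obtain ⟨m, hm, hQ⟩ := ih (by omega)
      obtain ⟨m', hm', hQ'⟩ := key m _ hm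
      refine ⟨m', by rw [← hm']; rfl, ?_⟩
      have hne : m' ≠ m₀ := by
        rintro rfl
        exact Nat.find_min hex (m := n) (by omega) hm'
      rw [← hQ, hQ', odd_anticomm false false m' m₀ (Or.inl hne)]
      rw [Matrix.mul_neg, Matrix.neg_mul, neg_neg]
  obtain ⟨m, hm, hQ⟩ := claim _ le_rfl
  obtain ⟨m', hm', hQ'⟩ := key m _ hm
  have hs := Nat.find_spec hex
  have : m' = m₀ := by
    have := hm'.symm.trans hs
    simpa [hp₀] using this
  subst this
  have h2 : d₁.mat * d₂.mat = - (d₁.mat * d₂.mat) := by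
    rw [odd_sq, Matrix.mul_one] at hQ'
    exact hQ.symm.trans hQ'
  ext u v
  have := congrFun (congrFun h2 u) v
  rw [Matrix.neg_apply] at this
  rw [Matrix.zero_apply]
  omega


/-! Colourings of the two stacked diagrams. -/

def stackColour (b : Fin i → Bool) (u : Fin j → Bool) (t : Fin k → Bool) : StackDot i j k → Bool :=
  Sum.elim (Sum.elim b u) (Sum.elim u t)

theorem stackColour_glue (b : Fin i → Bool) (u : Fin j → Bool) (t : Fin k → Bool)
    (p : StackDot i j k) : stackColour b u t (glue p) = stackColour b u t p := by
  rcases p with (a | m) | (m | c) <;> rfl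

theorem stackColour_outer (b : Fin i → Bool) (u : Fin j → Bool) (t : Fin k → Bool)
    (x : Dot i k) : stackColour b u t (outer x) = Sum.elim b t x := by
  rcases x with a | c <;> rfl

theorem adapted_iff (b : Fin i → Bool) (u : Fin j → Bool) (t : Fin k → Bool) :
    (d₁.Adapted (Sum.elim u t) ∧ d₂.Adapted (Sum.elim b u)) ↔
      ∀ p : StackDot i j k, stackColour b u t (along d₁ d₂ p) =
        xor (stackColour b u t p) (decide (side (along d₁ d₂ p) = side p)) := by
  have e : ∀ (x : Bool) (P : Prop) [Decidable P], (if P then !x else x) = xor x (decide P) := by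
    intro x P _
    by_cases h : P <;> simp [h]
  constructor
  · rintro ⟨h1, h2⟩ (x | x)
    · have := h2 x
      rw [e] at this
      exact this
    · have := h1 x
      rw [e] at this
      exact this
  · intro h
    refine ⟨fun x => ?_, fun x => ?_⟩
    · rw [e]; exact h (Sum.inr x)
    · rw [e]; exact h (Sum.inl x)

variable {d₁ d₂} in
theorem Exits.colour {p : StackDot i j k} {y : Dot i k} (h : Exits d₁ d₂ p y)
    {b : Fin i → Bool} {u : Fin j → Bool} {t : Fin k → Bool}
    (hc : ∀ p : StackDot i j k, stackColour b u t (along d₁ d₂ p) =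
        xor (stackColour b u t p) (decide (side (along d₁ d₂ p) = side p))) :
    stackColour b u t p = xor (Sum.elim b t y) (decide (y.isLeft = side p)) := by
  induction h with
  | @leave p y h =>
    have := hc p
    rw [h, stackColour_outer, side_outer] at this
    rw [this]
    cases stackColour b u t p <;> cases side p <;> cases y.isLeft <;> rfl
  | @cross p y h _ ih =>
    have := hc p
    rw [stackColour_glue, this, side_glue h] at ih
    generalize stackColour b u t p = A at *
    generalize Sum.elim b t y = B at *
    generalize side p = S at *
    generalize side (along d₁ d₂ p) = S' at *
    generalize y.isLeft = Y at *
    revert ih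
    cases A <;> cases B <;> cases S <;> cases S' <;> cases Y <;> simp

theorem midColour_eq {m : Fin j} {y : Dot i k} (h : Exits d₁ d₂ (Sum.inl (Sum.inr m)) y) :
    midColour d₁ d₂ m = xor ((comp d₁ d₂).canon y) y.isRight := by
  classical
  unfold midColour
  rw [Bool.eq_iff_iff]
  simp only [decide_eq_true_eq]
  constructor
  · rintro ⟨z, hz, hc⟩
    rwa [h.unique hz]
  · intro hc
    exact ⟨y, h, hc⟩

noncomputable abbrev canonColour : StackDot i j k → Bool :=
  stackColour ((comp d₁ d₂).canon ∘ Sum.inl) (midColour d₁ d₂) ((comp d₁ d₂).canon ∘ Sum.inr)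

theorem canonColour_outer (x : Dot i k) :
    canonColour d₁ d₂ (outer x) = (comp d₁ d₂).canon x := by
  unfold canonColour
  rw [stackColour_outer, Sum.elim_comp_inl_inr]

variable {d₁ d₂} in
theorem Exits.partner {p : StackDot i j k} {x : Dot i k} (h : Exits d₁ d₂ p x)
    (hp : glue p ≠ p) : Exits d₁ d₂ (glue p) ((comp d₁ d₂).partner x) :=
  h.forth hp (exits_comp d₁ d₂ x)

theorem canon_partner (x : Dot i k) : (comp d₁ d₂).canon ((comp d₁ d₂).partner x) =
    xor ((comp d₁ d₂).canon x) (decide (((comp d₁ d₂).partner x).isLeft = x.isLeft)) := by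
  rw [(comp d₁ d₂).adapted_canon x]
  have e : ∀ (x : Bool) (P : Prop) [Decidable P], (if P then !x else x) = xor x (decide P) := by
    intro x P _
    by_cases h : P <;> simp [h]
  rw [e]; rfl

theorem canonColour_exits (hl : ¬ HasLoop d₁ d₂) (p : StackDot i j k) :
    ∃ y, Exits d₁ d₂ p y ∧ canonColour d₁ d₂ p =
      xor ((comp d₁ d₂).canon y) (decide (y.isLeft = side p)) := by
  unfold HasLoop at hl
  push Not at hl
  have hmid : ∀ m, ∃ y, Exits d₁ d₂ (Sum.inl (Sum.inr m)) y ∧ canonColour d₁ d₂ (Sum.inl (Sum.inr m))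
      = xor ((comp d₁ d₂).canon y) (decide (y.isLeft = side (Sum.inl (Sum.inr m) : StackDot i j k))) := by
    intro m
    obtain ⟨y, hy⟩ := hl m
    refine ⟨y, hy, (midColour_eq d₁ d₂ hy).trans ?_⟩
    rcases y with a | c <;> simp [side]
  have hout : ∀ x : Dot i k, ∃ y, Exits d₁ d₂ (outer x) y ∧ canonColour d₁ d₂ (outer x) =
      xor ((comp d₁ d₂).canon y) (decide (y.isLeft = side (outer (j := j) x))) := by
    intro x
    refine ⟨_, exits_comp d₁ d₂ x, ?_⟩
    rw [canonColour_outer, side_outer, canon_partner]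
    simp
  rcases p with (a | m) | (m | c)
  · exact hout (Sum.inl a)
  · exact hmid m
  · obtain ⟨y, hy, hc⟩ := hmid m
    refine ⟨_, hy.partner (by simp [glue]), ?_⟩
    have e : canonColour d₁ d₂ (Sum.inr (Sum.inl m)) = canonColour d₁ d₂ (Sum.inl (Sum.inr m)) := rfl
    rw [e, hc, canon_partner]
    show _ = _
    simp only [glue, side, Sum.elim_inl, Sum.elim_inr, Sum.isLeft_inl, Sum.isLeft_inr]
    cases (comp d₁ d₂).canon y <;> cases y.isLeft <;>
      cases ((comp d₁ d₂).partner y).isLeft <;> rfl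
  · exact hout (Sum.inr c)

theorem canonColour_adapted (hl : ¬ HasLoop d₁ d₂) (p : StackDot i j k) :
    canonColour d₁ d₂ (along d₁ d₂ p) =
      xor (canonColour d₁ d₂ p) (decide (side (along d₁ d₂ p) = side p)) := by
  obtain ⟨y, hy, hc⟩ := canonColour_exits d₁ d₂ hl (along d₁ d₂ p)
  rw [hc]
  rcases outer_or p with ⟨x, rfl⟩ | ⟨hp, hs⟩
  · rw [hy.unique (exits_along_outer d₁ d₂ x), canonColour_outer, side_outer]
    congr 1
    exact decide_eq_decide.2 eq_comm
  · have h1 := hy.of_mid (by rwa [along_along])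
    rw [along_along] at h1
    obtain ⟨z, hz, hc'⟩ := canonColour_exits d₁ d₂ hl (glue p)
    unfold canonColour at hc' ⊢
    rw [stackColour_glue] at hc'
    rw [hc', hz.unique h1, hs]
    cases (comp d₁ d₂).canon y <;> cases y.isLeft <;> cases side p <;>
      cases side (along d₁ d₂ p) <;> rfl

/-- The matrices multiply like the diagrams. -/
theorem mat_mul_mat : d₁.mat * d₂.mat = sign d₁ d₂ • (comp d₁ d₂).mat := by
  by_cases hl : HasLoop d₁ d₂
  · rw [mul_eq_zero_of_loop d₁ d₂ hl, sign, if_pos hl, zero_smul]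
  · rw [sign, if_neg hl]
    have h := mat_mul d₁ d₂
    have hu : ∀ u : Fin j → Bool, (d₁.Adapted (Sum.elim u ((comp d₁ d₂).canon ∘ Sum.inr)) ∧
        d₂.Adapted (Sum.elim ((comp d₁ d₂).canon ∘ Sum.inl) u)) ↔ u = midColour d₁ d₂ := by
      intro u
      rw [adapted_iff]
      constructor
      · intro hc
        funext m
        obtain ⟨y, hy, hc'⟩ := canonColour_exits d₁ d₂ hl (Sum.inl (Sum.inr m))
        have := hy.colour hc
        rw [Sum.elim_comp_inl_inr] at this
        exact this.trans hc'.symm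
      · rintro rfl
        exact canonColour_adapted d₁ d₂ hl
    have e : ev (d₁.mat * d₂.mat) (comp d₁ d₂).canon =
        d₁.weight (Sum.elim (midColour d₁ d₂) ((comp d₁ d₂).canon ∘ Sum.inr)) *
        d₂.weight (Sum.elim ((comp d₁ d₂).canon ∘ Sum.inl) (midColour d₁ d₂)) := by
      unfold ev
      rw [Matrix.mul_apply, Finset.sum_eq_single (midColour d₁ d₂)]
      · have := (hu _).2 rfl
        unfold mat coeff
        rw [if_pos this.1, if_pos this.2]
      · intro u _ hne
        have := mt (hu u).1 hne
        unfold mat coeff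
        rw [not_and_or] at this
        rcases this with h | h
        · rw [if_neg h, zero_mul]
        · rw [if_neg h, mul_zero]
      · simp
    rw [← e]
    exact h

theorem sign_mul_self (hl : ¬ HasLoop d₁ d₂) : sign d₁ d₂ * sign d₁ d₂ = 1 := by
  rw [sign, if_neg hl]
  have a := d₁.weight_sq (Sum.elim (midColour d₁ d₂) ((comp d₁ d₂).canon ∘ Sum.inr))
  have b := d₂.weight_sq (Sum.elim ((comp d₁ d₂).canon ∘ Sum.inl) (midColour d₁ d₂))
  have c := (comp d₁ d₂).weight_sq (comp d₁ d₂).canon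
  generalize d₁.weight _ = x at *
  generalize d₂.weight _ = y at *
  generalize (comp d₁ d₂).weight _ = z at *
  linear_combination y * y * z * z * a + z * z * b + c

/-- The identity diagram, consisting of `n` non-crossing propagating lines. -/
def one (n : ℕ) : Diagram n n where
  partner := Sum.swap
  partner_partner := Sum.swap_swap
  partner_ne x := by rcases x with x | x <;> simp

theorem mat_one (n : ℕ) : (one n).mat = 1 := by
  have hT : ∀ x, ¬ (one n).Turns x := by
    intro x; rcases x with x | x <;> simp [Turns, one]
  have hr : ∀ x : Dot n n, (one n).rank x = n + n + Dot.pos x := by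
    intro x
    unfold rank
    rw [if_neg (hT x)]
    rcases x with x | x <;> simp [one, Dot.pos]
  ext u v
  have hA : (one n).Adapted (Sum.elim v u) ↔ u = v := by
    constructor
    · intro h
      funext m
      have := h (Sum.inl m)
      rw [if_neg (hT _)] at this
      exact this
    · rintro rfl x
      rw [if_neg (hT _)]
      rcases x with x | x <;> rfl
  unfold mat coeff
  rw [Matrix.one_apply]
  simp only [hA]
  congr 1
  rw [weight_eq, Finset.prod_eq_one, Finset.prod_eq_one, one_mul]
  · intro x _
    simp [sg, IsLeftEnd, hT]
  · intro x _
    refine Finset.prod_eq_one fun y _ => ?_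
    have : ¬ (one n).Crosses x y := by
      unfold Crosses; rw [hr, hr]; omega
    simp [sg, this]

theorem smul_mat_inj {d d' : Diagram i j} {a b : ℤ} (ha : a ≠ 0) (h : a • d.mat = b • d'.mat) :
    d = d' ∧ a = b := by
  have hb : b ≠ 0 := by
    rintro rfl
    rw [zero_smul] at h
    exact (smul_ne_zero ha d.mat_ne_zero) h
  have hd := mat_inj ha hb h
  subst hd
  refine ⟨rfl, ?_⟩
  have : (a - b) • d.mat = 0 := by rw [sub_smul, h, sub_self]
  rcases smul_eq_zero.1 this with h | h
  · omega
  · exact absurd h d.mat_ne_zero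

theorem comp_one (d : Diagram i j) : comp d (one i) = d ∧ sign d (one i) = 1 := by
  have h := mat_mul_mat d (one i)
  rw [mat_one, Matrix.mul_one] at h
  have := smul_mat_inj (a := 1) one_ne_zero ((one_smul ℤ d.mat).trans h)
  exact ⟨this.1.symm, this.2.symm⟩

theorem one_comp (d : Diagram i j) : comp (one j) d = d ∧ sign (one j) d = 1 := by
  have h := mat_mul_mat (one j) d
  rw [mat_one, Matrix.one_mul] at h
  have := smul_mat_inj (a := 1) one_ne_zero ((one_smul ℤ d.mat).trans h)
  exact ⟨this.1.symm, this.2.symm⟩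

theorem comp_assoc {l : ℕ} (d₁ : Diagram k l) (d₂ : Diagram j k) (d₃ : Diagram i j) :
    sign d₁ d₂ * sign (comp d₁ d₂) d₃ = sign d₂ d₃ * sign d₁ (comp d₂ d₃) ∧
      (sign d₁ d₂ * sign (comp d₁ d₂) d₃ ≠ 0 →
        comp (comp d₁ d₂) d₃ = comp d₁ (comp d₂ d₃)) := by
  have h : (sign d₁ d₂ * sign (comp d₁ d₂) d₃) • (comp (comp d₁ d₂) d₃).mat =
      (sign d₂ d₃ * sign d₁ (comp d₂ d₃)) • (comp d₁ (comp d₂ d₃)).mat := by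
    rw [mul_smul, mul_smul, ← mat_mul_mat, ← mat_mul_mat, ← Matrix.smul_mul, ← mat_mul_mat,
      ← Matrix.mul_smul, ← mat_mul_mat, Matrix.mul_assoc]
  by_cases h0 : sign d₁ d₂ * sign (comp d₁ d₂) d₃ = 0
  · refine ⟨?_, fun h => absurd h0 h⟩
    rw [h0, zero_smul] at h
    rcases smul_eq_zero.1 h.symm with h | h
    · rw [h0, h]
    · exact absurd h (mat_ne_zero _)
  · have := smul_mat_inj h0 h
    exact ⟨this.2, fun _ => this.1⟩

end Diagram

section general

variable {R : Type u} [Ring R]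

/-- The module has a finite filtration whose sections satisfy `Q` (which should be invariant under
isomorphisms). -/
inductive IsFilteredBy (Q : ModuleCat.{u} R → Prop) : ModuleCat.{u} R → Prop
  | zero {M : ModuleCat.{u} R} (h : Limits.IsZero M) : IsFilteredBy Q M
  | extend {M' M M'' : ModuleCat.{u} R} (f : M' ⟶ M) (g : M ⟶ M'') (w : f ≫ g = 0)
      (hfg : (ShortComplex.mk f g w).ShortExact) (h' : IsFilteredBy Q M') (h'' : Q M'') :
      IsFilteredBy Q M

/-- The module has a finite filtration whose sections are isomorphic to some `X a`. -/
def IsDeltaFiltered {ι : Type u} (X : ι → ModuleCat.{u} R) : ModuleCat.{u} R → Prop :=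
  IsFilteredBy fun Y => ∃ a, Nonempty (Y ≅ X a)

/-- The module has a finite filtration whose sections are isomorphic to direct summands of `X`. -/
def IsSummandFiltered (X : ModuleCat.{u} R) : ModuleCat.{u} R → Prop :=
  IsFilteredBy fun Y => Nonempty (Retract Y X)

/-- The module `M` has a composition series in which exactly `m` of the factors are isomorphic to
`S`; that is, `M` has finite length and `[M : S] = m`. -/
def HasMultiplicity (M S : ModuleCat.{u} R) (m : ℕ) : Prop :=
  ∃ s : CompositionSeries (Submodule R M), RelSeries.head s = ⊥ ∧ RelSeries.last s = ⊤ ∧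
    Nat.card {t : Fin s.length // Nonempty
      ((↥(s t.succ) ⧸ (s t.castSucc).submoduleOf (s t.succ)) ≃ₗ[R] S)} = m

/-- `π : P ⟶ S` is a projective cover: `P` is projective, and `π` is an essential epimorphism. -/
structure IsProjectiveCover {P S : ModuleCat.{u} R} (π : P ⟶ S) : Prop where
  projective : Projective P
  epi : Epi π
  essential : ∀ ⦃X : ModuleCat.{u} R⦄ (g : X ⟶ P), Epi (g ≫ π) → Epi g

/-- `R` is quasi-hereditary with respect to the partial order on `ι`, with simple modules `L a` and
standard modules `Δ a`. The `L a` represent the isomorphism classes of simple modules;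
`[Δ a : L a] = 1`, and `[Δ a : L b] = 0` unless `b ≤ a`; and the projective cover `P` of `L a` has a
surjection onto `Δ a` whose kernel is filtered by modules `Δ b` with `a < b`. -/
structure IsQuasiHereditary {ι : Type u} [PartialOrder ι] (L Δ : ι → ModuleCat.{u} R) : Prop where
  simple : ∀ a, IsSimpleModule R (L a)
  irredundant : ∀ a b, Nonempty (L a ≅ L b) → a = b
  complete : ∀ S : ModuleCat.{u} R, IsSimpleModule R S → ∃ a, Nonempty (S ≅ L a)
  multiplicity_one : ∀ a, HasMultiplicity (Δ a) (L a) 1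
  multiplicity_zero : ∀ a b, ¬ b ≤ a → HasMultiplicity (Δ a) (L b) 0
  projective : ∀ a, ∃ (P : ModuleCat.{u} R) (π : P ⟶ L a) (q : P ⟶ Δ a), IsProjectiveCover π ∧
    Function.Surjective q ∧ IsFilteredBy (fun Y => ∃ b, a < b ∧ Nonempty (Y ≅ Δ b))
      (ModuleCat.of R (LinearMap.ker q.hom))

/-- A standard system for a partially ordered set: `End (X a) = k`, `Hom (X a, X b) = 0` unless
`a ≤ b`, and `Ext¹ (X a, X b) = 0` unless `a < b`. -/
structure IsStandardSystem (k : Type u) [Field k] [Algebra k R] {ι : Type u} [PartialOrder ι]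
    (X : ι → ModuleCat.{u} R) : Prop where
  endo : ∀ a, Function.Bijective (algebraMap k (End (X a)))
  hom : ∀ a b, ¬ a ≤ b → Subsingleton (X a ⟶ X b)
  ext : ∀ a b, ¬ a < b → Subsingleton (Abelian.Ext (X a) (X b) 1)

/-- Two maximal left ideals are equivalent if the corresponding simple modules are isomorphic, so that
the equivalence classes are the isomorphism classes of simple left modules. -/
def simpleSetoid (R : Type u) [Ring R] : Setoid {I : Submodule R R // IsCoatom I} where
  r I I' := Nonempty ((R ⧸ I.1) ≃ₗ[R] (R ⧸ I'.1))
  iseqv := ⟨fun _ => ⟨LinearEquiv.refl _ _⟩, fun ⟨e⟩ => ⟨e.symm⟩, fun ⟨e⟩ ⟨e'⟩ => ⟨e.trans e'⟩⟩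

end general

variable (k : Type u) [Field k]

/-- The vector space with the `(i, j)`-Brauer diagrams as a basis. -/
abbrev HomSpace (i j : ℕ) : Type u := Diagram i j →₀ k

variable {k} in
/-- The bilinear composition of morphisms. -/
noncomputable def compose {i j l : ℕ} :
    HomSpace k j l →ₗ[k] HomSpace k i j →ₗ[k] HomSpace k i l :=
  Finsupp.linearCombination k fun d₁ => Finsupp.linearCombination k fun d₂ =>
    Finsupp.single (Diagram.comp d₁ d₂) (Diagram.sign d₁ d₂ : k)

theorem compose_single {i j l : ℕ} (d₁ : Diagram j l) (d₂ : Diagram i j) (a b : k) :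
    compose (Finsupp.single d₁ a) (Finsupp.single d₂ b) =
      Finsupp.single (Diagram.comp d₁ d₂) (a * b * (Diagram.sign d₁ d₂ : k)) := by
  rw [compose, Finsupp.linearCombination_single, LinearMap.smul_apply,
    Finsupp.linearCombination_single, Finsupp.smul_single, Finsupp.smul_single, smul_eq_mul,
    smul_eq_mul, mul_assoc]

variable {k} in
theorem compose_one {i j : ℕ} (f : HomSpace k i j) :
    compose f (Finsupp.single (Diagram.one i) 1) = f := by
  induction f using Finsupp.induction_linear with
  | zero => simp
  | add f g hf hg => rw [map_add, LinearMap.add_apply, hf, hg]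
  | single d a => rw [compose_single, (Diagram.comp_one d).1, (Diagram.comp_one d).2]; simp

variable {k} in
theorem one_compose {i j : ℕ} (f : HomSpace k i j) :
    compose (Finsupp.single (Diagram.one j) 1) f = f := by
  induction f using Finsupp.induction_linear with
  | zero => simp
  | add f g hf hg => rw [map_add, hf, hg]
  | single d a => rw [compose_single, (Diagram.one_comp d).1, (Diagram.one_comp d).2]; simp

variable {k} in
theorem compose_assoc {i j l m : ℕ} (f : HomSpace k l m) (g : HomSpace k j l) (h : HomSpace k i j) :
    compose (compose f g) h = compose f (compose g h) := by
  induction f using Finsupp.induction_linear with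
  | zero => simp
  | add f f' hf hf' => simp only [map_add, LinearMap.add_apply, hf, hf']
  | single d₁ a =>
    induction g using Finsupp.induction_linear with
    | zero => simp
    | add f f' hf hf' => simp only [map_add, LinearMap.add_apply, hf, hf']
    | single d₂ b =>
      induction h using Finsupp.induction_linear with
      | zero => simp
      | add f f' hf hf' => simp only [map_add, hf, hf']
      | single d₃ c =>
        simp only [compose_single]
        obtain ⟨h1, h2⟩ := Diagram.comp_assoc d₁ d₂ d₃
        have h1' : (Diagram.sign d₁ d₂ : k) * Diagram.sign (Diagram.comp d₁ d₂) d₃ =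
          Diagram.sign d₂ d₃ * Diagram.sign d₁ (Diagram.comp d₂ d₃) := by
          have := congrArg (Int.cast : ℤ → k) h1
          push_cast at this
          exact this
        by_cases h0 : Diagram.sign d₁ d₂ * Diagram.sign (Diagram.comp d₁ d₂) d₃ = 0
        · have h0' : (Diagram.sign d₁ d₂ : k) * Diagram.sign (Diagram.comp d₁ d₂) d₃ = 0 := by
            have := congrArg (Int.cast : ℤ → k) h0
            push_cast at this
            exact this
          have e1 : a * b * (Diagram.sign d₁ d₂ : k) * c * Diagram.sign (Diagram.comp d₁ d₂) d₃ = 0 := by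
            linear_combination a * b * c * h0'
          have e2 : a * (b * c * (Diagram.sign d₂ d₃ : k)) * Diagram.sign d₁ (Diagram.comp d₂ d₃) = 0 := by
            linear_combination a * b * c * h0' - a * b * c * h1'
          rw [e1, e2, Finsupp.single_zero, Finsupp.single_zero]
        · rw [h2 h0]
          congr 1
          linear_combination a * b * c * h1'

/-- The objects of the periplectic Brauer category over `k`: the natural numbers. -/
structure BrauerCategory (k : Type u) where
  /-- number of dots -/
  dots : ℕ

namespace BrauerCategory

/-- The periplectic Brauer category. -/
noncomputable instance : Category.{u} (BrauerCategory k) where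
  Hom i j := HomSpace k i.dots j.dots
  id i := Finsupp.single (Diagram.one i.dots) 1
  comp f g := compose g f
  id_comp f := compose_one f
  comp_id f := one_compose f
  assoc f g h := (compose_assoc h g f).symm

noncomputable instance : Preadditive (BrauerCategory k) where
  homGroup i j := inferInstanceAs (AddCommGroup (HomSpace k i.dots j.dots))
  add_comp _ _ _ f f' g := (compose g).map_add f f'
  comp_add _ _ _ f g g' := congrArg (fun c => c f) (compose.map_add g g')

noncomputable instance : Linear k (BrauerCategory k) where
  homModule i j := inferInstanceAs (Module k (HomSpace k i.dots j.dots))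
  smul_comp _ _ _ r f g := (compose g).map_smul r f
  comp_smul _ _ _ f r g := congrArg (fun c => c f) (compose.map_smul r g)

end BrauerCategory

noncomputable instance (M N : Mat_ (BrauerCategory k)) : Module k (M ⟶ N) :=
  inferInstanceAs (Module k (∀ i j, M.X i ⟶ N.X j))

noncomputable instance : Linear k (Mat_ (BrauerCategory k)) where
  smul_comp M N K r f g := by
    refine Mat_.hom_ext _ _ fun i j => ?_
    show ∑ l, (r • f i l) ≫ g l j = r • ∑ l, f i l ≫ g l j
    simp only [Linear.smul_comp, Finset.smul_sum]
  comp_smul M N K f r g := by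
    refine Mat_.hom_ext _ _ fun i j => ?_
    show ∑ l, f i l ≫ (r • g l j) = r • ∑ l, f i l ≫ g l j
    simp only [Linear.comp_smul, Finset.smul_sum]

/-- The set `{n - 2 i | 0 ≤ i ≤ n / 2}`. -/
def J (n : ℕ) : Finset ℕ := (Finset.range (n / 2 + 1)).image fun i => n - 2 * i

theorem self_mem_J (n : ℕ) : n ∈ J n := Finset.mem_image.2 ⟨0, by simp, rfl⟩

/-- The periplectic Brauer algebra, the endomorphism algebra of the object `n`; the product `a * b`
is the composition `a ∘ b`, with `a` on top of `b`. -/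
abbrev BrauerAlgebra (n : ℕ) : Type u := End (⟨n⟩ : BrauerCategory k)

/-- The tuple of the objects `i ∈ J n`. -/
def total (n : ℕ) : Mat_ (BrauerCategory k) where
  ι := J n
  X i := ⟨i⟩

/-- The algebra `⨁ Hom (i, j)`, `i, j ∈ J n`: its elements are the matrices `c` with entries
`c i j` in `Hom (i, j)`, multiplied by composition. -/
abbrev CoverAlgebra (n : ℕ) : Type u := End (total k n)

variable (n : ℕ)

/-- The identity of `n` if `i = n`, and zero otherwise. -/
noncomputable def toTop (i : ℕ) : (⟨i⟩ : BrauerCategory k) ⟶ ⟨n⟩ :=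
  if h : i = n then eqToHom (congrArg BrauerCategory.mk h) else 0

/-- The identity of `n` if `i = n`, and zero otherwise. -/
noncomputable def fromTop (i : ℕ) : (⟨n⟩ : BrauerCategory k) ⟶ ⟨i⟩ :=
  if h : n = i then eqToHom (congrArg BrauerCategory.mk h) else 0

theorem sum_fromTop_toTop : ∑ i : J n, fromTop k n i ≫ toTop k n i = 𝟙 (⟨n⟩ : BrauerCategory k) := by
  rw [Finset.sum_eq_single ⟨n, self_mem_J n⟩]
  · simp [fromTop, toTop]
  · intro i _ hi
    have : ¬ n = i := fun h => hi (Subtype.ext h.symm)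
    rw [fromTop, dif_neg this, Limits.zero_comp]
  · simp

/-- The inclusion of `End (n)` into `⨁ Hom (i, j)`, by zero outside of the block `(n, n)`. -/
noncomputable def corner : BrauerAlgebra k n →ₙ+* CoverAlgebra k n where
  toFun a := fun (i j : J n) => toTop k n i ≫ a ≫ fromTop k n j
  map_mul' a b := by
    refine Mat_.hom_ext (M := total k n) (N := total k n) _ _ fun (i j : J n) => ?_
    show toTop k n i ≫ (b ≫ a) ≫ fromTop k n j =
      ∑ l : J n, (toTop k n i ≫ b ≫ fromTop k n l) ≫ (toTop k n l ≫ a ≫ fromTop k n j)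
    have : ∀ l : J n, (toTop k n i ≫ b ≫ fromTop k n l) ≫ (toTop k n l ≫ a ≫ fromTop k n j) =
      toTop k n i ≫ b ≫ (fromTop k n l ≫ toTop k n l) ≫ a ≫ fromTop k n j := by simp
    simp_rw [this, ← Preadditive.comp_sum, ← Preadditive.sum_comp, sum_fromTop_toTop]
    simp
  map_zero' := by
    refine Mat_.hom_ext (M := total k n) (N := total k n) _ _ fun (i j : J n) => ?_
    show toTop k n i ≫ (0 : BrauerAlgebra k n) ≫ fromTop k n j = 0
    rw [Limits.zero_comp, Limits.comp_zero]
  map_add' a b := by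
    refine Mat_.hom_ext (M := total k n) (N := total k n) _ _ fun (i j : J n) => ?_
    show toTop k n i ≫ (a + b) ≫ fromTop k n j = _ + _
    rw [Preadditive.add_comp, Preadditive.comp_add]
    rfl

theorem corner_smul (r : k) (a : BrauerAlgebra k n) : corner k n (r • a) = r • corner k n a := by
  refine Mat_.hom_ext (M := total k n) (N := total k n) _ _ fun (i j : J n) => ?_
  show toTop k n i ≫ (r • a) ≫ fromTop k n j = r • (toTop k n i ≫ a ≫ fromTop k n j)
  rw [Linear.smul_comp, Linear.comp_smul]

/-- The idempotent given by the identity of `n`. -/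
noncomputable def idem : CoverAlgebra k n := corner k n 1

theorem idem_mul_corner (a : BrauerAlgebra k n) : idem k n * corner k n a = corner k n a := by
  rw [idem, ← map_mul, one_mul]

theorem idem_mul_idem : idem k n * idem k n = idem k n := idem_mul_corner k n 1

section
variable {k n} (M : Type*) [AddCommGroup M] [Module (CoverAlgebra k n) M]

/-- The subgroup `e M` of `M`, where `e` is the idempotent given by the identity of `n`. -/
def fixedPart : AddSubgroup M where
  carrier := {m | idem k n • m = m}
  zero_mem' := smul_zero _
  add_mem' {a b} ha hb := by
    show _ • (a + b) = _
    rw [smul_add, ha, hb]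
  neg_mem' {a} ha := by
    show _ • (- a) = _
    rw [smul_neg, ha]

variable {M}

theorem idem_smul_mem (m : M) : idem k n • m ∈ fixedPart (k := k) (n := n) M := by
  show _ • _ • _ = _
  rw [smul_smul, idem_mul_idem]

theorem corner_smul_mem (a : BrauerAlgebra k n) (m : M) : corner k n a • m ∈ fixedPart (k := k) (n := n) M := by
  show _ • _ • _ = _
  rw [smul_smul, idem_mul_corner]

/-- `A` acts on `e M` through the inclusion. -/
noncomputable instance : Module (BrauerAlgebra k n) (fixedPart (k := k) (n := n) M) where
  smul a m := ⟨corner k n a • (m : M), corner_smul_mem a _⟩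
  one_smul m := Subtype.ext m.2
  mul_smul a b m := Subtype.ext (by
    show corner k n (a * b) • (m : M) = corner k n a • corner k n b • (m : M)
    rw [map_mul, mul_smul])
  smul_zero a := Subtype.ext (smul_zero _)
  smul_add a x y := Subtype.ext (smul_add _ _ _)
  add_smul a b x := Subtype.ext (by
    show corner k n (a + b) • (x : M) = corner k n a • (x : M) + corner k n b • (x : M)
    rw [map_add, add_smul])
  zero_smul x := Subtype.ext (by
    show corner k n 0 • (x : M) = 0
    rw [map_zero, zero_smul])

end

/-- The functor `M ↦ e M` to the modules over `e C e = A`. -/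
noncomputable def coverFunctor : ModuleCat.{u} (CoverAlgebra k n) ⥤ ModuleCat.{u} (BrauerAlgebra k n) where
  obj M := ModuleCat.of (BrauerAlgebra k n) (fixedPart (k := k) (n := n) M)
  map {M N} f := ModuleCat.ofHom
    { toFun m := ⟨f.hom m.1, by
        have : idem k n • m.1 = m.1 := m.2
        show _ • _ = _
        rw [← map_smul, this]⟩
      map_add' x y := Subtype.ext (map_add f.hom _ _)
      map_smul' a x := Subtype.ext (map_smul f.hom (corner k n a) x.1) }

instance : (coverFunctor k n).Additive where
  map_add := rfl

open scoped ModuleCat in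
theorem algebraMap_smul_fixed (M : ModuleCat.{u} (CoverAlgebra k n)) (r : k) (m : (coverFunctor k n).obj M) :
    ((r • m : (coverFunctor k n).obj M)).1 = r • (m.1 : M) := by
  show corner k n (algebraMap k (BrauerAlgebra k n) r) • m.1 = algebraMap k (CoverAlgebra k n) r • m.1
  have h : idem k n • m.1 = m.1 := m.2
  conv_rhs => rw [← h, smul_smul]
  congr 1
  rw [Algebra.algebraMap_eq_smul_one, Algebra.algebraMap_eq_smul_one, corner_smul, smul_mul_assoc,
    one_mul]
  rfl

instance : (coverFunctor k n).Linear k where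
  map_smul {M N} f r := by
    ext m
    apply Subtype.ext
    exact (algebraMap_smul_fixed k n N r ((coverFunctor k n).map f m)).symm

theorem coverFunctor_exact (S : ShortComplex (ModuleCat.{u} (CoverAlgebra k n))) (h : S.Exact) :
    (S.map (coverFunctor k n)).Exact := by
  rw [ShortComplex.moduleCat_exact_iff] at h ⊢
  rintro ⟨x, hx⟩ h0
  obtain ⟨y, hy⟩ := h x (congrArg Subtype.val h0)
  refine ⟨⟨idem k n • y, idem_smul_mem y⟩, Subtype.ext ?_⟩
  show S.f.hom (idem k n • y) = x
  rw [map_smul]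
  exact (congrArg _ hy).trans hx

instance : Limits.PreservesFiniteLimits (coverFunctor k n) := by
  have := ((Functor.exact_tfae (coverFunctor k n)).out 1 3).mp (coverFunctor_exact k n)
  exact this.1

instance : Limits.PreservesFiniteColimits (coverFunctor k n) := by
  have := ((Functor.exact_tfae (coverFunctor k n)).out 1 3).mp (coverFunctor_exact k n)
  exact this.2

/-- The group algebra of the symmetric group on `i` letters. -/
abbrev GroupAlg (i : ℕ) : Type u := MonoidAlgebra k (Equiv.Perm (Fin i))

/-- Pairs of a number `i` and an isomorphism class of simple modules of the symmetric group on `i`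
letters. -/
def Label : Type u := Σ i : ℕ, Quotient (simpleSetoid (GroupAlg k i))

variable {k} in
/-- The number `i` of letters. -/
def Label.size (a : Label k) : ℕ := a.1

/-- The partial order with `a < b` if and only if `b.size < a.size`. -/
instance : PartialOrder (Label k) where
  le a b := a = b ∨ b.size < a.size
  le_refl a := Or.inl rfl
  le_trans := by
    rintro a b c (rfl | h) (rfl | h')
    · exact Or.inl rfl
    · exact Or.inr h'
    · exact Or.inr h
    · exact Or.inr (h'.trans h)
  le_antisymm := by
    rintro a b (h | h) (h' | h')
    · exact h
    · exact h
    · exact h'.symm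
    · exact absurd h (not_lt.2 h'.le)

theorem Label.lt_iff (a b : Label k) : a < b ↔ b.size < a.size := by
  rw [lt_iff_le_and_ne]
  constructor
  · rintro ⟨h | h, h'⟩
    · exact absurd h h'
    · exact h
  · intro h
    exact ⟨Or.inr h, fun e => by rw [e] at h; exact lt_irrefl _ h⟩

variable {k} in
/-- The simple module of the symmetric group given by a label. -/
abbrev Label.Simple (a : Label k) : Type u := GroupAlg k a.1 ⧸ a.2.out.1

/-- The labels of the simple modules over `CoverAlgebra k n`: those with `i ∈ J n`. -/
def LabelC : Type u := {a : Label k // a.size ∈ J n}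

/-- The labels of the simple modules over `BrauerAlgebra k n`: those with `i ∈ J n` and `i ≠ 0`. -/
def LabelA : Type u := {a : Label k // a.size ∈ (J n).erase 0}

instance : PartialOrder (LabelC k n) :=
  inferInstanceAs (PartialOrder {a : Label k // a.size ∈ J n})

instance : PartialOrder (LabelA k n) :=
  inferInstanceAs (PartialOrder {a : Label k // a.size ∈ (J n).erase 0})

/-- The inclusion of the two sets of labels. -/
def LabelA.toC {k : Type u} [Field k] {n : ℕ} (a : LabelA k n) : LabelC k n :=
  ⟨a.1, Finset.mem_of_mem_erase a.2⟩

/-- The diagram of a permutation, which has only propagating lines: the bottom dot `x` is connected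
to the top dot `σ x`. -/
def Diagram.ofPerm {i : ℕ} (σ : Equiv.Perm (Fin i)) : Diagram i i where
  partner := Sum.elim (fun x => Sum.inr (σ x)) fun y => Sum.inl (σ.symm y)
  partner_partner x := by rcases x with x | x <;> simp
  partner_ne x := by rcases x with x | x <;> simp

variable {k n} in
/-- The coefficient of a diagram in the block `Hom (i, j)`. -/
noncomputable def CoverAlgebra.coeff (c : CoverAlgebra k n) (i j : J n) : Diagram i j → k :=
  ((show HomSpace k i j from c i j) : Diagram i j →₀ k)

/-- The subalgebra `B`, which is the span of the diagrams without cups. -/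
def cupless : Set (CoverAlgebra k n) :=
  {c | ∀ (i j : J n) (d : Diagram i j), c.coeff i j d ≠ 0 → ∀ t : Fin j, ¬ d.Turns (Sum.inr t)}

variable {k n} in
/-- The part of an element that consists of the diagrams with `i` propagating lines and no other
lines, as an element of the group algebra. On `B` this is the homomorphism that kills all
diagrams with caps, followed by the projection to the factor number `i`. -/
noncomputable def CoverAlgebra.perm (c : CoverAlgebra k n) (i : J n) : GroupAlg k i :=
  ∑ σ : Equiv.Perm (Fin i), MonoidAlgebra.single σ (c.coeff i i (Diagram.ofPerm σ))

open TensorProduct in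
/-- The submodule of `C ⊗ V` by which one has to divide to obtain `C ⊗_B V`, where `B` acts on the
module `V` of the symmetric group through `CoverAlgebra.perm`. -/
noncomputable def balance (i : J n) (V : Type u) [AddCommGroup V] [Module k V] [Module (GroupAlg k i) V] :
    Submodule (CoverAlgebra k n) (CoverAlgebra k n ⊗[k] V) :=
  Submodule.span (CoverAlgebra k n)
    {x | ∃ c : CoverAlgebra k n, ∃ b ∈ cupless k n, ∃ v : V, x = (c * b) ⊗ₜ[k] v - c ⊗ₜ[k] (b.perm i • v)}

open TensorProduct in
/-- The module `C ⊗_B L`, with `L` the simple module of the symmetric group given by the label, on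
which diagrams with caps act by zero. -/
noncomputable def deltaBar (a : LabelC k n) : ModuleCat.{u} (CoverAlgebra k n) :=
  ModuleCat.of (CoverAlgebra k n) ((CoverAlgebra k n ⊗[k] a.1.Simple) ⧸ balance k n ⟨a.1.1, a.2⟩ a.1.Simple)

/-- The top of `deltaBar`, the quotient by its radical. -/
noncomputable def simpleC (a : LabelC k n) : ModuleCat.{u} (CoverAlgebra k n) :=
  ModuleCat.of (CoverAlgebra k n) (deltaBar k n a ⧸ Module.jacobson (CoverAlgebra k n) (deltaBar k n a))

/-- The image under `F` of the simple module with the same label. -/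
noncomputable def simpleA (a : LabelA k n) : ModuleCat.{u} (BrauerAlgebra k n) :=
  (coverFunctor k n).obj (simpleC k n a.toC)

/-- The image under `F` of the standard module with the same label. -/
noncomputable def deltaA (a : LabelA k n) : ModuleCat.{u} (BrauerAlgebra k n) :=
  (coverFunctor k n).obj (deltaBar k n a.toC)

/-- The direct sum of all modules `deltaBar`. -/
noncomputable def deltaBarSum : ModuleCat.{u} (CoverAlgebra k n) :=
  ModuleCat.of (CoverAlgebra k n) (DirectSum (LabelC k n) fun a => deltaBar k n a)

/-- With the modules `X a` as standard modules, `C` is a `1`-cover of `A`: `A = e C e`, the functor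
`F` is fully faithful on finitely generated projective modules, and it induces isomorphisms on
`Ext⁰` and `Ext¹` between modules that are filtered by standard modules. -/
structure IsOneCover (X : LabelC k n → ModuleCat.{u} (CoverAlgebra k n)) : Prop where
  corner_injective : Function.Injective (corner k n)
  corner_range : Set.range (corner k n) = {c | idem k n * c * idem k n = c}
  projective : ∀ P Q : ModuleCat.{u} (CoverAlgebra k n), Projective P → Module.Finite (CoverAlgebra k n) P →
    Projective Q → Module.Finite (CoverAlgebra k n) Q →
    Function.Bijective fun f : P ⟶ Q => (coverFunctor k n).map f
  faithful : ∀ M N : ModuleCat.{u} (CoverAlgebra k n), IsDeltaFiltered X M → IsDeltaFiltered X N →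
    ∀ i ≤ 1, Function.Bijective ((coverFunctor k n).mapExtAddHom M N i)

/-- With the modules `X a` as standard modules, `C` is a Schur algebra of `A`: the images `F (X a)` form
a standard system, and `F` restricts to an equivalence of exact categories from the modules that are
filtered by the `X a` to the modules that are filtered by the `F (X a)`. -/
structure IsSchurAlgebra (X : LabelC k n → ModuleCat.{u} (CoverAlgebra k n)) : Prop where
  standardSystem : IsStandardSystem k fun a => (coverFunctor k n).obj (X a)
  image : ∀ M : ModuleCat.{u} (CoverAlgebra k n), IsDeltaFiltered X M →
    IsDeltaFiltered (fun a => (coverFunctor k n).obj (X a)) ((coverFunctor k n).obj M)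
  fullyFaithful : ∀ M N : ModuleCat.{u} (CoverAlgebra k n), IsDeltaFiltered X M → IsDeltaFiltered X N →
    Function.Bijective fun f : M ⟶ N => (coverFunctor k n).map f
  essSurj : ∀ Y : ModuleCat.{u} (BrauerAlgebra k n), IsDeltaFiltered (fun a => (coverFunctor k n).obj (X a)) Y →
    ∃ M : ModuleCat.{u} (CoverAlgebra k n), IsDeltaFiltered X M ∧ Nonempty ((coverFunctor k n).obj M ≅ Y)
  exact : ∀ S : ShortComplex (ModuleCat.{u} (CoverAlgebra k n)), IsDeltaFiltered X S.X₁ →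
    IsDeltaFiltered X S.X₂ → IsDeltaFiltered X S.X₃ →
    (S.ShortExact ↔ (S.map (coverFunctor k n)).ShortExact)

end Periplectic

open Periplectic

/-!
Write `C` for the cover algebra, `e` for the idempotent of the object `n`, `A = e C e`, and `F` for the
functor `M ↦ e M`. It has the right adjoint `G = Hom_A (e C, -)`, with `F G = 1`. The comparison of `C`
and `A` rests on the notion of a *closed* module: `N` is closed up to degree `m` if `Ext i S N = 0` for
`i ≤ m` and all modules `S` with `e S = 0` (`IsClosedTo`). If `N` is closed up to degree `1`, then the
unit `N ⟶ G F N` is an isomorphism (`isIso_unit`), so that `F` is bijective on homomorphisms to `N`; if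
`N` is closed up to degree `2`, then `F` is bijective on `Ext 1` as well (`bijective_mapExtAddHom`),
by an embedding of `F N` into an injective module and a shift of degrees.

By a zigzag of a cup and a cap, the identity of an object `i ≥ 1` factors through `i + 2`. So `e S = 0`
implies that `S` is concentrated at the object `0` (`unit_smul_eq_zero`). For odd `n` there is no such
object, all modules are closed, and `F` is an equivalence.

For even `n ≥ 6` the module `S` is a direct sum of copies of the simple module `L` at `0`, which has the
projective presentation `C e₂ ⟶ C e₀ ⟶ L`, given by the multiplication with the cup. The kernel of
this map is generated by three explicit elements (`mem_cupRelations`). Standard modules carry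
operators that remove a cup on the right (`HasCupRemoval`, `Delta.hasCupRemoval`), and with these all
homomorphisms from the two syzygies to a standard module extend to the projective modules
(`exists_extension_range`, `exists_extension_ker`). The latter uses an exchange of three cups, and so
the object `6`. Hence standard modules, and all modules filtered by summands of their direct sum, are
closed up to degree `2`. The signs of the compositions enter only through relations between them that
follow from the associativity of the composition (`exists_cup_relations`).

If `p` is not in `[2, n]`, the group algebras of the symmetric groups are semisimple. A module is
*good* if, modulo lower vertex spaces `e_m M`, the configurations of cups act freely on its vertex
spaces (`IsGood`). The algebra `C` is good, so finitely generated projective modules are, and a good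
module is filtered by standard modules: a simple submodule of a lowest vertex space generates a standard
module, and the quotient is good again (`IsGood.isFilteredBy`). The projective cover of the top of a
standard module is a minimal direct summand of some `C e_i`, and the kernel of its map to the standard
module is generated by lower vertex spaces (`Delta.exists_projectiveCover`). This gives the filtrations
in the definition of a quasi-hereditary algebra, and the vanishing of `Ext 1` between standard modules.
The simple modules are classified by their lowest vertex spaces.

A module filtered by the `F Δ` is the image of a module filtered by the `Δ`, namely of its image under
`G`: this functor is exact on the relevant sequences (`epi_map_rightAdjoint`).
-/

open CategoryTheory

namespace Periplectic

section

/-! ### Exact quotient functors and extension groups -/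

section quotient

open Limits Abelian

universe w w' u₁ u₂

variable {𝒞 : Type u₁} [Category.{w} 𝒞] [Abelian 𝒞] {𝒟 : Type u₂} [Category.{w'} 𝒟]

/-- The object `N` is closed up to degree `m` for the functor `F`: the groups `Ext i S N` vanish for
all `i ≤ m` and all objects `S` killed by `F`. -/
def IsClosedTo [HasExt.{w} 𝒞] (F : 𝒞 ⥤ 𝒟) (m : ℕ) (N : 𝒞) : Prop :=
  ∀ S : 𝒞, IsZero (F.obj S) → ∀ i ≤ m, Subsingleton (Ext.{w} S N i)

theorem IsClosedTo.mono [HasExt.{w} 𝒞] {F : 𝒞 ⥤ 𝒟} {m m' : ℕ} (h : m ≤ m') {N : 𝒞}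
    (hN : IsClosedTo F m' N) : IsClosedTo F m N :=
  fun S hS i hi => hN S hS i (hi.trans h)

theorem IsClosedTo.hom_eq_zero [HasExt.{w} 𝒞] {F : 𝒞 ⥤ 𝒟} {m : ℕ} {N : 𝒞}
    (hN : IsClosedTo F m N) {S : 𝒞} (hS : IsZero (F.obj S)) (f : S ⟶ N) : f = 0 := by
  have := hN S hS 0 (Nat.zero_le _)
  exact Ext.homEquiv₀.symm.injective (Subsingleton.elim _ _)

theorem IsClosedTo.of_shortExact [HasExt.{w} 𝒞] {F : 𝒞 ⥤ 𝒟} {m : ℕ} {T : ShortComplex 𝒞}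
    (hT : T.ShortExact) (h₁ : IsClosedTo F m T.X₁) (h₃ : IsClosedTo F m T.X₃) :
    IsClosedTo F m T.X₂ := by
  intro S hS i hi
  have := h₁ S hS i hi
  have := h₃ S hS i hi
  refine subsingleton_of_forall_eq 0 fun x => ?_
  obtain ⟨y, rfl⟩ := Ext.covariant_sequence_exact₂ S hT x (Subsingleton.elim _ _)
  rw [Subsingleton.elim y 0, Ext.zero_comp]

theorem IsClosedTo.of_retract [HasExt.{w} 𝒞] {F : 𝒞 ⥤ 𝒟} {m : ℕ} {N N' : 𝒞} (r : Retract N' N)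
    (h : IsClosedTo F m N) : IsClosedTo F m N' := by
  intro S hS i hi
  have := h S hS i hi
  refine subsingleton_of_forall_eq 0 fun x => ?_
  have e : (x.comp (Ext.mk₀ r.i) (add_zero i)).comp (Ext.mk₀ r.r) (add_zero i) = x := by
    rw [Ext.comp_assoc_of_third_deg_zero, Ext.mk₀_comp_mk₀, r.retract, Ext.comp_mk₀_id]
  rw [← e, Subsingleton.elim (x.comp (Ext.mk₀ r.i) (add_zero i)) 0, Ext.zero_comp]

/-- The cokernel of a map between closed objects is closed in one degree less. -/
theorem IsClosedTo.of_shortExact_left [HasExt.{w} 𝒞] {F : 𝒞 ⥤ 𝒟} {m : ℕ} {T : ShortComplex 𝒞}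
    (hT : T.ShortExact) (h₁ : IsClosedTo F (m + 1) T.X₁) (h₂ : IsClosedTo F m T.X₂) :
    IsClosedTo F m T.X₃ := by
  intro S hS i hi
  have := h₁ S hS (i + 1) (by omega)
  have := h₂ S hS i hi
  refine subsingleton_of_forall_eq 0 fun x => ?_
  obtain ⟨y, rfl⟩ := Ext.covariant_sequence_exact₃ S hT x rfl (Subsingleton.elim _ _)
  rw [Subsingleton.elim y 0, Ext.zero_comp]

/-- An extension group of degree `1` vanishes if, for one projective presentation of the first
argument, all maps from the kernel extend. -/
theorem subsingleton_ext_one [HasExt.{w} 𝒞] {T : ShortComplex 𝒞} (hT : T.ShortExact)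
    [Projective T.X₂] {N : 𝒞} (h : ∀ f : T.X₁ ⟶ N, ∃ g : T.X₂ ⟶ N, T.f ≫ g = f) :
    Subsingleton (Ext.{w} T.X₃ N 1) := by
  refine subsingleton_of_forall_eq 0 fun x => ?_
  obtain ⟨y, rfl⟩ := Ext.contravariant_sequence_exact₃ hT N x (Ext.eq_zero_of_projective _)
    (add_zero 1)
  obtain ⟨f, rfl⟩ := Ext.homEquiv₀.symm.surjective y
  obtain ⟨g, rfl⟩ := h f
  rw [Ext.homEquiv₀_symm_apply, ← Ext.mk₀_comp_mk₀]
  exact hT.extClass_comp_assoc _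

/-- Dimension shifting along one projective presentation. -/
theorem subsingleton_ext_succ [HasExt.{w} 𝒞] {T : ShortComplex 𝒞} (hT : T.ShortExact)
    [Projective T.X₂] {N : 𝒞} {i : ℕ} (h : Subsingleton (Ext.{w} T.X₁ N i)) :
    Subsingleton (Ext.{w} T.X₃ N (i + 1)) := by
  refine subsingleton_of_forall_eq 0 fun x => ?_
  obtain ⟨y, rfl⟩ := Ext.contravariant_sequence_exact₃ hT N x (Ext.eq_zero_of_projective _)
    (add_comm 1 i)
  rw [Subsingleton.elim y 0, Ext.comp_zero]

variable {F : 𝒞 ⥤ 𝒟} {G : 𝒟 ⥤ 𝒞} (adj : F ⊣ G)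

include adj in
theorem eq_zero_of_adj {S : 𝒞} (hS : IsZero (F.obj S)) {J : 𝒟} (f : S ⟶ G.obj J) : f = 0 :=
  (adj.homEquiv S J).symm.injective (hS.eq_of_src _ _)

variable [Abelian 𝒟] [F.Additive] [PreservesFiniteLimits F] [PreservesFiniteColimits F]
variable [G.Full] [G.Faithful]

instance isIso_map_unit (N : 𝒞) : IsIso (F.map (adj.unit.app N)) := by
  have : IsIso (F.map (adj.unit.app N) ≫ adj.counit.app (F.obj N)) := by
    have h := adj.left_triangle_components N
    exact h ▸ inferInstanceAs (IsIso (𝟙 (F.obj N)))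
  exact IsIso.of_isIso_comp_right _ (adj.counit.app (F.obj N))

omit [PreservesFiniteColimits F] in
theorem mono_unit [HasExt.{w} 𝒞] {N : 𝒞} (hN : IsClosedTo F 0 N) : Mono (adj.unit.app N) := by
  refine Preadditive.mono_of_kernel_zero ?_
  refine hN.hom_eq_zero ?_ _
  exact (isZero_kernel_of_mono (F.map (adj.unit.app N))).of_iso (PreservesKernel.iso F _)

/-- An object without homomorphisms and extensions by killed objects is its own localization: the
kernel and the cokernel of the unit are killed by `F`, and the extension by the cokernel splits.
-/
theorem isIso_unit [HasExt.{w} 𝒞] {N : 𝒞} (hN : IsClosedTo F 1 N) :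
    IsIso (adj.unit.app N) := by
  have := mono_unit adj (hN.mono (Nat.zero_le 1))
  let T := ShortComplex.mk (adj.unit.app N) _ (cokernel.condition (adj.unit.app N))
  have hT : T.ShortExact := { exact := ShortComplex.exact_cokernel _ }
  have hQ : IsZero (F.obj T.X₃) :=
    (isZero_cokernel_of_epi (F.map (adj.unit.app N))).of_iso (PreservesCokernel.iso F _)
  have : Subsingleton (Ext T.X₃ T.X₁ 1) := hN _ hQ 1 le_rfl
  obtain ⟨s, hs⟩ := Ext.covariant_sequence_exact₃ T.X₃ hT (Ext.mk₀ (𝟙 T.X₃)) (zero_add 1)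
    (Subsingleton.elim _ _)
  obtain ⟨s, rfl⟩ := Ext.homEquiv₀.symm.surjective s
  rw [Ext.homEquiv₀_symm_apply, Ext.mk₀_comp_mk₀] at hs
  have hs := Ext.homEquiv₀.symm.injective hs
  have h0 : s = 0 := eq_zero_of_adj adj hQ s
  rw [h0, zero_comp] at hs
  have : Epi (adj.unit.app N) := by
    refine Preadditive.epi_of_cokernel_zero ?_
    rw [← Category.comp_id (cokernel.π _)]
    show T.g ≫ 𝟙 T.X₃ = 0
    rw [← hs, comp_zero]
  exact isIso_of_mono_of_epi _

include adj in
theorem bijective_map [HasExt.{w} 𝒞] {N : 𝒞} (hN : IsClosedTo F 1 N) (M : 𝒞) :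
    Function.Bijective fun f : M ⟶ N => F.map f := by
  have := isIso_unit adj hN
  have e : (fun f : M ⟶ N => F.map f) =
      fun f => (adj.homEquiv M (F.obj N)).symm ((asIso (adj.unit.app N)).homToEquiv f) := by
    funext f
    rw [Equiv.eq_symm_apply]
    simp [Adjunction.homEquiv_unit, Iso.homToEquiv]
  rw [e]
  exact ((asIso (adj.unit.app N)).homToEquiv.trans (adj.homEquiv M (F.obj N)).symm).bijective


include adj in
/-- For closed `N` the functor `F` induces isomorphisms on extension groups: embed `F N` into an
injective object `J`; then `N` embeds into the injective object `G J` with a quotient that is closed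
in one degree less, so the case of degree `1` reduces to that of degree `0`. -/
theorem bijective_mapExtAddHom [HasExt.{w} 𝒞] [HasExt.{w'} 𝒟] [EnoughInjectives 𝒟] {N : 𝒞}
    (hN : IsClosedTo F 2 N) (M : 𝒞) {i : ℕ} (hi : i ≤ 1) :
    Function.Bijective (F.mapExtAddHom M N i) := by
  have h0 : ∀ N', IsClosedTo F 1 N' → Function.Bijective (F.mapExtAddHom M N' 0) := fun N' hN' => by
    have := bijective_map adj hN' M
    rw [Functor.mapExtAddHom_coe, Ext.mapExactFunctor₀]
    exact Ext.homEquiv₀.symm.bijective.comp (this.comp Ext.homEquiv₀.bijective)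
  obtain rfl | rfl : i = 0 ∨ i = 1 := by omega
  · exact h0 N (hN.mono one_le_two)
  let I : InjectivePresentation (F.obj N) := Classical.arbitrary _
  have hI := I.injective
  have hGI : Injective (G.obj I.J) := adj.map_injective _ hI
  have hFG : Injective (F.obj (G.obj I.J)) :=
    Injective.of_iso (asIso (adj.counit.app I.J)).symm hI
  have := mono_unit adj (hN.mono (Nat.zero_le 2))
  have hm := adj.rightAdjoint_preservesLimits
  let T := ShortComplex.mk (adj.unit.app N ≫ G.map I.f) _ (cokernel.condition _)
  have hT : T.ShortExact :=
    { exact := ShortComplex.exact_cokernel _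
      mono_f := by dsimp [T]; infer_instance }
  have h2 : IsClosedTo F 1 T.X₂ := by
    intro S hS i _
    rcases i with _ | i
    · refine subsingleton_of_forall_eq 0 fun x => ?_
      obtain ⟨f, rfl⟩ := Ext.homEquiv₀.symm.surjective x
      rw [eq_zero_of_adj adj hS f, Ext.homEquiv₀_symm_apply, Ext.mk₀_zero]
    · exact Ext.subsingleton_of_injective _ _ _
  have h3 : IsClosedTo F 1 T.X₃ := hN.of_shortExact_left hT h2
  exact AddMonoidHom.bijective_of_surjective_of_bijective_of_right_exact _ _ _ _
      (F.mapExtAddHom M T.X₂ 0) (F.mapExtAddHom M T.X₃ 0) (F.mapExtAddHom M T.X₁ (0 + 1))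
      (by ext; simp [Ext.mapExactFunctor_comp, Ext.mapExactFunctor_mk₀]; rfl)
      (by ext; simp [Ext.mapExactFunctor_comp, Ext.mapExactFunctor_extClass]; rfl)
      ((ShortComplex.ab_exact_iff_function_exact _).mp
        (Ext.covariant_sequence_exact₃' M hT 0 (0 + 1) rfl))
      ((ShortComplex.ab_exact_iff_function_exact _).mp
        (Ext.covariant_sequence_exact₃' (F.obj M) (hT.map_of_exact F) 0 (0 + 1) rfl))
      (h0 _ h2).surjective (h0 _ h3)
      (fun x₁ => Ext.covariant_sequence_exact₁ _ hT x₁ (Ext.eq_zero_of_injective (I := T.X₂) _) rfl)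
      (fun y₁ => Ext.covariant_sequence_exact₁ _ (hT.map_of_exact F) y₁
        (Ext.eq_zero_of_injective (I := F.obj (G.obj I.J)) _) rfl)

include adj in
/-- A complex of closed objects is short exact if its image under `F` is. -/
theorem shortExact_of_map [HasExt.{w} 𝒞] {T : ShortComplex 𝒞} (h₁ : IsClosedTo F 2 T.X₁)
    (h₂ : IsClosedTo F 2 T.X₂) (h₃ : IsClosedTo F 2 T.X₃) (h : (T.map F).ShortExact) :
    T.ShortExact := by
  have hm : Mono T.f := by
    have : Mono (F.map T.f) := h.mono_f
    exact Preadditive.mono_of_kernel_zero (h₁.hom_eq_zero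
      ((isZero_kernel_of_mono (F.map T.f)).of_iso (PreservesKernel.iso F _)) _)
  -- the quotient of the second term by the first is closed in degrees at most `1`
  let U := ShortComplex.mk T.f _ (cokernel.condition T.f)
  have hU : U.ShortExact := { exact := ShortComplex.exact_cokernel _ }
  have hQ : IsClosedTo F 1 (cokernel T.f) :=
    IsClosedTo.of_shortExact_left hU h₁ (h₂.mono one_le_two)
  let q : cokernel T.f ⟶ T.X₃ := cokernel.desc _ T.g T.zero
  have hq : cokernel.π T.f ≫ q = T.g := cokernel.π_desc _ _ _
  -- `F` turns the induced map to the third term into an isomorphism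
  have hFq : IsIso (F.map q) := by
    have hg : Epi (T.map F).g := h.epi_g
    have hπ : Epi (F.map (cokernel.π T.f)) := (hU.map_of_exact F).epi_g
    have h0 : (T.map F).f ≫ F.map (cokernel.π T.f) = 0 := (U.map F).zero
    obtain ⟨r, hr⟩ : ∃ r : F.obj T.X₃ ⟶ F.obj (cokernel T.f),
        F.map T.g ≫ r = F.map (cokernel.π T.f) := ⟨h.exact.desc _ h0, h.exact.g_desc _ h0⟩
    refine ⟨r, ?_, ?_⟩
    · rw [← cancel_epi (F.map (cokernel.π T.f)), ← F.map_comp_assoc, hq, hr, Category.comp_id]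
    · have hg' : Epi (F.map T.g) := hg
      rw [← cancel_epi (F.map T.g), reassoc_of% hr, ← F.map_comp, hq]
      exact (Category.comp_id _).symm
  have hqi : IsIso q := by
    have n1 := adj.unit.naturality q
    have := isIso_unit adj hQ
    have := isIso_unit adj (h₃.mono one_le_two)
    have e : q = adj.unit.app _ ≫ G.map (F.map q) ≫ inv (adj.unit.app _) := by
      rw [← Category.assoc, IsIso.eq_comp_inv]; exact n1
    rw [e]; infer_instance
  refine ShortComplex.shortExact_of_iso (ShortComplex.isoMk (Iso.refl _) (Iso.refl _) (asIso q)
    ?_ ?_ : U ≅ T) hU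
  · simp [U]
  · simp [U, hq]

include adj in
/-- The right adjoint is exact on extensions by the image of a closed object. -/
theorem epi_map_rightAdjoint [HasExt.{w} 𝒞] [HasExt.{w'} 𝒟] [EnoughInjectives 𝒟]
    [EnoughProjectives 𝒞] {T : ShortComplex 𝒟} (hT : T.ShortExact) {N : 𝒞}
    (hN : IsClosedTo F 2 N) (e : T.X₁ ≅ F.obj N) : Epi (G.map T.g) := by
  let P : ProjectivePresentation (G.obj T.X₃) := Classical.arbitrary _
  have hP := P.projective
  have h0 : Subsingleton (Ext (F.obj P.p) T.X₁ 1) := by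
    have h1 : Subsingleton (Ext (F.obj P.p) (F.obj N) 1) := by
      have : Subsingleton (Ext P.p N 1) := Ext.subsingleton_of_projective _ _ _
      exact (bijective_mapExtAddHom adj hN P.p le_rfl).surjective.subsingleton
    refine subsingleton_of_forall_eq 0 fun x => ?_
    have : (x.comp (Ext.mk₀ e.hom) (add_zero 1)).comp (Ext.mk₀ e.inv) (add_zero 1) = x := by
      rw [Ext.comp_assoc_of_third_deg_zero, Ext.mk₀_comp_mk₀, e.hom_inv_id, Ext.comp_mk₀_id]
    rw [← this, Subsingleton.elim (x.comp (Ext.mk₀ e.hom) (add_zero 1)) 0, Ext.zero_comp]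
  obtain ⟨s, hs⟩ := Ext.covariant_sequence_exact₃ (F.obj P.p) hT
    (Ext.mk₀ ((adj.homEquiv _ _).symm P.f)) (zero_add 1) (Subsingleton.elim _ _)
  obtain ⟨s, rfl⟩ := Ext.homEquiv₀.symm.surjective s
  rw [Ext.homEquiv₀_symm_apply, Ext.mk₀_comp_mk₀] at hs
  have hs := Ext.homEquiv₀.symm.injective hs
  have : adj.homEquiv _ _ s ≫ G.map T.g = P.f := by
    rw [← adj.homEquiv_naturality_right, hs, Equiv.apply_symm_apply]
  have hf : Epi P.f := P.epi
  rw [← this] at hf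
  exact epi_of_epi (adj.homEquiv _ _ s) _

end quotient

end

section

/-! ### Matrix units of the cover algebra -/

section blocks

variable {k : Type u} [Field k] {n : ℕ}

/-- The entry of an element of the cover algebra in the block `Hom (i, j)`. -/
def CoverAlgebra.entry (c : CoverAlgebra k n) (i j : J n) : HomSpace k i j := c i j

theorem CoverAlgebra.ext_entry {c d : CoverAlgebra k n} (h : ∀ i j, c.entry i j = d.entry i j) :
    c = d :=
  Mat_.hom_ext (M := total k n) (N := total k n) _ _ h

theorem CoverAlgebra.entry_mul (c d : CoverAlgebra k n) (i j : J n) :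
    (c * d).entry i j = ∑ l : J n, compose (c.entry l j) (d.entry i l) := rfl

/-- Projection to a block as a linear map. -/
def entryₗ (i j : J n) : CoverAlgebra k n →ₗ[k] HomSpace k i j where
  toFun c := c.entry i j
  map_add' _ _ := rfl
  map_smul' _ _ := rfl

theorem CoverAlgebra.entry_sum {ι : Type*} (s : Finset ι) (f : ι → CoverAlgebra k n) (i j : J n) :
    (∑ t ∈ s, f t).entry i j = ∑ t ∈ s, (f t).entry i j :=
  map_sum (entryₗ i j) f s

/-- The inclusion of a block into the cover algebra. -/
noncomputable def blk (i j : J n) : HomSpace k i j →ₗ[k] CoverAlgebra k n where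
  toFun f := fun (i' j' : J n) => (Pi.single i (Pi.single j f : ∀ j' : J n, HomSpace k i j') :
    ∀ i' j' : J n, HomSpace k i' j') i' j'
  map_add' f g := by
    refine CoverAlgebra.ext_entry fun i' j' => ?_
    show (Pi.single i _ : ∀ i' j' : J n, HomSpace k i' j') i' j' =
      (Pi.single i _ : ∀ i' j' : J n, HomSpace k i' j') i' j' +
      (Pi.single i _ : ∀ i' j' : J n, HomSpace k i' j') i' j'
    rw [Pi.single_add, Pi.single_add]; rfl
  map_smul' r f := by
    refine CoverAlgebra.ext_entry fun i' j' => ?_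
    show (Pi.single i _ : ∀ i' j' : J n, HomSpace k i' j') i' j' =
      r • (Pi.single i _ : ∀ i' j' : J n, HomSpace k i' j') i' j'
    rw [Pi.single_smul, Pi.single_smul]; rfl

theorem entry_blk (i j : J n) (f : HomSpace k i j) : (blk i j f).entry i j = f := by
  show (Pi.single i _ : ∀ i' j' : J n, HomSpace k i' j') i j = f
  rw [Pi.single_eq_same, Pi.single_eq_same]

theorem entry_blk_ne {i j i' j' : J n} (h : i' ≠ i ∨ j' ≠ j) (f : HomSpace k i j) :
    (blk i j f).entry i' j' = 0 := by
  show (Pi.single i _ : ∀ i' j' : J n, HomSpace k i' j') i' j' = 0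
  by_cases hi : i' = i
  · subst hi
    rw [Pi.single_eq_same, Pi.single_eq_of_ne (h.resolve_left (not_not.2 rfl))]
  · rw [Pi.single_eq_of_ne hi]; rfl

theorem blk_injective (i j : J n) : Function.Injective (blk (k := k) i j) := fun f g h => by
  rw [← entry_blk i j f, h, entry_blk]

theorem blk_mul {i j l : J n} (f : HomSpace k j l) (g : HomSpace k i j) :
    blk j l f * blk i j g = blk i l (compose f g) := by
  refine CoverAlgebra.ext_entry fun i' j' => ?_
  rw [CoverAlgebra.entry_mul, Finset.sum_eq_single j]
  · by_cases hi : i' = i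
    · subst hi
      by_cases hj : j' = l
      · subst hj
        rw [entry_blk, entry_blk, entry_blk]
      · rw [entry_blk_ne (Or.inr hj), entry_blk_ne (Or.inr hj), map_zero, LinearMap.zero_apply]
    · rw [entry_blk_ne (Or.inl hi) g, entry_blk_ne (Or.inl hi), map_zero]
  · intro m _ hm
    rw [entry_blk_ne (Or.inr hm), map_zero]
  · simp

theorem blk_mul_ne {i j j' l : J n} (h : j ≠ j') (f : HomSpace k j' l) (g : HomSpace k i j) :
    blk j' l f * blk i j g = 0 := by
  refine CoverAlgebra.ext_entry fun a b => ?_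
  rw [CoverAlgebra.entry_mul]
  refine Finset.sum_eq_zero fun m _ => ?_
  by_cases hm : m = j
  · subst hm; rw [entry_blk_ne (Or.inl h), map_zero, LinearMap.zero_apply]
  · rw [entry_blk_ne (Or.inr hm), map_zero]

theorem sum_blk (c : CoverAlgebra k n) : ∑ i, ∑ j, blk i j (c.entry i j) = c := by
  refine CoverAlgebra.ext_entry fun a b => ?_
  rw [CoverAlgebra.entry_sum, Finset.sum_eq_single a, CoverAlgebra.entry_sum,
    Finset.sum_eq_single b, entry_blk]
  · intro j _ hj; exact entry_blk_ne (Or.inr hj.symm) _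
  · simp
  · intro i _ hi
    rw [CoverAlgebra.entry_sum]
    exact Finset.sum_eq_zero fun j _ => entry_blk_ne (Or.inl hi.symm) _
  · simp

/-- The element of the cover algebra given by a diagram. -/
noncomputable def bas {i j : J n} (d : Diagram i j) : CoverAlgebra k n :=
  blk i j (Finsupp.single d 1)

theorem blk_single {i j : J n} (d : Diagram i j) (a : k) :
    blk i j (Finsupp.single d a) = a • bas d := by
  rw [bas, ← map_smul, Finsupp.smul_single, smul_eq_mul, mul_one]

theorem bas_mul {i j l : J n} (d : Diagram j l) (d' : Diagram i j) :
    (bas d * bas d' : CoverAlgebra k n) = (Diagram.sign d d' : k) • bas (Diagram.comp d d') := by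
  rw [bas, bas, blk_mul, compose_single, one_mul, one_mul, blk_single]

theorem bas_mul_ne {i j j' l : J n} (h : j ≠ j') (d : Diagram j' l) (d' : Diagram i j) :
    (bas d * bas d' : CoverAlgebra k n) = 0 := blk_mul_ne h _ _

/-- An additive property of all elements holds if it holds for the multiples of diagrams. -/
theorem CoverAlgebra.induction {p : CoverAlgebra k n → Prop} (h0 : p 0)
    (hadd : ∀ c d, p c → p d → p (c + d))
    (hbas : ∀ (i j : J n) (d : Diagram i j) (a : k), p (a • bas d)) (c : CoverAlgebra k n) : p c := by
  have hsum : ∀ {ι : Type} (s : Finset ι) (f : ι → CoverAlgebra k n),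
      (∀ t, p (f t)) → p (∑ t ∈ s, f t) := by
    intro ι s f hf
    induction s using Finset.cons_induction with
    | empty => simpa using h0
    | cons a s ha ih => rw [Finset.sum_cons]; exact hadd _ _ (hf a) ih
  rw [← sum_blk c]
  refine hsum _ _ fun i => hsum _ _ fun j => ?_
  induction c.entry i j using Finsupp.induction_linear with
  | zero => rw [map_zero]; exact h0
  | add f g hf hg => rw [map_add]; exact hadd _ _ hf hg
  | single d a => rw [blk_single]; exact hbas i j d a

/-- The idempotent of the object `i`. -/
noncomputable def unit (k : Type u) [Field k] {n : ℕ} (i : J n) : CoverAlgebra k n :=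
  bas (Diagram.one i)

theorem unit_mul_bas {i j : J n} (d : Diagram i j) : unit k j * bas d = bas d := by
  rw [unit, bas_mul, (Diagram.one_comp d).1, (Diagram.one_comp d).2, Int.cast_one, one_smul]

theorem bas_mul_unit {i j : J n} (d : Diagram i j) : bas d * unit k i = bas d := by
  rw [unit, bas_mul, (Diagram.comp_one d).1, (Diagram.comp_one d).2, Int.cast_one, one_smul]

theorem unit_mul_bas_ne {i j l : J n} (h : l ≠ j) (d : Diagram i j) : unit k l * bas d = 0 :=
  bas_mul_ne h.symm _ _

theorem bas_mul_unit_ne {i j l : J n} (h : l ≠ i) (d : Diagram i j) : bas d * unit k l = 0 :=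
  bas_mul_ne h _ _

theorem unit_mul_unit (i : J n) : unit k i * unit k i = unit k i := unit_mul_bas _

theorem sum_unit : ∑ i : J n, unit k i = 1 := by
  have h : ∀ c : CoverAlgebra k n, c * ∑ i : J n, unit k i = c := by
    intro c
    induction c using CoverAlgebra.induction with
    | h0 => rw [zero_mul]
    | hadd c d hc hd => rw [add_mul, hc, hd]
    | hbas i j d a =>
      rw [smul_mul_assoc, Finset.mul_sum, Finset.sum_eq_single i, bas_mul_unit]
      · intro l _ hl; exact bas_mul_unit_ne hl d
      · simp
  rw [← one_mul (∑ i : J n, unit k i), h]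

/-- The label `n` as an element of `J n`. -/
abbrev top (n : ℕ) : J n := ⟨n, self_mem_J n⟩

theorem toTop_self : toTop k n n = 𝟙 _ := by simp [toTop]

theorem fromTop_self : fromTop k n n = 𝟙 _ := by simp [fromTop]

theorem corner_eq_blk (a : BrauerAlgebra k n) : corner k n a = blk (top n) (top n) a := by
  refine CoverAlgebra.ext_entry fun i j => ?_
  show toTop k n i ≫ a ≫ fromTop k n j = _
  by_cases hi : i = top n
  · subst hi
    by_cases hj : j = top n
    · subst hj
      rw [entry_blk]
      show toTop k n n ≫ a ≫ fromTop k n n = a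
      rw [toTop_self, fromTop_self, Category.comp_id, Category.id_comp]
    · rw [entry_blk_ne (Or.inr hj), fromTop, dif_neg (fun h => hj (Subtype.ext h.symm))]
      simp
  · rw [entry_blk_ne (Or.inl hi), toTop, dif_neg (fun h => hi (Subtype.ext h))]
    simp

theorem idem_eq : idem k n = unit k (top n) := corner_eq_blk 1

theorem entry_mul_unit (c : CoverAlgebra k n) (j l : J n) :
    (c * unit k j).entry j l = c.entry j l := by
  rw [CoverAlgebra.entry_mul, Finset.sum_eq_single j]
  · exact (congrArg _ (entry_blk j j _)).trans (compose_one _)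
  · intro m _ hm
    exact (congrArg _ (entry_blk_ne (Or.inr hm) _)).trans (map_zero _)
  · simp

theorem unit_mul_eq_sum (c : CoverAlgebra k n) (j : J n) :
    unit k j * c = ∑ i, blk i j (c.entry i j) := by
  conv_lhs => rw [← sum_blk c, Finset.mul_sum]
  refine Finset.sum_congr rfl fun i _ => ?_
  rw [Finset.mul_sum, Finset.sum_eq_single j]
  · exact (blk_mul _ _).trans (congrArg _ (one_compose _))
  · intro l _ hl; exact blk_mul_ne hl _ _
  · simp

theorem unit_mul_mul_unit (c : CoverAlgebra k n) (i j : J n) :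
    unit k j * c * unit k i = blk i j (c.entry i j) := by
  rw [unit_mul_eq_sum, Finset.sum_mul, Finset.sum_eq_single i]
  · exact (blk_mul _ _).trans (congrArg _ (compose_one _))
  · intro l _ hl
    exact blk_mul_ne (Ne.symm hl) _ _
  · simp

theorem corner_injective : Function.Injective (corner k n) := by
  intro a b h
  rw [corner_eq_blk, corner_eq_blk] at h
  exact blk_injective _ _ h

theorem idem_mul_mul_idem (c : CoverAlgebra k n) :
    idem k n * c * idem k n = corner k n (c.entry (top n) (top n) : HomSpace k n n) := by
  rw [idem_eq, unit_mul_mul_unit, corner_eq_blk]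

theorem corner_range : Set.range (corner k n) = {c | idem k n * c * idem k n = c} := by
  ext c
  constructor
  · rintro ⟨a, rfl⟩
    show idem k n * corner k n a * idem k n = corner k n a
    rw [idem, ← map_mul, ← map_mul, one_mul, mul_one]
  · intro h
    exact ⟨_, (idem_mul_mul_idem c).symm.trans h⟩

end blocks

/-! ### The right adjoint of the quotient functor -/

section adjoint

variable {k : Type u} [Field k] {n : ℕ}

/-- Right multiplication on `e C`. -/
noncomputable def mulRight (c : CoverAlgebra k n) :
    fixedPart (k := k) (n := n) (CoverAlgebra k n) →ₗ[BrauerAlgebra k n]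
      fixedPart (k := k) (n := n) (CoverAlgebra k n) where
  toFun x := ⟨x.1 * c, by
    show idem k n * (x.1 * c) = x.1 * c
    rw [← mul_assoc]; exact congrArg (· * c) x.2⟩
  map_add' x y := Subtype.ext (add_mul _ _ _)
  map_smul' a x := Subtype.ext (mul_assoc _ _ _)

/-- The coinduced module `Hom_A (e C, V)`. -/
def Coind (V : Type u) [AddCommGroup V] [Module (BrauerAlgebra k n) V] : Type u :=
  fixedPart (k := k) (n := n) (CoverAlgebra k n) →ₗ[BrauerAlgebra k n] V

namespace Coind

variable (V : Type u) [AddCommGroup V] [Module (BrauerAlgebra k n) V]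

noncomputable instance : AddCommGroup (Coind (k := k) (n := n) V) :=
  inferInstanceAs (AddCommGroup (_ →ₗ[BrauerAlgebra k n] V))

instance : FunLike (Coind (k := k) (n := n) V) (fixedPart (k := k) (n := n) (CoverAlgebra k n)) V :=
  inferInstanceAs (FunLike (_ →ₗ[BrauerAlgebra k n] V) _ _)

noncomputable instance : Module (CoverAlgebra k n) (Coind (k := k) (n := n) V) where
  smul c q := LinearMap.comp (show _ →ₗ[BrauerAlgebra k n] V from q) (mulRight c)
  one_smul q := LinearMap.ext fun _ => congrArg q (Subtype.ext (mul_one _))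
  mul_smul c d q := LinearMap.ext fun x => congrArg q (Subtype.ext (mul_assoc x.1 c d).symm)
  smul_zero _ := rfl
  smul_add _ _ _ := rfl
  add_smul c d q := LinearMap.ext fun x =>
    (congrArg q (Subtype.ext (mul_add x.1 c d))).trans
      (LinearMap.map_add (show _ →ₗ[BrauerAlgebra k n] V from q) _ _)
  zero_smul q := LinearMap.ext fun x =>
    (congrArg q (Subtype.ext (mul_zero x.1))).trans
      (LinearMap.map_zero (show _ →ₗ[BrauerAlgebra k n] V from q))

end Coind

/-- The idempotent as an element of `e C`. -/
noncomputable def idemFixed (k : Type u) [Field k] (n : ℕ) :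
    fixedPart (k := k) (n := n) (CoverAlgebra k n) := ⟨idem k n, idem_mul_idem k n⟩

variable (k n) in
/-- The coinduced module as a module over the cover algebra. -/
noncomputable def coindObj (V : ModuleCat.{u} (BrauerAlgebra k n)) : ModuleCat.{u} (CoverAlgebra k n) :=
  ModuleCat.of _ (Coind (k := k) (n := n) V)

/-- For `x` in `e C` and `m` in `M`, the element `x m` of `e M`. -/
noncomputable def fixedSmul {M : Type u} [AddCommGroup M] [Module (CoverAlgebra k n) M]
    (x : fixedPart (k := k) (n := n) (CoverAlgebra k n)) (m : M) : fixedPart (k := k) (n := n) M :=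
  ⟨x.1 • m, by
    show idem k n • x.1 • m = x.1 • m
    rw [smul_smul]; exact congrArg (· • m) x.2⟩

/-- The adjunction between `M ↦ e M` and coinduction, for modules. -/
noncomputable def coindLinearEquiv (M V : Type u) [AddCommGroup M] [Module (CoverAlgebra k n) M]
    [AddCommGroup V] [Module (BrauerAlgebra k n) V] :
    (fixedPart (k := k) (n := n) M →ₗ[BrauerAlgebra k n] V) ≃
      (M →ₗ[CoverAlgebra k n] Coind (k := k) (n := n) V) where
  toFun g :=
    { toFun := fun m =>
        { toFun := fun x => g (fixedSmul x m)
          map_add' := fun x y => by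
            rw [← map_add]
            exact congrArg _ (Subtype.ext (add_smul _ _ _))
          map_smul' := fun a x => by
            rw [RingHom.id_apply, ← map_smul]
            exact congrArg _ (Subtype.ext (mul_smul _ _ _)) }
      map_add' := fun m m' => LinearMap.ext fun x => by
        show g _ = g _ + g _
        rw [← map_add]
        exact congrArg _ (Subtype.ext (smul_add _ _ _))
      map_smul' := fun c m => LinearMap.ext fun x => by
        show g _ = g _
        exact congrArg _ (Subtype.ext (mul_smul _ _ _).symm) }
  invFun φ :=
    { toFun := fun y => φ y.1 (idemFixed k n)
      map_add' := fun y y' =>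
        congrArg (fun q : Coind (k := k) (n := n) V => q (idemFixed k n)) (map_add φ y.1 y'.1)
      map_smul' := fun a y => by
        have h2 : φ (corner k n a • y.1) (idemFixed k n) =
            φ y.1 (mulRight (corner k n a) (idemFixed k n)) :=
          congrArg (fun q : Coind (k := k) (n := n) V => q (idemFixed k n)) (map_smul φ _ _)
        have h3 : mulRight (corner k n a) (idemFixed k n) = a • idemFixed k n := by
          refine Subtype.ext ?_
          show idem k n * corner k n a = corner k n a * idem k n
          rw [idem_mul_corner, idem, ← map_mul, mul_one]
        rw [h3] at h2
        exact h2.trans (LinearMap.map_smul (show _ →ₗ[BrauerAlgebra k n] V from φ y.1) _ _) }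
  left_inv g := by
    refine LinearMap.ext fun y => ?_
    show g _ = g _
    exact congrArg _ (Subtype.ext y.2)
  right_inv φ := by
    refine LinearMap.ext fun m => LinearMap.ext fun x => ?_
    show φ (x.1 • m) (idemFixed k n) = φ m x
    rw [map_smul]
    exact congrArg (φ m) (Subtype.ext x.2)

/-- The adjunction between `F` and coinduction. -/
noncomputable def coindEquiv (M : ModuleCat.{u} (CoverAlgebra k n))
    (V : ModuleCat.{u} (BrauerAlgebra k n)) :
    ((coverFunctor k n).obj M ⟶ V) ≃ (M ⟶ coindObj k n V) :=
  { toFun := fun g => ModuleCat.ofHom (coindLinearEquiv M V g.hom)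
    invFun := fun φ => ModuleCat.ofHom ((coindLinearEquiv M V).symm φ.hom)
    left_inv := fun g => ModuleCat.hom_ext ((coindLinearEquiv M V).symm_apply_apply g.hom)
    right_inv := fun φ => ModuleCat.hom_ext ((coindLinearEquiv M V).apply_symm_apply φ.hom) }

theorem coindEquiv_naturality {M M' : ModuleCat.{u} (CoverAlgebra k n)}
    {V : ModuleCat.{u} (BrauerAlgebra k n)} (f : M' ⟶ M) (g : (coverFunctor k n).obj M ⟶ V) :
    coindEquiv M' V ((coverFunctor k n).map f ≫ g) = f ≫ coindEquiv M V g := by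
  refine ModuleCat.hom_ext (LinearMap.ext fun m => LinearMap.ext fun x => ?_)
  show g.hom _ = g.hom _
  exact congrArg _ (Subtype.ext (map_smul f.hom _ _))

variable (k n) in
/-- The right adjoint `Hom_A (e C, -)` of the functor `F`. -/
noncomputable def coverAdjoint : ModuleCat.{u} (BrauerAlgebra k n) ⥤ ModuleCat.{u} (CoverAlgebra k n) :=
  Adjunction.rightAdjointOfEquiv (F := coverFunctor k n) (G_obj := coindObj k n) coindEquiv
    fun _ _ _ f g => coindEquiv_naturality f g

variable (k n) in
/-- The functor `F` is left adjoint to coinduction. -/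
noncomputable def coverAdjunction : coverFunctor k n ⊣ coverAdjoint k n :=
  Adjunction.adjunctionOfEquivRight (F := coverFunctor k n) (G_obj := coindObj k n) coindEquiv _

theorem coverAdjunction_counit_app (V : ModuleCat.{u} (BrauerAlgebra k n)) :
    (coverAdjunction k n).counit.app V = (coindEquiv (coindObj k n V) V).symm (𝟙 _) := by
  have := (coverAdjunction k n).homEquiv_counit (g := 𝟙 ((coverAdjoint k n).obj V))
  rw [CategoryTheory.Functor.map_id, Category.id_comp] at this
  rw [← this]; rfl

/-- The counit is evaluation at the idempotent. -/
theorem coverAdjunction_counit_apply (V : ModuleCat.{u} (BrauerAlgebra k n))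
    (q : fixedPart (k := k) (n := n) (Coind (k := k) (n := n) V)) :
    ((coverAdjunction k n).counit.app V).hom q = q.1 (idemFixed k n) := by
  rw [coverAdjunction_counit_app]; rfl

instance : IsIso (coverAdjunction k n).counit := by
  rw [NatTrans.isIso_iff_isIso_app]
  intro V
  rw [ConcreteCategory.isIso_iff_bijective]
  suffices H : Function.Bijective fun q : fixedPart (k := k) (n := n) (Coind (k := k) (n := n) V) =>
      q.1 (idemFixed k n) by
    have e := funext (coverAdjunction_counit_apply V)
    exact e ▸ H
  constructor
  · intro q q' h
    replace h : q.1 (idemFixed k n) = q'.1 (idemFixed k n) := h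
    have key : ∀ (q : fixedPart (k := k) (n := n) (Coind (k := k) (n := n) V)) x,
        q.1 x = (show BrauerAlgebra k n from x.1.entry (top n) (top n)) • q.1 (idemFixed k n) := by
      intro q x
      have h1 : idem k n • q.1 = q.1 := q.2
      have h2 : q.1 (mulRight (idem k n) x) = q.1 x :=
        congrArg (fun q : Coind (k := k) (n := n) V => q x) h1
      rw [← h2]
      refine Eq.trans (congrArg q.1 (Subtype.ext ?_)) (LinearMap.map_smul
        (show _ →ₗ[BrauerAlgebra k n] V from q.1) _ _)
      show x.1 * idem k n = corner k n _ * idem k n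
      have : idem k n * x.1 = x.1 := x.2
      rw [← idem_mul_mul_idem, this, mul_assoc, idem_mul_idem]
    refine Subtype.ext (LinearMap.ext fun x => ?_)
    exact (key q x).trans ((congrArg _ h).trans (key q' x).symm)
  · intro v
    have hent : ∀ (a : BrauerAlgebra k n) (c : CoverAlgebra k n),
        (corner k n a * c).entry (top n) (top n) =
          a * (show BrauerAlgebra k n from c.entry (top n) (top n)) := by
      intro a c
      rw [CoverAlgebra.entry_mul, Finset.sum_eq_single (top n), corner_eq_blk, entry_blk]
      · rfl
      · intro l _ hl
        rw [corner_eq_blk, entry_blk_ne (Or.inl hl), map_zero, LinearMap.zero_apply]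
      · simp
    let q : fixedPart (k := k) (n := n) (CoverAlgebra k n) →ₗ[BrauerAlgebra k n] V :=
      { toFun := fun x => (show BrauerAlgebra k n from x.1.entry (top n) (top n)) • v
        map_add' := fun x y => add_smul _ _ _
        map_smul' := fun a x => by
          rw [RingHom.id_apply, smul_smul]
          exact congrArg (fun b : BrauerAlgebra k n => b • v) (hent a x.1) }
    refine ⟨⟨(q : Coind (k := k) (n := n) V), LinearMap.ext fun x => ?_⟩, ?_⟩
    · show (show BrauerAlgebra k n from (x.1 * idem k n).entry (top n) (top n)) • v =
        (show BrauerAlgebra k n from x.1.entry (top n) (top n)) • v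
      congr 1
      rw [idem_eq]
      exact entry_mul_unit _ _ _
    · show (show BrauerAlgebra k n from (idem k n).entry (top n) (top n)) • v = v
      rw [idem, corner_eq_blk, entry_blk]
      exact one_smul _ v

instance : (coverAdjoint k n).Full := (coverAdjunction k n).fullyFaithfulROfIsIsoCounit.full

instance : (coverAdjoint k n).Faithful := (coverAdjunction k n).fullyFaithfulROfIsIsoCounit.faithful

end adjoint

end

section

/-! ### Composition of diagrams -/

namespace Diagram

open StackDot

variable {i j l : ℕ}

/-- The diagram has no caps: all lines starting at the bottom propagate. -/
def Capless (d : Diagram i j) : Prop := ∀ a : Fin i, (d.partner (Sum.inl a)).isRight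

/-- The diagram has no cups: all lines starting at the top propagate. -/
def Cupless (d : Diagram i j) : Prop := ∀ b : Fin j, (d.partner (Sum.inr b)).isLeft

instance (d : Diagram i j) : Decidable d.Capless := inferInstanceAs (Decidable (∀ _, _))

instance (d : Diagram i j) : Decidable d.Cupless := inferInstanceAs (Decidable (∀ _, _))

theorem Capless.exists {d : Diagram i j} (h : d.Capless) (a : Fin i) :
    ∃ b, d.partner (Sum.inl a) = Sum.inr b := Sum.isRight_iff.1 (h a)

theorem Cupless.exists {d : Diagram i j} (h : d.Cupless) (b : Fin j) :
    ∃ a, d.partner (Sum.inr b) = Sum.inl a := Sum.isLeft_iff.1 (h b)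

theorem exists_cap {d : Diagram i j} (h : ¬ d.Capless) :
    ∃ a b, d.partner (Sum.inl a) = Sum.inl b := by
  unfold Capless at h
  push Not at h
  obtain ⟨a, ha⟩ := h
  exact ⟨a, Sum.isLeft_iff.1 (by simpa using ha)⟩

theorem exists_cup {d : Diagram i j} (h : ¬ d.Cupless) :
    ∃ a b, d.partner (Sum.inr a) = Sum.inr b := by
  unfold Cupless at h
  push Not at h
  obtain ⟨a, ha⟩ := h
  exact ⟨a, Sum.isRight_iff.1 (by simpa using ha)⟩

theorem partner_eq_iff (d : Diagram i j) {x y : Dot i j} : d.partner x = y ↔ d.partner y = x :=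
  ⟨fun h => by rw [← h, d.partner_partner], fun h => by rw [← h, d.partner_partner]⟩

theorem partner_injective (d : Diagram i j) : Function.Injective d.partner :=
  Function.LeftInverse.injective d.partner_partner

instance : Finite (Diagram i j) :=
  Finite.of_injective (fun d => d.partner) fun _ _ h => ext' (congrFun h)

noncomputable instance : Fintype (Diagram i j) := Fintype.ofFinite _

noncomputable instance : DecidableEq (Diagram i j) := Classical.decEq _

theorem comp_partner_eq {d₁ : Diagram j l} {d₂ : Diagram i j} {x y : Dot i l}
    (h : Exits d₁ d₂ (outer x) y) : (comp d₁ d₂).partner x = y :=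
  (exits_comp d₁ d₂ x).unique h

theorem exits_inl_inl {d₁ : Diagram j l} {d₂ : Diagram i j} {x : Dot i j} {b : Fin i}
    (h : d₂.partner x = Sum.inl b) : Exits d₁ d₂ (Sum.inl x) (Sum.inl b) :=
  .leave (congrArg Sum.inl h)

theorem exits_inr_inr {d₁ : Diagram j l} {d₂ : Diagram i j} {x : Dot j l} {b : Fin l}
    (h : d₁.partner x = Sum.inr b) : Exits d₁ d₂ (Sum.inr x) (Sum.inr b) :=
  .leave (congrArg Sum.inr h)

theorem exits_cross_up {d₁ : Diagram j l} {d₂ : Diagram i j} {x : Dot i j} {m : Fin j} {y : Dot i l}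
    (h : d₂.partner x = Sum.inr m) (h' : Exits d₁ d₂ (Sum.inr (Sum.inl m)) y) :
    Exits d₁ d₂ (Sum.inl x) y := by
  have e : along d₁ d₂ (Sum.inl x) = Sum.inl (Sum.inr m) := congrArg Sum.inl h
  refine .cross ?_ ?_
  · rw [e]; simp [glue]
  · rw [e]; exact h'

theorem exits_cross_down {d₁ : Diagram j l} {d₂ : Diagram i j} {x : Dot j l} {m : Fin j}
    {y : Dot i l} (h : d₁.partner x = Sum.inl m) (h' : Exits d₁ d₂ (Sum.inl (Sum.inr m)) y) :
    Exits d₁ d₂ (Sum.inr x) y := by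
  have e : along d₁ d₂ (Sum.inr x) = Sum.inr (Sum.inl m) := congrArg Sum.inr h
  refine .cross ?_ ?_
  · rw [e]; simp [glue]
  · rw [e]; exact h'

theorem hasLoop_of {d₁ : Diagram j l} {d₂ : Diagram i j} {m m' : Fin j}
    (h₁ : d₁.partner (Sum.inl m') = Sum.inl m) (h₂ : d₂.partner (Sum.inr m) = Sum.inr m') :
    HasLoop d₁ d₂ := by
  refine ⟨m, ?_⟩
  rintro ⟨y, hy⟩
  have e₁ : along d₁ d₂ (Sum.inr (Sum.inl m')) = Sum.inr (Sum.inl m) := congrArg Sum.inr h₁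
  have e₂ : along d₁ d₂ (Sum.inl (Sum.inr m)) = Sum.inl (Sum.inr m') := congrArg Sum.inl h₂
  suffices H : ∀ p y, Exits d₁ d₂ p y → p ≠ Sum.inl (Sum.inr m) ∧ p ≠ Sum.inr (Sum.inl m') from
    (H _ _ hy).1 rfl
  intro p y h
  induction h with
  | @leave p y h =>
    constructor
    · rintro rfl; rw [e₂] at h; rcases y with y | y <;> simp [outer] at h
    · rintro rfl; rw [e₁] at h; rcases y with y | y <;> simp [outer] at h
  | cross _ _ ih =>
    constructor
    · rintro rfl; rw [e₂] at ih; exact ih.2 rfl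
    · rintro rfl; rw [e₁] at ih; exact ih.1 rfl

theorem sign_eq_zero {d₁ : Diagram j l} {d₂ : Diagram i j} (h : HasLoop d₁ d₂) :
    sign d₁ d₂ = 0 := by
  rw [sign, if_pos h]

/-! ### Composition with a diagram without caps -/

/-- The top end of the line starting at a bottom dot. -/
def Capless.up {u : Diagram j l} (h : u.Capless) (m : Fin j) : Fin l :=
  (u.partner (Sum.inl m)).getRight (h m)

theorem Capless.partner_inl {u : Diagram j l} (h : u.Capless) (m : Fin j) :
    u.partner (Sum.inl m) = Sum.inr (h.up m) := (Sum.inr_getRight _ _).symm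

theorem Capless.partner_up {u : Diagram j l} (h : u.Capless) (m : Fin j) :
    u.partner (Sum.inr (h.up m)) = Sum.inl m := by
  rw [← h.partner_inl, u.partner_partner]

theorem Capless.up_injective {u : Diagram j l} (h : u.Capless) : Function.Injective h.up :=
  fun a b hab => Sum.inl_injective (by rw [← h.partner_up a, hab, h.partner_up])

theorem Capless.up_eq {u : Diagram j l} (h : u.Capless) {m : Fin j} {c : Fin l}
    (e : u.partner (Sum.inr c) = Sum.inl m) : h.up m = c :=
  Sum.inr_injective (by rw [← h.partner_inl, ← e, u.partner_partner])

/-- The dot of a composition that lies on the same line as a given dot of the lower diagram, if the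
upper diagram has no caps. -/
def Capless.lift {u : Diagram j l} (h : u.Capless) (x : Dot i j) : Dot i l :=
  Sum.map id h.up x

theorem Capless.lift_injective {u : Diagram j l} (h : u.Capless) :
    Function.Injective (h.lift (i := i)) :=
  Sum.map_injective.2 ⟨Function.injective_id, h.up_injective⟩

/-- The involution of the composition of a diagram without caps and the diagram given by the
involution `p`. -/
def Capless.after {u : Diagram j l} (h : u.Capless) (p : Dot i j → Dot i j) : Dot i l → Dot i l :=
  Sum.elim (fun a => h.lift (p (Sum.inl a))) fun c =>
    Sum.elim (fun m => h.lift (p (Sum.inr m))) Sum.inr (u.partner (Sum.inr c))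

theorem Capless.comp_partner {u : Diagram j l} (h : u.Capless) (d : Diagram i j) :
    (comp u d).partner = h.after d.partner := by
  funext x
  apply comp_partner_eq
  rcases x with a | c
  · show Exits u d (Sum.inl (Sum.inl a)) (h.lift (d.partner (Sum.inl a)))
    rcases hd : d.partner (Sum.inl a) with b | m
    · exact exits_inl_inl hd
    · exact exits_cross_up hd (exits_inr_inr (h.partner_inl m))
  · show Exits u d (Sum.inr (Sum.inr c)) (Sum.elim (fun m => h.lift (d.partner (Sum.inr m))) Sum.inr
      (u.partner (Sum.inr c)))
    rcases hu : u.partner (Sum.inr c) with m | c'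
    · rw [Sum.elim_inl]
      refine exits_cross_down hu ?_
      rcases hd : d.partner (Sum.inr m) with b | m'
      · exact exits_inl_inl hd
      · exact exits_cross_up hd (exits_inr_inr (h.partner_inl m'))
    · exact exits_inr_inr hu

theorem Capless.comp_partner_lift {u : Diagram j l} (h : u.Capless) (d : Diagram i j)
    (x : Dot i j) : (comp u d).partner (h.lift x) = h.lift (d.partner x) := by
  rw [h.comp_partner]
  rcases x with a | m
  · rfl
  · show Sum.elim _ _ (u.partner (Sum.inr (h.up m))) = _
    rw [h.partner_up]; rfl

theorem Capless.comp_partner_cup {u : Diagram j l} (h : u.Capless) (d : Diagram i j)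
    {c c' : Fin l} (hc : u.partner (Sum.inr c) = Sum.inr c') :
    (comp u d).partner (Sum.inr c) = Sum.inr c' := by
  rw [h.comp_partner]
  show Sum.elim _ _ (u.partner (Sum.inr c)) = _
  rw [hc]; rfl

/-- A diagram is determined by its composition with a diagram without caps. -/
theorem Capless.comp_injective {u : Diagram j l} (h : u.Capless) {d d' : Diagram i j}
    (e : comp u d = comp u d') : d = d' := by
  refine ext' fun x => h.lift_injective ?_
  rw [← h.comp_partner_lift, e, h.comp_partner_lift]

theorem Capless.comp {u : Diagram j l} (h : u.Capless) {d : Diagram i j} (hd : d.Capless) :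
    (comp u d).Capless := by
  intro a
  rw [h.comp_partner]
  show (h.lift (d.partner (Sum.inl a))).isRight
  rw [hd.partner_inl]; rfl

theorem Capless.not_hasLoop {u : Diagram j l} (h : u.Capless) (d : Diagram i j) :
    ¬ HasLoop u d := by
  rintro ⟨m, hm⟩
  apply hm
  rcases hd : d.partner (Sum.inr m) with b | m'
  · exact ⟨_, exits_inl_inl hd⟩
  · exact ⟨_, exits_cross_up hd (exits_inr_inr (h.partner_inl m'))⟩

theorem Cupless.not_hasLoop {v : Diagram i j} (h : v.Cupless) (d : Diagram j l) :
    ¬ HasLoop d v := by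
  rintro ⟨m, hm⟩
  obtain ⟨a, ha⟩ := h.exists m
  exact hm ⟨_, exits_inl_inl ha⟩

theorem comp_cap (d : Diagram j l) {d' : Diagram i j} {a b : Fin i}
    (h : d'.partner (Sum.inl a) = Sum.inl b) : (comp d d').partner (Sum.inl a) = Sum.inl b :=
  comp_partner_eq (exits_inl_inl h)

theorem comp_cup {d : Diagram j l} (d' : Diagram i j) {a b : Fin l}
    (h : d.partner (Sum.inr a) = Sum.inr b) : (comp d d').partner (Sum.inr a) = Sum.inr b :=
  comp_partner_eq (exits_inr_inr h)

theorem not_capless_comp (d : Diagram j l) {d' : Diagram i j} (h : ¬ d'.Capless) :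
    ¬ (comp d d').Capless := by
  obtain ⟨a, b, hab⟩ := exists_cap h
  intro hc
  have := hc a
  rw [comp_cap d hab] at this
  simp at this

theorem Capless.of_comp {d : Diagram j l} {d' : Diagram i j} (h : (Diagram.comp d d').Capless) :
    d'.Capless := by
  by_contra hd
  exact not_capless_comp d hd h

/-- A criterion for `e` to be the composition of `d` with a diagram without caps: `e` has the lines of
`d`, moved to the top, and the cups of `u`. -/
theorem Capless.eq_comp_iff {u : Diagram j l} (h : u.Capless) (d : Diagram i j) (e : Diagram i l)
    (h1 : ∀ x, e.partner (h.lift x) = h.lift (d.partner x))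
    (h2 : ∀ c c', u.partner (Sum.inr c) = Sum.inr c' → e.partner (Sum.inr c) = Sum.inr c') :
    Diagram.comp u d = e := by
  refine ext' fun x => ?_
  rcases x with a | c
  · exact (h.comp_partner_lift d (Sum.inl a)).trans (h1 (Sum.inl a)).symm
  · rcases hu : u.partner (Sum.inr c) with m | c'
    · rw [← h.up_eq hu]
      exact (h.comp_partner_lift d (Sum.inr m)).trans (h1 (Sum.inr m)).symm
    · rw [h.comp_partner_cup d hu, h2 _ _ hu]

/-- A diagram factors through the top dots outside of a set of cups. -/
theorem exists_factor_top {m : ℕ} (d : Diagram i l) (g : Fin m → Fin l) (hg : Function.Injective g)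
    (hd : ∀ c, c ∉ Set.range g → ∃ c', c' ∉ Set.range g ∧ d.partner (Sum.inr c) = Sum.inr c') :
    ∃ (u : Diagram m l) (d' : Diagram i m) (hu : u.Capless), Diagram.comp u d' = d ∧
      ∀ a, hu.up a = g a := by
  classical
  -- the upper factor
  let pu : Dot m l → Dot m l := Sum.elim (fun a => Sum.inr (g a)) fun c =>
    if h : ∃ a, g a = c then Sum.inl h.choose
    else Sum.inr (Sum.elim (fun _ => c) id (d.partner (Sum.inr c)))
  have pu1 : ∀ a, pu (Sum.inr (g a)) = Sum.inl a := by
    intro a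
    have h : ∃ a', g a' = g a := ⟨a, rfl⟩
    show dite _ _ _ = _
    rw [dif_pos h]
    exact congrArg Sum.inl (hg h.choose_spec)
  have pu2 : ∀ c c', c ∉ Set.range g → d.partner (Sum.inr c) = Sum.inr c' →
      pu (Sum.inr c) = Sum.inr c' := by
    intro c c' hc e
    show dite _ _ _ = _
    rw [dif_neg (show ¬ ∃ a, g a = c from hc), e]; rfl
  let u : Diagram m l :=
    { partner := pu
      partner_partner := by
        rintro (a | c)
        · exact pu1 a
        · by_cases hc : c ∈ Set.range g
          · obtain ⟨a, rfl⟩ := hc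
            rw [pu1]; rfl
          · obtain ⟨c', hc', e⟩ := hd c hc
            rw [pu2 c c' hc e, pu2 c' c hc' ((partner_eq_iff d).1 e)]
      partner_ne := by
        rintro (a | c)
        · simp [pu]
        · by_cases hc : c ∈ Set.range g
          · obtain ⟨a, rfl⟩ := hc
            rw [pu1]; simp
          · obtain ⟨c', hc', e⟩ := hd c hc
            rw [pu2 c c' hc e]
            intro h
            exact d.partner_ne (Sum.inr c) (e.trans (congrArg Sum.inr (Sum.inr_injective h))) }
  have hu : u.Capless := fun a => rfl
  have hup : ∀ a, hu.up a = g a := fun a => rfl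
  -- the lower factor
  have hmem : ∀ x : Dot i m, ∃ y : Dot i m, hu.lift y = d.partner (hu.lift x) := by
    intro x
    rcases hy : d.partner (hu.lift x) with b | c
    · exact ⟨Sum.inl b, rfl⟩
    · by_cases hc : c ∈ Set.range g
      · obtain ⟨a, rfl⟩ := hc
        exact ⟨Sum.inr a, rfl⟩
      · obtain ⟨c', hc', e⟩ := hd c hc
        rw [(partner_eq_iff d).1 hy] at e
        rcases x with b | a
        · exact absurd e (by simp [Capless.lift])
        · exact absurd ⟨a, Sum.inr_injective e⟩ hc'
  choose p hp using hmem
  let d' : Diagram i m :=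
    { partner := p
      partner_partner := fun x => hu.lift_injective (by rw [hp, hp, d.partner_partner])
      partner_ne := fun x e => d.partner_ne (hu.lift x) (by rw [← hp, e]) }
  refine ⟨u, d', hu, hu.eq_comp_iff _ _ (fun x => (hp x).symm) ?_, hup⟩
  intro c c' e
  by_cases hc : c ∈ Set.range g
  · obtain ⟨a, rfl⟩ := hc
    exact absurd ((pu1 a).symm.trans e) (by simp)
  · obtain ⟨c'', hc'', e'⟩ := hd c hc
    have h : (Sum.inr c'' : Dot m l) = Sum.inr c' := (pu2 c c'' hc e').symm.trans e
    rw [e', Sum.inr_injective h]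

/-- A diagram with a cup factors through two dots fewer. -/
theorem exists_factor_of_cup {d : Diagram i (l + 2)} (h : ¬ d.Cupless) :
    ∃ (u : Diagram l (l + 2)) (d' : Diagram i l), u.Capless ∧ Diagram.comp u d' = d := by
  obtain ⟨x, y, hxy⟩ := exists_cup h
  have hne : x ≠ y := fun e => d.partner_ne (Sum.inr x) (by rw [hxy, e])
  have hcard : ((Finset.univ : Finset (Fin (l + 2))) \ {x, y}).card = l := by
    rw [Finset.card_sdiff_of_subset (Finset.subset_univ _), Finset.card_pair hne]
    simp
  let g := (((Finset.univ : Finset (Fin (l + 2))) \ {x, y}).orderEmbOfFin hcard)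
  have hr : ∀ c, c ∉ Set.range g ↔ c = x ∨ c = y := by
    intro c
    rw [Finset.range_orderEmbOfFin]
    simp
    tauto
  obtain ⟨u, d', hu, e, -⟩ := exists_factor_top d g g.injective (fun c hc => by
    rcases (hr c).1 hc with rfl | rfl
    · exact ⟨y, (hr y).2 (Or.inr rfl), hxy⟩
    · exact ⟨x, (hr x).2 (Or.inl rfl), (partner_eq_iff d).1 hxy⟩)
  exact ⟨u, d', hu, e⟩

/-! ### Reflection of diagrams at a horizontal line -/

/-- The diagram turned upside down. -/
def swap (d : Diagram i j) : Diagram j i where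
  partner x := (d.partner x.swap).swap
  partner_partner x := by rw [Sum.swap_swap, d.partner_partner, Sum.swap_swap]
  partner_ne x h := d.partner_ne x.swap (by
    have := congrArg Sum.swap h
    rwa [Sum.swap_swap] at this)

theorem swap_swap (d : Diagram i j) : d.swap.swap = d :=
  ext' fun x => by simp [swap]

theorem capless_swap (d : Diagram i j) : d.swap.Capless ↔ d.Cupless := by
  refine forall_congr' fun a => ?_
  show (d.partner (Sum.inr a)).swap.isRight ↔ _
  rw [Sum.isRight_swap]

theorem cupless_swap (d : Diagram i j) : d.swap.Cupless ↔ d.Capless := by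
  rw [← capless_swap, swap_swap]

theorem Exits.swap {d₁ : Diagram j l} {d₂ : Diagram i j} {p : StackDot i j l} {y : Dot i l}
    (h : Exits d₁ d₂ p y) :
    Exits d₂.swap d₁.swap (Sum.map Sum.swap Sum.swap p.swap) y.swap := by
  have key : ∀ p : StackDot i j l, along d₂.swap d₁.swap (Sum.map Sum.swap Sum.swap p.swap) =
      Sum.map Sum.swap Sum.swap (along d₁ d₂ p).swap := by
    rintro (x | x) <;> simp [along, Diagram.swap]
  have keyg : ∀ p : StackDot i j l, glue (Sum.map Sum.swap Sum.swap p.swap) =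
      Sum.map Sum.swap Sum.swap (glue p).swap := by
    rintro ((x | x) | (x | x)) <;> simp [glue]
  induction h with
  | @leave p y h =>
    refine .leave ?_
    rw [key, h]
    rcases y with y | y <;> rfl
  | @cross p y h _ ih =>
    refine .cross ?_ ?_
    · rw [key, keyg]
      intro e
      apply h
      generalize glue (along d₁ d₂ p) = q at *
      generalize along d₁ d₂ p = q' at *
      rcases q with (q | q) | (q | q) <;> rcases q' with (q' | q') | (q' | q') <;> simp_all
    · rw [key, keyg]; exact ih

theorem swap_comp (d₁ : Diagram j l) (d₂ : Diagram i j) :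
    (Diagram.comp d₁ d₂).swap = Diagram.comp d₂.swap d₁.swap := by
  refine ext' fun x => (comp_partner_eq ?_).symm
  have := (exits_comp d₁ d₂ x.swap).swap
  rcases x with x | x <;> exact this

/-- A diagram with a cap factors through two dots fewer. -/
theorem exists_factor_of_cap {d : Diagram (i + 2) l} (h : ¬ d.Capless) :
    ∃ (d' : Diagram i l) (v : Diagram (i + 2) i), v.Cupless ∧ Diagram.comp d' v = d := by
  obtain ⟨u, d', hu, e⟩ := exists_factor_of_cup (d := d.swap) (fun hc => h ((cupless_swap d).1 hc))
  refine ⟨d'.swap, u.swap, (cupless_swap u).2 hu, ?_⟩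
  rw [← swap_comp, e, swap_swap]

/-! ### Permutation diagrams -/

theorem capless_ofPerm (σ : Equiv.Perm (Fin j)) : (ofPerm σ).Capless := fun _ => rfl

theorem cupless_ofPerm (σ : Equiv.Perm (Fin j)) : (ofPerm σ).Cupless := fun _ => rfl

theorem ofPerm_injective : Function.Injective (ofPerm (i := i)) := fun _ _ h =>
  Equiv.ext fun x => Sum.inr_injective (congrArg (fun d => Diagram.partner d (Sum.inl x)) h)

theorem ofPerm_one : ofPerm (1 : Equiv.Perm (Fin i)) = one i :=
  ext' fun x => by rcases x with x | x <;> rfl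

theorem comp_ofPerm_ofPerm (σ τ : Equiv.Perm (Fin i)) :
    Diagram.comp (ofPerm σ) (ofPerm τ) = ofPerm (σ * τ) := by
  refine (capless_ofPerm σ).eq_comp_iff _ _ ?_ ?_
  · rintro (a | a)
    · rfl
    · show Sum.inl ((σ * τ).symm (σ a)) = Sum.inl (τ.symm a)
      congr 1
      simp [Equiv.Perm.mul_def]
  · intro c c' h
    simp [ofPerm] at h

theorem weight_false (d : Diagram i j) : d.weight (fun _ => false) = 1 := by
  simp [weight]

theorem canon_of_not_turns {d : Diagram i j} (h : ∀ x, ¬ d.Turns x) : d.canon = fun _ => false := by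
  funext x
  simp [canon, IsLeftEnd, h x]

theorem not_turns {d : Diagram i j} (h : d.Capless) (h' : d.Cupless) (x : Dot i j) :
    ¬ d.Turns x := by
  rcases x with a | b
  · obtain ⟨c, hc⟩ := h.exists a
    simp [Turns, hc]
  · obtain ⟨c, hc⟩ := h'.exists b
    simp [Turns, hc]

theorem sign_ofPerm_ofPerm (σ τ : Equiv.Perm (Fin i)) : sign (ofPerm σ) (ofPerm τ) = 1 := by
  have hc : (Diagram.comp (ofPerm σ) (ofPerm τ)).canon = fun _ => false := by
    rw [comp_ofPerm_ofPerm]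
    exact canon_of_not_turns (not_turns (capless_ofPerm _) (cupless_ofPerm _))
  have hm : midColour (ofPerm σ) (ofPerm τ) = fun _ => false := by
    funext m
    rw [midColour_eq _ _ (exits_inl_inl (b := τ.symm m) rfl), hc]
    rfl
  have he : ∀ a b : ℕ, Sum.elim (fun _ : Fin a => false) (fun _ : Fin b => false) =
      fun _ => false := by
    intro a b; funext x; rcases x with x | x <;> rfl
  rw [sign, if_neg ((capless_ofPerm σ).not_hasLoop _), hm, hc]
  have h1 := weight_false (ofPerm σ)
  have h2 := weight_false (ofPerm τ)
  have h3 := weight_false (Diagram.comp (ofPerm σ) (ofPerm τ))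
  rw [← he] at h1 h2
  rw [h3, mul_one]
  exact (congrArg₂ (· * ·) h1 h2).trans (one_mul 1)

theorem exists_ofPerm {d : Diagram i j} (h : d.Capless) (h' : d.Cupless) : i = j := by
  have h1 := Fintype.card_le_of_injective _ h.up_injective
  have h2 := Fintype.card_le_of_injective _ ((capless_swap d).2 h').up_injective
  simp at h1 h2
  omega

theorem exists_eq_ofPerm {d : Diagram i i} (h : d.Capless) : ∃ σ, d = ofPerm σ := by
  refine ⟨Equiv.ofBijective h.up (Finite.injective_iff_bijective.1 h.up_injective), ext' ?_⟩
  have hl : ∀ a, d.partner (Sum.inl a) =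
      (ofPerm (Equiv.ofBijective h.up (Finite.injective_iff_bijective.1 h.up_injective))).partner
        (Sum.inl a) := h.partner_inl
  rintro (a | b)
  · exact hl a
  · rw [partner_eq_iff]
    show d.partner (Sum.inl _) = _
    rw [hl]
    show Sum.inr (Equiv.ofBijective h.up _ _) = _
    rw [Equiv.apply_symm_apply]

/-! ### Cup configurations -/

/-- The right action of permutations on diagrams without caps, as an equivalence relation. -/
def permSetoid (j l : ℕ) : Setoid {u : Diagram j l // u.Capless} where
  r u u' := ∃ σ, Diagram.comp u.1 (ofPerm σ) = u'.1
  iseqv :=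
    { refl := fun u => ⟨1, by rw [ofPerm_one, (comp_one u.1).1]⟩
      symm := by
        rintro u u' ⟨σ, h⟩
        refine ⟨σ⁻¹, ?_⟩
        rw [← h, (comp_assoc u.1 (ofPerm σ) (ofPerm σ⁻¹)).2, comp_ofPerm_ofPerm, mul_inv_cancel,
          ofPerm_one, (comp_one u.1).1]
        refine mul_ne_zero ?_ ?_
        · intro h0
          have := sign_mul_self _ _ (u.2.not_hasLoop (ofPerm σ))
          simp [h0] at this
        · intro h0
          have := sign_mul_self _ _ ((u.2.comp (capless_ofPerm σ)).not_hasLoop (ofPerm σ⁻¹))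
          simp [h0] at this
      trans := by
        rintro u u' u'' ⟨σ, h⟩ ⟨τ, h'⟩
        refine ⟨σ * τ, ?_⟩
        rw [← h', ← h, (comp_assoc u.1 (ofPerm σ) (ofPerm τ)).2, comp_ofPerm_ofPerm]
        refine mul_ne_zero ?_ ?_
        · intro h0
          have := sign_mul_self _ _ (u.2.not_hasLoop (ofPerm σ))
          simp [h0] at this
        · intro h0
          have := sign_mul_self _ _ ((u.2.comp (capless_ofPerm σ)).not_hasLoop (ofPerm τ))
          simp [h0] at this }

/-- The cup configurations with `j` free dots on a line with `l` dots. -/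
abbrev CupConfig (j l : ℕ) := Quotient (permSetoid j l)

/-- A diagram without caps that has the given cups. -/
noncomputable def CupConfig.rep (t : CupConfig j l) : Diagram j l := t.out.1

theorem CupConfig.capless_rep (t : CupConfig j l) : t.rep.Capless := t.out.2

instance : Finite (CupConfig j l) := Quotient.finite _

noncomputable instance : Fintype (CupConfig j l) := Fintype.ofFinite _

noncomputable instance : DecidableEq (CupConfig j l) := Classical.decEq _

theorem Capless.exists_rep {u : Diagram j l} (h : u.Capless) :
    ∃ (t : CupConfig j l) (σ : Equiv.Perm (Fin j)), Diagram.comp t.rep (ofPerm σ) = u := by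
  refine ⟨Quotient.mk (permSetoid j l) ⟨u, h⟩, ?_⟩
  exact Quotient.exact (s := permSetoid j l) (Quotient.out_eq (s := permSetoid j l) _)

/-- The cup configuration of the upper factor is determined by the composition. -/
theorem CupConfig.eq_of_comp_eq {t t' : CupConfig j l} {v v' : Diagram i j} (hv : v.Cupless)
    (e : Diagram.comp t.rep v = Diagram.comp t'.rep v') : t = t' := by
  have hu := t.capless_rep
  have hu' := t'.capless_rep
  set u := t.rep with hut
  set u' := t'.rep with hut'
  have key : ∀ m, ∃ m', hu'.up m' = hu.up m := by
    intro m
    obtain ⟨a, ha⟩ := hv.exists m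
    have h1 := hu.comp_partner_lift v (Sum.inr m)
    rw [ha, e] at h1
    have h1 : (Diagram.comp u' v').partner (Sum.inr (hu.up m)) = Sum.inl a := h1
    rcases hx : u'.partner (Sum.inr (hu.up m)) with m' | c
    · exact ⟨m', hu'.up_eq hx⟩
    · rw [hu'.comp_partner_cup v' hx] at h1
      simp at h1
  choose f hf using key
  have hfi : Function.Injective f := fun a b hab => hu.up_injective (by rw [← hf, hab, hf])
  let σ : Equiv.Perm (Fin j) := Equiv.ofBijective f (Finite.injective_iff_bijective.1 hfi)
  have hσ : Diagram.comp u' (ofPerm σ) = u := by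
    refine hu'.eq_comp_iff _ _ ?_ ?_
    · have h0 : ∀ a, u.partner (Sum.inl a) = Sum.inr (hu'.up (σ a)) := by
        intro a
        rw [hu.partner_inl]
        exact congrArg Sum.inr (hf a).symm
      rintro (a | a)
      · exact h0 a
      · show u.partner (Sum.inr (hu'.up a)) = Sum.inl (σ.symm a)
        rw [partner_eq_iff, h0, Equiv.apply_symm_apply]
    · intro c c' h
      rcases hx : u.partner (Sum.inr c) with m | c''
      · have := hu.up_eq hx
        rw [← this, ← hf, hu'.partner_up] at h
        simp at h
      · have h1 : (Sum.inr c'' : Dot i l) = Sum.inr c' := by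
          rw [← hu.comp_partner_cup v hx, e, hu'.comp_partner_cup v' h]
        exact congrArg Sum.inr (Sum.inr_injective h1)
  have : Quotient.mk (permSetoid j l) t'.out = Quotient.mk (permSetoid j l) t.out := by
    refine Quotient.sound (s := permSetoid j l) ⟨σ, ?_⟩
    exact hσ
  rw [Quotient.out_eq, Quotient.out_eq] at this
  exact this.symm

/-! ### Diagrams that factor through few dots -/

/-- The diagram factors through fewer than `m` dots. -/
def FactorsBelow (m : ℕ) (d : Diagram i l) : Prop :=
  ∃ (r : ℕ) (_ : r < m) (d₁ : Diagram r l) (d₂ : Diagram i r), d = Diagram.comp d₁ d₂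

/-- The number of propagating lines of `u ∘ v` is `j`, so it cannot factor through fewer dots. -/
theorem not_factorsBelow {u : Diagram j l} {v : Diagram i j} (hu : u.Capless) (hv : v.Cupless) :
    ¬ FactorsBelow j (Diagram.comp u v) := by
  rintro ⟨r, hr, d₁, d₂, e⟩
  have key : ∀ m : Fin j, ∃ (a : Fin i) (q : Fin r), v.partner (Sum.inr m) = Sum.inl a ∧
      d₂.partner (Sum.inl a) = Sum.inr q := by
    intro m
    obtain ⟨a, ha⟩ := hv.exists m
    refine ⟨a, ?_⟩
    rcases hx : d₂.partner (Sum.inl a) with b | q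
    · have h1 := hu.comp_partner_lift v (Sum.inl a)
      have h2 := comp_cap d₁ hx
      rw [← e] at h2
      rw [(partner_eq_iff v).1 ha] at h1
      have h3 := h2.symm.trans h1
      simp [Capless.lift] at h3
    · exact ⟨q, ha, rfl⟩
  choose a q h1 h2 using key
  have : Function.Injective q := by
    intro m m' h
    have h3 : a m = a m' := Sum.inl_injective (d₂.partner_injective (by rw [h2, h2, h]))
    exact Sum.inr_injective (v.partner_injective (by rw [h1, h1, h3]))
  have := Fintype.card_le_of_injective _ this
  simp at this
  omega

end Diagram

end

section

/-! ### Diagrams with few dots -/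

namespace Diagram

open StackDot

variable {i j l : ℕ}

/-- The diagram that adds a cup to the right of `j` propagating lines. -/
def addCup (j : ℕ) : Diagram j (j + 2) where
  partner := Sum.elim (fun a => Sum.inr (Fin.castAdd 2 a))
    (Fin.addCases Sum.inl fun b => Sum.inr (Fin.natAdd j (Fin.rev b)))
  partner_partner := by
    rintro (a | b)
    · simp
    · refine Fin.addCases (fun a => ?_) (fun b => ?_) b <;> simp
  partner_ne := by
    rintro (a | b)
    · simp
    · refine Fin.addCases (fun a => ?_) (fun b => ?_) b
      · simp
      · fin_cases b <;> simp [Fin.ext_iff]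

theorem capless_addCup (j : ℕ) : (addCup j).Capless := fun _ => rfl

theorem addCup_partner_natAdd (j : ℕ) (b : Fin 2) :
    (addCup j).partner (Sum.inr (Fin.natAdd j b)) = Sum.inr (Fin.natAdd j (Fin.rev b)) := by
  simp [addCup]

/-- The two rightmost top dots are connected by a cup. -/
def EndsInCup (d : Diagram i (j + 2)) : Prop :=
  d.partner (Sum.inr (Fin.natAdd j 0)) = Sum.inr (Fin.natAdd j 1)

theorem endsInCup_comp_addCup (d : Diagram i j) : EndsInCup (comp (addCup j) d) :=
  comp_cup d (addCup_partner_natAdd j 0)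

theorem EndsInCup.exists_eq {d : Diagram i (j + 2)} (h : EndsInCup d) :
    ∃ d', d = comp (addCup j) d' := by
  have hr : ∀ b : Fin 2, Fin.natAdd j b ∉ Set.range (Fin.castAdd (n := j) 2) := by
    rintro b ⟨a, ha⟩
    simp [Fin.ext_iff] at ha
    omega
  have hb : ∀ b : Fin 2, d.partner (Sum.inr (Fin.natAdd j b)) = Sum.inr (Fin.natAdd j (Fin.rev b)) := by
    intro b
    fin_cases b
    · exact h
    · exact (partner_eq_iff d).1 h
  have hd : ∀ c, c ∉ Set.range (Fin.castAdd (n := j) 2) →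
      ∃ c', c' ∉ Set.range (Fin.castAdd (n := j) 2) ∧ d.partner (Sum.inr c) = Sum.inr c' := by
    intro c
    refine Fin.addCases (fun a => ?_) (fun b => ?_) c
    · intro h; exact absurd ⟨a, rfl⟩ h
    · intro _; exact ⟨_, hr _, hb b⟩
  obtain ⟨u, d', hu, e, hup⟩ := exists_factor_top d _ (Fin.castAdd_injective j 2) hd
  refine ⟨d', ((capless_addCup j).eq_comp_iff _ _ ?_ ?_).symm⟩
  · have hl : ∀ x : Dot i j, (capless_addCup j).lift x = hu.lift x := by
      rintro (x | x)
      · rfl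
      · exact congrArg Sum.inr (hup x).symm
    intro x
    rw [hl, hl, ← e, hu.comp_partner_lift]
  · intro c c'
    refine Fin.addCases (fun a => ?_) (fun b => ?_) c
    · intro h'
      simp [addCup] at h'
    · intro h'
      rw [addCup_partner_natAdd] at h'
      rw [hb, Sum.inr_injective h']

/-- The diagram that connects the last of `j + 1` top dots with the last of the `j + 3` bottom dots,
and the two bottom dots before the last one with each other. -/
def slide (j : ℕ) : Diagram (j + 3) (j + 1) where
  partner := Sum.elim
    (fun a => if h : a.1 < j then Sum.inr ⟨a, by omega⟩ else
      if a.1 = j then Sum.inl ⟨j + 1, by omega⟩ else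
      if a.1 = j + 1 then Sum.inl ⟨j, by omega⟩ else Sum.inr ⟨j, by omega⟩)
    fun b => if b.1 < j then Sum.inl ⟨b, by omega⟩ else Sum.inl ⟨j + 2, by omega⟩
  partner_partner := by
    rintro (a | b)
    · obtain ⟨a, ha⟩ := a
      rcases (by omega : a < j ∨ a = j ∨ a = j + 1 ∨ a = j + 2) with h | rfl | rfl | rfl <;>
        simp_all
    · obtain ⟨b, hb⟩ := b
      rcases (by omega : b < j ∨ b = j) with h | rfl <;> simp_all
  partner_ne := by
    rintro (a | b)
    · obtain ⟨a, ha⟩ := a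
      rcases (by omega : a < j ∨ a = j ∨ a = j + 1 ∨ a = j + 2) with h | rfl | rfl | rfl <;>
        simp_all
    · obtain ⟨b, hb⟩ := b
      rcases (by omega : b < j ∨ b = j) with h | rfl <;> simp_all

theorem slide_comp_addCup (j : ℕ) :
    comp (slide j) (addCup (j + 1)) = one (j + 1) ∧ ¬ HasLoop (slide j) (addCup (j + 1)) := by
  have s1 : ∀ (a : ℕ) (h : a < j), (slide j).partner (Sum.inl ⟨a, by omega⟩) =
      Sum.inr ⟨a, by omega⟩ := fun a h => by simp [slide, h]
  have s2 : (slide j).partner (Sum.inl ⟨j, by omega⟩) = Sum.inl ⟨j + 1, by omega⟩ := by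
    simp [slide]
  have s3 : (slide j).partner (Sum.inl ⟨j + 2, by omega⟩) = Sum.inr ⟨j, by omega⟩ := by
    simp [slide]
  have c1 : ∀ (a : ℕ) (h : a < j + 1), (addCup (j + 1)).partner (Sum.inl ⟨a, h⟩) =
      Sum.inr ⟨a, by omega⟩ := fun _ _ => rfl
  have c2 : (addCup (j + 1)).partner (Sum.inr ⟨j + 1, by omega⟩) = Sum.inr ⟨j + 2, by omega⟩ :=
    addCup_partner_natAdd (j + 1) 0
  have e3 : Exits (slide j) (addCup (j + 1)) (Sum.inr (Sum.inl ⟨j + 2, by omega⟩))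
      (Sum.inr ⟨j, by omega⟩) := exits_inr_inr s3
  have e2 : Exits (slide j) (addCup (j + 1)) (Sum.inr (Sum.inl ⟨j, by omega⟩))
      (Sum.inr ⟨j, by omega⟩) := exits_cross_down s2 (exits_cross_up c2 e3)
  have e1 : ∀ a : Fin (j + 1), Exits (slide j) (addCup (j + 1)) (Sum.inl (Sum.inl a))
      (Sum.inr a) := by
    rintro ⟨a, ha⟩
    rcases (by omega : a < j ∨ a = j) with h | rfl
    · exact exits_cross_up (c1 a ha) (exits_inr_inr (s1 a h))
    · exact exits_cross_up (c1 a ha) e2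
  have hp : ∀ a, (comp (slide j) (addCup (j + 1))).partner (Sum.inl a) = Sum.inr a :=
    fun a => comp_partner_eq (e1 a)
  constructor
  · refine ext' fun x => ?_
    rcases x with a | a
    · exact hp a
    · rw [partner_eq_iff]; exact hp a
  · rintro ⟨⟨m, hm⟩, h⟩
    apply h
    rcases (by omega : m < j + 1 ∨ m = j + 1 ∨ m = j + 2) with h | rfl | rfl
    · exact ⟨_, exits_inl_inl ((partner_eq_iff _).1 (c1 m h))⟩
    · exact ⟨_, exits_cross_up c2 e3⟩
    · exact ⟨_, exits_cross_up ((partner_eq_iff _).1 c2)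
        (exits_cross_down ((partner_eq_iff _).1 s2) (exits_inl_inl ((partner_eq_iff _).1 (c1 j (by omega)))))⟩

/-- The cap on two dots. -/
def capTwo : Diagram 2 0 := (addCup 0).swap

/-- The cap on the first two of four dots. -/
def capFour : Diagram 4 2 where
  partner := Sum.elim ![Sum.inl 1, Sum.inl 0, Sum.inr 0, Sum.inr 1] ![Sum.inl 2, Sum.inl 3]
  partner_partner := by decide
  partner_ne := by decide

/-- The transposition of two letters. -/
def swapTwo : Equiv.Perm (Fin 2) := Equiv.swap 0 1

/-- The transposition of the first two of four letters. -/
def swapFst : Equiv.Perm (Fin 4) := Equiv.swap 0 1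

/-- The transposition of the last two of four letters. -/
def swapSnd : Equiv.Perm (Fin 4) := Equiv.swap 2 3

/-- The exchange of the two pairs of adjacent letters among four. -/
def swapPairs : Equiv.Perm (Fin 4) := Equiv.swap 0 2 * Equiv.swap 1 3

/-- The exchange of the first two of three pairs of adjacent letters. -/
def swapPairsFst : Equiv.Perm (Fin 6) := Equiv.swap 0 2 * Equiv.swap 1 3

/-- The exchange of the last two of three pairs of adjacent letters. -/
def swapPairsSnd : Equiv.Perm (Fin 6) := Equiv.swap 2 4 * Equiv.swap 3 5

theorem comp_eq_comp {j' : ℕ} {u : Diagram j l} {u' : Diagram j' l} (h : u.Capless) (h' : u'.Capless)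
    {d : Diagram i j} {d' : Diagram i j'} (e : ∀ x, h.after d.partner x = h'.after d'.partner x) :
    comp u d = comp u' d' :=
  ext' fun x => by rw [h.comp_partner, h'.comp_partner, e]

theorem comp_swapTwo : comp (ofPerm swapTwo) (addCup 0) = addCup 0 :=
  ext' fun x => by rw [(capless_ofPerm swapTwo).comp_partner]; revert x; decide

theorem comp_swapSnd : comp (ofPerm swapSnd) (addCup 2) = addCup 2 :=
  ext' fun x => by rw [(capless_ofPerm swapSnd).comp_partner]; revert x; decide

theorem comp_swapFst : comp (ofPerm swapFst) (addCup 2) = comp (addCup 2) (ofPerm swapTwo) :=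
  comp_eq_comp (capless_ofPerm _) (capless_addCup 2) (by decide)

theorem comp_swapPairsFst :
    comp (ofPerm swapPairsFst) (addCup 4) = comp (addCup 4) (ofPerm swapPairs) :=
  comp_eq_comp (capless_ofPerm _) (capless_addCup 4) (by decide)

theorem comp_swapPairs :
    comp (ofPerm swapPairs) (comp (addCup 2) (addCup 0)) = comp (addCup 2) (addCup 0) :=
  ext' fun x => by
    rw [(capless_ofPerm _).comp_partner, (capless_addCup 2).comp_partner]; revert x; decide

theorem comp_swapPairsSnd :
    comp (ofPerm swapPairsSnd) (comp (addCup 4) (addCup 2)) = comp (addCup 4) (addCup 2) :=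
  ext' fun x => by
    rw [(capless_ofPerm _).comp_partner, (capless_addCup 4).comp_partner]; revert x; decide

theorem swapFst_mul : swapFst * swapPairs = swapPairs * swapSnd := by decide

theorem swapPairs_braid : swapPairsFst * swapPairsSnd * swapPairsFst =
    swapPairsSnd * swapPairsFst * swapPairsSnd := by decide

theorem hasLoop_capTwo : HasLoop capTwo (addCup 0) :=
  hasLoop_of (m := 0) (m' := 1) (by decide) (by decide)

theorem hasLoop_capFour : HasLoop capFour (comp (ofPerm swapPairs) (addCup 2)) :=
  hasLoop_of (m := 0) (m' := 1) (by decide) (by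
    rw [(capless_ofPerm _).comp_partner]; decide)

theorem comp_capFour : comp capFour (addCup 2) = comp (addCup 0) capTwo := by
  have e1 : (comp capFour (addCup 2)).partner (Sum.inl 0) = Sum.inl 1 := comp_partner_eq
    (exits_cross_up (m := 0) (by decide) (exits_cross_down (m := 1) (by decide)
      (exits_inl_inl (by decide))))
  have e2 : (comp capFour (addCup 2)).partner (Sum.inr 0) = Sum.inr 1 := comp_partner_eq
    (exits_cross_down (m := 2) (by decide) (exits_cross_up (m := 3) (by decide)
      (exits_inr_inr (by decide))))
  have e3 := (partner_eq_iff _).1 e1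
  have e4 := (partner_eq_iff _).1 e2
  refine ext' fun x => ?_
  rw [(capless_addCup 0).comp_partner]
  rcases x with x | x <;> fin_cases x
  · exact e1.trans (by decide)
  · exact e3.trans (by decide)
  · exact e2.trans (by decide)
  · exact e4.trans (by decide)

theorem not_hasLoop_capFour : ¬ HasLoop capFour (addCup 2) := by
  rintro ⟨m, h⟩
  apply h
  fin_cases m
  · exact ⟨_, exits_inl_inl (b := 0) (by decide)⟩
  · exact ⟨_, exits_inl_inl (b := 1) (by decide)⟩
  · exact ⟨Sum.inr 1, exits_cross_up (m := 3) (by decide) (exits_inr_inr (by decide))⟩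
  · exact ⟨Sum.inr 0, exits_cross_up (m := 2) (by decide) (exits_inr_inr (by decide))⟩

/-- Two diagrams with two bottom dots and without caps that agree after closing the two dots by a
cup are obtained from one another by a permutation, or by opening different cups of the same
diagram. -/
theorem eq_or_exists_of_comp_addCup {d d' : Diagram 2 l} (h : d.Capless) (h' : d'.Capless)
    (e : comp d (addCup 0) = comp d' (addCup 0)) :
    ∃ σ : Equiv.Perm (Fin 2), d' = comp d (ofPerm σ) ∨ ∃ v : Diagram 4 l, v.Capless ∧
      d = comp v (addCup 2) ∧ d' = comp v (comp (ofPerm swapPairs) (addCup 2)) := by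
  -- the diagram obtained by closing the two dots
  set m := comp d (addCup 0) with hm
  have a0 : ∀ b : Fin 2, (addCup 0).partner (Sum.inr b) = Sum.inr (Fin.rev b) := by decide
  have mu : ∀ a, m.partner (Sum.inr (h.up a)) = Sum.inr (h.up (Fin.rev a)) := fun a =>
    (h.comp_partner_lift (addCup 0) (Sum.inr a)).trans (congrArg h.lift (a0 a))
  have mu' : ∀ a, m.partner (Sum.inr (h'.up a)) = Sum.inr (h'.up (Fin.rev a)) := fun a => by
    rw [e]
    exact (h'.comp_partner_lift (addCup 0) (Sum.inr a)).trans (congrArg h'.lift (a0 a))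
  have mc : ∀ c c', d.partner (Sum.inr c) = Sum.inr c' → m.partner (Sum.inr c) = Sum.inr c' :=
    fun c c' hc => h.comp_partner_cup _ hc
  have mc' : ∀ c, c ∉ Set.range h'.up → d'.partner (Sum.inr c) = Sum.inr
      ((m.partner (Sum.inr c)).elim Fin.elim0 id) := by
    intro c hc
    rcases hx : d'.partner (Sum.inr c) with a | c'
    · exact absurd ⟨a, h'.up_eq hx⟩ hc
    · rw [e, h'.comp_partner_cup _ hx]; rfl
  have key : ∀ σ : Equiv.Perm (Fin 2), (∀ a, h'.up a = h.up (σ a)) → d' = comp d (ofPerm σ) := by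
    intro σ hσ
    refine (h.eq_comp_iff _ _ ?_ ?_).symm
    · have h0 : ∀ a, d'.partner (Sum.inl a) = Sum.inr (h.up (σ a)) := fun a => by
        rw [h'.partner_inl, hσ]
      rintro (a | a)
      · exact h0 a
      · show d'.partner (Sum.inr (h.up a)) = Sum.inl (σ.symm a)
        rw [partner_eq_iff, h0, Equiv.apply_symm_apply]
    · intro c c' hc
      rw [mc', mc c c' hc]
      · rfl
      · rintro ⟨a, rfl⟩
        rw [hσ, h.partner_up] at hc
        simp at hc
  by_cases h0 : h'.up 0 = h.up 0
  · refine ⟨1, Or.inl (key 1 fun a => ?_)⟩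
    have := (mu' 0).symm.trans ((congrArg (fun x => m.partner (Sum.inr x)) h0).trans (mu 0))
    fin_cases a
    · exact h0
    · exact Sum.inr_injective this
  by_cases h1 : h'.up 0 = h.up 1
  · refine ⟨swapTwo, Or.inl (key _ fun a => ?_)⟩
    have := (mu' 0).symm.trans ((congrArg (fun x => m.partner (Sum.inr x)) h1).trans (mu 1))
    fin_cases a
    · exact h1
    · exact Sum.inr_injective this
  refine ⟨1, Or.inr ?_⟩
  have h2 : h'.up 1 ≠ h.up 0 := fun h2 => h1 (Sum.inr_injective
    ((mu' 1).symm.trans ((congrArg (fun x => m.partner (Sum.inr x)) h2).trans (mu 0))))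
  have h3 : h'.up 1 ≠ h.up 1 := fun h3 => h0 (Sum.inr_injective
    ((mu' 1).symm.trans ((congrArg (fun x => m.partner (Sum.inr x)) h3).trans (mu 1))))
  have h4 : h.up 0 ≠ h.up 1 := fun h4 => by simpa using h.up_injective h4
  have h5 : h'.up 0 ≠ h'.up 1 := fun h5 => by simpa using h'.up_injective h5
  have hne : ∀ a b, h'.up b ≠ h.up a := by
    intro a b
    fin_cases a <;> fin_cases b <;> assumption
  set g : Fin 4 → Fin l := ![h.up 0, h.up 1, h'.up 0, h'.up 1] with hg
  have hgi : Function.Injective g := by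
    intro a b hab
    fin_cases a <;> fin_cases b <;> first
      | rfl
      | exact absurd hab h4
      | exact absurd hab.symm h4
      | exact absurd hab h5
      | exact absurd hab.symm h5
      | exact absurd hab (hne _ _)
      | exact absurd hab.symm (hne _ _)
  have hgd : ∀ a, h.up a ∈ Set.range g := by
    intro a
    fin_cases a
    · exact ⟨0, rfl⟩
    · exact ⟨1, rfl⟩
  have hgd' : ∀ a, h'.up a ∈ Set.range g := by
    intro a
    fin_cases a
    · exact ⟨2, rfl⟩
    · exact ⟨3, rfl⟩
  have hgm : ∀ c c', m.partner (Sum.inr c) = Sum.inr c' → c ∈ Set.range g → c' ∈ Set.range g := by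
    rintro c c' hc ⟨a, rfl⟩
    fin_cases a
    · rw [← Sum.inr_injective ((mu 0).symm.trans hc)]; exact hgd _
    · rw [← Sum.inr_injective ((mu 1).symm.trans hc)]; exact hgd _
    · rw [← Sum.inr_injective ((mu' 0).symm.trans hc)]; exact hgd' _
    · rw [← Sum.inr_injective ((mu' 1).symm.trans hc)]; exact hgd' _
  obtain ⟨v, d'', hv, ev, hvu⟩ := exists_factor_top d g hgi (by
    intro c hc
    rcases hx : d.partner (Sum.inr c) with a | c'
    · exact absurd (h.up_eq hx ▸ hgd a) hc
    · exact ⟨c', fun hc' => hc (hgm _ _ ((partner_eq_iff _).1 (mc _ _ hx)) hc'), rfl⟩)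
  have vc : ∀ c c', v.partner (Sum.inr c) = Sum.inr c' → d.partner (Sum.inr c) = Sum.inr c' := by
    intro c c' hc
    rw [← ev, hv.comp_partner_cup _ hc]
  have hlift : ∀ {r : ℕ} (b : Fin 4), hv.lift (Sum.inr b : Dot r 4) = Sum.inr (g b) :=
    fun b => congrArg Sum.inr (hvu b)
  have hd' : ∀ a, d'.partner (Sum.inr (h.up a)) = Sum.inr (h.up (Fin.rev a)) := by
    intro a
    rw [mc', mu]
    · rfl
    · rintro ⟨b, hb⟩
      exact hne _ _ hb
  have hd : ∀ a, d.partner (Sum.inr (h'.up a)) = Sum.inr (h'.up (Fin.rev a)) := by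
    intro a
    rcases hx : d.partner (Sum.inr (h'.up a)) with b | c'
    · exact absurd (h.up_eq hx).symm (hne _ _)
    · exact (congrArg Sum.inr (Sum.inr_injective ((mc _ _ hx).symm.trans (mu' a))) )
  refine ⟨v, hv, (hv.eq_comp_iff _ _ ?_ vc).symm, (hv.eq_comp_iff _ _ ?_ ?_).symm⟩
  · rintro (a | b)
    · show d.partner (Sum.inl a) = hv.lift (Sum.inr (Fin.castAdd 2 a))
      rw [hlift, h.partner_inl]
      fin_cases a <;> rfl
    · rw [hlift]
      fin_cases b
      · exact h.partner_up 0
      · exact h.partner_up 1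
      · exact (hd 0).trans (hlift 3).symm
      · exact (hd 1).trans (hlift 2).symm
  · rintro (a | b) <;> rw [(capless_ofPerm swapPairs).comp_partner]
    · fin_cases a
      · exact (h'.partner_inl 0).trans (hlift 2).symm
      · exact (h'.partner_inl 1).trans (hlift 3).symm
    · rw [hlift]
      fin_cases b
      · exact (hd' 0).trans (hlift 1).symm
      · exact (hd' 1).trans (hlift 0).symm
      · exact h'.partner_up 0
      · exact h'.partner_up 1
  · intro c c' hc
    rw [mc', mc c c' (vc c c' hc)]
    · rfl
    · rintro ⟨a, rfl⟩
      obtain ⟨b, hb⟩ := hgd' a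
      rw [← hb, ← hvu, hv.partner_up] at hc
      simp at hc

/-- A diagram with top dots and without bottom dots has a cup that can be opened. -/
theorem exists_comp_addCup {m : Diagram 0 l} (hl : l ≠ 0) :
    ∃ d : Diagram 2 l, d.Capless ∧ comp d (addCup 0) = m := by
  let q : Fin l := ⟨0, by omega⟩
  have hq : ∀ c, ∃ c', m.partner (Sum.inr c) = Sum.inr c' := by
    intro c
    rcases hc : m.partner (Sum.inr c) with a | c'
    · exact a.elim0
    · exact ⟨c', rfl⟩
  obtain ⟨q', hq'⟩ := hq q
  have hqq := (partner_eq_iff _).1 hq'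
  have hne : q ≠ q' := fun e => m.partner_ne (Sum.inr q) (by rw [hq', e])
  have hg : Function.Injective ![q, q'] := by
    intro a b
    fin_cases a <;> fin_cases b <;> simp [hne, hne.symm]
  obtain ⟨u, d', hu, e, hup⟩ := exists_factor_top m ![q, q'] hg (by
    intro c hc
    obtain ⟨c', hc'⟩ := hq c
    refine ⟨c', ?_, hc'⟩
    rintro ⟨a, rfl⟩
    have := (partner_eq_iff _).1 hc'
    fin_cases a
    · exact hc ⟨1, Sum.inr_injective (hq'.symm.trans this)⟩
    · exact hc ⟨0, Sum.inr_injective (hqq.symm.trans this)⟩)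
  refine ⟨u, hu, hu.eq_comp_iff _ _ ?_ ?_⟩
  · rintro (a | a)
    · exact a.elim0
    · show m.partner (Sum.inr (hu.up a)) = hu.lift ((addCup 0).partner (Sum.inr a))
      have h1 : ∀ b : Fin 2, (addCup 0).partner (Sum.inr b) = Sum.inr (Fin.rev b) := by decide
      rw [h1]
      show _ = Sum.inr (hu.up _)
      rw [hup, hup]
      fin_cases a
      · exact hq'
      · exact hqq
  · intro c c' hc
    rw [← e, hu.comp_partner_cup d' hc]

end Diagram

end

section

variable {k : Type u} [Field k] {n : ℕ}

/-! ### Vertices and signs -/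

theorem mem_J {n i : ℕ} : i ∈ J n ↔ i ≤ n ∧ Even (n - i) := by
  rw [J, Finset.mem_image]
  constructor
  · rintro ⟨a, ha, rfl⟩
    rw [Finset.mem_range] at ha
    exact ⟨by omega, a, by omega⟩
  · rintro ⟨h, a, ha⟩
    exact ⟨a, by rw [Finset.mem_range]; omega, by omega⟩

theorem mem_J_of_add_two {i : ℕ} (h : i + 2 ∈ J n) : i ∈ J n := by
  rw [mem_J] at *
  obtain ⟨h1, a, ha⟩ := h
  exact ⟨by omega, a + 1, by omega⟩

theorem unit_mul_unit_ne {i j : J n} (h : i ≠ j) : unit k i * unit k j = 0 :=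
  unit_mul_bas_ne h _

/-- A composition without loops is a product in the cover algebra, up to a sign. -/
theorem exists_bas_mul {i j l : J n} {d : Diagram j l} {d' : Diagram i j} {e : Diagram i l}
    (h : ¬ Diagram.HasLoop d d') (he : Diagram.comp d d' = e) :
    ∃ s : k, s * s = 1 ∧ bas d * bas d' = s • (bas e : CoverAlgebra k n) := by
  refine ⟨(Diagram.sign d d' : k), ?_, by rw [bas_mul, he]⟩
  have := congrArg (Int.cast : ℤ → k) (Diagram.sign_mul_self d d' h)
  simpa using this

/-- A composition without loops is a product in the cover algebra, up to a sign. -/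
theorem exists_bas_eq {i j l : J n} {d : Diagram j l} {d' : Diagram i j} {e : Diagram i l}
    (h : ¬ Diagram.HasLoop d d') (he : Diagram.comp d d' = e) :
    ∃ s : k, s * s = 1 ∧ bas e = s • (bas d * bas d' : CoverAlgebra k n) := by
  obtain ⟨s, hs, e⟩ := exists_bas_mul (k := k) h he
  exact ⟨s, hs, by rw [e, smul_smul, hs, one_smul]⟩

theorem bas_mul_eq_zero {i j l : J n} {d : Diagram j l} {d' : Diagram i j}
    (h : Diagram.HasLoop d d') : (bas d * bas d' : CoverAlgebra k n) = 0 := by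
  rw [bas_mul, Diagram.sign_eq_zero h, Int.cast_zero, zero_smul]

namespace Diagram

variable {i j l m : ℕ}

theorem comp_comp_of_not_hasLoop {d₁ : Diagram l m} {d₂ : Diagram j l} {d₃ : Diagram i j}
    (h : ¬ HasLoop d₁ d₂) (h' : ¬ HasLoop (Diagram.comp d₁ d₂) d₃) :
    Diagram.comp (Diagram.comp d₁ d₂) d₃ = Diagram.comp d₁ (Diagram.comp d₂ d₃) := by
  refine (comp_assoc d₁ d₂ d₃).2 fun h0 => ?_
  have h1 := sign_mul_self _ _ h
  have h2 := sign_mul_self _ _ h'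
  rcases mul_eq_zero.1 h0 with h0 | h0
  · rw [h0] at h1; simp at h1
  · rw [h0] at h2; simp at h2

theorem comp_ofPerm_inv (d : Diagram i j) (σ : Equiv.Perm (Fin i)) :
    Diagram.comp (Diagram.comp d (ofPerm σ)) (ofPerm σ⁻¹) = d := by
  rw [comp_comp_of_not_hasLoop ((cupless_ofPerm σ).not_hasLoop d)
    ((cupless_ofPerm _).not_hasLoop _), comp_ofPerm_ofPerm, mul_inv_cancel, ofPerm_one,
    (comp_one d).1]

theorem capless_of_comp_ofPerm {d : Diagram i j} {σ : Equiv.Perm (Fin i)}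
    (h : (Diagram.comp d (ofPerm σ)).Capless) : d.Capless := by
  rw [← comp_ofPerm_inv d σ]
  by_contra hc
  obtain ⟨a, b, hab⟩ := exists_cap hc
  rw [comp_ofPerm_inv] at hab
  have h1 := h (σ⁻¹ a)
  rw [comp_partner_eq (x := Sum.inl (σ⁻¹ a)) (y := Sum.inl (σ⁻¹ b))
    (exits_cross_up (m := a) (congrArg Sum.inr (σ.apply_symm_apply a))
      (exits_cross_down hab (exits_inl_inl rfl)))] at h1
  simp at h1

end Diagram

/-! ### Permutations in the cover algebra -/

/-- The group algebra of the symmetric group on `i` letters as the span of the permutation diagrams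
in the endomorphism algebra of `i`. -/
noncomputable def permHom (k : Type u) [Field k] (i : ℕ) : GroupAlg k i →ₐ[k] BrauerAlgebra k i :=
  MonoidAlgebra.lift k (BrauerAlgebra k i) (Equiv.Perm (Fin i))
    { toFun σ := (Finsupp.single (Diagram.ofPerm σ) 1 : HomSpace k i i)
      map_one' := by rw [Diagram.ofPerm_one]; rfl
      map_mul' σ τ := by
        refine Eq.symm ((compose_single k (Diagram.ofPerm σ) (Diagram.ofPerm τ) 1 1).trans ?_)
        rw [Diagram.comp_ofPerm_ofPerm, Diagram.sign_ofPerm_ofPerm]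
        simp }

/-- The group algebra of the symmetric group on `i` letters as the span of the permutation diagrams
in the cover algebra. -/
noncomputable def permElt (i : J n) : GroupAlg k i →ₗ[k] CoverAlgebra k n :=
  (blk i i).comp (permHom k i).toLinearMap

theorem permElt_single (i : J n) (σ : Equiv.Perm (Fin i)) :
    permElt i (MonoidAlgebra.single σ 1) = (bas (Diagram.ofPerm σ) : CoverAlgebra k n) := by
  show blk i i (permHom k i _) = _
  rw [permHom, MonoidAlgebra.lift_single, one_smul]
  rfl

theorem permElt_mul (i : J n) (a b : GroupAlg k i) :
    (permElt i (a * b) : CoverAlgebra k n) = permElt i a * permElt i b := by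
  show blk i i (permHom k i _) = _
  rw [map_mul]
  exact (blk_mul _ _).symm

theorem permElt_one (i : J n) : (permElt i 1 : CoverAlgebra k n) = unit k i := by
  show blk i i (permHom k i _) = _
  rw [map_one]
  rfl

theorem unit_mul_permElt (i : J n) (a : GroupAlg k i) :
    (unit k i * permElt i a : CoverAlgebra k n) = permElt i a := by
  rw [← permElt_one, ← permElt_mul, one_mul]

theorem permElt_mul_unit (i : J n) (a : GroupAlg k i) :
    (permElt i a * unit k i : CoverAlgebra k n) = permElt i a := by
  rw [← permElt_one, ← permElt_mul, mul_one]

theorem GroupAlg.induction {i : ℕ} {p : GroupAlg k i → Prop}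
    (hadd : ∀ a b, p a → p b → p (a + b))
    (h : ∀ (r : k) σ, p (r • MonoidAlgebra.single σ 1)) (a : GroupAlg k i) : p a := by
  suffices H : ∀ r : k, p (r • a) by simpa using H 1
  induction a using MonoidAlgebra.induction_on with
  | of σ => exact fun r => h r σ
  | add a b ha hb => exact fun r => by rw [smul_add]; exact hadd _ _ (ha r) (hb r)
  | smul s a ha => exact fun r => by rw [smul_smul]; exact ha _

/-- The part `CoverAlgebra.perm` as a linear map. -/
noncomputable def permₗ (i : J n) : CoverAlgebra k n →ₗ[k] GroupAlg k i where
  toFun c := c.perm i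
  map_add' c d := by
    rw [CoverAlgebra.perm, CoverAlgebra.perm, CoverAlgebra.perm, ← Finset.sum_add_distrib]
    refine Finset.sum_congr rfl fun σ _ => ?_
    rw [← MonoidAlgebra.single_add]; rfl
  map_smul' r c := by
    rw [CoverAlgebra.perm, CoverAlgebra.perm, RingHom.id_apply, Finset.smul_sum]
    refine Finset.sum_congr rfl fun σ _ => ?_
    rw [MonoidAlgebra.smul_single]; rfl

theorem coeff_bas {i j : J n} (d d' : Diagram i j) :
    (bas d : CoverAlgebra k n).coeff i j d' = Finsupp.single d (1 : k) d' := by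
  show ((bas d : CoverAlgebra k n).entry i j) d' = _
  rw [bas, entry_blk]

theorem coeff_bas_ne {i j i' j' : J n} (h : i' ≠ i ∨ j' ≠ j) (d : Diagram i j) (d' : Diagram i' j') :
    (bas d : CoverAlgebra k n).coeff i' j' d' = 0 := by
  show ((bas d : CoverAlgebra k n).entry i' j') d' = _
  rw [bas, entry_blk_ne h]; rfl

theorem perm_bas_ofPerm (i : J n) (σ : Equiv.Perm (Fin i)) :
    (bas (Diagram.ofPerm σ) : CoverAlgebra k n).perm i = MonoidAlgebra.single σ 1 := by
  rw [CoverAlgebra.perm, Finset.sum_eq_single σ]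
  · rw [coeff_bas, Finsupp.single_eq_same]
  · intro τ _ hτ
    rw [coeff_bas, Finsupp.single_eq_of_ne, MonoidAlgebra.single_zero]
    intro h; exact hτ (Diagram.ofPerm_injective h)
  · simp

theorem perm_bas_ne {i j l : J n} (h : l ≠ i ∨ l ≠ j) (d : Diagram i j) :
    (bas d : CoverAlgebra k n).perm l = 0 := by
  rw [CoverAlgebra.perm]
  refine Finset.sum_eq_zero fun τ _ => ?_
  rw [coeff_bas_ne h, MonoidAlgebra.single_zero]

theorem perm_bas_of_not_capless {i j l : J n} {d : Diagram i j} (h : ¬ d.Capless) :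
    (bas d : CoverAlgebra k n).perm l = 0 := by
  by_cases hl : l ≠ i ∨ l ≠ j
  · exact perm_bas_ne hl d
  push Not at hl
  obtain ⟨rfl, rfl⟩ := hl
  rw [CoverAlgebra.perm]
  refine Finset.sum_eq_zero fun τ _ => ?_
  rw [coeff_bas, Finsupp.single_eq_of_ne, MonoidAlgebra.single_zero]
  rintro rfl
  exact h (Diagram.capless_ofPerm _)

theorem perm_mul_bas_ofPerm (c : CoverAlgebra k n) (i : J n) (σ : Equiv.Perm (Fin i)) :
    (c * bas (Diagram.ofPerm σ)).perm i = c.perm i * MonoidAlgebra.single σ 1 := by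
  induction c using CoverAlgebra.induction with
  | h0 =>
    show permₗ i (0 * _) = permₗ i 0 * _
    rw [zero_mul, map_zero, zero_mul]
  | hadd c d hc hd =>
    show permₗ i ((c + d) * _) = permₗ i (c + d) * _
    rw [add_mul, map_add, map_add, add_mul]
    exact congrArg₂ (· + ·) hc hd
  | hbas i' j d a =>
    show permₗ i ((a • _) * _) = permₗ i (a • _) * _
    rw [smul_mul_assoc, map_smul, map_smul, smul_mul_assoc]
    congr 1
    show (bas d * _ : CoverAlgebra k n).perm i = (bas d : CoverAlgebra k n).perm i * _
    by_cases hi : i = i'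
    · subst hi
      by_cases hd : d.Capless
      · by_cases hj : i = j
        · subst hj
          obtain ⟨τ, rfl⟩ := Diagram.exists_eq_ofPerm hd
          rw [bas_mul, Diagram.comp_ofPerm_ofPerm, Diagram.sign_ofPerm_ofPerm, Int.cast_one,
            one_smul, perm_bas_ofPerm, perm_bas_ofPerm, MonoidAlgebra.single_mul_single, one_mul]
        · rw [perm_bas_ne (Or.inr hj), zero_mul, bas_mul]
          show permₗ i (_ • _) = 0
          rw [map_smul]
          show _ • (bas _ : CoverAlgebra k n).perm i = 0
          rw [perm_bas_ne (Or.inr hj), smul_zero]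
      · rw [perm_bas_of_not_capless hd, zero_mul, bas_mul]
        show permₗ i (_ • _) = 0
        rw [map_smul]
        show _ • (bas _ : CoverAlgebra k n).perm i = 0
        rw [perm_bas_of_not_capless (fun h => hd (Diagram.capless_of_comp_ofPerm h)), smul_zero]
    · rw [perm_bas_ne (Or.inl hi), zero_mul, bas_mul_ne hi]
      exact map_zero (permₗ i)

/-! ### Vertex spaces -/

/-- The subgroup `e M` of `M`, where `e` is the idempotent of the object `i`. -/
def vtx (k : Type u) [Field k] {n : ℕ} (i : J n) (M : Type*) [AddCommGroup M]
    [Module (CoverAlgebra k n) M] : AddSubgroup M where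
  carrier := {m | unit k i • m = m}
  zero_mem' := smul_zero _
  add_mem' {a b} ha hb := by
    show _ • (a + b) = _
    rw [smul_add, ha, hb]
  neg_mem' {a} ha := by
    show _ • (- a) = _
    rw [smul_neg, ha]

section
variable {M N : Type*} [AddCommGroup M] [Module (CoverAlgebra k n) M] [AddCommGroup N]
  [Module (CoverAlgebra k n) N]

theorem mem_vtx {i : J n} {m : M} : m ∈ vtx k i M ↔ unit k i • m = m := Iff.rfl

theorem bas_smul_mem {i j : J n} (d : Diagram i j) (m : M) :
    (bas d : CoverAlgebra k n) • m ∈ vtx k j M := by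
  rw [mem_vtx, smul_smul, unit_mul_bas]

theorem unit_smul_mem (i : J n) (m : M) : unit k i • m ∈ vtx k i M := bas_smul_mem _ m

theorem permElt_smul_mem (i : J n) (a : GroupAlg k i) (m : M) :
    (permElt i a : CoverAlgebra k n) • m ∈ vtx k i M := by
  rw [mem_vtx, smul_smul, unit_mul_permElt]

theorem map_mem_vtx {i : J n} (f : M →ₗ[CoverAlgebra k n] N) {m : M} (hm : m ∈ vtx k i M) :
    f m ∈ vtx k i N := by
  rw [mem_vtx] at *
  rw [← map_smul, hm]

theorem exists_mem_vtx {i : J n} {f : M →ₗ[CoverAlgebra k n] N} (hf : Function.Surjective f) {x : N}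
    (hx : x ∈ vtx k i N) : ∃ m ∈ vtx k i M, f m = x := by
  obtain ⟨m, rfl⟩ := hf x
  exact ⟨unit k i • m, unit_smul_mem i m, by rw [map_smul]; exact hx⟩

theorem unit_smul_of_ne {i j : J n} (h : i ≠ j) {m : M} (hm : m ∈ vtx k j M) :
    unit k i • m = 0 := by
  rw [← mem_vtx.1 hm, smul_smul, unit_mul_unit_ne h, zero_smul]

theorem bas_smul_of_ne {i j l : J n} (d : Diagram i l) (h : i ≠ j) {m : M} (hm : m ∈ vtx k j M) :
    (bas d : CoverAlgebra k n) • m = 0 := by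
  rw [← bas_mul_unit, mul_smul, unit_smul_of_ne h hm, smul_zero]

theorem sum_unit_smul (m : M) : ∑ i : J n, unit k i • m = m := by
  rw [← Finset.sum_smul, sum_unit, one_smul]

/-- The symmetric group acts on the vertex spaces. -/
noncomputable instance (i : J n) : Module (GroupAlg k i) (vtx k i M) where
  smul a m := ⟨permElt i a • (m : M), permElt_smul_mem i a _⟩
  one_smul m := Subtype.ext (by
    show permElt i 1 • (m : M) = m
    rw [permElt_one]; exact m.2)
  mul_smul a b m := Subtype.ext (by
    show permElt i (a * b) • (m : M) = permElt i a • permElt i b • (m : M)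
    rw [permElt_mul, mul_smul])
  smul_zero a := Subtype.ext (smul_zero _)
  smul_add a x y := Subtype.ext (smul_add _ _ _)
  add_smul a b x := Subtype.ext (by
    show permElt i (a + b) • (x : M) = permElt i a • (x : M) + permElt i b • (x : M)
    rw [map_add, add_smul])
  zero_smul x := Subtype.ext (by
    show permElt i 0 • (x : M) = 0
    rw [map_zero, zero_smul])

theorem coe_smul_vtx (i : J n) (a : GroupAlg k i) (m : vtx k i M) :
    ((a • m : vtx k i M) : M) = permElt i a • (m : M) := rfl

/-- A homomorphism maps vertex spaces to vertex spaces. -/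
noncomputable def vtxMap (i : J n) (f : M →ₗ[CoverAlgebra k n] N) :
    vtx k i M →ₗ[GroupAlg k i] vtx k i N where
  toFun m := ⟨f m, map_mem_vtx f m.2⟩
  map_add' _ _ := Subtype.ext (map_add f _ _)
  map_smul' _ _ := Subtype.ext (map_smul f _ _)

end

/-! ### Peeling off diagrams without caps -/

open Classical in
/-- The value of `peel` on a diagram. -/
noncomputable def peelDiagram {j l : ℕ} (u : Diagram j l) (Q : ∀ ⦃i : ℕ⦄, Diagram i j → Prop) {i : ℕ}
    (d : Diagram i l) : HomSpace k i j :=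
  if h : ∃ v, Q v ∧ Diagram.comp u v = d then
    Finsupp.single h.choose (Diagram.sign u h.choose : k) else 0

/-- The linear map that sends `bas u * bas v` to `bas v` for all diagrams `v` with a given property,
and all other diagrams to zero. -/
noncomputable def peel {j l : J n} (u : Diagram j l) (Q : ∀ ⦃i : ℕ⦄, Diagram i j → Prop) :
    CoverAlgebra k n →ₗ[k] CoverAlgebra k n :=
  ∑ i : J n, (blk i j).comp ((Finsupp.linearCombination k (peelDiagram u Q)).comp (entryₗ i l))

section
variable {j l : J n} {u : Diagram j l} {Q : ∀ ⦃i : ℕ⦄, Diagram i j → Prop}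

theorem peel_bas {i : J n} (d : Diagram i l) :
    peel u Q (bas d : CoverAlgebra k n) = blk i j (peelDiagram u Q d) := by
  rw [peel, LinearMap.sum_apply, Finset.sum_eq_single i]
  · show blk i j (Finsupp.linearCombination k _ ((bas d : CoverAlgebra k n).entry i l)) = _
    rw [bas, entry_blk, Finsupp.linearCombination_single, one_smul]
  · intro i' _ hi
    show blk i' j (Finsupp.linearCombination k _ ((bas d : CoverAlgebra k n).entry i' l)) = _
    rw [bas, entry_blk_ne (Or.inl hi), map_zero, map_zero]
  · simp

theorem peel_bas_of_ne {i l' : J n} (h : l' ≠ l) (d : Diagram i l') :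
    peel u Q (bas d : CoverAlgebra k n) = 0 := by
  rw [peel, LinearMap.sum_apply]
  refine Finset.sum_eq_zero fun i' _ => ?_
  show blk i' j (Finsupp.linearCombination k _ ((bas d : CoverAlgebra k n).entry i' l)) = _
  rw [bas, entry_blk_ne (Or.inr h.symm), map_zero, map_zero]

theorem peel_bas_eq_zero {i : J n} {d : Diagram i l} (h : ∀ v, Q v → Diagram.comp u v ≠ d) :
    peel u Q (bas d : CoverAlgebra k n) = 0 := by
  rw [peel_bas, peelDiagram, dif_neg, map_zero]
  rintro ⟨v, hv, e⟩
  exact h v hv e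

theorem peel_bas_mul (hu : u.Capless) {i : J n} {v : Diagram i j} (hv : Q v) :
    peel u Q (bas u * bas v : CoverAlgebra k n) = bas v := by
  have h : ∃ v', Q v' ∧ Diagram.comp u v' = Diagram.comp u v := ⟨v, hv, rfl⟩
  have e : h.choose = v := hu.comp_injective h.choose_spec.2
  rw [bas_mul, map_smul, peel_bas, peelDiagram, dif_pos h, e, blk_single, smul_smul]
  have := congrArg (Int.cast : ℤ → k) (Diagram.sign_mul_self u v (hu.not_hasLoop v))
  rw [Int.cast_mul, Int.cast_one] at this
  rw [this, one_smul]

theorem peel_mul_bas_of_not_capless (hu : u.Capless) {i m : J n} {d : Diagram i m} (hd : ¬ d.Capless)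
    (c : CoverAlgebra k n) :
    peel u (fun _ => Diagram.Capless) (c * bas d) = 0 := by
  induction c using CoverAlgebra.induction with
  | h0 => rw [zero_mul, map_zero]
  | hadd c d hc hd => rw [add_mul, map_add, hc, hd, add_zero]
  | hbas i' j' e a =>
    rw [smul_mul_assoc, map_smul]
    by_cases h : i' = m
    · subst h
      rw [bas_mul, map_smul]
      by_cases hl : j' = l
      · subst hl
        rw [peel_bas_eq_zero, smul_zero, smul_zero]
        intro v hv e'
        exact Diagram.not_capless_comp _ hd (e' ▸ hu.comp hv)
      · rw [peel_bas_of_ne hl, smul_zero, smul_zero]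
    · rw [bas_mul_ne (Ne.symm h), map_zero, smul_zero]

theorem peel_mul_bas_ofPerm (hu : u.Capless) {i : J n} (σ : Equiv.Perm (Fin i))
    (c : CoverAlgebra k n) :
    peel u (fun _ => Diagram.Capless) (c * bas (Diagram.ofPerm σ)) =
      peel u (fun _ => Diagram.Capless) c * bas (Diagram.ofPerm σ) := by
  induction c using CoverAlgebra.induction with
  | h0 => rw [zero_mul, map_zero, zero_mul]
  | hadd c d hc hd => rw [add_mul, map_add, hc, hd, map_add, add_mul]
  | hbas i' j' e a =>
    rw [smul_mul_assoc, map_smul, map_smul, smul_mul_assoc]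
    congr 1
    by_cases hl : j' = l
    swap
    · rw [peel_bas_of_ne hl, zero_mul]
      by_cases hi : i' = i
      · subst hi
        rw [bas_mul, map_smul, peel_bas_of_ne hl, smul_zero]
      · rw [bas_mul_ne (Ne.symm hi), map_zero]
    subst hl
    by_cases hi : i' = i
    · subst hi
      by_cases he : ∃ v, Diagram.Capless v ∧ Diagram.comp u v = e
      · obtain ⟨v, hv, e'⟩ := he
        obtain ⟨s, -, hs⟩ := exists_bas_eq (k := k) (hu.not_hasLoop v) e'
        obtain ⟨t, -, ht⟩ := exists_bas_mul (k := k) (n := n)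
          ((Diagram.cupless_ofPerm σ).not_hasLoop v) rfl
        rw [hs, smul_mul_assoc, map_smul, map_smul, mul_assoc, ht, mul_smul_comm, map_smul,
          peel_bas_mul (Q := fun _ => Diagram.Capless) hu (hv.comp (Diagram.capless_ofPerm σ)),
          peel_bas_mul (Q := fun _ => Diagram.Capless) hu hv, smul_mul_assoc, ht]
      · rw [peel_bas_eq_zero (d := e) (fun v hv e' => he ⟨v, hv, e'⟩), zero_mul, bas_mul, map_smul,
          peel_bas_eq_zero, smul_zero]
        intro v hv e'
        refine he ⟨Diagram.comp v (Diagram.ofPerm σ⁻¹), hv.comp (Diagram.capless_ofPerm _), ?_⟩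
        rw [← Diagram.comp_comp_of_not_hasLoop (hu.not_hasLoop v)
          ((Diagram.cupless_ofPerm _).not_hasLoop _), e', Diagram.comp_ofPerm_inv]
    · rw [bas_mul_ne (Ne.symm hi), map_zero, peel_bas, bas]
      exact (blk_mul_ne (Ne.symm hi) _ _).symm

end

end

section

open TensorProduct

variable {k : Type u} [Field k] {n : ℕ}

/-! ### Standard modules -/

/-- The module `C ⊗_B V` for a module `V` of the symmetric group. -/
abbrev Delta (k : Type u) [Field k] {n : ℕ} (i : J n) (V : Type u) [AddCommGroup V] [Module k V] [Module (GroupAlg k i) V] : Type u :=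
  (CoverAlgebra k n ⊗[k] V) ⧸ balance k n i V

section
variable {i : J n} {V : Type u} [AddCommGroup V] [Module k V] [Module (GroupAlg k i) V]

/-- The element `c ⊗ v` of `C ⊗_B V`. -/
noncomputable def Delta.mk (c : CoverAlgebra k n) (v : V) : Delta k i V :=
  Submodule.Quotient.mk (c ⊗ₜ v)

theorem Delta.mk_add_left (c d : CoverAlgebra k n) (v : V) :
    (mk (c + d) v : Delta k i V) = mk c v + mk d v := by
  rw [mk, add_tmul]; rfl

theorem Delta.mk_zero_left (v : V) : (mk (0 : CoverAlgebra k n) v : Delta k i V) = 0 := by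
  rw [mk, zero_tmul]; rfl

theorem Delta.mk_add (c : CoverAlgebra k n) (v w : V) :
    (mk c (v + w) : Delta k i V) = mk c v + mk c w := by
  rw [mk, tmul_add]; rfl

theorem Delta.mk_zero (c : CoverAlgebra k n) : (mk c 0 : Delta k i V) = 0 := by
  rw [mk, tmul_zero]; rfl

theorem Delta.mk_smul_left (r : k) (c : CoverAlgebra k n) (v : V) :
    (mk (r • c) v : Delta k i V) = mk c (r • v) := by
  rw [mk, smul_tmul]; rfl

theorem Delta.smul_mk (c d : CoverAlgebra k n) (v : V) :
    c • (mk d v : Delta k i V) = mk (c * d) v := rfl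

theorem Delta.mk_mul {b : CoverAlgebra k n} (hb : b ∈ cupless k n) (c : CoverAlgebra k n) (v : V) :
    (mk (c * b) v : Delta k i V) = mk c (b.perm i • v) := by
  refine (Submodule.Quotient.eq _).2 (Submodule.subset_span ⟨c, b, hb, v, rfl⟩)

theorem bas_mem_cupless {j l : J n} {d : Diagram j l} (h : d.Cupless) :
    bas d ∈ cupless k n := by
  intro j' l' d' hd' t ht
  by_cases hjl : j' ≠ j ∨ l' ≠ l
  · exact hd' (coeff_bas_ne hjl d d')
  push Not at hjl
  obtain ⟨rfl, rfl⟩ := hjl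
  rw [coeff_bas] at hd'
  have e : d = d' := by
    by_contra hne
    exact hd' (Finsupp.single_eq_of_ne (Ne.symm hne))
  subst e
  have := h t
  unfold Diagram.Turns at ht
  rw [this] at ht
  simp at ht

theorem Delta.mk_mul_ofPerm (c : CoverAlgebra k n) (σ : Equiv.Perm (Fin i)) (v : V) :
    (mk (c * bas (Diagram.ofPerm σ)) v : Delta k i V) =
      mk c ((MonoidAlgebra.single σ 1 : GroupAlg k i) • v) := by
  rw [mk_mul (bas_mem_cupless (Diagram.cupless_ofPerm σ)), perm_bas_ofPerm]

theorem Delta.mk_mul_unit (c : CoverAlgebra k n) (v : V) :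
    (mk (c * unit k i) v : Delta k i V) = mk c v := by
  have h : (unit k i : CoverAlgebra k n) = bas (i := i) (j := i) (Diagram.ofPerm 1) := by
    rw [Diagram.ofPerm_one]; rfl
  rw [h, mk_mul_ofPerm]
  congr 1
  exact one_smul _ v

theorem Delta.mk_bas_of_ne {j l : J n} (h : j ≠ i) (d : Diagram j l) (v : V) :
    (mk (bas d : CoverAlgebra k n) v : Delta k i V) = 0 := by
  rw [← mk_mul_unit, bas_mul_unit_ne h.symm, mk_zero_left]

theorem Delta.mk_bas_of_not_capless {j l : J n} {d : Diagram j l} (hd : ¬ d.Capless) (v : V) :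
    (mk (bas d : CoverAlgebra k n) v : Delta k i V) = 0 := by
  obtain ⟨j, hj⟩ := j
  rcases j with _ | _ | j'
  · exact absurd (fun a => Fin.elim0 a) hd
  · obtain ⟨a, b, hab⟩ := Diagram.exists_cap hd
    rw [Subsingleton.elim (α := Fin 1) b a] at hab
    exact absurd hab (d.partner_ne _)
  · obtain ⟨d', w, hw, e⟩ := Diagram.exists_factor_of_cap (i := j') hd
    obtain ⟨s, -, hs⟩ := exists_bas_eq (k := k) (i := ⟨j' + 2, hj⟩) (j := ⟨j', mem_J_of_add_two hj⟩)
      (l := l) (hw.not_hasLoop d') e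
    rw [hs, mk_smul_left, mk_mul (bas_mem_cupless hw), perm_bas_of_not_capless, zero_smul, mk_zero]
    intro hc
    have := Diagram.exists_ofPerm hc hw
    simp at this

theorem Delta.induction {p : Delta k i V → Prop} (h0 : p 0) (hadd : ∀ x y, p x → p y → p (x + y))
    (h : ∀ (l : J n) (d : Diagram i l) (v : V), d.Capless → p (mk (bas d) v)) (x : Delta k i V) :
    p x := by
  obtain ⟨x, rfl⟩ := Submodule.Quotient.mk_surjective _ x
  induction x using TensorProduct.induction_on with
  | zero => exact h0
  | add x y hx hy => exact hadd _ _ hx hy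
  | tmul c v =>
    show p (mk c v)
    induction c using CoverAlgebra.induction with
    | h0 => rw [mk_zero_left]; exact h0
    | hadd c d hc hd => rw [mk_add_left]; exact hadd _ _ hc hd
    | hbas j l d a =>
      rw [mk_smul_left]
      by_cases hj : j = i
      · subst hj
        by_cases hd : d.Capless
        · exact h l d _ hd
        · rw [mk_bas_of_not_capless hd]; exact h0
      · rw [mk_bas_of_ne hj]; exact h0

section lift
variable [IsScalarTower k (GroupAlg k i) V] {W : Type*} [AddCommGroup W] (β : CoverAlgebra k n →+ V →+ W)

theorem Delta.lift_aux (hk : ∀ (r : k) c v, β (r • c) v = β c (r • v))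
    (h1 : ∀ c (σ : Equiv.Perm (Fin i)) v, β (c * bas (Diagram.ofPerm σ)) v =
      β c ((MonoidAlgebra.single σ 1 : GroupAlg k i) • v))
    (h2 : ∀ c (l : J n) v, l ≠ i → β (c * unit k l) v = 0)
    (h3 : ∀ c (l m : J n) (d : Diagram l m) v, ¬ d.Capless → β (c * bas d) v = 0)
    (x : CoverAlgebra k n ⊗[k] V) (hx : x ∈ balance k n i V) :
    TensorProduct.liftAddHom β hk x = 0 := by
  have hd : ∀ (l m : J n) (d : Diagram l m), d.Cupless → ∀ c v,
      β (c * bas d) v = β c ((bas d : CoverAlgebra k n).perm i • v) := by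
    intro l m d hd c v
    by_cases hc : d.Capless
    · have hlm := Subtype.ext (Diagram.exists_ofPerm hc hd)
      subst hlm
      obtain ⟨σ, rfl⟩ := Diagram.exists_eq_ofPerm hc
      by_cases hl : l = i
      · subst hl
        rw [h1, perm_bas_ofPerm]
      · rw [← bas_mul_unit, ← mul_assoc, h2 _ _ _ hl, bas_mul_unit, perm_bas_ne (Or.inl (Ne.symm hl)),
          zero_smul, map_zero]
    · rw [h3 _ _ _ _ _ hc, perm_bas_of_not_capless hc, zero_smul, map_zero]
  have hb : ∀ b ∈ cupless k n, ∀ c v, β (c * b) v = β c (b.perm i • v) := by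
    intro b hb c v
    let T : CoverAlgebra k n →+ W :=
      { toFun b := β (c * b) v - β c (permₗ i b • v)
        map_zero' := by simp
        map_add' a b := by
          rw [mul_add, map_add, map_add, add_smul, map_add, AddMonoidHom.add_apply]; abel }
    suffices H : T b = 0 from sub_eq_zero.1 H
    rw [← sum_blk b, map_sum]
    refine Finset.sum_eq_zero fun l _ => ?_
    rw [map_sum]
    refine Finset.sum_eq_zero fun m _ => ?_
    rw [← Finsupp.sum_single (b.entry l m), Finsupp.sum, map_sum, map_sum]
    refine Finset.sum_eq_zero fun d hd' => ?_
    have hdc : d.Cupless := by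
      by_contra h
      obtain ⟨a, a', haa⟩ := Diagram.exists_cup h
      refine hb l m d (Finsupp.mem_support_iff.1 hd') a ?_
      simp [Diagram.Turns, haa]
    rw [blk_single]
    show β (c * _ • _) v - β c (permₗ i (_ • _) • v) = 0
    rw [mul_smul_comm, ← smul_mul_assoc, hd _ _ _ hdc, hk, LinearMap.map_smul (permₗ i),
      smul_assoc]
    exact sub_self _
  suffices H : ∀ c : CoverAlgebra k n, TensorProduct.liftAddHom β hk (c • x) = 0 by
    have := H 1
    rwa [one_smul] at this
  induction hx using Submodule.span_induction with
  | zero => intro c; rw [smul_zero, map_zero]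
  | add x y _ _ hx hy => intro c; rw [smul_add, map_add, hx, hy, add_zero]
  | smul d x _ hx => intro c; rw [smul_smul]; exact hx _
  | mem x hx =>
    intro c
    obtain ⟨d, b, hb', v, rfl⟩ := hx
    rw [smul_sub, TensorProduct.smul_tmul', TensorProduct.smul_tmul', map_sub,
      TensorProduct.liftAddHom_tmul, TensorProduct.liftAddHom_tmul, sub_eq_zero, smul_eq_mul,
      smul_eq_mul, ← mul_assoc]
    exact hb b hb' _ v

/-- The universal property of `C ⊗_B V`, for additive maps: a biadditive map has to be balanced over
the field and the permutations, and it has to vanish after multiplication with the idempotents of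
other objects and with diagrams with caps. -/
noncomputable def Delta.lift (hk : ∀ (r : k) c v, β (r • c) v = β c (r • v))
    (h1 : ∀ c (σ : Equiv.Perm (Fin i)) v, β (c * bas (Diagram.ofPerm σ)) v =
      β c ((MonoidAlgebra.single σ 1 : GroupAlg k i) • v))
    (h2 : ∀ c (l : J n) v, l ≠ i → β (c * unit k l) v = 0)
    (h3 : ∀ c (l m : J n) (d : Diagram l m) v, ¬ d.Capless → β (c * bas d) v = 0) :
    Delta k i V →+ W :=
  QuotientAddGroup.lift (balance k n i V).toAddSubgroup (TensorProduct.liftAddHom β hk)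
    fun x hx => Delta.lift_aux β hk h1 h2 h3 x hx

end lift

open Diagram in
theorem Delta.exists_eq_sum {l : J n} {x : Delta k i V} (hx : x ∈ vtx k l (Delta k i V)) :
    ∃ w : CupConfig i l → V, x = ∑ t, mk (bas t.rep : CoverAlgebra k n) (w t) := by
  rw [← mem_vtx.1 hx]
  clear hx
  induction x using Delta.induction with
  | h0 => exact ⟨0, by simp [mk_zero]⟩
  | hadd x y hx hy =>
    obtain ⟨w, hw⟩ := hx
    obtain ⟨w', hw'⟩ := hy
    refine ⟨w + w', ?_⟩
    rw [smul_add, hw, hw', ← Finset.sum_add_distrib]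
    exact Finset.sum_congr rfl fun t _ => (mk_add _ _ _).symm
  | h m d v hd =>
    by_cases hm : l = m
    · subst hm
      rw [smul_mk, unit_mul_bas]
      obtain ⟨t, σ, e⟩ := hd.exists_rep
      obtain ⟨s, -, hs⟩ := exists_bas_eq (k := k) ((cupless_ofPerm σ).not_hasLoop _) e
      refine ⟨fun t' => if t' = t then (MonoidAlgebra.single σ 1 : GroupAlg k i) • s • v else 0, ?_⟩
      rw [Finset.sum_eq_single t]
      · show _ = mk _ (if t = t then _ else _)
        rw [if_pos rfl, hs, mk_smul_left, mk_mul_ofPerm]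
      · intro t' _ h
        show mk _ (if t' = t then _ else _) = 0
        rw [if_neg h, mk_zero]
      · simp
    · refine ⟨0, ?_⟩
      rw [smul_mk, unit_mul_bas_ne hm, mk_zero_left]
      exact (Finset.sum_eq_zero fun t _ => mk_zero _).symm

/-- A diagram without caps cannot have more bottom dots than top dots. -/
theorem Delta.eq_zero_of_lt {l : J n} (h : l.1 < i.1) {x : Delta k i V}
    (hx : x ∈ vtx k l (Delta k i V)) : x = 0 := by
  obtain ⟨w, rfl⟩ := exists_eq_sum hx
  refine Finset.sum_eq_zero fun t _ => ?_
  have := Fintype.card_le_of_injective _ t.capless_rep.up_injective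
  rw [Fintype.card_fin, Fintype.card_fin] at this
  omega

theorem Delta.mk_unit_mem (v : V) : (mk (unit k i) v : Delta k i V) ∈ vtx k i (Delta k i V) := by
  rw [mem_vtx, smul_mk, unit_mul_unit]

theorem Delta.exists_eq_mk_unit {x : Delta k i V} (hx : x ∈ vtx k i (Delta k i V)) :
    ∃ v, x = mk (unit k i) v := by
  obtain ⟨w, rfl⟩ := exists_eq_sum hx
  choose σ hσ using fun t : Diagram.CupConfig i i => Diagram.exists_eq_ofPerm t.capless_rep
  refine ⟨∑ t, (MonoidAlgebra.single (σ t) 1 : GroupAlg k i) • w t, ?_⟩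
  have h : ∀ s : Finset (Diagram.CupConfig i i), ∑ t ∈ s, mk (bas t.rep : CoverAlgebra k n) (w t) =
      (mk (unit k i) (∑ t ∈ s, (MonoidAlgebra.single (σ t) 1 : GroupAlg k i) • w t) :
        Delta k i V) := by
    intro s
    induction s using Finset.cons_induction with
    | empty => rw [Finset.sum_empty, Finset.sum_empty, mk_zero]
    | cons t s ht ih =>
      rw [Finset.sum_cons, Finset.sum_cons, mk_add, ih, ← mk_mul_ofPerm, unit_mul_bas, ← hσ]
  exact h _

theorem Delta.mk_eq_smul (c : CoverAlgebra k n) (v : V) :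
    (mk c v : Delta k i V) = c • mk (unit k i) v := by
  rw [smul_mk, mk_mul_unit]

variable [IsScalarTower k (GroupAlg k i) V]

section desc
variable {N : Type*} [AddCommGroup N] [Module (CoverAlgebra k n) N]
  (f : V →ₗ[GroupAlg k i] vtx k i N)

theorem smul_map_smul (c : CoverAlgebra k n) (r : k) (v : V) :
    (r • c) • (f v : N) = c • (f (r • v) : N) := by
  have h : r • v = (r • (1 : GroupAlg k i)) • v := by rw [smul_assoc, one_smul]
  rw [h, map_smul, coe_smul_vtx, map_smul, permElt_one, smul_smul, mul_smul_comm,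
    ← smul_mul_assoc, mul_smul, mem_vtx.1 (f v).2]

/-- The additive map underlying `Delta.desc`. -/
noncomputable def Delta.descAux
    (hf : ∀ (l : J n) (d : Diagram i l) v, ¬ d.Capless → (bas d : CoverAlgebra k n) • (f v : N) = 0) :
    Delta k i V →+ N :=
  Delta.lift (i := i)
    (AddMonoidHom.mk' (fun c => (smulAddHom (CoverAlgebra k n) N c).comp
      ((vtx k i N).subtype.comp f.toAddMonoidHom)) fun c d => by
        ext v; exact add_smul c d _)
    (fun r c v => smul_map_smul f c r v)
    (fun c σ v => by
      show (c * _) • (f v : N) = c • (f _ : N)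
      rw [map_smul, coe_smul_vtx, permElt_single, mul_smul])
    (fun c l v hl => by
      show (c * _) • (f v : N) = 0
      rw [mul_smul, unit_smul_of_ne hl (f v).2, smul_zero])
    (fun c l m d v hd => by
      show (c * _) • (f v : N) = 0
      rw [mul_smul]
      by_cases hl : l = i
      · subst hl
        rw [hf m d v hd, smul_zero]
      · rw [bas_smul_of_ne d hl (f v).2, smul_zero])

/-- The universal property of `C ⊗_B V`: a homomorphism from `V` to a vertex space of `N` whose image
is killed by diagrams with caps extends to a homomorphism of modules. -/
noncomputable def Delta.desc
    (hf : ∀ (l : J n) (d : Diagram i l) v, ¬ d.Capless → (bas d : CoverAlgebra k n) • (f v : N) = 0) :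
    Delta k i V →ₗ[CoverAlgebra k n] N :=
  { Delta.descAux f hf with
    map_smul' c x := by
      show Delta.descAux f hf (c • x) = c • Delta.descAux f hf x
      induction x using Delta.induction with
      | h0 => rw [smul_zero, map_zero, smul_zero]
      | hadd x y hx hy => rw [smul_add, map_add, hx, hy, map_add, smul_add]
      | h l d v _ => exact mul_smul c (bas d) (f v : N) }

end desc

/-! ### Coordinates on the standard modules -/

/-- The endomorphism of `C ⊗_B V` given by an endomorphism of `C` that commutes with permutations and
vanishes on multiples of diagrams with caps. -/
noncomputable def Delta.map (g : CoverAlgebra k n →ₗ[k] CoverAlgebra k n)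
    (h1 : ∀ (l : J n) (σ : Equiv.Perm (Fin l)) c,
      g (c * bas (Diagram.ofPerm σ)) = g c * bas (Diagram.ofPerm σ))
    (h2 : ∀ (l m : J n) (d : Diagram l m) c, ¬ d.Capless → g (c * bas d) = 0) :
    Delta k i V →+ Delta k i V :=
  Delta.lift (i := i)
    (AddMonoidHom.mk' (fun c => AddMonoidHom.mk' (fun v => mk (g c) v) (mk_add (g c)))
      fun c d => by ext v; exact (congrArg (fun c => mk c v) (map_add g c d)).trans (mk_add_left _ _ _))
    (fun r c v => (congrArg (fun c => mk c v) (map_smul g r c)).trans (mk_smul_left _ _ _))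
    (fun c σ v => (congrArg (fun c => mk c v) (h1 i σ c)).trans (mk_mul_ofPerm _ _ _))
    (fun c l v hl => by
      show mk (g (c * unit k l)) v = 0
      rw [← mk_mul_unit, unit, ← Diagram.ofPerm_one, h1, Diagram.ofPerm_one, mul_assoc]
      show mk (_ * (unit k l * _)) v = 0
      rw [unit_mul_unit_ne hl, mul_zero, mk_zero_left])
    (fun c l m d v hd => by
      show mk (g (c * bas d)) v = 0
      rw [h2 l m d c hd, mk_zero_left])

theorem perm_mul_unit_of_ne {l : J n} (h : l ≠ i) (c : CoverAlgebra k n) :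
    (c * unit k l).perm i = 0 := by
  induction c using CoverAlgebra.induction with
  | h0 =>
    rw [zero_mul]; exact map_zero (permₗ i)
  | hadd c d hc hd =>
    rw [add_mul]
    exact (map_add (permₗ i) _ _).trans ((congrArg₂ (· + ·) hc hd).trans (add_zero _))
  | hbas j j' d a =>
    rw [smul_mul_assoc]
    refine (map_smul (permₗ i) _ _).trans ?_
    by_cases hj : l = j
    · subst hj
      rw [bas_mul_unit]
      exact (congrArg _ (perm_bas_ne (Or.inl (Ne.symm h)) d)).trans (smul_zero _)
    · rw [bas_mul_unit_ne hj, map_zero, smul_zero]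

theorem perm_mul_bas_of_not_capless {l m : J n} {d : Diagram l m} (h : ¬ d.Capless)
    (c : CoverAlgebra k n) : (c * bas d).perm i = 0 := by
  induction c using CoverAlgebra.induction with
  | h0 =>
    rw [zero_mul]; exact map_zero (permₗ i)
  | hadd c d hc hd =>
    rw [add_mul]
    exact (map_add (permₗ i) _ _).trans ((congrArg₂ (· + ·) hc hd).trans (add_zero _))
  | hbas j j' e a =>
    rw [smul_mul_assoc]
    refine (map_smul (permₗ i) _ _).trans ?_
    by_cases hj : m = j
    · subst hj
      rw [bas_mul, map_smul]
      refine (congrArg (fun x => a • _ • x) (perm_bas_of_not_capless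
        (Diagram.not_capless_comp e h))).trans ?_
      rw [smul_zero, smul_zero]
    · rw [bas_mul_ne hj, map_zero, smul_zero]

variable (i V) in
/-- The projection to `V` given by the coefficients of the permutations. -/
noncomputable def Delta.top : Delta k i V →+ V :=
  Delta.lift (i := i)
    (AddMonoidHom.mk' (fun c => smulAddHom (GroupAlg k i) V (c.perm i)) fun c d => by
      ext v
      exact (congrArg (· • v) (map_add (permₗ i) c d)).trans (add_smul _ _ _))
    (fun r c v => (congrArg (· • v) (map_smul (permₗ i) r c)).trans (by
      show _ = permₗ i c • r • v
      rw [smul_assoc, smul_algebra_smul_comm]))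
    (fun c σ v => (congrArg (· • v) (perm_mul_bas_ofPerm c i σ)).trans (mul_smul _ _ _))
    (fun c l v hl => (congrArg (· • v) (perm_mul_unit_of_ne hl c)).trans (zero_smul _ _))
    (fun c l m d v hd => (congrArg (· • v) (perm_mul_bas_of_not_capless hd c)).trans (zero_smul _ _))

theorem Delta.top_mk (c : CoverAlgebra k n) (v : V) : top i V (mk c v) = c.perm i • v := rfl

theorem Delta.top_mk_unit (v : V) : top i V (mk (unit k i : CoverAlgebra k n) v) = v := by
  rw [top_mk, unit, ← Diagram.ofPerm_one, perm_bas_ofPerm]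
  exact one_smul _ v

/-- The additive endomorphism of `C ⊗_B V` given by the operator `peel`. -/
noncomputable def Delta.peel {j l : J n} {u : Diagram j l} (hu : u.Capless) :
    Delta k i V →+ Delta k i V :=
  map (Periplectic.peel u fun _ => Diagram.Capless) (fun _ σ c => peel_mul_bas_ofPerm hu σ c)
    fun _ _ _ c hd => peel_mul_bas_of_not_capless hu hd c

theorem Delta.peel_mk {j l : J n} {u : Diagram j l} (hu : u.Capless) (c : CoverAlgebra k n) (v : V) :
    Delta.peel hu (mk c v : Delta k i V) = mk (Periplectic.peel u (fun _ => Diagram.Capless) c) v :=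
  rfl

theorem Delta.mk_permElt (a : GroupAlg k i) (v : V) :
    (mk (permElt i a : CoverAlgebra k n) v : Delta k i V) = mk (unit k i) (a • v) := by
  induction a using GroupAlg.induction with
  | hadd a b ha hb => rw [map_add, mk_add_left, ha, hb, add_smul, mk_add]
  | h r σ =>
    rw [map_smul, mk_smul_left, permElt_single, ← unit_mul_bas, mk_mul_ofPerm, smul_assoc,
      smul_algebra_smul_comm]

variable (k i V) in
/-- The vertex space of the object `i` in `C ⊗_B V` is `V`. -/
noncomputable def Delta.vtxEquiv : V ≃ₗ[GroupAlg k i] vtx k i (Delta k i V) :=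
  LinearEquiv.ofBijective
    { toFun v := ⟨mk (unit k i) v, mk_unit_mem v⟩
      map_add' v w := Subtype.ext (mk_add _ _ _)
      map_smul' a v := Subtype.ext (by
        show mk _ _ = permElt i a • mk _ _
        rw [smul_mk, permElt_mul_unit, mk_permElt]) }
    ⟨fun v w h => by
      have h : (mk (unit k i) v : Delta k i V) = mk (unit k i) w := congrArg Subtype.val h
      rw [← top_mk_unit (k := k) (i := i) v, h, top_mk_unit],
    fun ⟨x, hx⟩ => by
      obtain ⟨v, rfl⟩ := exists_eq_mk_unit hx
      exact ⟨v, rfl⟩⟩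

end

end

section

variable {k : Type u} [Field k] {n : ℕ}

/-! ### Direct sums of exact sequences -/

section finsupp

variable {R : Type u} [Ring R] {ι K P Q N : Type u} [AddCommGroup K] [Module R K] [AddCommGroup P]
  [Module R P] [AddCommGroup Q] [Module R Q] [AddCommGroup N] [Module R N]

theorem exists_extension_finsupp {i : K →ₗ[R] P}
    (h : ∀ f : K →ₗ[R] N, ∃ g : P →ₗ[R] N, g.comp i = f) (f : (ι →₀ K) →ₗ[R] N) :
    ∃ g : (ι →₀ P) →ₗ[R] N, g.comp (Finsupp.mapRange.linearMap i) = f := by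
  choose g hg using fun t => h (f.comp (Finsupp.lsingle t))
  refine ⟨Finsupp.lsum ℕ g, ?_⟩
  ext t x
  have := LinearMap.congr_fun (hg t) x
  simpa using this

theorem exists_mapRange_eq {i : K →ₗ[R] P} {x : ι →₀ P} (h : ∀ t, x t ∈ LinearMap.range i) :
    ∃ y : ι →₀ K, Finsupp.mapRange.linearMap i y = x := by
  have : x ∈ Set.range (Finsupp.mapRange (α := ι) i (map_zero i)) := by
    rw [Finsupp.range_mapRange]
    exact h
  exact this

theorem exact_mapRange {i : K →ₗ[R] P} {p : P →ₗ[R] Q} (h : Function.Exact i p) :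
    Function.Exact (Finsupp.mapRange.linearMap i : (ι →₀ K) →ₗ[R] _)
      (Finsupp.mapRange.linearMap p) := by
  intro x
  constructor
  · intro hx
    refine exists_mapRange_eq fun t => (h (x t)).1 ?_
    exact DFunLike.congr_fun hx t
  · rintro ⟨y, rfl⟩
    ext t
    exact (h _).2 ⟨y t, rfl⟩

theorem projective_finsupp [Module.Projective R P] : Module.Projective R (ι →₀ P) := by
  classical exact Module.Projective.of_equiv (finsuppLEquivDirectSum R P ι).symm

end finsupp

/-! ### Modules killed by the idempotent -/

theorem idem_smul_eq_zero {S : ModuleCat.{u} (CoverAlgebra k n)}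
    (h : Limits.IsZero ((coverFunctor k n).obj S)) (x : S) : idem k n • x = 0 := by
  have := ModuleCat.subsingleton_of_isZero h
  exact congrArg Subtype.val (@Subsingleton.elim _ this
    (⟨idem k n • x, idem_smul_mem x⟩ : (coverFunctor k n).obj S) 0)

theorem unit_mem_of_add_two {j : ℕ} (h : j + 3 ∈ J n) :
    ∃ a b : CoverAlgebra k n, unit k (⟨j + 1, mem_J_of_add_two h⟩ : J n) =
      a * unit k ⟨j + 3, h⟩ * b := by
  obtain ⟨s, -, hs⟩ := exists_bas_eq (k := k) (i := ⟨j + 1, mem_J_of_add_two h⟩) (j := ⟨j + 3, h⟩)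
    (l := ⟨j + 1, mem_J_of_add_two h⟩) (Diagram.slide_comp_addCup j).2
    (Diagram.slide_comp_addCup j).1
  refine ⟨s • bas (i := ⟨j + 3, h⟩) (j := ⟨j + 1, mem_J_of_add_two h⟩) (Diagram.slide j),
    bas (i := ⟨j + 1, mem_J_of_add_two h⟩) (j := ⟨j + 3, h⟩) (Diagram.addCup (j + 1)), ?_⟩
  rw [smul_mul_assoc, smul_mul_assoc, bas_mul_unit]
  exact hs

/-- If the idempotent of `n` kills a module, then so do the idempotents of all objects except for
the object zero: the identity of `i` factors through `i + 2`, by a zigzag, for all `i ≥ 1`. -/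
theorem unit_smul_eq_zero {S : Type*} [AddCommGroup S] [Module (CoverAlgebra k n) S]
    (h : ∀ x : S, idem k n • x = 0) {i : J n} (hi : i.1 ≠ 0) (x : S) : unit k i • x = 0 := by
  obtain ⟨m, hm⟩ : ∃ m, n = i.1 + 2 * m := by
    obtain ⟨h1, m, hm⟩ := mem_J.1 i.2
    exact ⟨m, by omega⟩
  induction m generalizing i x with
  | zero =>
    have : i = top n := Subtype.ext (by show i.1 = n; omega)
    rw [this, ← idem_eq]; exact h x
  | succ m ih =>
    obtain ⟨i, hi'⟩ := i
    obtain ⟨j, rfl⟩ : ∃ j, i = j + 1 := ⟨i - 1, by simp at hi; omega⟩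
    have hj : j + 3 ∈ J n := mem_J.2 ⟨by simp at hm; omega, m, by simp at hm; omega⟩
    obtain ⟨a, b, e⟩ := unit_mem_of_add_two (k := k) hj
    rw [e, mul_smul, mul_smul, ih (by simp) _ (by simp at hm ⊢; omega), smul_zero]

theorem bas_ne_zero {i j : J n} (d : Diagram i j) : (bas d : CoverAlgebra k n) ≠ 0 := fun h => by
  have := blk_injective i j (h.trans (map_zero (blk i j)).symm)
  simp at this

theorem exists_bas_mul_eq {i j j' l : J n} {d : Diagram j l} {d' : Diagram i j} {e : Diagram j' l}
    {e' : Diagram i j'} (h : ¬ Diagram.HasLoop d d') (h' : ¬ Diagram.HasLoop e e')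
    (he : Diagram.comp d d' = Diagram.comp e e') :
    ∃ s : k, s * s = 1 ∧ bas d * bas d' = s • (bas e * bas e' : CoverAlgebra k n) := by
  obtain ⟨s, hs, e1⟩ := exists_bas_mul (k := k) (n := n) h he
  obtain ⟨t, ht, e2⟩ := exists_bas_eq (k := k) (n := n) h' rfl
  exact ⟨s * t, by linear_combination s * s * ht + hs, by rw [e1, e2, smul_smul]⟩

theorem exists_bas_mul_mul {i j l : J n} {f : Diagram l l} {d : Diagram j l} {d' : Diagram i j}
    (h : ¬ Diagram.HasLoop d d') (hf : f.Capless)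
    (he : Diagram.comp f (Diagram.comp d d') = Diagram.comp d d') :
    ∃ s : k, s * s = 1 ∧ bas f * (bas d * bas d') = s • (bas d * bas d' : CoverAlgebra k n) := by
  obtain ⟨s, hs, e1⟩ := exists_bas_mul (k := k) (n := n) h rfl
  obtain ⟨t, ht, e2⟩ := exists_bas_mul (k := k) (n := n) (hf.not_hasLoop (Diagram.comp d d')) he
  exact ⟨t, ht, by rw [e1, mul_smul_comm, e2, smul_comm]⟩

/-! ### Adding cups to the right -/

section points

variable (n) [h : Fact (Even n ∧ 6 ≤ n)]

theorem mem_J_of_even {i : ℕ} (hi : Even i) (h6 : i ≤ 6) : i ∈ J n := by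
  obtain ⟨⟨a, ha⟩, h'⟩ := h.out
  obtain ⟨b, hb⟩ := hi
  exact mem_J.2 ⟨by omega, a - b, by omega⟩

/-- The object `0`. -/
abbrev p₀ : J n := ⟨0, mem_J_of_even n (by decide) (by decide)⟩

/-- The object `2`. -/
abbrev p₂ : J n := ⟨2, mem_J_of_even n (by decide) (by decide)⟩

/-- The object `4`. -/
abbrev p₄ : J n := ⟨4, mem_J_of_even n (by decide) (by decide)⟩

/-- The object `6`. -/
abbrev p₆ : J n := ⟨6, mem_J_of_even n (by decide) (by decide)⟩

open Diagram

variable (k)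

/-- The cup, as a morphism from `0` to `2`. -/
noncomputable def c₀ : CoverAlgebra k n := bas (i := p₀ n) (j := p₂ n) (addCup 0)

/-- The morphism from `2` to `4` that adds a cup. -/
noncomputable def c₂ : CoverAlgebra k n := bas (i := p₂ n) (j := p₄ n) (addCup 2)

/-- The morphism from `4` to `6` that adds a cup. -/
noncomputable def c₄ : CoverAlgebra k n := bas (i := p₄ n) (j := p₆ n) (addCup 4)

/-- The exchange of the two pairs of points of `4`. -/
noncomputable def τ : CoverAlgebra k n := bas (i := p₄ n) (j := p₄ n) (ofPerm swapPairs)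

/-- The exchange of the first two pairs of points of `6`. -/
noncomputable def τ₁ : CoverAlgebra k n := bas (i := p₆ n) (j := p₆ n) (ofPerm swapPairsFst)

/-- The exchange of the last two pairs of points of `6`. -/
noncomputable def τ₂ : CoverAlgebra k n := bas (i := p₆ n) (j := p₆ n) (ofPerm swapPairsSnd)

/-- The transposition in the endomorphisms of `2`. -/
noncomputable def σ₀ : CoverAlgebra k n := bas (i := p₂ n) (j := p₂ n) (ofPerm swapTwo)

/-- The exchange of the first two points of `4`. -/
noncomputable def σ₁ : CoverAlgebra k n := bas (i := p₄ n) (j := p₄ n) (ofPerm swapFst)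

/-- The exchange of the last two points of `4`. -/
noncomputable def σ₃ : CoverAlgebra k n := bas (i := p₄ n) (j := p₄ n) (ofPerm swapSnd)

/-- The cap, as a morphism from `2` to `0`. -/
noncomputable def cap₂ : CoverAlgebra k n := bas (i := p₂ n) (j := p₀ n) capTwo

/-- The cap on the first two points, as a morphism from `4` to `2`. -/
noncomputable def cap₄ : CoverAlgebra k n := bas (i := p₄ n) (j := p₂ n) capFour

variable {n k}

theorem exists_cup_relations : ∃ η η' κ μ ε ε' lam : k,
    η * η = 1 ∧ η' * η' = 1 ∧ μ * μ = 1 ∧ lam * lam = 1 ∧ η' = κ * η ∧ η' * κ = η ∧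
    τ k n * (c₂ k n * c₀ k n) = η • (c₂ k n * c₀ k n) ∧
    τ₂ k n * (c₄ k n * c₂ k n) = η' • (c₄ k n * c₂ k n) ∧
    τ₁ k n * c₄ k n = κ • (c₄ k n * τ k n) ∧
    τ₁ k n * τ₂ k n * τ₁ k n = τ₂ k n * τ₁ k n * τ₂ k n ∧
    σ₁ k n * c₂ k n = μ • (c₂ k n * σ₀ k n) ∧ σ₃ k n * c₂ k n = ε' • c₂ k n ∧
    σ₀ k n * c₀ k n = ε • c₀ k n ∧ ε' = μ * ε ∧ σ₁ k n * τ k n = τ k n * σ₃ k n ∧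
    cap₂ k n * c₀ k n = 0 ∧ cap₄ k n * c₂ k n = lam • (c₀ k n * cap₂ k n) ∧
    cap₄ k n * (τ k n * c₂ k n) = 0 := by
  obtain ⟨η, hη, e1⟩ := exists_bas_mul_mul (k := k) (i := p₀ n) (j := p₂ n) (l := p₄ n)
    ((capless_addCup 2).not_hasLoop (addCup 0)) (capless_ofPerm swapPairs) comp_swapPairs
  obtain ⟨η', hη', e2⟩ := exists_bas_mul_mul (k := k) (i := p₂ n) (j := p₄ n) (l := p₆ n)
    ((capless_addCup 4).not_hasLoop (addCup 2)) (capless_ofPerm swapPairsSnd) comp_swapPairsSnd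
  obtain ⟨κ, hκ, e3⟩ := exists_bas_mul_eq (k := k) (i := p₄ n) (j := p₆ n) (j' := p₄ n) (l := p₆ n)
    ((capless_ofPerm _).not_hasLoop _) ((capless_addCup 4).not_hasLoop _) comp_swapPairsFst
  obtain ⟨μ, hμ, e4⟩ := exists_bas_mul_eq (k := k) (i := p₂ n) (j := p₄ n) (j' := p₂ n) (l := p₄ n)
    ((capless_ofPerm _).not_hasLoop _) ((capless_addCup 2).not_hasLoop _) comp_swapFst
  obtain ⟨ε', hε', e5⟩ := exists_bas_mul (k := k) (i := p₂ n) (j := p₄ n) (l := p₄ n)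
    ((capless_ofPerm swapSnd).not_hasLoop (addCup 2)) comp_swapSnd
  obtain ⟨ε, hε, e6⟩ := exists_bas_mul (k := k) (i := p₀ n) (j := p₂ n) (l := p₂ n)
    ((capless_ofPerm swapTwo).not_hasLoop (addCup 0)) comp_swapTwo
  obtain ⟨lam, hlam, e7⟩ := exists_bas_mul_eq (k := k) (i := p₂ n) (j := p₄ n) (j' := p₀ n)
    (l := p₂ n) not_hasLoop_capFour ((capless_addCup 0).not_hasLoop _) comp_capFour
  have e8 : cap₂ k n * c₀ k n = 0 := bas_mul_eq_zero hasLoop_capTwo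
  have e9 : cap₄ k n * (τ k n * c₂ k n) = 0 := by
    obtain ⟨t, -, ht⟩ := exists_bas_mul (k := k) (i := p₂ n) (j := p₄ n) (l := p₄ n)
      ((capless_ofPerm swapPairs).not_hasLoop (addCup 2)) rfl
    refine (congrArg _ ht).trans ?_
    rw [mul_smul_comm, cap₄, bas_mul_eq_zero hasLoop_capFour, smul_zero]
  have e10 : ∀ f g : Equiv.Perm (Fin 6), bas (i := p₆ n) (j := p₆ n) (ofPerm f) *
      bas (i := p₆ n) (j := p₆ n) (ofPerm g) =
      (bas (i := p₆ n) (j := p₆ n) (ofPerm (f * g)) : CoverAlgebra k n) := fun f g => by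
    rw [bas_mul, comp_ofPerm_ofPerm, sign_ofPerm_ofPerm, Int.cast_one, one_smul]
  have e11 : τ₁ k n * τ₂ k n * τ₁ k n = τ₂ k n * τ₁ k n * τ₂ k n := by
    rw [τ₁, τ₂, e10, e10, e10, e10, swapPairs_braid]
  have e12 : σ₁ k n * τ k n = τ k n * σ₃ k n := by
    rw [σ₁, τ, σ₃, bas_mul, bas_mul, comp_ofPerm_ofPerm, sign_ofPerm_ofPerm, comp_ofPerm_ofPerm,
      sign_ofPerm_ofPerm, swapFst_mul]
  -- the products of cups do not vanish
  have n1 : c₂ k n * c₀ k n ≠ 0 := by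
    obtain ⟨s, hs, h⟩ := exists_bas_mul (k := k) (i := p₀ n) (j := p₂ n) (l := p₄ n)
      ((capless_addCup 2).not_hasLoop (addCup 0)) rfl
    intro h0
    rw [c₂, c₀, h] at h0
    rcases smul_eq_zero.1 h0 with rfl | h0
    · simp at hs
    · exact bas_ne_zero _ h0
  have n2 : c₄ k n * (c₂ k n * c₀ k n) ≠ 0 := by
    obtain ⟨s, hs, h⟩ := exists_bas_mul (k := k) (i := p₀ n) (j := p₂ n) (l := p₄ n)
      ((capless_addCup 2).not_hasLoop (addCup 0)) rfl
    obtain ⟨t, ht, h'⟩ := exists_bas_mul (k := k) (i := p₀ n) (j := p₄ n) (l := p₆ n)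
      ((capless_addCup 4).not_hasLoop (Diagram.comp (addCup 2) (addCup 0))) rfl
    intro h0
    rw [c₂, c₀, h, c₄, mul_smul_comm, h', smul_smul] at h0
    rcases smul_eq_zero.1 h0 with h0 | h0
    · have : (s * s) * (t * t) = 0 := by linear_combination s * t * h0
      rw [hs, ht] at this
      simp at this
    · exact bas_ne_zero _ h0
  change τ k n * (c₂ k n * c₀ k n) = η • (c₂ k n * c₀ k n) at e1
  change τ₂ k n * (c₄ k n * c₂ k n) = η' • (c₄ k n * c₂ k n) at e2
  change τ₁ k n * c₄ k n = κ • (c₄ k n * τ k n) at e3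
  change σ₁ k n * c₂ k n = μ • (c₂ k n * σ₀ k n) at e4
  change σ₃ k n * c₂ k n = ε' • c₂ k n at e5
  change σ₀ k n * c₀ k n = ε • c₀ k n at e6
  -- the braid relation, applied to three cups, compares the signs of the two exchanges
  have hκη : η' = κ * η := by
    set x := c₄ k n * (c₂ k n * c₀ k n) with hx
    have x1 : τ₁ k n * x = (κ * η) • x := by
      rw [hx, ← mul_assoc, e3, smul_mul_assoc, mul_assoc, e1, mul_smul_comm, smul_smul]
    have x2 : τ₂ k n * x = η' • x := by
      rw [hx, ← mul_assoc, ← mul_assoc, mul_assoc (τ₂ k n), e2, smul_mul_assoc, mul_assoc]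
    have h := congrArg (· * x) e11
    simp only [mul_assoc, x1, x2, mul_smul_comm, smul_smul] at h
    have h := smul_left_injective k n2 h
    have h1 : κ * η * (η' * (κ * η)) = η' := by linear_combination κ * κ * η' * hη + η' * hκ
    have h2 : η' * (κ * η * η') = κ * η := by linear_combination κ * η * hη'
    linear_combination h - h1 + h2
  have hμε : ε' = μ * ε := by
    have h1 : σ₁ k n * (τ k n * (c₂ k n * c₀ k n)) = (η * ε') • (c₂ k n * c₀ k n) := by
      rw [← mul_assoc, e12, mul_assoc, ← mul_assoc (σ₃ k n), e5, smul_mul_assoc, mul_smul_comm, e1,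
        smul_smul, mul_comm]
    have h2 : σ₁ k n * (τ k n * (c₂ k n * c₀ k n)) = (η * (μ * ε)) • (c₂ k n * c₀ k n) := by
      rw [e1, mul_smul_comm, ← mul_assoc, e4, smul_mul_assoc, mul_assoc, e6, mul_smul_comm, smul_smul,
        smul_smul, mul_assoc]
    have h := smul_left_injective k n1 (h1.symm.trans h2)
    linear_combination η * h - (ε' - μ * ε) * hη
  exact ⟨η, η', κ, μ, ε, ε', lam, hη, hη', hμ, hlam, hκη, by rw [hκη]; linear_combination η * hκ,
    e1, e2, e3, e11, e4, e5, e6, hμε, e12, e8, e7, e9⟩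

end points

end

section

variable {k : Type u} [Field k] {n : ℕ}

/-! ### Removing cups on the right -/

/-- The module has operators that remove a cup on the right: they are left inverse to the addition of
such a cup, and elements that do not end in a cup are sent to zero. The latter is expressed by the
rules for the elements that are obtained by moving other points to the right. -/
structure HasCupRemoval [Fact (Even n ∧ 6 ≤ n)] (N : Type u) [AddCommGroup N]
    [Module (CoverAlgebra k n) N] (δ₀ δ₂ δ₄ : N →+ N) : Prop where
  removal₀ : ∀ x, δ₀ (c₀ k n • x) = unit k (p₀ n) • x
  removal₂ : ∀ x, δ₂ (c₂ k n • x) = unit k (p₂ n) • x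
  removal₄ : ∀ x, δ₄ (c₄ k n • x) = unit k (p₄ n) • x
  move₀ : ∀ (s : k) x, δ₂ ((s • (τ k n * c₂ k n)) • x) =
    δ₂ ((s • (τ k n * (c₂ k n * c₀ k n))) • δ₀ x)
  move₂ : ∀ (s : k) x, δ₄ ((s • (τ₂ k n * c₄ k n)) • x) =
    δ₄ ((s • (τ₂ k n * (c₄ k n * c₂ k n))) • δ₂ x)
  move₄ : ∀ x, δ₄ (τ₁ k n • x) = δ₄ ((τ₁ k n * c₄ k n) • δ₄ x)

open Diagram in
/-- Peeling off `u` is left inverse to the multiplication by `u`. -/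
theorem Delta.peel_addCup_smul {i : J n} {V : Type u} [AddCommGroup V] [Module k V]
    [Module (GroupAlg k i) V] [IsScalarTower k (GroupAlg k i) V] {j l : J n} {u : Diagram j l}
    (hu : u.Capless) (x : Delta k i V) :
    Delta.peel hu ((bas u : CoverAlgebra k n) • x) = unit k j • x := by
  induction x using Delta.induction with
  | h0 => rw [smul_zero, map_zero, smul_zero]
  | hadd x y hx hy => rw [smul_add, map_add, hx, hy, smul_add]
  | h m d v hd =>
    rw [smul_mk, smul_mk, peel_mk]
    by_cases hm : m = j
    · subst hm
      rw [peel_bas_mul (Q := fun _ => Capless) hu hd, unit_mul_bas]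
    · rw [bas_mul_ne hm, map_zero, unit_mul_bas_ne (Ne.symm hm)]

open Diagram in
/-- A move of the last two points to the last two points commutes with the removal of a cup on the
right. -/
theorem Delta.peel_addCup_move {i : J n} {V : Type u} [AddCommGroup V] [Module k V]
    [Module (GroupAlg k i) V] [IsScalarTower k (GroupAlg k i) V] {j m : ℕ} {hj : j ∈ J n}
    {hj' : j + 2 ∈ J n} {hm : m ∈ J n} {hm' : m + 2 ∈ J n} {a : Diagram (m + 2) (j + 2)}
    (ha : a.Capless) (ha' : ∀ b : Fin 2, ha.up (Fin.natAdd m b) = Fin.natAdd j b) (s : k)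
    (x : Delta k i V) :
    Delta.peel (j := ⟨j, hj⟩) (l := ⟨j + 2, hj'⟩) (capless_addCup j)
      ((s • bas (i := ⟨m + 2, hm'⟩) (j := ⟨j + 2, hj'⟩) a : CoverAlgebra k n) • x) =
    Delta.peel (j := ⟨j, hj⟩) (l := ⟨j + 2, hj'⟩) (capless_addCup j)
      ((s • (bas (i := ⟨m + 2, hm'⟩) (j := ⟨j + 2, hj'⟩) a *
        bas (i := ⟨m, hm⟩) (j := ⟨m + 2, hm'⟩) (addCup m)) : CoverAlgebra k n) •
          Delta.peel (j := ⟨m, hm⟩) (l := ⟨m + 2, hm'⟩) (capless_addCup m) x) := by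
  induction x using Delta.induction with
  | h0 => simp only [smul_zero, map_zero]
  | hadd x y hx hy => simp only [smul_add, map_add, hx, hy]
  | h q d v hd =>
    rw [peel_mk, smul_mk, smul_mk, peel_mk, peel_mk]
    congr 1
    by_cases hq : q = ⟨m + 2, hm'⟩
    · subst hq
      by_cases he : EndsInCup (j := m) d
      · obtain ⟨d', hd'⟩ := he.exists_eq
        obtain ⟨t, -, ht⟩ := exists_bas_eq (k := k) (i := i) (j := ⟨m, hm⟩) (l := ⟨m + 2, hm'⟩)
          ((capless_addCup m).not_hasLoop d') hd'.symm
        have hc : d'.Capless := by rw [hd'] at hd; exact hd.of_comp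
        rw [ht, map_smul, peel_bas_mul (Q := fun _ => Capless) (j := ⟨m, hm⟩) (l := ⟨m + 2, hm'⟩)
          (capless_addCup m) hc]
        simp only [mul_smul_comm, smul_mul_assoc, mul_assoc]
      · rw [peel_bas_eq_zero (j := ⟨m, hm⟩) (l := ⟨m + 2, hm'⟩) (d := d), mul_zero, map_zero,
          smul_mul_assoc, map_smul, bas_mul, map_smul, peel_bas_eq_zero (j := ⟨j, hj⟩)
          (l := ⟨j + 2, hj'⟩), smul_zero, smul_zero]
        · intro w _ e
          apply he
          have h1 := endsInCup_comp_addCup w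
          have h2 : EndsInCup (Diagram.comp a d) := e ▸ h1
          refine ha.lift_injective ?_
          rw [← ha.comp_partner_lift]
          show (Diagram.comp a d).partner (Sum.inr (ha.up _)) = Sum.inr (ha.up _)
          rw [ha', ha']
          exact h2
        · intro w _ e
          exact he (e ▸ endsInCup_comp_addCup w)
    · rw [smul_mul_assoc, bas_mul_ne hq, smul_zero, map_zero, peel_bas_of_ne hq, mul_zero, map_zero]

open Diagram in
theorem Delta.hasCupRemoval [Fact (Even n ∧ 6 ≤ n)] {i : J n} {V : Type u} [AddCommGroup V]
    [Module k V] [Module (GroupAlg k i) V] [IsScalarTower k (GroupAlg k i) V] :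
    HasCupRemoval (k := k) (n := n) (Delta k i V)
      (Delta.peel (j := p₀ n) (l := p₂ n) (capless_addCup 0))
      (Delta.peel (j := p₂ n) (l := p₄ n) (capless_addCup 2))
      (Delta.peel (j := p₄ n) (l := p₆ n) (capless_addCup 4)) where
  removal₀ x := peel_addCup_smul (j := p₀ n) (l := p₂ n) (capless_addCup 0) x
  removal₂ x := peel_addCup_smul (j := p₂ n) (l := p₄ n) (capless_addCup 2) x
  removal₄ x := peel_addCup_smul (j := p₄ n) (l := p₆ n) (capless_addCup 4) x
  move₀ s x := by
    obtain ⟨t, -, ht⟩ := exists_bas_mul (k := k) (i := p₂ n) (j := p₄ n) (l := p₄ n)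
      ((capless_ofPerm swapPairs).not_hasLoop (addCup 2)) rfl
    have h := peel_addCup_move (k := k) (i := i) (j := 2) (m := 0) (hj := (p₂ n).2)
      (hj' := (p₄ n).2) (hm := (p₀ n).2) (hm' := (p₂ n).2)
      ((capless_ofPerm swapPairs).comp (capless_addCup 2)) (by
        intro b
        refine Capless.up_eq _ ?_
        rw [(capless_ofPerm swapPairs).comp_partner]
        revert b; decide) (s * t) x
    rw [← mul_assoc, τ, c₂, c₀, ht, smul_mul_assoc]
    rw [mul_smul, mul_smul] at h
    exact h
  move₂ s x := by
    obtain ⟨t, -, ht⟩ := exists_bas_mul (k := k) (i := p₄ n) (j := p₆ n) (l := p₆ n)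
      ((capless_ofPerm swapPairsSnd).not_hasLoop (addCup 4)) rfl
    have h := peel_addCup_move (k := k) (i := i) (j := 4) (m := 2) (hj := (p₄ n).2)
      (hj' := (p₆ n).2) (hm := (p₂ n).2) (hm' := (p₄ n).2)
      ((capless_ofPerm swapPairsSnd).comp (capless_addCup 4)) (by
        intro b
        refine Capless.up_eq _ ?_
        rw [(capless_ofPerm swapPairsSnd).comp_partner]
        revert b; decide) (s * t) x
    rw [← mul_assoc, τ₂, c₄, c₂, ht, smul_mul_assoc]
    rw [mul_smul, mul_smul] at h
    exact h
  move₄ x := by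
    have h := peel_addCup_move (k := k) (i := i) (j := 4) (m := 4) (hj := (p₄ n).2)
      (hj' := (p₆ n).2) (hm := (p₄ n).2) (hm' := (p₆ n).2)
      (capless_ofPerm swapPairsFst) (by decide) 1 x
    rw [one_smul, one_smul] at h
    exact h

theorem HasCupRemoval.directSum [Fact (Even n ∧ 6 ≤ n)] {ι : Type u} {N : ι → Type u}
    [∀ a, AddCommGroup (N a)] [∀ a, Module (CoverAlgebra k n) (N a)]
    {δ₀ δ₂ δ₄ : ∀ a, N a →+ N a} (h : ∀ a, HasCupRemoval (k := k) (n := n) (N a) (δ₀ a) (δ₂ a) (δ₄ a)) :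
    HasCupRemoval (k := k) (n := n) (DirectSum ι N) (DirectSum.map δ₀) (DirectSum.map δ₂)
      (DirectSum.map δ₄) where
  removal₀ x := by ext a; exact (h a).removal₀ (x a)
  removal₂ x := by ext a; exact (h a).removal₂ (x a)
  removal₄ x := by ext a; exact (h a).removal₄ (x a)
  move₀ s x := by ext a; exact (h a).move₀ s (x a)
  move₂ s x := by ext a; exact (h a).move₂ s (x a)
  move₄ x := by ext a; exact (h a).move₄ (x a)

/-! ### The start of a projective resolution of the simple module of the object zero -/

section resolution

variable (k n)

/-- The projective module `C e` for the idempotent `e` of the object `i`. -/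
def col (i : J n) : Submodule (CoverAlgebra k n) (CoverAlgebra k n) where
  carrier := {x | x * unit k i = x}
  zero_mem' := zero_mul _
  add_mem' {x y} hx hy := by
    show (x + y) * _ = _
    rw [add_mul, hx, hy]
  smul_mem' c x hx := by
    show c * x * _ = c * x
    rw [mul_assoc, hx]

variable {k n}

theorem mem_col {i : J n} {x : CoverAlgebra k n} : x ∈ col k n i ↔ x * unit k i = x := Iff.rfl

theorem mul_unit_mem_col (c : CoverAlgebra k n) (i : J n) : c * unit k i ∈ col k n i := by
  rw [mem_col, mul_assoc, unit_mul_unit]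

theorem bas_mem_col {i j : J n} (d : Diagram i j) : (bas d : CoverAlgebra k n) ∈ col k n i :=
  bas_mul_unit d

/-- The homomorphism from `C e` given by an element. -/
noncomputable def colMap {N : Type u} [AddCommGroup N] [Module (CoverAlgebra k n) N] (i : J n)
    (x : N) : col k n i →ₗ[CoverAlgebra k n] N :=
  (LinearMap.toSpanSingleton (CoverAlgebra k n) N x).comp (col k n i).subtype

theorem colMap_apply {N : Type u} [AddCommGroup N] [Module (CoverAlgebra k n) N] (i : J n) (x : N)
    (c : col k n i) : colMap i x c = (c : CoverAlgebra k n) • x := rfl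

instance (i : J n) : Module.Projective (CoverAlgebra k n) (col k n i) :=
  Module.Projective.of_split (col k n i).subtype
    ((LinearMap.toSpanSingleton (CoverAlgebra k n) _ (unit k i)).codRestrict (col k n i)
      fun c => mul_unit_mem_col c i) (by ext c; exact c.2)

variable [Fact (Even n ∧ 6 ≤ n)]

variable (k n) in
/-- The multiplication with the cup, from `C e₂` to `C e₀`. -/
noncomputable def mulCup : col k n (p₂ n) →ₗ[CoverAlgebra k n] col k n (p₀ n) :=
  colMap (p₂ n) ⟨c₀ k n, bas_mem_col _⟩

theorem coe_mulCup (x : col k n (p₂ n)) : (mulCup k n x : CoverAlgebra k n) = x * c₀ k n := rfl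

/-- Every diagram from `0` to another object is a multiple of the cup, so the cokernel of the
multiplication with the cup is one-dimensional. -/
theorem exists_sub_smul_mem_range (c : CoverAlgebra k n) : ∃ a : k, ∃ y : CoverAlgebra k n,
    c * unit k (p₀ n) - a • unit k (p₀ n) = y * c₀ k n := by
  induction c using CoverAlgebra.induction with
  | h0 => exact ⟨0, 0, by simp⟩
  | hadd c d hc hd =>
    obtain ⟨a, y, h⟩ := hc
    obtain ⟨b, z, h'⟩ := hd
    exact ⟨a + b, y + z, by rw [add_mul, add_mul, ← h, ← h', add_smul]; abel⟩
  | hbas i l d r =>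
    by_cases hi : i = p₀ n
    · subst hi
      rw [smul_mul_assoc, bas_mul_unit]
      by_cases hl : l = p₀ n
      · subst hl
        have : d = Diagram.one 0 := Diagram.ext' fun x => x.elim Fin.elim0 Fin.elim0
        subst this
        exact ⟨r, 0, by rw [zero_mul]; exact sub_self _⟩
      · obtain ⟨d', hd', e⟩ := Diagram.exists_comp_addCup (m := d) (fun h => hl (Subtype.ext h))
        obtain ⟨s, -, hs⟩ := exists_bas_eq (k := k) (i := p₀ n) (j := p₂ n) (l := l)
          (hd'.not_hasLoop (Diagram.addCup 0)) e
        exact ⟨0, (r * s) • bas (i := p₂ n) (j := l) d', by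
          rw [hs, zero_smul, sub_zero, smul_smul, smul_mul_assoc]; rfl⟩
    · exact ⟨0, 0, by rw [smul_mul_assoc, bas_mul_unit_ne (Ne.symm hi), smul_zero]; simp⟩

/-- The span of the generators of the kernel of the multiplication with the cup. -/
noncomputable def cupRelations (η ε : k) : Submodule (CoverAlgebra k n) (CoverAlgebra k n) :=
  Submodule.span _ {σ₀ k n - ε • unit k (p₂ n), cap₂ k n, c₂ k n - η • (τ k n * c₂ k n)}

open Diagram in
theorem exists_smul_sub_mem_cupRelations {η ε : k} (hη : η * η = 1) {l : J n} {d d' : Diagram 2 l}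
    (hd : d.Capless) (hd' : d'.Capless)
    (e : Diagram.comp d (addCup 0) = Diagram.comp d' (addCup 0)) :
    ∃ a : k, (bas (i := p₂ n) (j := l) d' : CoverAlgebra k n) - a • bas (i := p₂ n) (j := l) d ∈
      cupRelations η ε := by
  obtain ⟨σ, h | ⟨v, hv, h, h'⟩⟩ := eq_or_exists_of_comp_addCup hd hd' e
  · obtain ⟨s, -, hs⟩ := exists_bas_eq (k := k) (i := p₂ n) (j := p₂ n) (l := l)
      ((cupless_ofPerm σ).not_hasLoop d) h.symm
    have hσ : ∀ σ : Equiv.Perm (Fin 2), σ = 1 ∨ σ = swapTwo := by decide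
    rcases hσ σ with rfl | rfl
    · refine ⟨s, ?_⟩
      rw [hs, ofPerm_one]
      have : (bas (i := p₂ n) (j := l) d : CoverAlgebra k n) * bas (i := p₂ n) (j := p₂ n) (one 2) =
        bas (i := p₂ n) (j := l) d := bas_mul_unit _
      rw [this, sub_self]
      exact Submodule.zero_mem _
    · refine ⟨s * ε, ?_⟩
      have : s • (bas (i := p₂ n) (j := l) d * bas (i := p₂ n) (j := p₂ n) (ofPerm swapTwo)) -
          (s * ε) • bas (i := p₂ n) (j := l) d =
          (s • bas (i := p₂ n) (j := l) d : CoverAlgebra k n) •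
            (σ₀ k n - ε • unit k (p₂ n)) := by
        rw [smul_sub, smul_eq_mul, smul_eq_mul, smul_mul_assoc, mul_smul_comm, smul_mul_assoc,
          bas_mul_unit, smul_smul, mul_comm ε s]
        rfl
      rw [hs, this]
      exact Submodule.smul_mem _ _ (Submodule.subset_span (by simp))
  · obtain ⟨s, hs', hs⟩ := exists_bas_mul (k := k) (i := p₂ n) (j := p₄ n) (l := l)
      (hv.not_hasLoop (addCup 2)) h.symm
    obtain ⟨t, -, ht⟩ := exists_bas_eq (k := k) (i := p₂ n) (j := p₄ n) (l := l)
      (hv.not_hasLoop (Diagram.comp (ofPerm swapPairs) (addCup 2))) h'.symm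
    obtain ⟨r, -, hr⟩ := exists_bas_eq (k := k) (i := p₂ n) (j := p₄ n) (l := p₄ n)
      ((capless_ofPerm swapPairs).not_hasLoop (addCup 2)) rfl
    refine ⟨t * r * η * s, ?_⟩
    have : t • (bas (i := p₄ n) (j := l) v * r • (τ k n * c₂ k n)) -
        (t * r * η * s) • bas (i := p₂ n) (j := l) d =
        (-(t * r * η) • bas (i := p₄ n) (j := l) v : CoverAlgebra k n) •
          (c₂ k n - η • (τ k n * c₂ k n)) := by
      have hs : (bas (i := p₄ n) (j := l) v : CoverAlgebra k n) * c₂ k n = _ := hs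
      rw [smul_sub, smul_eq_mul, smul_eq_mul, smul_mul_assoc, hs, mul_smul_comm, mul_smul_comm,
        smul_mul_assoc]
      simp only [smul_smul]
      have e1 : -(t * r * η) * s = -(t * r * η * s) := by ring
      have e2 : η * -(t * r * η) = -(t * r) := by linear_combination -(t * r) * hη
      rw [e1, e2]
      module
    rw [ht, hr]
    exact this ▸ Submodule.smul_mem _ _ (Submodule.subset_span (by simp))

/-- The listed elements are killed by the right multiplication with the cup. -/
theorem mul_cup_eq_zero {η ε : k} (hτ : τ k n * (c₂ k n * c₀ k n) = η • (c₂ k n * c₀ k n))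
    (hη : η * η = 1) (hσ : σ₀ k n * c₀ k n = ε • c₀ k n) (hcap : cap₂ k n * c₀ k n = 0)
    {x : CoverAlgebra k n} (hx : x ∈ cupRelations η ε) : x * c₀ k n = 0 := by
  have hu : unit k (p₂ n) * c₀ k n = c₀ k n := unit_mul_bas _
  induction hx using Submodule.span_induction with
  | zero => rw [zero_mul]
  | add x y _ _ hx hy => rw [add_mul, hx, hy, add_zero]
  | smul c x _ hx => rw [smul_eq_mul, mul_assoc, hx, mul_zero]
  | mem x hx =>
    rcases hx with rfl | rfl | rfl
    · rw [sub_mul, hσ, smul_mul_assoc, hu, sub_self]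
    · exact hcap
    · rw [sub_mul, smul_mul_assoc, mul_assoc, hτ, smul_smul, hη, one_smul, sub_self]

theorem Diagram.eq_capTwo (w : Diagram 2 0) : w = Diagram.capTwo := by
  refine Diagram.ext' fun x => ?_
  rcases x with x | x
  · have h := w.partner_ne (Sum.inl x)
    rcases e : w.partner (Sum.inl x) with y | y
    · rw [e] at h
      clear e
      revert x y; decide
    · exact y.elim0
  · exact x.elim0

open Diagram in
/-- The kernel of the multiplication with the cup is generated by three elements. Two diagrams without
caps that become equal after closing the two bottom dots by a cup are related by a permutation of the
two dots or by opening another cup instead; diagrams with caps are multiples of the cap. -/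
theorem mem_cupRelations {η ε : k} (hτ : τ k n * (c₂ k n * c₀ k n) = η • (c₂ k n * c₀ k n))
    (hη : η * η = 1) (hσ : σ₀ k n * c₀ k n = ε • c₀ k n) (hcap : cap₂ k n * c₀ k n = 0)
    {x : CoverAlgebra k n} (hx : x ∈ col k n (p₂ n)) (h : x * c₀ k n = 0) :
    x ∈ cupRelations η ε := by
  classical
  -- a diagram with one cup opened
  let P : ∀ l : J n, Diagram 0 l → Prop := fun l m => ∃ d : Diagram 2 l, d.Capless ∧
    Diagram.comp d (addCup 0) = m
  let θ : ∀ l : J n, Diagram 0 l → CoverAlgebra k n ⧸ cupRelations η ε := fun l m =>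
    if hm : P l m then Submodule.Quotient.mk
      ((sign hm.choose (addCup 0) : k) • bas (i := p₂ n) (j := l) hm.choose) else 0
  let Θ : CoverAlgebra k n →ₗ[k] CoverAlgebra k n ⧸ cupRelations η ε :=
    ∑ l : J n, (Finsupp.linearCombination k (θ l)).comp (entryₗ (p₀ n) l)
  have hΘ : ∀ (l : J n) (m : Diagram 0 l), Θ (bas (i := p₀ n) (j := l) m) = θ l m := by
    intro l m
    show (∑ l : J n, (Finsupp.linearCombination k (θ l)).comp (entryₗ (p₀ n) l)) _ = _
    rw [LinearMap.sum_apply, Finset.sum_eq_single l]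
    · show Finsupp.linearCombination k (θ l) ((bas (i := p₀ n) (j := l) m :
        CoverAlgebra k n).entry (p₀ n) l) = _
      rw [bas, entry_blk, Finsupp.linearCombination_single, one_smul]
    · intro l' _ hl
      show Finsupp.linearCombination k (θ l') ((bas (i := p₀ n) (j := l) m :
        CoverAlgebra k n).entry (p₀ n) l') = _
      rw [bas, entry_blk_ne (Or.inr hl), map_zero]
    · simp
  suffices H : ∀ c : CoverAlgebra k n, Θ (c * unit k (p₂ n) * c₀ k n) =
      Submodule.Quotient.mk (c * unit k (p₂ n)) by
    have := H x
    rw [mem_col.1 hx, h, map_zero] at this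
    exact (Submodule.Quotient.mk_eq_zero _).1 this.symm
  intro c
  induction c using CoverAlgebra.induction with
  | h0 => simp only [zero_mul, map_zero, Submodule.Quotient.mk_zero]
  | hadd c d hc hd => rw [add_mul, add_mul, map_add, hc, hd, Submodule.Quotient.mk_add]
  | hbas i l d a =>
    simp only [smul_mul_assoc]
    rw [map_smul, Submodule.Quotient.mk_smul]
    congr 1
    by_cases hi : p₂ n = i
    swap
    · rw [bas_mul_unit_ne hi, zero_mul, map_zero, Submodule.Quotient.mk_zero]
    subst hi
    rw [bas_mul_unit]
    by_cases hd : d.Capless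
    · have hm : P l (Diagram.comp d (addCup 0)) := ⟨d, hd, rfl⟩
      have e1 : bas d * c₀ k n = (sign d (addCup 0) : k) •
        bas (i := p₀ n) (j := l) (Diagram.comp d (addCup 0)) := bas_mul _ _
      rw [e1, map_smul, hΘ]
      show _ • dite _ _ _ = _
      rw [dif_pos hm]
      obtain ⟨hc, he⟩ := hm.choose_spec
      set d' := hm.choose
      rw [← Submodule.Quotient.mk_smul, Submodule.Quotient.eq]
      obtain ⟨b, hb⟩ := exists_smul_sub_mem_cupRelations (ε := ε) hη hd hc he.symm
      have e2 : bas (i := p₂ n) (j := l) d' * c₀ k n = (sign d' (addCup 0) : k) •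
        bas (i := p₀ n) (j := l) (Diagram.comp d (addCup 0)) :=
          (bas_mul _ _).trans (by rw [he])
      have q1 := congrArg (Int.cast : ℤ → k) (sign_mul_self _ _ (hd.not_hasLoop (addCup 0)))
      have q2 := congrArg (Int.cast : ℤ → k) (sign_mul_self _ _ (hc.not_hasLoop (addCup 0)))
      push_cast at q1 q2
      have e3 := mul_cup_eq_zero hτ hη hσ hcap hb
      rw [sub_mul, smul_mul_assoc, e1, e2, smul_smul, ← sub_smul] at e3
      have e4 := (smul_eq_zero.1 e3).resolve_right (bas_ne_zero _)
      have e5 : (sign d (addCup 0) : k) • (sign d' (addCup 0) : k) • bas (i := p₂ n) (j := l) d' -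
          (bas (i := p₂ n) (j := l) d : CoverAlgebra k n) =
          ((sign d (addCup 0) : k) * (sign d' (addCup 0) : k)) •
            (bas (i := p₂ n) (j := l) d' - b • bas (i := p₂ n) (j := l) d) := by
        have : (sign d (addCup 0) : k) * (sign d' (addCup 0) : k) * b = 1 := by
          linear_combination -(sign d' (addCup 0) : k) * e4 * 1 + q2
        rw [smul_sub, smul_smul, smul_smul, this, one_smul]
      exact e5 ▸ Submodule.smul_of_tower_mem _ _ hb
    · obtain ⟨d', w, hw, e⟩ := exists_factor_of_cap (i := 0) hd
      have hw' : w = capTwo := eq_capTwo w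
      obtain ⟨s, -, hs⟩ := exists_bas_eq (k := k) (i := p₂ n) (j := p₀ n) (l := l)
        (hw.not_hasLoop d') e
      subst hw'
      have h1 : s • (bas (i := p₀ n) (j := l) d' * bas (i := p₂ n) (j := p₀ n) capTwo) =
        (s • bas (i := p₀ n) (j := l) d' : CoverAlgebra k n) • cap₂ k n := by
        rw [smul_eq_mul, smul_mul_assoc]; rfl
      have h2 : s • (bas (i := p₀ n) (j := l) d' * bas (i := p₂ n) (j := p₀ n) capTwo) ∈
        cupRelations η ε := h1 ▸ Submodule.smul_mem _ _ (Submodule.subset_span (by simp))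
      rw [hs, mul_cup_eq_zero hτ hη hσ hcap h2, map_zero]
      exact ((Submodule.Quotient.mk_eq_zero _).2 h2).symm

end resolution

end

section

variable {k : Type u} [Field k] {n : ℕ} [Fact (Even n ∧ 6 ≤ n)]

/-! ### Extensions of modules concentrated at the object zero -/

theorem unit_smul_p₀ {S : Type*} [AddCommGroup S] [Module (CoverAlgebra k n) S]
    (h : ∀ x : S, idem k n • x = 0) (x : S) : unit k (p₀ n) • x = x := by
  conv_rhs => rw [← sum_unit_smul (k := k) (n := n) x]
  rw [Finset.sum_eq_single (p₀ n)]
  · intro i _ hi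
    exact unit_smul_eq_zero h (fun e => hi (Subtype.ext e)) x
  · simp

theorem cup_smul_eq_zero {S : Type*} [AddCommGroup S] [Module (CoverAlgebra k n) S]
    (h : ∀ x : S, idem k n • x = 0) (x : S) : c₀ k n • x = 0 := by
  have : unit k (p₂ n) * c₀ k n = c₀ k n := unit_mul_bas _
  rw [← this, mul_smul]
  exact unit_smul_eq_zero h (by simp) _

theorem mul_cup_mem_range (z : CoverAlgebra k n) (y : col k n (p₀ n))
    (h : (y : CoverAlgebra k n) = z * c₀ k n) : y ∈ LinearMap.range (mulCup k n) := by
  refine ⟨⟨z * unit k (p₂ n), mul_unit_mem_col _ _⟩, Subtype.ext ?_⟩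
  have : unit k (p₂ n) * c₀ k n = c₀ k n := unit_mul_bas _
  rw [coe_mulCup, mul_assoc, this, h]

/-- A module killed by the idempotent is a direct sum of copies of the simple module of the object
zero, which is the cokernel of the multiplication with the cup. -/
theorem exists_presentation {S : Type u} [AddCommGroup S] [Module (CoverAlgebra k n) S]
    (h : ∀ x : S, idem k n • x = 0) : ∃ (ι : Type u)
    (p : (ι →₀ col k n (p₀ n)) →ₗ[CoverAlgebra k n] S), Function.Surjective p ∧
      Function.Exact (Finsupp.mapRange.linearMap (LinearMap.range (mulCup k n)).subtype) p := by
  classical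
  let _ : Module k S := Module.compHom S (algebraMap k (CoverAlgebra k n))
  have hsm : ∀ (a : k) (x : S), a • x = (a • (1 : CoverAlgebra k n)) • x := fun a x => by
    rw [← Algebra.algebraMap_eq_smul_one]; rfl
  have hun : ∀ (a : k) (x : S), a • x = (a • unit k (p₀ n)) • x := fun a x => by
    conv_lhs => rw [← unit_smul_p₀ h x, hsm, ← mul_smul, smul_mul_assoc, one_mul]
  let b := Module.Basis.ofVectorSpace k S
  let p : (Module.Basis.ofVectorSpaceIndex k S →₀ col k n (p₀ n)) →ₗ[CoverAlgebra k n] S :=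
    Finsupp.lsum ℕ fun t => colMap (p₀ n) (b t)
  have hp : ∀ y, p y = ∑ t ∈ y.support, (y t : CoverAlgebra k n) • b t := fun y => rfl
  refine ⟨_, p, ?_, ?_⟩
  · intro x
    have hx := b.linearCombination_repr x
    rw [Finsupp.linearCombination_apply, Finsupp.sum] at hx
    refine ⟨∑ t ∈ (b.repr x).support, Finsupp.single t
      ((b.repr x t • (1 : CoverAlgebra k n)) • ⟨unit k (p₀ n), unit_mul_unit _⟩), ?_⟩
    rw [map_sum, ← hx]
    refine Finset.sum_congr (by rw [hx]) fun t _ => ?_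
    rw [hx, hun]
    show Finsupp.lsum ℕ _ (Finsupp.single _ _) = _
    rw [Finsupp.lsum_single, colMap_apply]
    congr 1
    show (_ • (1 : CoverAlgebra k n)) * unit k (p₀ n) = _
    rw [smul_mul_assoc, one_mul]
  · intro y
    constructor
    · intro hy
      refine exists_mapRange_eq (R := CoverAlgebra k n)
        (K := LinearMap.range (mulCup k n)) (P := col k n (p₀ n)) (i := (LinearMap.range (mulCup k n)).subtype) fun t => ?_
      rw [Submodule.range_subtype]
      choose a z hz using fun t => exists_sub_smul_mem_range (k := k) (n := n) (y t)
      have hz' : ∀ t, (y t : CoverAlgebra k n) = a t • unit k (p₀ n) + z t * c₀ k n := fun t => by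
        rw [← hz, mem_col.1 (y t).2]; abel
      by_cases ht : t ∈ y.support
      · have : ∑ t ∈ y.support, a t • b t = 0 := by
          rw [← hy, hp]
          refine Finset.sum_congr rfl fun t _ => ?_
          rw [hz', add_smul, mul_smul, cup_smul_eq_zero h, smul_zero, add_zero, hun]
        have := linearIndependent_iff'.1 b.linearIndependent _ _ this t ht
        refine mul_cup_mem_range (z t) _ ?_
        rw [hz', this, zero_smul, zero_add]
      · rw [Finsupp.notMem_support_iff.1 ht]
        exact Submodule.zero_mem _
    · rintro ⟨y, rfl⟩
      rw [hp]
      refine Finset.sum_eq_zero fun t _ => ?_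
      obtain ⟨z, hz⟩ := (y t).2
      show ((y t).1 : CoverAlgebra k n) • b t = 0
      rw [← hz, coe_mulCup, mul_smul, cup_smul_eq_zero h, smul_zero]

section closed

variable {N : Type u} [AddCommGroup N] [Module (CoverAlgebra k n) N] {δ₀ δ₂ δ₄ : N →+ N}
  (hN : HasCupRemoval (k := k) (n := n) N δ₀ δ₂ δ₄)
include hN

/-- The value `w` of `f` at the cup satisfies the relation that exchanges two cups. Removing the
right cup in this relation shows that `w = c₀ • δ₀ w`. -/
theorem HasCupRemoval.exists_extension_range
    (f : LinearMap.range (mulCup k n) →ₗ[CoverAlgebra k n] N) :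
    ∃ g : col k n (p₀ n) →ₗ[CoverAlgebra k n] N,
      g.comp (LinearMap.range (mulCup k n)).subtype = f := by
  obtain ⟨η, -, -, -, -, -, -, hη, -, -, -, -, -, hτ, -⟩ := exists_cup_relations (k := k) (n := n)
  have hc : (⟨c₀ k n, bas_mem_col _⟩ : col k n (p₀ n)) ∈ LinearMap.range (mulCup k n) :=
    mul_cup_mem_range 1 _ (one_mul _).symm
  set w := f ⟨_, hc⟩ with hw
  have hf : ∀ (c : CoverAlgebra k n) (y : LinearMap.range (mulCup k n)),
      (y : CoverAlgebra k n) = c * c₀ k n → f y = c • w := by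
    intro c y hy
    rw [hw, ← map_smul]
    exact congrArg f (Subtype.ext (Subtype.ext hy))
  have hu : unit k (p₂ n) * c₀ k n = c₀ k n := unit_mul_bas _
  have h1 : c₂ k n • w = (η • (τ k n * c₂ k n)) • w := by
    have hm : (⟨c₂ k n * c₀ k n, by rw [mem_col, mul_assoc]; exact congrArg _ (bas_mul_unit _)⟩ :
        col k n (p₀ n)) ∈ LinearMap.range (mulCup k n) := mul_cup_mem_range _ _ rfl
    rw [← hf (c₂ k n) ⟨_, hm⟩ rfl, ← hf (η • (τ k n * c₂ k n)) ⟨_, hm⟩]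
    show c₂ k n * c₀ k n = _
    rw [smul_mul_assoc, mul_assoc, hτ, smul_smul, hη, one_smul]
  have h2 : w = c₀ k n • δ₀ w := by
    have h3 := congrArg δ₂ h1
    rw [hN.removal₂, hN.move₀, hτ, smul_smul, hη, one_smul, mul_smul, hN.removal₂, ← mul_smul,
      hu] at h3
    rw [← h3]
    have := hf (unit k (p₂ n)) ⟨_, hc⟩ hu.symm
    exact this
  refine ⟨colMap (p₀ n) (δ₀ w), ?_⟩
  ext ⟨y, x, rfl⟩
  rw [hf x _ rfl]
  show ((x : CoverAlgebra k n) * c₀ k n) • δ₀ w = (x : CoverAlgebra k n) • w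
  rw [mul_smul, ← h2]

/-- The homomorphism `f` is determined by its values at the three generators of the kernel. Three
exchanges of cups lead to a relation for the generator `r = c₂ - η τ c₂`; removing the right cup
in it gives `f r = r • g`, with `g` the value `f r` with its right cup removed. The other two
generators become multiples of `r` after adding a cup on the right, so that their values are `s •
g` and `cap • g` as well. -/
theorem HasCupRemoval.exists_extension_ker
    (f : LinearMap.ker (mulCup k n) →ₗ[CoverAlgebra k n] N) :
    ∃ g : col k n (p₂ n) →ₗ[CoverAlgebra k n] N,
      g.comp (LinearMap.ker (mulCup k n)).subtype = f := by
  obtain ⟨η, η', κ, μ, ε, ε', lam, hη, hη', hμ, hlam, hκ, hκ', hτ, hτ₂, hτ₁, hbr, hσ₁, hσ₃, hσ, hε,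
    hστ, hcap, hcap₄, hcap₄'⟩ := exists_cup_relations (k := k) (n := n)
  -- the values of `f`
  let φ : ∀ x : CoverAlgebra k n, x ∈ col k n (p₂ n) → x * c₀ k n = 0 → N :=
    fun x h h' => f ⟨⟨x, h⟩, Subtype.ext h'⟩
  have hφ : ∀ (a b x y : CoverAlgebra k n) (hx : x ∈ col k n (p₂ n)) (hx' : x * c₀ k n = 0)
      (hy : y ∈ col k n (p₂ n)) (hy' : y * c₀ k n = 0), a * x = b * y →
      a • φ x hx hx' = b • φ y hy hy' := by
    intro a b x y hx hx' hy hy' e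
    show a • f _ = b • f _
    rw [← map_smul, ← map_smul]
    exact congrArg f (Subtype.ext (Subtype.ext e))
  have uc₀ : unit k (p₂ n) * c₀ k n = c₀ k n := unit_mul_bas _
  have c₂u : c₂ k n * unit k (p₂ n) = c₂ k n := bas_mul_unit _
  have uc₂ : unit k (p₄ n) * c₂ k n = c₂ k n := unit_mul_bas _
  have uτ : unit k (p₄ n) * τ k n = τ k n := unit_mul_bas _
  have uσ : unit k (p₂ n) * σ₀ k n = σ₀ k n := unit_mul_bas _
  have ucap : unit k (p₀ n) * cap₂ k n = cap₂ k n := unit_mul_bas _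
  have σu : σ₀ k n * unit k (p₂ n) = σ₀ k n := bas_mul_unit _
  have hr : c₂ k n - η • (τ k n * c₂ k n) ∈ col k n (p₂ n) := by
    rw [mem_col, sub_mul, smul_mul_assoc, mul_assoc, c₂u]
  have hs : σ₀ k n - ε • unit k (p₂ n) ∈ col k n (p₂ n) := by
    rw [mem_col, sub_mul, smul_mul_assoc, unit_mul_unit, σu]
  have hc : cap₂ k n ∈ col k n (p₂ n) := bas_mem_col _
  have hmem : ∀ {x}, x ∈ cupRelations (k := k) (n := n) η ε → x * c₀ k n = 0 :=
    fun hx => mul_cup_eq_zero hτ hη hσ hcap hx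
  have hr' := hmem (Submodule.subset_span (by simp) :
    c₂ k n - η • (τ k n * c₂ k n) ∈ cupRelations η ε)
  have hs' := hmem (Submodule.subset_span (by simp) :
    σ₀ k n - ε • unit k (p₂ n) ∈ cupRelations η ε)
  set r := c₂ k n - η • (τ k n * c₂ k n) with hr0
  set s := σ₀ k n - ε • unit k (p₂ n) with hs0
  have us : unit k (p₂ n) * s = s := by
    rw [hs0, mul_sub, mul_smul_comm, unit_mul_unit, uσ]
  have ur : unit k (p₄ n) * r = r := by
    rw [hr0, mul_sub, mul_smul_comm, uc₂, ← mul_assoc, uτ]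
  -- the alternating sum over the exchanges of three cups kills `r`
  have rel : c₄ k n * r = (η' • (τ₂ k n * c₄ k n) - τ₁ k n * (τ₂ k n * c₄ k n)) * r := by
    obtain ⟨X, hX⟩ : ∃ X, X = c₄ k n * c₂ k n := ⟨_, rfl⟩
    rw [← hX] at hτ₂
    have e1 : c₄ k n * r = X - η' • (τ₁ k n * X) := by
      rw [hX, ← mul_assoc (τ₁ k n), hτ₁, smul_mul_assoc, smul_smul, hκ', hr0, mul_sub, mul_smul_comm,
        mul_assoc]
    have e2 : τ₂ k n * (c₄ k n * r) = η' • X - η' • (τ₂ k n * (τ₁ k n * X)) := by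
      rw [e1, mul_sub, hτ₂, mul_smul_comm]
    have e3 : τ₁ k n * (τ₂ k n * (τ₁ k n * X)) = η' • (τ₂ k n * (τ₁ k n * X)) := by
      rw [← mul_assoc, ← mul_assoc, hbr, mul_assoc, hτ₂, mul_smul_comm, mul_assoc]
    have e4 : τ₁ k n * (τ₂ k n * (c₄ k n * r)) = η' • (τ₁ k n * X) - τ₂ k n * (τ₁ k n * X) := by
      rw [e2, mul_sub, mul_smul_comm, mul_smul_comm, e3, smul_smul, hη', one_smul]
    rw [sub_mul, smul_mul_assoc, mul_assoc, mul_assoc (τ₁ k n), mul_assoc (τ₂ k n), e4, e2, e1, smul_sub,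
      smul_smul, smul_smul, hη', one_smul, one_smul]
    abel
  set g₀ := φ r hr hr' with hg₀
  have ug₀ : unit k (p₄ n) • g₀ = g₀ := by
    have := hφ (unit k (p₄ n)) 1 r r hr hr' hr hr' (by rw [ur, one_mul])
    rwa [one_smul] at this
  set g := δ₂ g₀ with hg
  have main : g₀ = r • g := by
    have h1 := congrArg δ₄ (hφ _ _ r r hr hr' hr hr' rel)
    rw [hN.removal₄, ← hg₀, ug₀, sub_smul, map_sub, hN.move₂, hτ₂, smul_smul, hη', one_smul,
      mul_smul (c₄ k n), hN.removal₄, ← mul_smul, uc₂, mul_smul (τ₁ k n), hN.move₄] at h1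
    have h2 := hN.move₂ 1 g₀
    rw [one_smul, one_smul, hτ₂, ← mul_smul_comm, mul_smul (c₄ k n), hN.removal₄, ← mul_smul,
      mul_smul_comm, uc₂] at h2
    have h3 : τ₁ k n * c₄ k n * (η' • c₂ k n) = c₄ k n * (η • (τ k n * c₂ k n)) := by
      rw [hτ₁, smul_mul_smul_comm, mul_comm κ, hκ', mul_smul_comm, mul_assoc]
    rw [h2, ← mul_smul, h3, mul_smul, hN.removal₄, ← mul_smul, mul_smul_comm, ← mul_assoc, uτ] at h1
    rw [hr0, sub_smul]
    exact h1
  have main_s : φ s hs hs' = s • g := by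
    have e : c₂ k n * s = (μ • (σ₁ k n - ε' • 1)) * r := by
      rw [hr0, hs0, smul_mul_assoc, sub_mul, smul_mul_assoc, one_mul, mul_sub, mul_sub, mul_smul_comm,
        mul_smul_comm, hσ₁, ← mul_assoc (σ₁ k n), hστ, mul_assoc, hσ₃, mul_smul_comm, c₂u]
      simp only [smul_sub, smul_smul]
      have a1 : μ * ε' = ε := by rw [hε]; linear_combination ε * hμ
      have a2 : μ * (η * ε') = η * ε := by linear_combination η * a1
      have a3 : μ * (ε' * η) = η * ε := by linear_combination η * a1
      rw [hμ, a1, a2, a3, one_smul]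
      abel
    have h1 := congrArg δ₂ (hφ _ _ s r hs hs' hr hr' e)
    rw [← hg₀, main, ← mul_smul, ← e, mul_smul, hN.removal₂, hN.removal₂, ← mul_smul, us] at h1
    rw [← h1]
    have := hφ 1 (unit k (p₂ n)) s s hs hs' hs hs' (by rw [us, one_mul])
    rwa [one_smul] at this
  have main_c : φ (cap₂ k n) hc hcap = cap₂ k n • g := by
    have e : c₀ k n * cap₂ k n = (lam • cap₄ k n) * r := by
      rw [hr0, smul_mul_assoc, mul_sub, mul_smul_comm, hcap₄', hcap₄, smul_zero, sub_zero, smul_smul,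
        hlam, one_smul]
    have h1 := congrArg δ₀ (hφ _ _ _ r hc hcap hr hr' e)
    rw [← hg₀, main, ← mul_smul, ← e, mul_smul, hN.removal₀, hN.removal₀, ← mul_smul, ucap] at h1
    rw [← h1]
    have := hφ 1 (unit k (p₀ n)) _ _ hc hcap hc hcap (by rw [ucap, one_mul])
    rwa [one_smul] at this
  refine ⟨colMap (p₂ n) g, ?_⟩
  -- the two maps agree on the generators of the kernel
  let E := (LinearMap.eqLocus ((colMap (p₂ n) g).comp (LinearMap.ker (mulCup k n)).subtype) f).map
    ((col k n (p₂ n)).subtype.comp (LinearMap.ker (mulCup k n)).subtype)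
  have hE : cupRelations η ε ≤ E := by
    refine Submodule.span_le.2 ?_
    rintro x (rfl | rfl | rfl)
    · exact ⟨⟨⟨_, hs⟩, Subtype.ext hs'⟩, main_s.symm, rfl⟩
    · exact ⟨⟨⟨_, hc⟩, Subtype.ext hcap⟩, main_c.symm, rfl⟩
    · exact ⟨⟨⟨_, hr⟩, Subtype.ext hr'⟩, main.symm, rfl⟩
  refine LinearMap.ext fun x => ?_
  obtain ⟨y, hy, e⟩ := hE (mem_cupRelations hτ hη hσ hcap x.1.2 (congrArg Subtype.val x.2))
  have : y = x := Subtype.ext (Subtype.ext e)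
  exact this ▸ hy

end closed

noncomputable instance : AddCommGroup (LinearMap.range (mulCup k n)) := Submodule.addCommGroup _

noncomputable instance : AddCommGroup (LinearMap.ker (mulCup k n)) := Submodule.addCommGroup _

/-- The modules killed by the idempotent have a projective presentation with generators at the
object `0` and first syzygies generated at the object `2`; the extension groups are computed from
it. -/
theorem HasCupRemoval.isClosedTo {N : ModuleCat.{u} (CoverAlgebra k n)} {δ₀ δ₂ δ₄ : N →+ N}
    (hN : HasCupRemoval (k := k) (n := n) N δ₀ δ₂ δ₄) : IsClosedTo (coverFunctor k n) 2 N := by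
  intro S hS i hi
  have h : ∀ x : S, idem k n • x = 0 := idem_smul_eq_zero hS
  obtain ⟨ι, p, hp, hex⟩ := exists_presentation h
  set K := LinearMap.range (mulCup k n)
  have P₀ : Module.Projective (CoverAlgebra k n) (ι →₀ col k n (p₀ n)) := projective_finsupp
  have P₂ : Module.Projective (CoverAlgebra k n) (ι →₀ col k n (p₂ n)) := projective_finsupp
  let i₁ := Finsupp.mapRange.linearMap (α := ι) K.subtype
  let f₁ : ModuleCat.of (CoverAlgebra k n) (ι →₀ K) ⟶
    ModuleCat.of (CoverAlgebra k n) (ι →₀ col k n (p₀ n)) := ModuleCat.ofHom i₁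
  let q₁ : ModuleCat.of (CoverAlgebra k n) (ι →₀ col k n (p₀ n)) ⟶ S := ModuleCat.ofHom p
  have z₁ : f₁ ≫ q₁ = 0 := ModuleCat.hom_ext hex.linearMap_comp_eq_zero
  let T₁ : ShortComplex (ModuleCat.{u} (CoverAlgebra k n)) := ShortComplex.mk _ _ z₁
  have hT₁ : T₁.ShortExact := ModuleCat.shortComplex_shortExact T₁ hex
    (Finsupp.mapRange_injective _ (map_zero _) K.injective_subtype) hp
  have hex₂ : Function.Exact (LinearMap.ker (mulCup k n)).subtype (mulCup k n).rangeRestrict :=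
    fun x => by
      rw [← LinearMap.mem_ker, LinearMap.ker_rangeRestrict]
      simp
  let i₂ := Finsupp.mapRange.linearMap (α := ι) (LinearMap.ker (mulCup k n)).subtype
  let p₂' := Finsupp.mapRange.linearMap (α := ι) (mulCup k n).rangeRestrict
  let f₂ : ModuleCat.of (CoverAlgebra k n) (ι →₀ LinearMap.ker (mulCup k n)) ⟶
    ModuleCat.of (CoverAlgebra k n) (ι →₀ col k n (p₂ n)) := ModuleCat.ofHom i₂
  let q₂ : ModuleCat.of (CoverAlgebra k n) (ι →₀ col k n (p₂ n)) ⟶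
    ModuleCat.of (CoverAlgebra k n) (ι →₀ K) := ModuleCat.ofHom p₂'
  have z₂ : f₂ ≫ q₂ = 0 := ModuleCat.hom_ext (exact_mapRange hex₂).linearMap_comp_eq_zero
  let T₂ : ShortComplex (ModuleCat.{u} (CoverAlgebra k n)) := ShortComplex.mk _ _ z₂
  have hT₂ : T₂.ShortExact := ModuleCat.shortComplex_shortExact T₂ (exact_mapRange hex₂)
    (Finsupp.mapRange_injective _ (map_zero _) (Submodule.injective_subtype _))
    (Finsupp.mapRange_surjective _ (map_zero _) (LinearMap.surjective_rangeRestrict _))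
  have : Projective T₁.X₂ := (IsProjective.iff_projective _).1 P₀
  have : Projective T₂.X₂ := (IsProjective.iff_projective _).1 P₂
  interval_cases i
  · refine subsingleton_of_forall_eq 0 fun x => ?_
    obtain ⟨f, rfl⟩ := Abelian.Ext.homEquiv₀.symm.surjective x
    have : f = 0 := by
      ext x
      have h1 : unit k (p₀ n) • f x = f x := by
        rw [← map_smul]
        exact congrArg f (unit_smul_p₀ h x)
      have h2 : c₀ k n • f x = 0 := by
        rw [← map_smul]
        exact (congrArg f (cup_smul_eq_zero h x)).trans (map_zero _)
      have h3 := hN.removal₀ (f x)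
      rw [h2, map_zero, h1] at h3
      exact h3.symm
    rw [this]
    exact Abelian.Ext.mk₀_zero _ _
  · refine subsingleton_ext_one hT₁ fun f => ?_
    obtain ⟨g, hg⟩ := exists_extension_finsupp hN.exists_extension_range f.hom
    exact ⟨ModuleCat.ofHom g, ModuleCat.hom_ext hg⟩
  · refine subsingleton_ext_succ hT₁ (subsingleton_ext_one hT₂ fun f => ?_)
    obtain ⟨g, hg⟩ := exists_extension_finsupp hN.exists_extension_ker f.hom
    exact ⟨ModuleCat.ofHom g, ModuleCat.hom_ext hg⟩

end

section

variable {k : Type u} [Field k] {n : ℕ}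

/-! ### Closed modules over the cover algebra -/

/-- For odd `n` the object `0` does not occur, so the idempotent generates the whole algebra. -/
theorem isZero_of_odd (hn : Odd n) {S : ModuleCat.{u} (CoverAlgebra k n)}
    (h : Limits.IsZero ((coverFunctor k n).obj S)) : Limits.IsZero S := by
  have : Subsingleton S := by
    refine subsingleton_of_forall_eq 0 fun x => ?_
    rw [← sum_unit_smul (k := k) (n := n) x]
    refine Finset.sum_eq_zero fun i _ => unit_smul_eq_zero (idem_smul_eq_zero h) ?_ x
    obtain ⟨h1, m, hm⟩ := mem_J.1 i.2
    obtain ⟨q, hq⟩ := hn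
    omega
  exact ModuleCat.isZero_of_subsingleton S

theorem isClosedTo_of_odd (hn : Odd n) (m : ℕ) (N : ModuleCat.{u} (CoverAlgebra k n)) :
    IsClosedTo (coverFunctor k n) m N := fun S hS i _ => by
  have hid : 𝟙 S = 0 := (isZero_of_odd hn hS).eq_of_src _ _
  refine subsingleton_of_forall_eq 0 fun x => ?_
  rw [← Abelian.Ext.mk₀_id_comp x, hid, Abelian.Ext.mk₀_zero, Abelian.Ext.zero_comp]

theorem IsFilteredBy.isClosedTo {Q : ModuleCat.{u} (CoverAlgebra k n) → Prop} {m : ℕ}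
    (hQ : ∀ N, Q N → IsClosedTo (coverFunctor k n) m N) {N : ModuleCat.{u} (CoverAlgebra k n)}
    (h : IsFilteredBy Q N) : IsClosedTo (coverFunctor k n) m N := by
  induction h with
  | zero h =>
    intro S _ i _
    refine subsingleton_of_forall_eq 0 fun x => ?_
    rw [← Abelian.Ext.comp_mk₀_id x, h.eq_of_src (𝟙 _) 0, Abelian.Ext.mk₀_zero,
      Abelian.Ext.comp_zero]
  | extend f g w hfg _ h'' ih => exact ih.of_shortExact hfg (hQ _ h'')

theorem isClosedTo_deltaBarSum (hn : Odd n ∨ Even n ∧ 6 ≤ n) :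
    IsClosedTo (coverFunctor k n) 2 (deltaBarSum k n) := by
  rcases hn with hn | hn
  · exact isClosedTo_of_odd hn _ _
  · have : Fact (Even n ∧ 6 ≤ n) := ⟨hn⟩
    exact (HasCupRemoval.directSum fun a : LabelC k n =>
      Delta.hasCupRemoval (i := ⟨a.1.1, a.2⟩) (V := a.1.Simple)).isClosedTo

theorem isClosedTo_deltaBar (hn : Odd n ∨ Even n ∧ 6 ≤ n) (a : LabelC k n) :
    IsClosedTo (coverFunctor k n) 2 (deltaBar k n a) := by
  rcases hn with hn | hn
  · exact isClosedTo_of_odd hn _ _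
  · have : Fact (Even n ∧ 6 ≤ n) := ⟨hn⟩
    exact (Delta.hasCupRemoval (i := ⟨a.1.1, a.2⟩) (V := a.1.Simple)).isClosedTo

theorem IsSummandFiltered.isClosedTo (hn : Odd n ∨ Even n ∧ 6 ≤ n)
    {N : ModuleCat.{u} (CoverAlgebra k n)} (h : IsSummandFiltered (deltaBarSum k n) N) :
    IsClosedTo (coverFunctor k n) 2 N :=
  IsFilteredBy.isClosedTo (fun _ ⟨r⟩ => (isClosedTo_deltaBarSum hn).of_retract r) h

theorem IsDeltaFiltered.isClosedTo (hn : Odd n ∨ Even n ∧ 6 ≤ n)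
    {N : ModuleCat.{u} (CoverAlgebra k n)} (h : IsDeltaFiltered (deltaBar k n) N) :
    IsClosedTo (coverFunctor k n) 2 N :=
  IsFilteredBy.isClosedTo (fun _ ⟨a, ⟨e⟩⟩ => (isClosedTo_deltaBar hn a).of_retract e.retract) h

theorem bijective_mapExtAddHom_coverFunctor {N : ModuleCat.{u} (CoverAlgebra k n)}
    (hN : IsClosedTo (coverFunctor k n) 2 N) (M : ModuleCat.{u} (CoverAlgebra k n)) {i : ℕ} (hi : i ≤ 1) :
    Function.Bijective ((coverFunctor k n).mapExtAddHom M N i) :=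
  bijective_mapExtAddHom (coverAdjunction k n) hN M hi

variable (k) in
theorem isEquivalence_coverFunctor (hn : Odd n) : (coverFunctor k n).IsEquivalence := by
  have : ∀ N, IsIso ((coverAdjunction k n).unit.app N) := fun N =>
    isIso_unit (coverAdjunction k n) (isClosedTo_of_odd hn 1 N)
  have : IsIso (coverAdjunction k n).unit := NatIso.isIso_of_isIso_app _
  exact (coverAdjunction k n).toEquivalence.isEquivalence_functor

variable (k) in
theorem exists_moritaEquivalence (hn : Odd n) :
    ∃ e : MoritaEquivalence k (CoverAlgebra k n) (BrauerAlgebra k n),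
      Nonempty (e.eqv.functor ≅ coverFunctor k n) := by
  have := isEquivalence_coverFunctor k hn
  exact ⟨{ eqv := (coverFunctor k n).asEquivalence
           linear := inferInstanceAs ((coverFunctor k n).Linear k) }, ⟨Iso.refl _⟩⟩

end

section

variable {k : Type u} [Field k] {n : ℕ}

/-! ### Modules with free cup actions -/

section below

variable (k n)

/-- The submodule generated by the vertex spaces of the objects below `l`. -/
noncomputable def below (l : ℕ) (M : Type*) [AddCommGroup M] [Module (CoverAlgebra k n) M] :
    Submodule (CoverAlgebra k n) M :=
  Submodule.span _ {x | ∃ m : J n, m.1 < l ∧ x ∈ vtx k m M}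

open Diagram in
/-- Modulo the submodules generated by lower vertex spaces, the cup configurations act freely:
sums of vectors moved by different cup configurations vanish only if all vectors vanish. -/
def IsGood (M : Type*) [AddCommGroup M] [Module (CoverAlgebra k n) M] : Prop :=
  ∀ (l j : J n) (w : CupConfig l j → M), (∀ t, w t ∈ vtx k l M) →
    ∑ t, (bas t.rep : CoverAlgebra k n) • w t ∈ below k n l M → ∀ t, w t ∈ below k n l M

variable {k n} {M N : Type*} [AddCommGroup M] [Module (CoverAlgebra k n) M] [AddCommGroup N]
  [Module (CoverAlgebra k n) N]

theorem mem_below {l : ℕ} {m : J n} (h : m.1 < l) {x : M} (hx : x ∈ vtx k m M) : x ∈ below k n l M :=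
  Submodule.subset_span ⟨m, h, hx⟩

theorem below_le {l : ℕ} {X : Submodule (CoverAlgebra k n) M}
    (h : ∀ m : J n, m.1 < l → ∀ x ∈ vtx k m M, x ∈ X) : below k n l M ≤ X :=
  Submodule.span_le.2 fun x ⟨m, hm, hx⟩ => h m hm x hx

theorem map_mem_below {l : ℕ} (f : M →ₗ[CoverAlgebra k n] N) {x : M} (hx : x ∈ below k n l M) :
    f x ∈ below k n l N :=
  below_le (X := (below k n l N).comap f) (fun _ hm _ hx => mem_below hm (map_mem_vtx f hx)) hx

theorem exists_mem_below {l : ℕ} {f : M →ₗ[CoverAlgebra k n] N} (hf : Function.Surjective f) {y : N}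
    (hy : y ∈ below k n l N) : ∃ x ∈ below k n l M, f x = y :=
  below_le (X := (below k n l M).map f) (fun m hm y hy => by
    obtain ⟨x, hx, e⟩ := exists_mem_vtx hf hy
    exact ⟨x, mem_below hm hx, e⟩) hy

theorem below_mono {l l' : ℕ} (h : l ≤ l') : below k n l M ≤ below k n l' M :=
  below_le fun _ hm _ hx => mem_below (hm.trans_le h) hx

theorem below_eq_top {l : ℕ} (h : n < l) : below k n l M = ⊤ := by
  refine eq_top_iff.2 fun x _ => ?_
  rw [← sum_unit_smul (k := k) (n := n) x]
  exact Submodule.sum_mem _ fun i _ => mem_below ((mem_J.1 i.2).1.trans_lt h) (unit_smul_mem i x)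

theorem IsGood.of_retract (h : IsGood k n M) (i : N →ₗ[CoverAlgebra k n] M)
    (r : M →ₗ[CoverAlgebra k n] N) (hr : ∀ x, r (i x) = x) : IsGood k n N := by
  intro l j w hw hs t
  rw [← hr (w t)]
  refine map_mem_below r (h l j (fun t => i (w t)) (fun t => map_mem_vtx i (hw t)) ?_ t)
  have := map_mem_below i hs
  rw [map_sum] at this
  simpa only [map_smul] using this

theorem IsGood.fun {ι : Type*} [Fintype ι] (h : IsGood k n M) : IsGood k n (ι → M) := by
  classical
  intro l j w hw hs t
  have : w t = ∑ s, LinearMap.single (CoverAlgebra k n) (fun _ : ι => M) s (w t s) := by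
    ext s
    simp [Finset.sum_apply, Pi.single_apply]
  rw [this]
  refine Submodule.sum_mem _ fun s _ => map_mem_below _ (h l j (fun t => w t s)
    (fun t => map_mem_vtx (LinearMap.proj s) (hw t)) ?_ t)
  have := map_mem_below (LinearMap.proj s) hs
  rw [map_sum] at this
  exact this

theorem mem_vtx_coe {X : Submodule (CoverAlgebra k n) M} {m : J n} {x : X} :
    x ∈ vtx k m X ↔ (x : M) ∈ vtx k m M := by
  rw [mem_vtx, mem_vtx, Subtype.ext_iff]; rfl

theorem mem_below_below {l i : ℕ} (h : l ≤ i) {x : below k n i M}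
    (hx : (x : M) ∈ below k n l M) : x ∈ below k n l (below k n i M) := by
  have key : below k n l M ≤ (below k n l (below k n i M)).map (below k n i M).subtype :=
    below_le fun m hm y hy => ⟨⟨y, mem_below (hm.trans_le h) hy⟩,
      mem_below hm (mem_vtx_coe.2 hy), rfl⟩
  obtain ⟨y, hy, e⟩ := key hx
  have : y = x := Subtype.ext e
  exact this ▸ hy

theorem below_below (i : ℕ) : below k n i (below k n i M) = ⊤ :=
  eq_top_iff.2 fun x _ => mem_below_below le_rfl x.2

theorem IsGood.below (h : IsGood k n M) (i : ℕ) : IsGood k n (below k n i M) := by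
  intro l j w hw hs t
  rcases le_total l.1 i with hl | hl
  · refine mem_below_below hl (h l j (fun t => w t) (fun t => mem_vtx_coe.1 (hw t)) ?_ t)
    have := map_mem_below (Submodule.subtype _) hs
    rw [map_sum] at this
    exact this
  · exact below_mono hl (by rw [below_below]; trivial)

theorem exists_vtx_of_below {i : ℕ} (h : below k n i M = ⊤) [Nontrivial M] :
    ∃ m : J n, m.1 < i ∧ ∃ x ∈ vtx k m M, x ≠ 0 := by
  by_contra! H
  have : below k n i M ≤ ⊥ := below_le fun m hm x hx => (Submodule.mem_bot _).2 (H m hm x hx)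
  rw [h] at this
  exact bot_ne_top (le_antisymm bot_le this)

end below

section regular

open Diagram

theorem Diagram.exists_factor_below {i l : ℕ} {d : Diagram i l} (hd : ¬ d.Cupless) :
    ∃ r, r + 2 = l ∧ ∃ (u : Diagram r l) (d' : Diagram i r), u.Capless ∧ Diagram.comp u d' = d := by
  obtain ⟨a, b, hab⟩ := exists_cup hd
  have hne : a.1 ≠ b.1 := fun e => d.partner_ne (Sum.inr a) (by rw [hab, Fin.ext e])
  obtain ⟨r, rfl⟩ : ∃ m, l = m + 2 := ⟨l - 2, by have := a.2; have := b.2; omega⟩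
  exact ⟨r, rfl, exists_factor_of_cup hd⟩

theorem bas_mem_below {i l : J n} {d : Diagram i l} (hd : ¬ d.Cupless) :
    (bas d : CoverAlgebra k n) ∈ below k n l (CoverAlgebra k n) := by
  obtain ⟨r, hr, u, d', hu, e⟩ := Diagram.exists_factor_below hd
  have hJ : r ∈ J n := mem_J_of_add_two (hr ▸ l.2)
  obtain ⟨s, -, hs⟩ := exists_bas_eq (k := k) (i := i) (j := ⟨r, hJ⟩) (l := l) (hu.not_hasLoop d') e
  rw [hs, ← smul_mul_assoc]
  exact Submodule.smul_mem _ (s • bas (i := ⟨r, hJ⟩) (j := l) u)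
    (mem_below (m := ⟨r, hJ⟩) (by show r < l.1; omega) (unit_mul_bas _))

/-- The operator that keeps the diagrams without cups. -/
noncomputable abbrev cuplessPart (l : J n) : CoverAlgebra k n →ₗ[k] CoverAlgebra k n :=
  peel (Diagram.one l) fun _ => Cupless

theorem capless_one (l : ℕ) : (Diagram.one l).Capless := fun _ => rfl

theorem sub_cuplessPart_mem (l : J n) (x : CoverAlgebra k n) :
    unit k l * x - cuplessPart l x ∈ below k n l (CoverAlgebra k n) := by
  induction x using CoverAlgebra.induction with
  | h0 => simp
  | hadd x y hx hy =>
    rw [mul_add, map_add, add_sub_add_comm]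
    exact Submodule.add_mem _ hx hy
  | hbas i j d a =>
    rw [mul_smul_comm, map_smul, ← smul_sub]
    refine Submodule.smul_of_tower_mem _ _ ?_
    by_cases hj : j = l
    · subst hj
      by_cases hd : d.Cupless
      · have := peel_bas_mul (k := k) (n := n) (Q := fun _ => Cupless) (capless_one j) hd
        rw [← unit, unit_mul_bas] at this
        rw [unit_mul_bas, cuplessPart, this, sub_self]
        exact Submodule.zero_mem _
      · rw [unit_mul_bas, cuplessPart, peel_bas_eq_zero, sub_zero]
        · exact bas_mem_below hd
        · intro v hv e
          rw [(Diagram.one_comp v).1] at e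
          exact hd (e ▸ hv)
    · rw [unit_mul_bas_ne (Ne.symm hj), cuplessPart, peel_bas_of_ne hj, sub_self]
      exact Submodule.zero_mem _

theorem peel_rep_mul {l j : J n} (t t' : CupConfig l j) (x : CoverAlgebra k n) :
    peel t.rep (fun _ => Cupless) (bas t'.rep * x) = if t = t' then cuplessPart l x else 0 := by
  induction x using CoverAlgebra.induction with
  | h0 => simp
  | hadd x y hx hy => rw [mul_add, map_add, hx, hy, map_add]; split_ifs <;> simp
  | hbas i m d a =>
    rw [mul_smul_comm, map_smul, map_smul]
    by_cases hm : m = l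
    · subst hm
      by_cases hd : d.Cupless
      · have h := peel_bas_mul (k := k) (n := n) (Q := fun _ => Cupless) (capless_one m) hd
        rw [← unit, unit_mul_bas] at h
        rw [cuplessPart, h]
        split_ifs with ht
        · subst ht
          rw [peel_bas_mul (Q := fun _ => Cupless) t.capless_rep hd]
        · rw [bas_mul, map_smul, peel_bas_eq_zero, smul_zero, smul_zero]
          intro v hv e
          exact ht (CupConfig.eq_of_comp_eq hv e)
      · have h : cuplessPart m (bas d : CoverAlgebra k n) = 0 := peel_bas_eq_zero fun v hv e => by
          rw [(Diagram.one_comp v).1] at e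
          exact hd (e ▸ hv)
        rw [h, smul_zero, ite_self, bas_mul, map_smul, peel_bas_eq_zero, smul_zero, smul_zero]
        intro v hv e
        obtain ⟨r, hr, u, d', hu, rfl⟩ := Diagram.exists_factor_below hd
        have hc := t'.capless_rep.comp hu
        rw [← comp_comp_of_not_hasLoop (t'.capless_rep.not_hasLoop u) (hc.not_hasLoop d')] at e
        exact not_factorsBelow t.capless_rep hv ⟨r, by omega, _, _, e⟩
    · rw [bas_mul_ne hm, map_zero, smul_zero, cuplessPart, peel_bas_of_ne hm, smul_zero, ite_self]

/-- Diagrams that factor through few dots do not have the form `u ∘ v` with `v` without cups. -/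
theorem peel_eq_zero_of_mem_below {l j : J n} {u : Diagram l j} (hu : u.Capless)
    {x : CoverAlgebra k n} (hx : x ∈ below k n l (CoverAlgebra k n)) :
    peel u (fun _ => Cupless) x = 0 := by
  refine Submodule.closure_induction (p := fun x _ => peel u (fun _ => Cupless) x = 0) (map_zero _)
    (fun x y _ _ hx hy => by rw [map_add, hx, hy, add_zero]) ?_ hx
  rintro c x ⟨m, hm, hx⟩
  rw [← mem_vtx.1 hx, smul_eq_mul, smul_eq_mul]
  clear hx
  induction c using CoverAlgebra.induction with
  | h0 => simp
  | hadd c d hc hd => rw [add_mul, map_add, hc, hd, add_zero]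
  | hbas i j' d a =>
    rw [smul_mul_assoc, map_smul]
    by_cases hi : m = i
    swap
    · rw [← mul_assoc, bas_mul_unit_ne hi, zero_mul, map_zero, smul_zero]
    subst hi
    rw [← mul_assoc, bas_mul_unit]
    induction x using CoverAlgebra.induction with
    | h0 => simp
    | hadd x y hx hy => rw [mul_add, map_add, smul_add, hx, hy, add_zero]
    | hbas i j'' d' b =>
      rw [mul_smul_comm, map_smul]
      by_cases hj : j'' = m
      swap
      · rw [bas_mul_ne hj, map_zero, smul_zero, smul_zero]
      subst hj
      rw [bas_mul, map_smul]
      by_cases hj : j' = j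
      swap
      · rw [peel_bas_of_ne hj, smul_zero, smul_zero, smul_zero]
      subst hj
      rw [peel_bas_eq_zero, smul_zero, smul_zero, smul_zero]
      intro v hv e
      exact not_factorsBelow hu hv ⟨_, hm, d, d', e⟩

/-- The vectors can be recovered, up to diagrams with cups, by peeling off the cup configurations.
-/
theorem isGood_coverAlgebra : IsGood k n (CoverAlgebra k n) := by
  intro l j w hw hs t
  have h := peel_eq_zero_of_mem_below t.capless_rep hs
  rw [map_sum, Finset.sum_eq_single t] at h
  · rw [smul_eq_mul, peel_rep_mul, if_pos rfl] at h
    have := sub_cuplessPart_mem l (w t)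
    rw [h, sub_zero] at this
    exact (mem_vtx.1 (hw t)) ▸ this
  · intro t' _ ht
    rw [smul_eq_mul, peel_rep_mul, if_neg ht.symm]
  · simp

theorem IsGood.of_projective (M : Type u) [AddCommGroup M] [Module (CoverAlgebra k n) M]
    [Module.Projective (CoverAlgebra k n) M] [Module.Finite (CoverAlgebra k n) M] : IsGood k n M := by
  obtain ⟨m, f, g, -, -, h⟩ := Module.Finite.exists_comp_eq_id_of_projective (CoverAlgebra k n) M
  exact isGood_coverAlgebra.fun.of_retract g f fun x => LinearMap.congr_fun h x

end regular

instance : Module.Finite k (CoverAlgebra k n) := by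
  let f : (∀ i j : J n, HomSpace k i j) →ₗ[k] CoverAlgebra k n :=
    LinearMap.lsum k (fun i : J n => ∀ j : J n, HomSpace k i j) k fun i =>
      LinearMap.lsum k (fun j : J n => HomSpace k i j) k fun j => blk i j
  refine Module.Finite.of_surjective f fun c => ⟨fun i j => c.entry i j, ?_⟩
  simp only [f, LinearMap.lsum_apply, LinearMap.sum_apply, LinearMap.comp_apply, LinearMap.proj_apply]
  exact sum_blk c

instance : IsNoetherianRing (CoverAlgebra k n) := isNoetherian_of_tower k inferInstance

instance : IsArtinianRing (CoverAlgebra k n) := isArtinian_of_tower k inferInstance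

end

section

variable {k : Type u} [Field k] {n : ℕ}

/-! ### Filtrations by standard modules -/

section general

variable {R : Type u} [Ring R] {Q : ModuleCat.{u} R → Prop}

theorem IsFilteredBy.of_iso {M N : ModuleCat.{u} R} (h : IsFilteredBy Q M) (e : M ≅ N) :
    IsFilteredBy Q N := by
  cases h with
  | zero h => exact .zero (h.of_iso e.symm)
  | extend f g w hfg h' h'' =>
    have z : (f ≫ e.hom) ≫ e.inv ≫ g = 0 := by simp [w]
    refine .extend (f ≫ e.hom) (e.inv ≫ g) z (ShortComplex.shortExact_of_iso ?_ hfg) h' h''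
    exact ShortComplex.isoMk (Iso.refl _) e (Iso.refl _) (by simp) (by simp)

theorem IsFilteredBy.imp {Q' : ModuleCat.{u} R → Prop} (h : ∀ M, Q M → Q' M) {M : ModuleCat.{u} R}
    (hM : IsFilteredBy Q M) : IsFilteredBy Q' M := by
  induction hM with
  | zero h => exact .zero h
  | extend f g w hfg _ h'' ih => exact .extend f g w hfg ih (h _ h'')

theorem IsFilteredBy.of_le {M Y : Type u} [AddCommGroup M] [Module R M] [AddCommGroup Y]
    [Module R Y] {X X' : Submodule R M} (hX : IsFilteredBy Q (ModuleCat.of R X)) (h : X ≤ X')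
    (g : X' →ₗ[R] Y) (hg : Function.Surjective g) (hg' : ∀ x, g x = 0 ↔ (x : M) ∈ X)
    (hY : Q (ModuleCat.of R Y)) : IsFilteredBy Q (ModuleCat.of R X') := by
  have hex : Function.Exact (Submodule.inclusion h) g := fun x => by
    rw [hg']
    constructor
    · intro hx
      exact ⟨⟨x, hx⟩, rfl⟩
    · rintro ⟨y, rfl⟩
      exact y.2
  have z : ModuleCat.ofHom (Submodule.inclusion h) ≫ ModuleCat.ofHom g = 0 :=
    ModuleCat.hom_ext hex.linearMap_comp_eq_zero
  exact .extend _ _ z (ModuleCat.shortComplex_shortExact (ShortComplex.mk _ _ z) hex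
    (Submodule.inclusion_injective h) hg) hX hY

end general

variable {N : Type u} [AddCommGroup N] [Module (CoverAlgebra k n) N]

/-- A nonzero module has a lowest nonvanishing vertex space. -/
theorem exists_minimal_vtx (k : Type u) [Field k] {n : ℕ} (N : Type*) [AddCommGroup N]
    [Module (CoverAlgebra k n) N] [Nontrivial N] : ∃ l : J n, (∃ x ∈ vtx k l N, x ≠ 0) ∧
    ∀ m : J n, m.1 < l.1 → ∀ x ∈ vtx k m N, x = 0 := by
  have hne : ∃ m : J n, ∃ x ∈ vtx k m N, x ≠ 0 := by
    obtain ⟨m, -, h⟩ := exists_vtx_of_below (below_eq_top (k := k) (M := N) (Nat.lt_succ_self n))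
    exact ⟨m, h⟩
  obtain ⟨l, hl, hmin⟩ := (measure fun m : J n => m.1).wf.has_min
    {m | ∃ x ∈ vtx k m N, x ≠ 0} hne
  refine ⟨l, hl, fun m hm x hx => ?_⟩
  by_contra h
  exact hmin m ⟨x, hx, h⟩ hm

/-- Diagrams with caps kill a lowest vertex space, since they factor through fewer dots. -/
theorem bas_smul_eq_zero_of_not_capless {l j : J n}
    (hN : ∀ m : J n, m.1 < l.1 → ∀ x ∈ vtx k m N, x = 0) {d : Diagram l j} (hd : ¬ d.Capless)
    (x : N) : (bas d : CoverAlgebra k n) • x = 0 := by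
  obtain ⟨r, hr, u, v, hu, e⟩ := Diagram.exists_factor_below (d := d.swap)
    (by rwa [Diagram.cupless_swap])
  have hJ : r ∈ J n := mem_J_of_add_two (hr ▸ l.2)
  have e' : Diagram.comp v.swap u.swap = d := by rw [← Diagram.swap_comp, e, Diagram.swap_swap]
  obtain ⟨s, -, hs⟩ := exists_bas_eq (k := k) (i := l) (j := ⟨r, hJ⟩) (l := j)
    (((Diagram.cupless_swap u).2 hu).not_hasLoop v.swap) e'
  rw [hs, ← smul_mul_assoc, mul_smul, hN ⟨r, hJ⟩ (by show r < l.1; omega) _ (bas_smul_mem _ x),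
    smul_zero]

/-- The homomorphism from a standard module given by a homomorphism to a lowest vertex space. -/
noncomputable def Delta.ofVtx {l : J n} {V : Type u} [AddCommGroup V] [Module k V]
    [Module (GroupAlg k l) V] [IsScalarTower k (GroupAlg k l) V]
    (hN : ∀ m : J n, m.1 < l.1 → ∀ x ∈ vtx k m N, x = 0) (f : V →ₗ[GroupAlg k l] vtx k l N) :
    Delta k l V →ₗ[CoverAlgebra k n] N :=
  Delta.desc f fun _ _ _ hd => bas_smul_eq_zero_of_not_capless hN hd _

section ofVtx

variable {l : J n} {V : Type u} [AddCommGroup V] [Module k V]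
    [Module (GroupAlg k l) V] [IsScalarTower k (GroupAlg k l) V]
    (hN : ∀ m : J n, m.1 < l.1 → ∀ x ∈ vtx k m N, x = 0) {f : V →ₗ[GroupAlg k l] vtx k l N}

theorem Delta.ofVtx_unit (v : V) : ofVtx hN f (mk (unit k l) v) = f v := (f v).2

theorem Delta.ofVtx_mem_below {l' : ℕ} (h : l.1 < l') (x : Delta k l V) :
    ofVtx hN f x ∈ below k n l' N := by
  induction x using Delta.induction with
  | h0 => rw [map_zero]; exact Submodule.zero_mem _
  | hadd x y hx hy => rw [map_add]; exact Submodule.add_mem _ hx hy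
  | h m d v _ => exact Submodule.smul_mem _ _ (mem_below h (f v).2)

include hN in
theorem eq_zero_of_mem_below {x : N} (hx : x ∈ below k n l N) : x = 0 :=
  (Submodule.mem_bot (CoverAlgebra k n)).1
    (below_le (X := ⊥) (fun m hm x hx => (Submodule.mem_bot _).2 (hN m hm x hx)) hx)

/-- In a good module the cup configurations act freely on a lowest vertex space, as they do in the
standard module. -/
theorem Delta.ofVtx_injective (hg : IsGood k n N) (hf : Function.Injective f) :
    Function.Injective (ofVtx hN f) := by
  refine (injective_iff_map_eq_zero _).2 fun x hx => ?_
  rw [← sum_unit_smul (k := k) (n := n) x]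
  refine Finset.sum_eq_zero fun j _ => ?_
  obtain ⟨w, hw⟩ := Delta.exists_eq_sum (unit_smul_mem (k := k) j x)
  have h0 : ∑ t, (bas (Diagram.CupConfig.rep t) : CoverAlgebra k n) • (f (w t) : N) = 0 := by
    have := congrArg (ofVtx hN f) hw
    rw [map_smul, hx, smul_zero, map_sum] at this
    exact this.symm
  rw [hw]
  refine Finset.sum_eq_zero fun t _ => ?_
  have h1 := eq_zero_of_mem_below hN (hg l j (fun t => f (w t)) (fun t => (f (w t)).2)
    (by rw [h0]; exact Submodule.zero_mem _) t)
  rw [hf (a₁ := w t) (a₂ := 0) (Subtype.ext (by rw [h1, map_zero]; rfl)), mk_zero]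

/-- The quotient of a good module by a standard submodule generated in a lowest vertex space is
good. -/
theorem IsGood.of_surjective (hg : IsGood k n N) {N' : Type u} [AddCommGroup N']
    [Module (CoverAlgebra k n) N'] {p : N →ₗ[CoverAlgebra k n] N'} (hp : Function.Surjective p)
    (hker : ∀ x, p x = 0 ↔ x ∈ LinearMap.range (Delta.ofVtx hN f)) : IsGood k n N' := by
  intro l' j w' hw' hs t
  choose w hw hpw using fun t => exists_mem_vtx hp (hw' t)
  obtain ⟨y, hy, e⟩ := exists_mem_below hp hs
  have hR : ∑ t, (bas (Diagram.CupConfig.rep t) : CoverAlgebra k n) • w t - y ∈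
      LinearMap.range (Delta.ofVtx hN f) := by
    rw [← hker, map_sub, map_sum, e]
    simp only [map_smul, hpw, sub_self]
  rw [← hpw]
  rcases lt_trichotomy l.1 l'.1 with h | h | h
  · refine map_mem_below p (hg l' j w hw ?_ t)
    rw [← sub_add_cancel (∑ t, (bas (Diagram.CupConfig.rep t) : CoverAlgebra k n) • w t) y]
    obtain ⟨x, hx⟩ := hR
    exact Submodule.add_mem _ (hx ▸ Delta.ofVtx_mem_below hN h x) hy
  · obtain rfl : l = l' := Subtype.ext h
    rw [eq_zero_of_mem_below hN hy, sub_zero] at hR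
    obtain ⟨x, hx⟩ := hR
    obtain ⟨v, hv⟩ := Delta.exists_eq_sum (unit_smul_mem (k := k) j x)
    have h0 : ∑ t, (bas (Diagram.CupConfig.rep t) : CoverAlgebra k n) • (w t - f (v t)) = 0 := by
      have h1 := congrArg (Delta.ofVtx hN f) hv
      rw [map_smul, hx, map_sum, Finset.smul_sum] at h1
      simp only [smul_sub, Finset.sum_sub_distrib]
      refine sub_eq_zero.2 (Eq.trans ?_ h1)
      refine Finset.sum_congr rfl fun t _ => ?_
      rw [smul_smul, unit_mul_bas]
    have h1 := eq_zero_of_mem_below hN (hg l j (fun t => w t - f (v t))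
      (fun t => AddSubgroup.sub_mem _ (hw t) (f (v t)).2)
      (by rw [h0]; exact Submodule.zero_mem _) t)
    have h2 : p (w t) = 0 := (hker _).2 ⟨_, (Delta.ofVtx_unit hN (v t)).trans (sub_eq_zero.1 h1).symm⟩
    rw [h2]
    exact Submodule.zero_mem _
  · rw [hN l' h _ (hw t), map_zero]
    exact Submodule.zero_mem _

end ofVtx

/-- Every simple module of a symmetric group belongs to a label. -/
theorem exists_label (m : ℕ) (W : Type u) [AddCommGroup W] [Module (GroupAlg k m) W]
    [IsSimpleModule (GroupAlg k m) W] : ∃ q : Quotient (simpleSetoid (GroupAlg k m)),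
      Nonempty ((GroupAlg k m ⧸ q.out.1) ≃ₗ[GroupAlg k m] W) := by
  obtain ⟨I, hI, ⟨e⟩⟩ := isSimpleModule_iff_quot_maximal.1 ‹IsSimpleModule (GroupAlg k m) W›
  refine ⟨Quotient.mk _ ⟨I, hI.out⟩, ?_⟩
  obtain ⟨e'⟩ := Quotient.exact (Quotient.out_eq (Quotient.mk (simpleSetoid (GroupAlg k m)) ⟨I, hI.out⟩))
  exact ⟨e'.trans e.symm⟩

/-- A good module that is generated by the vertex spaces below `i` has a filtration by standard
modules: a simple submodule of a lowest vertex space generates a standard module, and the quotient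
is good again. -/
theorem IsGood.isFilteredBy (hss : ∀ l : J n, IsSemisimpleRing (GroupAlg k l)) {M : Type u}
    [AddCommGroup M] [Module (CoverAlgebra k n) M] [IsNoetherian (CoverAlgebra k n) M]
    (hM : IsGood k n M) {i : ℕ} (hi : Periplectic.below k n i M = ⊤) :
    IsFilteredBy (fun Y => ∃ b : LabelC k n, b.1.size < i ∧ Nonempty (Y ≅ deltaBar k n b))
      (ModuleCat.of (CoverAlgebra k n) M) := by
  set Q : ModuleCat.{u} (CoverAlgebra k n) → Prop :=
    fun Y => ∃ b : LabelC k n, b.1.size < i ∧ Nonempty (Y ≅ deltaBar k n b)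
  obtain ⟨X, ⟨hX, hX'⟩, hmax⟩ := (wellFounded_gt (α := Submodule (CoverAlgebra k n) M)).has_min
    {X | IsFilteredBy Q (ModuleCat.of (CoverAlgebra k n) X) ∧ IsGood k n (M ⧸ X)} ⟨⊥,
      .zero (ModuleCat.isZero_of_subsingleton _),
      hM.of_retract (Submodule.quotEquivOfEqBot ⊥ rfl).toLinearMap
        (Submodule.quotEquivOfEqBot ⊥ rfl).symm.toLinearMap fun x =>
          LinearEquiv.symm_apply_apply _ x⟩
  by_cases hT : X = ⊤
  · subst hT
    exact hX.of_iso (LinearEquiv.toModuleIso Submodule.topEquiv)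
  exfalso
  have hnt : Nontrivial (M ⧸ X) := Submodule.Quotient.nontrivial_iff.2 hT
  obtain ⟨l, ⟨x, hx, hx0⟩, hl⟩ := exists_minimal_vtx k (n := n) (M ⧸ X)
  have hli : l.1 < i := by
    have : Periplectic.below k n i (M ⧸ X) = ⊤ := eq_top_iff.2 fun y _ => by
      obtain ⟨y, rfl⟩ := X.mkQ_surjective y
      exact map_mem_below _ (hi ▸ Submodule.mem_top)
    obtain ⟨m, hm, y, hy, hy0⟩ := exists_vtx_of_below this
    by_contra h
    exact hy0 (hl m (by omega) y hy)
  have := hss l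
  have : Nontrivial (vtx k l (M ⧸ X)) := ⟨⟨x, hx⟩, 0, fun h => hx0 (congrArg Subtype.val h)⟩
  obtain ⟨W, hW⟩ := IsSemisimpleModule.exists_simple_submodule (GroupAlg k l) (vtx k l (M ⧸ X))
  obtain ⟨q, ⟨e⟩⟩ := exists_label (k := k) l.1 W
  let f : (GroupAlg k l ⧸ q.out.1) →ₗ[GroupAlg k l] vtx k l (M ⧸ X) := W.subtype.comp e.toLinearMap
  have hf : Function.Injective f := W.injective_subtype.comp e.injective
  let D := Delta.ofVtx hl f
  have hD : Function.Injective D := Delta.ofVtx_injective hl hX' hf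
  let X' := (LinearMap.range D).comap X.mkQ
  have hXX' : X ≤ X' := fun y hy => by
    show X.mkQ y ∈ LinearMap.range D
    rw [Submodule.mkQ_apply, (Submodule.Quotient.mk_eq_zero X).2 hy]
    exact Submodule.zero_mem _
  let g : X' →ₗ[CoverAlgebra k n] Delta k l (GroupAlg k l ⧸ q.out.1) :=
    (LinearEquiv.ofInjective D hD).symm.toLinearMap.comp (X.mkQ.restrict fun y hy => hy)
  have hg : ∀ y, D (g y) = X.mkQ y := fun y =>
    congrArg Subtype.val ((LinearEquiv.ofInjective D hD).apply_symm_apply _)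
  refine hmax X' ⟨hX.of_le hXX' g ?_ ?_ ⟨⟨⟨l.1, q⟩, l.2⟩, hli, ⟨Iso.refl _⟩⟩, ?_⟩ ?_
  · intro z
    obtain ⟨y, hy⟩ := X.mkQ_surjective (D z)
    exact ⟨⟨y, by show X.mkQ y ∈ LinearMap.range D; rw [hy]; exact ⟨z, rfl⟩⟩, hD (by rw [hg]; exact hy)⟩
  · intro y
    rw [← hD.eq_iff, hg, map_zero, Submodule.mkQ_apply, Submodule.Quotient.mk_eq_zero]
  · refine hX'.of_surjective hl (f := f) (p := Submodule.factor hXX')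
      (Submodule.factor_surjective hXX') fun y => ?_
    obtain ⟨y, rfl⟩ := X.mkQ_surjective y
    show Submodule.Quotient.mk y = 0 ↔ _
    rw [Submodule.Quotient.mk_eq_zero]
    rfl
  · refine lt_of_le_of_ne hXX' fun h => ?_
    have := IsSimpleModule.nontrivial (GroupAlg k l) W
    obtain ⟨v, hv⟩ := exists_ne (0 : W)
    obtain ⟨y, hy⟩ := X.mkQ_surjective (v : M ⧸ X)
    have : y ∈ X' := by
      show X.mkQ y ∈ LinearMap.range D
      rw [hy]
      refine ⟨_, (Delta.ofVtx_unit hl (e.symm v)).trans ?_⟩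
      show (((e (e.symm v) : W) : vtx k l (M ⧸ X)) : M ⧸ X) = _
      rw [e.apply_symm_apply]
    rw [← h, ← Submodule.Quotient.mk_eq_zero X, ← Submodule.mkQ_apply, hy] at this
    exact hv (Subtype.ext (Subtype.ext this))

end

section

variable {k : Type u} [Field k] {n : ℕ}

/-! ### Minimal direct summands -/

/-- A minimal direct summand `P` of a projective module among those that are not killed by a map to a
simple module is a projective cover. Such a summand is the image of an idempotent `e`; a submodule
of `P` that is not killed contains a smaller summand, by Fitting's lemma. -/
theorem exists_minimal_summand {R : Type u} [Ring R] {P₀ S : Type u} [AddCommGroup P₀] [Module R P₀]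
    [AddCommGroup S] [Module R S] [Module.Projective R P₀] [IsNoetherian R P₀] [IsArtinian R P₀]
    [IsSimpleModule R S] {π : P₀ →ₗ[R] S} (hπ : π ≠ 0) :
    ∃ P : ModuleCat.{u} R, Module.Projective R P ∧ IsNoetherian R P ∧ ∃ π' : P →ₗ[R] S, π' ≠ 0 ∧
      ∀ Y : Submodule R P, (∃ y ∈ Y, π' y ≠ 0) → Y = ⊤ := by
  obtain ⟨P, ⟨e, he, he', x₀, hx₀, hπ₀⟩, hmin⟩ := (wellFounded_lt (α := Submodule R P₀)).has_min
    {P | ∃ e : P₀ →ₗ[R] P₀, (∀ x, e x ∈ P) ∧ (∀ x ∈ P, e x = x) ∧ ∃ x ∈ P, π x ≠ 0}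
    ⟨⊤, LinearMap.id, fun _ => trivial, fun _ _ => rfl, by
      by_contra! h
      exact hπ (LinearMap.ext fun x => h x trivial)⟩
  suffices H : ∀ Y ≤ P, (∃ y ∈ Y, π y ≠ 0) → Y = P by
    refine ⟨ModuleCat.of R P, Module.Projective.of_split P.subtype (e.codRestrict P he)
      (LinearMap.ext fun x => Subtype.ext (he' x x.2)), inferInstanceAs (IsNoetherian R P),
      π.comp P.subtype, fun h => hπ₀ (LinearMap.congr_fun h ⟨x₀, hx₀⟩), ?_⟩
    rintro Y ⟨y, hy, hy0⟩
    have h1 := H (Y.map P.subtype) (Submodule.map_subtype_le P Y) ⟨y, ⟨y, hy, rfl⟩, hy0⟩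
    refine Submodule.map_injective_of_injective P.injective_subtype ?_
    rw [h1, Submodule.map_top, Submodule.range_subtype]
  rintro Y hY ⟨y, hy, hy0⟩
  have hs : Function.Surjective (π.comp Y.subtype) := LinearMap.surjective_of_ne_zero fun h =>
    hy0 (LinearMap.congr_fun h ⟨y, hy⟩)
  obtain ⟨h, hh⟩ := Module.projective_lifting_property (π.comp Y.subtype) (π.comp e) hs
  let h' : Module.End R P₀ := Y.subtype.comp h
  have h1 : ∀ z, h' z ∈ Y := fun z => (h z).2
  have h2 : ∀ z ∈ P, π (h' z) = π z := fun z hz => by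
    have h3 : π (h' z) = π (e z) := LinearMap.congr_fun hh z
    rw [h3, he' z hz]
  obtain ⟨m, hm, hm1⟩ := ((LinearMap.eventually_isCompl_ker_pow_range_pow h').and
    (Filter.eventually_ge_atTop 1)).exists
  obtain ⟨m, rfl⟩ : ∃ m', m = m' + 1 := ⟨m - 1, by omega⟩
  have hle : LinearMap.range (h' ^ (m + 1)) ≤ Y := by
    rintro _ ⟨z, rfl⟩
    rw [pow_succ']
    exact h1 _
  have h3 : ∀ j, (h' ^ j) x₀ ∈ P ∧ π ((h' ^ j) x₀) = π x₀ := by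
    intro j
    induction j with
    | zero => exact ⟨hx₀, rfl⟩
    | succ j ih =>
      rw [pow_succ']
      exact ⟨hY (h1 _), (h2 _ ih.1).trans ih.2⟩
  have h4 := hmin (LinearMap.range (h' ^ (m + 1))) ⟨Submodule.projection _ _ hm.symm,
    fun x => Submodule.projection_apply_mem _ _, fun x hx =>
      Submodule.projection_apply_left hm.symm ⟨x, hx⟩, _, ⟨x₀, rfl⟩, by rw [(h3 _).2]; exact hπ₀⟩
  have h5 : LinearMap.range (h' ^ (m + 1)) = P := by
    by_contra hne
    exact h4 (lt_of_le_of_ne (hle.trans hY) hne)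
  exact le_antisymm hY (h5 ▸ hle)

/-! ### The simple tops of the standard modules -/

section rad

variable (k) (i : J n) (V : Type u) [AddCommGroup V] [Module k V] [Module (GroupAlg k i) V]

/-- The largest submodule of `C ⊗_B V` with vanishing vertex space of the object `i`. -/
def Delta.rad : Submodule (CoverAlgebra k n) (Delta k i V) where
  carrier := {x | ∀ c : CoverAlgebra k n, unit k i • c • x = 0}
  zero_mem' c := by rw [smul_zero, smul_zero]
  add_mem' {x y} hx hy c := by rw [smul_add, smul_add, hx, hy, add_zero]
  smul_mem' a x hx c := by rw [smul_smul c]; exact hx _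

variable {k i V}

theorem Delta.eq_zero_of_mem_rad {x : Delta k i V} (h : x ∈ rad k i V) (hx : x ∈ vtx k i (Delta k i V)) :
    x = 0 := by
  have := h 1
  rwa [one_smul, mem_vtx.1 hx] at this

theorem Delta.eq_zero_of_mem_vtx_of_le_rad {X : Submodule (CoverAlgebra k n) (Delta k i V)}
    (hX : X ≤ rad k i V) {m : J n} (hm : m.1 ≤ i.1) {x : X} (hx : x ∈ vtx k m X) : x = 0 := by
  refine Subtype.ext ?_
  rcases hm.lt_or_eq with h | h
  · exact Delta.eq_zero_of_lt h (mem_vtx_coe.1 hx)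
  · obtain rfl : m = i := Subtype.ext h
    exact eq_zero_of_mem_rad (hX x.2) (mem_vtx_coe.1 hx)

theorem Delta.eq_top_of_mk_unit_mem {X : Submodule (CoverAlgebra k n) (Delta k i V)}
    (h : ∀ v : V, mk (unit k i) v ∈ X) : X = ⊤ := by
  refine eq_top_iff.2 fun x _ => ?_
  induction x using Delta.induction with
  | h0 => exact X.zero_mem
  | hadd x y hx hy => exact X.add_mem (hx trivial) (hy trivial)
  | h m d v _ => rw [mk_eq_smul]; exact X.smul_mem _ (h v)

variable [IsScalarTower k (GroupAlg k i) V]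

theorem Delta.mk_unit_eq_zero {v : V} (h : (mk (unit k i) v : Delta k i V) = 0) : v = 0 := by
  rw [← top_mk_unit (k := k) (i := i) v, h, map_zero]

variable [IsSimpleModule (GroupAlg k i) V]

/-- A proper submodule meets the generating vertex space `V`, which is simple, trivially. -/
theorem Delta.le_rad {X : Submodule (CoverAlgebra k n) (Delta k i V)} (hX : X ≠ ⊤) :
    X ≤ rad k i V := by
  let W : Submodule (GroupAlg k i) V :=
    { carrier := {v | mk (unit k i) v ∈ X}
      zero_mem' := by
        show mk _ 0 ∈ X
        rw [mk_zero]; exact X.zero_mem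
      add_mem' {v w} hv hw := by
        show mk _ (v + w) ∈ X
        rw [mk_add]; exact X.add_mem hv hw
      smul_mem' a v hv := by
        show mk _ (a • v) ∈ X
        rw [← mk_permElt, ← permElt_mul_unit, ← smul_mk]
        exact X.smul_mem _ hv }
  rcases eq_bot_or_eq_top W with h | h
  · intro x hx c
    obtain ⟨v, hv⟩ := exists_eq_mk_unit (unit_smul_mem (k := k) i (c • x))
    have : v ∈ W := by
      show mk _ v ∈ X
      rw [← hv]
      exact X.smul_mem _ (X.smul_mem _ hx)
    rw [h, Submodule.mem_bot] at this
    rw [hv, this, mk_zero]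
  · exact absurd (eq_top_of_mk_unit_mem fun v => (h ▸ Submodule.mem_top : v ∈ W)) hX

theorem Delta.rad_ne_top : rad k i V ≠ ⊤ := fun h => by
  have := IsSimpleModule.nontrivial (GroupAlg k i) V
  obtain ⟨v, hv⟩ := exists_ne (0 : V)
  exact hv (mk_unit_eq_zero (eq_zero_of_mem_rad (h ▸ Submodule.mem_top) (mk_unit_mem v)))

theorem Delta.isCoatom_rad : IsCoatom (rad k i V) :=
  ⟨rad_ne_top, fun X hX => by
    by_contra h
    exact not_le_of_gt hX (le_rad h)⟩

theorem Delta.eq_rad_of_isCoatom {X : Submodule (CoverAlgebra k n) (Delta k i V)} (h : IsCoatom X) :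
    X = rad k i V := by
  by_contra hne
  exact rad_ne_top (h.2 _ (lt_of_le_of_ne (le_rad h.1) hne))

theorem Delta.jacobson_eq : Module.jacobson (CoverAlgebra k n) (Delta k i V) = rad k i V :=
  le_antisymm (sInf_le isCoatom_rad) (le_sInf fun _ hX => (eq_rad_of_isCoatom hX).ge)

variable (k i V) in
/-- The quotient of `C ⊗_B V` by its radical. -/
abbrev Delta.Top : Type u := Delta k i V ⧸ Module.jacobson (CoverAlgebra k n) (Delta k i V)

theorem Delta.isSimpleModule_top : IsSimpleModule (CoverAlgebra k n) (Top k i V) :=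
  isSimpleModule_iff_isCoatom.2 ((jacobson_eq (k := k) (i := i) (V := V)).symm ▸ isCoatom_rad)

variable (k i V) in
/-- The vertex space of the object `i` in the simple top of `C ⊗_B V` is `V`. -/
noncomputable def Delta.vtxTopEquiv : V ≃ₗ[GroupAlg k i] vtx k i (Top k i V) :=
  LinearEquiv.ofBijective
    ((vtxMap i (Submodule.mkQ (Module.jacobson (CoverAlgebra k n) (Delta k i V)))).comp
      (vtxEquiv k i V).toLinearMap) ⟨by
    refine (injective_iff_map_eq_zero _).2 fun v hv => mk_unit_eq_zero (k := k) (i := i) ?_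
    have h : Submodule.Quotient.mk (mk (unit k i) v : Delta k i V) = 0 := congrArg Subtype.val hv
    rw [Submodule.Quotient.mk_eq_zero, jacobson_eq] at h
    exact eq_zero_of_mem_rad h (mk_unit_mem v), by
    rintro ⟨x, hx⟩
    obtain ⟨y, hy, rfl⟩ := exists_mem_vtx (Submodule.mkQ_surjective _) hx
    obtain ⟨v, rfl⟩ := exists_eq_mk_unit hy
    exact ⟨v, rfl⟩⟩

end rad

theorem Delta.vtx_top_eq_zero {i : J n} {V : Type u} [AddCommGroup V] [Module k V]
    [Module (GroupAlg k i) V] {m : J n} (h : m.1 < i.1) {x : Top k i V}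
    (hx : x ∈ vtx k m (Top k i V)) : x = 0 := by
  obtain ⟨y, hy, rfl⟩ := exists_mem_vtx (Submodule.mkQ_surjective (Module.jacobson _ _)) hx
  rw [Delta.eq_zero_of_lt h hy, map_zero]

/-- The isomorphism of vertex spaces given by an isomorphism of modules. -/
noncomputable def vtxCongr {M N : Type*} [AddCommGroup M] [Module (CoverAlgebra k n) M]
    [AddCommGroup N] [Module (CoverAlgebra k n) N] (i : J n) (f : M ≃ₗ[CoverAlgebra k n] N) :
    vtx k i M ≃ₗ[GroupAlg k i] vtx k i N :=
  LinearEquiv.ofLinearMap (vtxMap i f.toLinearMap) (vtxMap i f.symm.toLinearMap)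
    (LinearMap.ext fun _ => Subtype.ext (f.apply_symm_apply _))
    (LinearMap.ext fun _ => Subtype.ext (f.symm_apply_apply _))

theorem Delta.le_of_topEquiv {i j : J n} {V W : Type u} [AddCommGroup V] [Module k V]
    [Module (GroupAlg k i) V] [IsScalarTower k (GroupAlg k i) V] [IsSimpleModule (GroupAlg k i) V]
    [AddCommGroup W] [Module k W] [Module (GroupAlg k j) W]
    (f : Top k i V ≃ₗ[CoverAlgebra k n] Top k j W) : j.1 ≤ i.1 := by
  by_contra h
  have := IsSimpleModule.nontrivial (GroupAlg k i) V
  obtain ⟨v, hv⟩ := exists_ne (0 : V)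
  refine hv ((vtxTopEquiv k i V).injective (Subtype.ext (f.injective ?_)))
  have h0 : f (vtxTopEquiv k i V v) = 0 := vtx_top_eq_zero (m := i) (not_le.1 h)
    (map_mem_vtx f.toLinearMap (vtxTopEquiv k i V v).2)
  rw [h0, map_zero]
  exact (map_zero f).symm

theorem isSimpleModule_quotient {i : ℕ} (q : Quotient (simpleSetoid (GroupAlg k i))) :
    IsSimpleModule (GroupAlg k i) (GroupAlg k i ⧸ q.out.1) :=
  isSimpleModule_iff_isCoatom.2 q.out.2

theorem isSimpleModule_simpleC (a : LabelC k n) : IsSimpleModule (CoverAlgebra k n) (simpleC k n a) := by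
  obtain ⟨⟨i, q⟩, ha⟩ := a
  have := isSimpleModule_quotient q
  exact Delta.isSimpleModule_top (k := k) (i := ⟨i, ha⟩) (V := GroupAlg k i ⧸ q.out.1)

theorem eq_of_quotientEquiv {i : ℕ} {q q' : Quotient (simpleSetoid (GroupAlg k i))}
    (e : (GroupAlg k i ⧸ q.out.1) ≃ₗ[GroupAlg k i] (GroupAlg k i ⧸ q'.out.1)) : q = q' := by
  rw [← Quotient.out_eq q, ← Quotient.out_eq q']
  exact Quotient.sound ⟨e⟩

/-- A simple module is determined by its lowest nonvanishing vertex space. -/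
theorem simpleC_irredundant {a b : LabelC k n} (e : Nonempty (simpleC k n a ≅ simpleC k n b)) :
    a = b := by
  obtain ⟨e⟩ := e
  obtain ⟨⟨i, q⟩, ha⟩ := a
  obtain ⟨⟨j, q'⟩, hb⟩ := b
  have := isSimpleModule_quotient q
  have := isSimpleModule_quotient q'
  have f : Delta.Top k (n := n) ⟨i, ha⟩ (GroupAlg k i ⧸ q.out.1) ≃ₗ[CoverAlgebra k n]
    Delta.Top k (n := n) ⟨j, hb⟩ (GroupAlg k j ⧸ q'.out.1) := e.toLinearEquiv
  obtain rfl : i = j := le_antisymm (Delta.le_of_topEquiv f.symm) (Delta.le_of_topEquiv f)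
  rw [eq_of_quotientEquiv (((Delta.vtxTopEquiv k (n := n) ⟨i, ha⟩ (GroupAlg k i ⧸ q.out.1)).trans
    (vtxCongr _ f)).trans (Delta.vtxTopEquiv k (n := n) ⟨i, hb⟩ (GroupAlg k i ⧸ q'.out.1)).symm)]

/-- A simple module is a quotient of the standard module given by a simple submodule of its lowest
nonvanishing vertex space. -/
theorem simpleC_complete (hss : ∀ l : J n, IsSemisimpleRing (GroupAlg k l))
    (S : ModuleCat.{u} (CoverAlgebra k n)) (hS : IsSimpleModule (CoverAlgebra k n) S) :
    ∃ a : LabelC k n, Nonempty (S ≅ simpleC k n a) := by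
  have := IsSimpleModule.nontrivial (CoverAlgebra k n) S
  obtain ⟨l, ⟨x, hx, hx0⟩, hl⟩ := exists_minimal_vtx k (n := n) S
  have := hss l
  have : Nontrivial (vtx k l S) := ⟨⟨x, hx⟩, 0, fun h => hx0 (congrArg Subtype.val h)⟩
  obtain ⟨W, hW⟩ := IsSemisimpleModule.exists_simple_submodule (GroupAlg k l) (vtx k l S)
  obtain ⟨q, ⟨e⟩⟩ := exists_label (k := k) l.1 W
  have := isSimpleModule_quotient q
  let D : Delta k l (GroupAlg k l ⧸ q.out.1) →ₗ[CoverAlgebra k n] S :=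
    Delta.ofVtx hl (W.subtype.comp e.toLinearMap)
  have hD : D ≠ 0 := fun h => by
    have := IsSimpleModule.nontrivial (GroupAlg k l) W
    obtain ⟨v, hv⟩ := exists_ne (0 : W)
    refine hv (Subtype.ext (Subtype.ext ?_))
    have h1 := (Delta.ofVtx_unit hl (f := W.subtype.comp e.toLinearMap) (e.symm v)).symm.trans
      (LinearMap.congr_fun h _)
    have h2 : (((e (e.symm v) : W) : vtx k l S) : S) = 0 := h1
    rw [e.apply_symm_apply] at h2
    exact h2
  have hsurj := LinearMap.surjective_of_ne_zero hD
  let f := D.quotKerEquivOfSurjective hsurj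
  have hker : IsCoatom (LinearMap.ker D) := isSimpleModule_iff_isCoatom.1 (IsSimpleModule.congr f)
  have h3 : LinearMap.ker D = Module.jacobson (CoverAlgebra k n) (Delta k l _) :=
    (Delta.eq_rad_of_isCoatom hker).trans Delta.jacobson_eq.symm
  exact ⟨⟨⟨l.1, q⟩, l.2⟩,
    ⟨(LinearEquiv.toModuleIso ((Submodule.quotEquivOfEq _ _ h3).symm.trans f)).symm⟩⟩

end

section

variable {k : Type u} [Field k] {n : ℕ}

/-! ### Projective covers -/

instance (i : J n) : IsNoetherian (CoverAlgebra k n) (col k n i) :=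
  inferInstanceAs (IsNoetherian (CoverAlgebra k n) (col k n i))

/-- The projective cover of the top of a standard module is a direct summand of a module `C e`. The
kernel of its projection to the standard module is generated by the lower vertex spaces. -/
theorem Delta.exists_projectiveCover (hss : ∀ l : J n, IsSemisimpleRing (GroupAlg k l)) (i : J n)
    (V : Type u) [AddCommGroup V] [Module k V] [Module (GroupAlg k i) V]
    [IsScalarTower k (GroupAlg k i) V] [IsSimpleModule (GroupAlg k i) V] :
    ∃ (P : ModuleCat.{u} (CoverAlgebra k n)) (q : P →ₗ[CoverAlgebra k n] Delta k i V),
      IsProjectiveCover (ModuleCat.ofHom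
        ((Submodule.mkQ (Module.jacobson (CoverAlgebra k n) (Delta k i V))).comp q)) ∧
      Function.Surjective q ∧ below k n i (LinearMap.ker q) = ⊤ ∧
      IsFilteredBy (fun Y => ∃ b : LabelC k n, b.1.size < i.1 ∧ Nonempty (Y ≅ deltaBar k n b))
        (ModuleCat.of (CoverAlgebra k n) (LinearMap.ker q)) := by
  set rad := Module.jacobson (CoverAlgebra k n) (Delta k i V) with hrad
  have hsimple : IsSimpleModule (CoverAlgebra k n) (Top k i V) := isSimpleModule_top
  obtain ⟨y₀, hy₀, hy₀'⟩ : ∃ y₀ : Top k i V, y₀ ≠ 0 ∧ y₀ ∈ vtx k i (Top k i V) := by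
    have := IsSimpleModule.nontrivial (GroupAlg k i) V
    obtain ⟨v, hv⟩ := exists_ne (0 : V)
    refine ⟨vtxTopEquiv k i V v, fun h => hv ((vtxTopEquiv k i V).injective (Subtype.ext ?_)),
      (vtxTopEquiv k i V v).2⟩
    rw [h, map_zero]
    rfl
  have hπ₀ : colMap (k := k) i y₀ ≠ 0 := fun h =>
    hy₀ ((mem_vtx.1 hy₀').symm.trans (LinearMap.congr_fun h ⟨unit k i, unit_mul_unit i⟩))
  obtain ⟨P, hP, hPn, π, hπ, hess⟩ := exists_minimal_summand hπ₀
  have hπs : Function.Surjective π := by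
    rw [← LinearMap.range_eq_top]
    exact (eq_bot_or_eq_top _).resolve_left fun h => hπ (LinearMap.range_eq_bot.1 h)
  have hgood : IsGood k n P := IsGood.of_projective P
  obtain ⟨q, hq⟩ := Module.projective_lifting_property rad.mkQ π rad.mkQ_surjective
  have hq' : ∀ x, rad.mkQ (q x) = π x := LinearMap.congr_fun hq
  have hqs : Function.Surjective q := by
    rw [← LinearMap.range_eq_top]
    by_contra h
    refine hπ (LinearMap.ext fun x => ?_)
    rw [← hq', Submodule.mkQ_apply, LinearMap.zero_apply, Submodule.Quotient.mk_eq_zero, hrad,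
      jacobson_eq]
    exact le_rad h ⟨x, rfl⟩
  have hle : below k n i P ≤ LinearMap.ker q := below_le fun m hm x hx =>
    Delta.eq_zero_of_lt hm (map_mem_vtx q hx)
  -- a section of `q` on the vertex space of `i`
  obtain ⟨s, hs⟩ : ∃ s : V →ₗ[GroupAlg k i] vtx k i P, ∀ v, q (s v) = mk (unit k i) v := by
    have := hss i
    have := Module.projective_of_isSemisimpleRing (GroupAlg k i) V
    have h1 : Function.Surjective (vtxMap i q) := fun ⟨x, hx⟩ => by
      obtain ⟨y, hy, e⟩ := exists_mem_vtx hqs hx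
      exact ⟨⟨y, hy⟩, Subtype.ext e⟩
    obtain ⟨s, hs⟩ := Module.projective_lifting_property (vtxMap i q)
      (vtxEquiv k i V).toLinearMap h1
    exact ⟨s, fun v => congrArg Subtype.val (LinearMap.congr_fun hs v)⟩
  have hN : ∀ m : J n, m.1 < i.1 → ∀ x ∈ vtx k m (P ⧸ below k n i P), x = 0 := by
    intro m hm x hx
    obtain ⟨y, hy, rfl⟩ := exists_mem_vtx (Submodule.mkQ_surjective _) hx
    exact (Submodule.Quotient.mk_eq_zero _).2 (mem_below hm hy)
  let ψ := Delta.ofVtx hN ((vtxMap i (Submodule.mkQ (below k n i P))).comp s)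
  let q' := (below k n i P).liftQ q hle
  have hψ : ∀ z, q' (ψ z) = z := by
    intro z
    induction z using Delta.induction with
    | h0 => rw [map_zero, map_zero]
    | hadd x y hx hy => rw [map_add, map_add, hx, hy]
    | h m d v _ =>
      rw [mk_eq_smul, map_smul, map_smul, ofVtx_unit, ← hs]
      rfl
  have hR : (LinearMap.range ψ).comap (below k n i P).mkQ = ⊤ := by
    obtain ⟨z, hz⟩ := rad.mkQ_surjective y₀
    obtain ⟨x, hx⟩ := (below k n i P).mkQ_surjective (ψ z)
    refine hess _ ⟨x, ⟨z, hx.symm⟩, ?_⟩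
    have h1 : q x = z := (congrArg q' hx).trans (hψ z)
    rw [← hq', h1, hz]
    exact hy₀
  have hker : LinearMap.ker q = below k n i P := by
    refine le_antisymm (fun x hx => ?_) hle
    obtain ⟨z, hz⟩ : x ∈ (LinearMap.range ψ).comap (below k n i P).mkQ := hR ▸ Submodule.mem_top
    have h1 : q x = z := (congrArg q' hz).symm.trans (hψ z)
    rw [LinearMap.mem_ker.1 hx] at h1
    rw [← h1, map_zero] at hz
    exact (Submodule.Quotient.mk_eq_zero _).1 hz.symm
  refine ⟨P, q, ⟨(IsProjective.iff_projective _).1 hP, ?_, ?_⟩, hqs, ?_, ?_⟩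
  · refine (ModuleCat.epi_iff_surjective _).2 ?_
    exact hq ▸ hπs
  · intro X g hg
    rw [ModuleCat.epi_iff_surjective] at hg ⊢
    rw [← LinearMap.range_eq_top]
    obtain ⟨x, hx⟩ := hg y₀
    refine hess _ ⟨g x, ⟨x, rfl⟩, ?_⟩
    rw [← hq']
    exact fun h => hy₀ (hx.symm.trans h)
  · rw [hker]
    exact below_below i.1
  · rw [hker]
    exact (hgood.below i.1).isFilteredBy hss (below_below i.1)

end

section

/-! ### Multiplicities of composition factors -/

section

variable {R : Type u} [Ring R] {Y S : ModuleCat.{u} R} [IsNoetherian R Y] [IsArtinian R Y]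

/-- The simple module `S` is no composition factor of `Y` if it is no quotient of a submodule. -/
theorem hasMultiplicity_zero
    (h : ∀ (X : ModuleCat.{u} R) (j : X ⟶ Y) (g : X ⟶ S), Mono j → ¬ Epi g) :
    HasMultiplicity Y S 0 := by
  obtain ⟨s, hs₀, hs₁⟩ := exists_compositionSeries_of_isNoetherian_isArtinian R Y
  refine ⟨s, hs₀, hs₁, Nat.card_eq_zero.2 (Or.inl ⟨fun ⟨t, ⟨e⟩⟩ => ?_⟩)⟩
  refine h (ModuleCat.of R (s t.succ)) (ModuleCat.ofHom (s t.succ).subtype)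
    (ModuleCat.ofHom (e.toLinearMap.comp (Submodule.mkQ _))) ?_ ?_
  · exact (ModuleCat.mono_iff_injective _).2 (Submodule.injective_subtype _)
  · exact (ModuleCat.epi_iff_surjective _).2 (e.surjective.comp (Submodule.mkQ_surjective _))

/-- If no proper submodule of `Y` maps onto the simple module `S`, then in every composition series
exactly the last factor can be isomorphic to `S`. -/
theorem hasMultiplicity_one (hS : IsSimpleModule R S) (p : Y ⟶ S) (hp : Epi p)
    (h : ∀ (X : ModuleCat.{u} R) (j : X ⟶ Y) (g : X ⟶ S), Mono j → Epi g → Epi j) :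
    HasMultiplicity Y S 1 := by
  have h' : ∀ (X : Submodule R Y) (g : X →ₗ[R] S), Function.Surjective g → X = ⊤ := by
    intro X g hg
    have := h (ModuleCat.of R X) (ModuleCat.ofHom X.subtype) (ModuleCat.ofHom g)
      ((ModuleCat.mono_iff_injective _).2 X.injective_subtype) ((ModuleCat.epi_iff_surjective _).2 hg)
    have h1 : Function.Surjective X.subtype := (ModuleCat.epi_iff_surjective _).1 this
    rw [← LinearMap.range_eq_top, Submodule.range_subtype] at h1
    exact h1
  have hps : Function.Surjective p.hom := (ModuleCat.epi_iff_surjective _).1 hp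
  obtain ⟨s, hs₀, hs₁⟩ := exists_compositionSeries_of_isNoetherian_isArtinian R Y
  have hlast : ∀ t : Fin s.length, s t.succ = ⊤ → t.succ = Fin.last _ := by
    intro t ht
    exact s.strictMono.injective (ht.trans hs₁.symm)
  have hlen : s.length ≠ 0 := by
    intro h0
    have h1 : RelSeries.head s = RelSeries.last s := congrArg s (Fin.ext (by simp [h0]))
    rw [hs₀, hs₁] at h1
    have := IsSimpleModule.nontrivial R S
    obtain ⟨x, hx⟩ := exists_ne (0 : S)
    obtain ⟨y, rfl⟩ := hps x
    have hy : y ∈ (⊥ : Submodule R Y) := h1 ▸ Submodule.mem_top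
    rw [Submodule.mem_bot] at hy
    exact hx (by rw [hy, map_zero])
  let t₀ : Fin s.length := ⟨s.length - 1, by omega⟩
  have ht₀ : t₀.succ = Fin.last _ := Fin.ext (by simp only [t₀, Fin.val_succ, Fin.val_last]; omega)
  refine ⟨s, hs₀, hs₁, Nat.card_eq_one_iff_unique.2 ⟨⟨fun ⟨t, ⟨e⟩⟩ ⟨t', ⟨e'⟩⟩ => ?_⟩, ⟨t₀, ?_⟩⟩⟩
  · refine Subtype.ext (Fin.succ_injective _ ?_)
    rw [hlast t (h' _ (e.toLinearMap.comp (Submodule.mkQ _))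
        (e.surjective.comp (Submodule.mkQ_surjective _))),
      hlast t' (h' _ (e'.toLinearMap.comp (Submodule.mkQ _))
        (e'.surjective.comp (Submodule.mkQ_surjective _)))]
  · have htop : s t₀.succ = ⊤ := (congrArg s ht₀).trans hs₁
    have hN : IsCoatom (s t₀.castSucc) := by
      rw [← covBy_top_iff, ← htop]
      exact s.step t₀
    have hle : s t₀.castSucc ≤ LinearMap.ker p.hom := by
      by_contra hle
      refine hN.1 (h' _ (p.hom.comp (Submodule.subtype _)) ?_)
      rw [← LinearMap.range_eq_top]
      refine (eq_bot_or_eq_top _).resolve_left fun hr => hle fun x hx => ?_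
      exact LinearMap.congr_fun (LinearMap.range_eq_bot.1 hr) ⟨x, hx⟩
    have hker : LinearMap.ker p.hom = s t₀.castSucc := by
      refine le_antisymm ?_ hle
      by_contra hne
      have h1 := hN.2 _ (lt_of_le_not_ge hle hne)
      have := IsSimpleModule.nontrivial R S
      obtain ⟨x, hx⟩ := exists_ne (0 : S)
      obtain ⟨y, rfl⟩ := hps x
      exact hx (LinearMap.mem_ker.1 (h1 ▸ Submodule.mem_top))
    let f : s t₀.succ →ₗ[R] S := p.hom.comp (Submodule.subtype _)
    have hf : Function.Surjective f := fun x => by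
      obtain ⟨y, hy⟩ := hps x
      exact ⟨⟨y, htop ▸ Submodule.mem_top⟩, hy⟩
    have hfk : (s t₀.castSucc).submoduleOf (s t₀.succ) = LinearMap.ker f := by
      rw [← hker]
      rfl
    exact ⟨(Submodule.quotEquivOfEq _ _ hfk).trans (f.quotKerEquivOfSurjective hf)⟩

end

/-- A criterion for quasi-heredity, in terms of morphisms in the category of modules. -/
theorem isQuasiHereditary_of {R : Type u} [Ring R] {ι : Type u} [PartialOrder ι]
    {L Δ : ι → ModuleCat.{u} R} (simple : ∀ a, IsSimpleModule R (L a))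
    (irredundant : ∀ a b, Nonempty (L a ≅ L b) → a = b)
    (complete : ∀ S : ModuleCat.{u} R, IsSimpleModule R S → ∃ a, Nonempty (S ≅ L a))
    (noetherian : ∀ a, IsNoetherian R (Δ a)) (artinian : ∀ a, IsArtinian R (Δ a))
    (top : ∀ a, ∃ p : Δ a ⟶ L a, Epi p)
    (section_eq : ∀ a b, ¬ b < a → ∀ (X : ModuleCat.{u} R) (j : X ⟶ Δ a) (g : X ⟶ L b),
      Mono j → Epi g → Epi j)
    (top_eq : ∀ a b (g : Δ a ⟶ L b), Epi g → a = b)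
    (projective : ∀ a, ∃ (P : ModuleCat.{u} R) (π : P ⟶ L a) (q : P ⟶ Δ a), IsProjectiveCover π ∧
      Function.Surjective q ∧ IsFilteredBy (fun Y => ∃ b, a < b ∧ Nonempty (Y ≅ Δ b))
        (ModuleCat.of R (LinearMap.ker q.hom))) :
    IsQuasiHereditary L Δ where
  simple := simple
  irredundant := irredundant
  complete := complete
  multiplicity_one a := by
    have := noetherian a
    have := artinian a
    obtain ⟨p, hp⟩ := top a
    exact hasMultiplicity_one (simple a) p hp (section_eq a a (lt_irrefl a))
  multiplicity_zero a b hab := by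
    have := noetherian a
    have := artinian a
    refine hasMultiplicity_zero fun X j g hj hg => hab ?_
    have hj' := section_eq a b (fun h => hab h.le) X j g hj hg
    have : IsIso j := isIso_of_mono_of_epi j
    exact (top_eq a b (inv j ≫ g) (epi_comp _ _)).ge
  projective := projective

variable {k : Type u} [Field k] {n : ℕ}

/-- The standard module is generated by any nonzero vector of `V`. -/
theorem Delta.finite {i : J n} {V : Type u} [AddCommGroup V] [Module k V] [Module (GroupAlg k i) V]
    [IsScalarTower k (GroupAlg k i) V] [IsSimpleModule (GroupAlg k i) V] :
    Module.Finite (CoverAlgebra k n) (Delta k i V) := by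
  have := IsSimpleModule.nontrivial (GroupAlg k i) V
  obtain ⟨v, hv⟩ := exists_ne (0 : V)
  refine ⟨⟨{mk (unit k i) v}, ?_⟩⟩
  by_contra h
  rw [Finset.coe_singleton] at h
  exact hv (mk_unit_eq_zero (eq_zero_of_mem_rad (le_rad h (Submodule.mem_span_singleton_self _))
    (mk_unit_mem v)))

theorem finite_deltaBar (a : LabelC k n) : Module.Finite (CoverAlgebra k n) (deltaBar k n a) := by
  obtain ⟨⟨i, q⟩, ha⟩ := a
  have := isSimpleModule_quotient q
  exact Delta.finite (k := k) (i := ⟨i, ha⟩) (V := GroupAlg k i ⧸ q.out.1)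

/-- No proper submodule of a standard module has a quotient `L b` unless `b` is smaller than the
label of the standard module, since the vertex spaces that generate `L b` vanish in the radical. -/
theorem epi_of_epi_simpleC {a b : LabelC k n} (h : b.1.size ≤ a.1.size)
    {X : ModuleCat.{u} (CoverAlgebra k n)} (j : X ⟶ deltaBar k n a) (g : X ⟶ simpleC k n b)
    (hj : Mono j) (hg : Epi g) : Epi j := by
  obtain ⟨⟨i, q⟩, ha⟩ := a
  obtain ⟨⟨l, q'⟩, hb⟩ := b
  have := isSimpleModule_quotient q
  have := isSimpleModule_quotient q'
  have hj' := (ModuleCat.mono_iff_injective _).1 hj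
  have hg' := (ModuleCat.epi_iff_surjective _).1 hg
  rw [ModuleCat.epi_iff_surjective]
  refine LinearMap.range_eq_top.1 ?_
  by_contra hr
  have hr' : LinearMap.range j.hom ≤ Delta.rad k ⟨i, ha⟩ (GroupAlg k i ⧸ q.out.1) :=
    Delta.le_rad (k := k) (i := ⟨i, ha⟩) (V := GroupAlg k i ⧸ q.out.1) hr
  have := IsSimpleModule.nontrivial (GroupAlg k l) (GroupAlg k l ⧸ q'.out.1)
  obtain ⟨v, hv⟩ := exists_ne (0 : GroupAlg k l ⧸ q'.out.1)
  let y := Delta.vtxTopEquiv k ⟨l, hb⟩ (GroupAlg k l ⧸ q'.out.1) v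
  obtain ⟨x, hx, hxy⟩ := exists_mem_vtx (f := g.hom) hg' y.2
  have hjx : j.hom x ∈ vtx k ⟨l, hb⟩ (deltaBar k n ⟨⟨i, q⟩, ha⟩) := map_mem_vtx j.hom hx
  have h0 : (⟨j.hom x, ⟨x, rfl⟩⟩ : LinearMap.range j.hom) = 0 :=
    Delta.eq_zero_of_mem_vtx_of_le_rad hr' (m := ⟨l, hb⟩) h (mem_vtx_coe.2 hjx)
  have hx0 : x = 0 := hj' ((congrArg Subtype.val h0).trans (map_zero j.hom).symm)
  rw [hx0, map_zero] at hxy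
  refine hv ((Delta.vtxTopEquiv k ⟨l, hb⟩ _).injective ?_)
  rw [map_zero]
  exact Subtype.ext hxy.symm

theorem eq_of_epi_simpleC {a b : LabelC k n} (g : deltaBar k n a ⟶ simpleC k n b) (hg : Epi g) :
    a = b := by
  have hs := isSimpleModule_simpleC b
  refine simpleC_irredundant ?_
  obtain ⟨⟨i, q⟩, ha⟩ := a
  have := isSimpleModule_quotient q
  have hg' := (ModuleCat.epi_iff_surjective _).1 hg
  let e := g.hom.quotKerEquivOfSurjective hg'
  have hc : IsCoatom (LinearMap.ker g.hom) :=
    isSimpleModule_iff_isCoatom.1 (IsSimpleModule.congr e)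
  have hk : Module.jacobson (CoverAlgebra k n) (deltaBar k n ⟨⟨i, q⟩, ha⟩) = LinearMap.ker g.hom :=
    (Delta.jacobson_eq (k := k) (i := ⟨i, ha⟩) (V := GroupAlg k i ⧸ q.out.1)).trans
      (Delta.eq_rad_of_isCoatom (k := k) (i := ⟨i, ha⟩) (V := GroupAlg k i ⧸ q.out.1) hc).symm
  exact ⟨((Submodule.quotEquivOfEq _ _ hk).trans e).toModuleIso⟩

theorem LabelC.lt_iff {a b : LabelC k n} : a < b ↔ b.1.size < a.1.size := Label.lt_iff k a.1 b.1

/-- The projective cover of a simple module, and its filtration by standard modules. -/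
theorem exists_projectiveCover (hss : ∀ l : J n, IsSemisimpleRing (GroupAlg k l)) (a : LabelC k n) :
    ∃ (P : ModuleCat.{u} (CoverAlgebra k n)) (π : P ⟶ simpleC k n a) (q : P ⟶ deltaBar k n a),
      IsProjectiveCover π ∧ Function.Surjective q ∧
      below k n a.1.size (LinearMap.ker q.hom) = ⊤ ∧
      IsFilteredBy (fun Y => ∃ b, a < b ∧ Nonempty (Y ≅ deltaBar k n b))
        (ModuleCat.of (CoverAlgebra k n) (LinearMap.ker q.hom)) := by
  obtain ⟨⟨i, r⟩, ha⟩ := a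
  have := isSimpleModule_quotient r
  obtain ⟨P, q, h1, h2, h3, h4⟩ :=
    Delta.exists_projectiveCover hss ⟨i, ha⟩ (GroupAlg k i ⧸ r.out.1)
  exact ⟨P, _, ModuleCat.ofHom q, h1, h2, h3,
    h4.imp fun Y ⟨b, hb, e⟩ => ⟨b, LabelC.lt_iff.2 hb, e⟩⟩

theorem isQuasiHereditary_simpleC (hss : ∀ l : J n, IsSemisimpleRing (GroupAlg k l)) :
    IsQuasiHereditary (simpleC k n) (deltaBar k n) := by
  refine isQuasiHereditary_of isSimpleModule_simpleC (fun a b => simpleC_irredundant)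
    (simpleC_complete hss) (fun a => ?_) (fun a => ?_)
    (fun a => ⟨ModuleCat.ofHom (Submodule.mkQ _),
      (ModuleCat.epi_iff_surjective _).2 (Submodule.mkQ_surjective _)⟩)
    (fun a b h X j g => epi_of_epi_simpleC (not_lt.1 fun h' => h (LabelC.lt_iff.2 h')) j g)
    (fun a b => eq_of_epi_simpleC) (fun a => ?_)
  · have := finite_deltaBar a
    infer_instance
  · have := finite_deltaBar a
    infer_instance
  · obtain ⟨P, π, q, h1, h2, -, h4⟩ := exists_projectiveCover hss a
    exact ⟨P, π, q, h1, h2, h4⟩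

/-- Maschke's theorem for the symmetric groups on at most `n` letters. -/
theorem isSemisimpleRing_groupAlg (p : ℕ) [CharP k p] (hp : p ∉ Set.Icc 2 n) (l : J n) :
    IsSemisimpleRing (GroupAlg k l) := by
  have hl : l.1 ≤ n := by
    obtain ⟨i, -, h⟩ := Finset.mem_image.1 l.2
    omega
  have : NeZero (Nat.card (Equiv.Perm (Fin l.1)) : k) := by
    refine ⟨fun h => ?_⟩
    rw [Nat.card_eq_fintype_card, Fintype.card_perm, Fintype.card_fin, CharP.cast_eq_zero_iff k p] at h
    rcases CharP.char_is_prime_or_zero k p with hp' | rfl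
    · exact hp ⟨hp'.two_le, ((hp'.dvd_factorial).1 h).trans hl⟩
    · exact Nat.factorial_ne_zero _ (Nat.eq_zero_of_zero_dvd h)
  infer_instance

end

section

/-! ### Transport to the Brauer algebra -/

section

variable {R R' : Type u} [Ring R] [Ring R'] (F : ModuleCat.{u} R ⥤ ModuleCat.{u} R')

theorem IsFilteredBy.map [F.Additive] [Limits.PreservesFiniteLimits F]
    [Limits.PreservesFiniteColimits F] {Q : ModuleCat.{u} R → Prop} {Q' : ModuleCat.{u} R' → Prop}
    (hQ : ∀ M, Q M → Q' (F.obj M)) {M : ModuleCat.{u} R} (hM : IsFilteredBy Q M) :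
    IsFilteredBy Q' (F.obj M) := by
  induction hM with
  | zero h => exact .zero (F.map_isZero h)
  | extend f g w hfg _ h'' ih =>
    exact .extend (F.map f) (F.map g) (by rw [← F.map_comp, w, F.map_zero]) (hfg.map_of_exact F) ih
      (hQ _ h'')

variable [F.IsEquivalence]

theorem IsProjectiveCover.map {P S : ModuleCat.{u} R} {π : P ⟶ S} (h : IsProjectiveCover π) :
    IsProjectiveCover (F.map π) where
  projective := (F.asEquivalence.map_projective_iff P).2 h.projective
  epi := by
    have := h.epi
    exact F.map_epi π
  essential X g hg := by
    let e := F.objObjPreimageIso X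
    have h1 : F.map (F.preimage (e.hom ≫ g) ≫ π) = e.hom ≫ g ≫ F.map π := by simp
    have h2 : Epi (F.map (F.preimage (e.hom ≫ g) ≫ π)) := h1 ▸ epi_comp _ _
    have h3 := h.essential _ (F.epi_of_epi_map h2)
    have h4 : g = e.inv ≫ F.map (F.preimage (e.hom ≫ g)) := by simp
    rw [h4]
    exact epi_comp _ _

theorem epi_of_epi_of_isEquivalence {Y S : ModuleCat.{u} R}
    (h : ∀ (X : ModuleCat.{u} R) (j : X ⟶ Y) (g : X ⟶ S), Mono j → Epi g → Epi j)
    (X : ModuleCat.{u} R') (j : X ⟶ F.obj Y) (g : X ⟶ F.obj S) (hj : Mono j) (hg : Epi g) :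
    Epi j := by
  let e := F.objObjPreimageIso X
  have h1 : Mono (F.map (F.preimage (e.hom ≫ j))) := by
    rw [F.map_preimage]
    exact mono_comp _ _
  have h2 : Epi (F.map (F.preimage (e.hom ≫ g))) := by
    rw [F.map_preimage]
    exact epi_comp _ _
  have h3 := h _ _ _ (F.mono_of_mono_map h1) (F.epi_of_epi_map h2)
  have h4 : j = e.inv ≫ F.map (F.preimage (e.hom ≫ j)) := by simp
  rw [h4]
  exact epi_comp _ _

theorem isSimpleModule_map_iff (S : ModuleCat.{u} R) :
    IsSimpleModule R' (F.obj S) ↔ IsSimpleModule R S := by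
  rw [← simple_iff_isSimpleModule', ← simple_iff_isSimpleModule', simple_obj_iff]

end

variable {k : Type u} [Field k] {n : ℕ}

/-- Extension of submodules from `e M` to `M` is strictly monotone, since `X = e C X` for a
submodule `X` of `e M`. -/
theorem strictMono_span_fixedPart (M : Type*) [AddCommGroup M] [Module (CoverAlgebra k n) M] :
    StrictMono fun X : Submodule (BrauerAlgebra k n) (fixedPart (k := k) (n := n) M) =>
      Submodule.span (CoverAlgebra k n) (Subtype.val '' (X : Set (fixedPart (k := k) (n := n) M))) := by
  have key : ∀ (X : Submodule (BrauerAlgebra k n) (fixedPart (k := k) (n := n) M)) (m : M),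
      m ∈ Submodule.span (CoverAlgebra k n) (Subtype.val '' (X : Set (fixedPart (k := k) (n := n) M))) →
      ∀ c : CoverAlgebra k n, ∃ x ∈ X, x.1 = idem k n • c • m := by
    intro X m hm
    induction hm using Submodule.span_induction with
    | mem m h =>
      obtain ⟨x, hx, rfl⟩ := h
      intro c
      have hc : idem k n * c * idem k n ∈ Set.range (corner k n) := by
        rw [corner_range]
        show idem k n * (idem k n * c * idem k n) * idem k n = _
        rw [mul_assoc, mul_assoc, mul_assoc, idem_mul_idem, ← mul_assoc, idem_mul_idem, ← mul_assoc]
      obtain ⟨a, ha⟩ := hc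
      refine ⟨a • x, X.smul_mem a hx, ?_⟩
      have h1 : idem k n • x.1 = x.1 := x.2
      show corner k n a • x.1 = _
      rw [ha, mul_assoc, mul_smul, mul_smul, h1]
    | zero => exact fun c => ⟨0, X.zero_mem, by rw [smul_zero, smul_zero]; rfl⟩
    | add m m' _ _ h h' =>
      intro c
      obtain ⟨x, hx, e⟩ := h c
      obtain ⟨x', hx', e'⟩ := h' c
      exact ⟨x + x', X.add_mem hx hx', by rw [smul_add, smul_add, ← e, ← e']; rfl⟩
    | smul r m _ h =>
      intro c
      obtain ⟨x, hx, e⟩ := h (c * r)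
      exact ⟨x, hx, by rw [e, mul_smul]⟩
  have hmono : ∀ X X' : Submodule (BrauerAlgebra k n) (fixedPart (k := k) (n := n) M),
      Submodule.span (CoverAlgebra k n) (Subtype.val '' (X : Set (fixedPart (k := k) (n := n) M))) ≤
        Submodule.span (CoverAlgebra k n) (Subtype.val '' (X' : Set (fixedPart (k := k) (n := n) M))) →
      X ≤ X' := by
    intro X X' h x hx
    obtain ⟨x', hx', e⟩ := key X' x.1 (h (Submodule.subset_span ⟨x, hx, rfl⟩)) 1
    have h1 : idem k n • x.1 = x.1 := x.2
    rw [one_smul, h1] at e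
    rwa [← Subtype.ext e]
  intro X X' h
  refine lt_of_le_not_ge (Submodule.span_mono (Set.image_mono h.le)) fun h' => ?_
  exact not_le_of_gt h (hmono _ _ h')

theorem isNoetherian_fixedPart (M : Type*) [AddCommGroup M] [Module (CoverAlgebra k n) M]
    [IsNoetherian (CoverAlgebra k n) M] :
    IsNoetherian (BrauerAlgebra k n) (fixedPart (k := k) (n := n) M) :=
  isNoetherian_iff'.2 (strictMono_span_fixedPart M).wellFoundedGT

theorem isArtinian_fixedPart (M : Type*) [AddCommGroup M] [Module (CoverAlgebra k n) M]
    [IsArtinian (CoverAlgebra k n) M] :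
    IsArtinian (BrauerAlgebra k n) (fixedPart (k := k) (n := n) M) :=
  (strictMono_span_fixedPart M).wellFoundedLT

/-- For odd `n` the quasi-hereditary structure is transported along the equivalence `F`; the two
sets of labels agree as `0` is not in `J n`. -/
theorem isQuasiHereditary_simpleA (hn : Odd n) (hss : ∀ l : J n, IsSemisimpleRing (GroupAlg k l)) :
    IsQuasiHereditary (simpleA k n) (deltaA k n) := by
  have := isEquivalence_coverFunctor k hn
  let F := coverFunctor k n
  have htoC : ∀ b : LabelC k n, ∃ a : LabelA k n, a.toC = b := by
    rintro ⟨b, hb⟩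
    refine ⟨⟨b, Finset.mem_erase.2 ⟨?_, hb⟩⟩, rfl⟩
    obtain ⟨i, hi, h⟩ := Finset.mem_image.1 hb
    have hi := Finset.mem_range.1 hi
    obtain ⟨m, hm⟩ := hn
    omega
  have hinj : ∀ a b : LabelA k n, a.toC = b.toC → a = b := fun a b h =>
    Subtype.ext (show a.toC.1 = b.toC.1 by rw [h])
  refine isQuasiHereditary_of (fun a => (isSimpleModule_map_iff F _).2 (isSimpleModule_simpleC _))
    (fun a b ⟨e⟩ => hinj _ _ (simpleC_irredundant ⟨F.preimageIso e⟩)) (fun S hS => ?_)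
    (fun a => ?_) (fun a => ?_) (fun a => ?_) (fun a b hab => ?_) (fun a b g hg => ?_) (fun a => ?_)
  · let e := F.objObjPreimageIso S
    have h1 : IsSimpleModule (BrauerAlgebra k n) (F.obj (F.objPreimage S)) :=
      IsSimpleModule.congr e.toLinearEquiv
    obtain ⟨b, ⟨f⟩⟩ := simpleC_complete hss _ ((isSimpleModule_map_iff F _).1 h1)
    obtain ⟨a, rfl⟩ := htoC b
    exact ⟨a, ⟨e.symm ≪≫ F.mapIso f⟩⟩
  · have := finite_deltaBar a.toC
    exact isNoetherian_fixedPart (deltaBar k n a.toC)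
  · have := finite_deltaBar a.toC
    exact isArtinian_fixedPart (deltaBar k n a.toC)
  · let p : deltaBar k n a.toC ⟶ simpleC k n a.toC := ModuleCat.ofHom (Submodule.mkQ _)
    have hp : Epi p := (ModuleCat.epi_iff_surjective _).2 (Submodule.mkQ_surjective _)
    exact ⟨F.map p, F.map_epi p⟩
  · have h : b.toC.1.size ≤ a.toC.1.size := not_lt.1 fun h' => hab ((Label.lt_iff k _ _).2 h')
    exact epi_of_epi_of_isEquivalence F fun X j g => epi_of_epi_simpleC h j g
  · let g' : F.obj (deltaBar k n a.toC) ⟶ F.obj (simpleC k n b.toC) := g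
    have hg' : Epi (F.map (F.preimage g')) := by
      rw [F.map_preimage]
      exact hg
    exact hinj _ _ (eq_of_epi_simpleC _ (F.epi_of_epi_map hg'))
  · obtain ⟨P, π, q, h1, h2, -, h4⟩ := exists_projectiveCover hss a.toC
    have hq : Epi q := (ModuleCat.epi_iff_surjective _).2 h2
    refine ⟨F.obj P, F.map π, F.map q, h1.map F, ?_, ?_⟩
    · exact (ModuleCat.epi_iff_surjective _).1 (F.map_epi q)
    · have h5 : IsFilteredBy (fun Y => ∃ b, a < b ∧ Nonempty (Y ≅ deltaA k n b))
          (F.obj (ModuleCat.of _ (LinearMap.ker q.hom))) := by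
        refine h4.map F fun M ⟨b, hb, ⟨e⟩⟩ => ?_
        obtain ⟨b, rfl⟩ := htoC b
        exact ⟨b, hb, ⟨F.mapIso e⟩⟩
      exact h5.of_iso (F.mapIso (ModuleCat.kernelIsoKer q).symm ≪≫ Limits.PreservesKernel.iso F q ≪≫
        ModuleCat.kernelIsoKer (F.map q))

end

section

variable {k : Type u} [Field k] {n : ℕ}

/-! ### Homomorphisms and extensions between standard modules -/

theorem Delta.hom_ext {i : J n} {V N : Type u} [AddCommGroup V] [Module k V]
    [Module (GroupAlg k i) V] [AddCommGroup N] [Module (CoverAlgebra k n) N]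
    {f g : Delta k i V →ₗ[CoverAlgebra k n] N} (h : ∀ v, f (mk (unit k i) v) = g (mk (unit k i) v)) :
    f = g := by
  refine LinearMap.ext fun x => ?_
  induction x using Delta.induction with
  | h0 => rw [map_zero, map_zero]
  | hadd x y hx hy => rw [map_add, map_add, hx, hy]
  | h m d v _ => rw [mk_eq_smul, map_smul, map_smul, h]

/-- A nonzero homomorphism between standard modules with `a.size ≤ b.size` does not map the
generating vertex space into the radical, so it is surjective and the tops agree. -/
theorem deltaBar_hom_subsingleton {a b : LabelC k n} (h : ¬ a ≤ b) :
    Subsingleton (deltaBar k n a ⟶ deltaBar k n b) := by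
  have hsize : a.1.size ≤ b.1.size := not_lt.1 fun h' => h (LabelC.lt_iff.2 h').le
  have hne : a ≠ b := fun e => h e.le
  refine subsingleton_of_forall_eq 0 fun f => ?_
  let p : deltaBar k n b ⟶ simpleC k n b := ModuleCat.ofHom (Submodule.mkQ _)
  have hp : Epi p := (ModuleCat.epi_iff_surjective _).2 (Submodule.mkQ_surjective _)
  by_contra hf
  refine hne (eq_of_epi_simpleC (f ≫ p) ?_)
  suffices Epi f from epi_comp f p
  obtain ⟨⟨i, q⟩, ha⟩ := a
  obtain ⟨⟨l, q'⟩, hb⟩ := b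
  have := isSimpleModule_quotient q'
  rw [ModuleCat.epi_iff_surjective]
  refine LinearMap.range_eq_top.1 ?_
  by_contra hr
  have hr' : LinearMap.range f.hom ≤ Delta.rad k ⟨l, hb⟩ (GroupAlg k l ⧸ q'.out.1) :=
    Delta.le_rad (k := k) (i := ⟨l, hb⟩) (V := GroupAlg k l ⧸ q'.out.1) hr
  refine hf (ModuleCat.hom_ext ?_)
  refine Delta.hom_ext (k := k) (i := ⟨i, ha⟩) (V := GroupAlg k i ⧸ q.out.1) fun v => ?_
  have h0 : (⟨f.hom _, ⟨_, rfl⟩⟩ : LinearMap.range f.hom) = 0 :=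
    Delta.eq_zero_of_mem_vtx_of_le_rad hr' (m := ⟨i, ha⟩) hsize
      (mem_vtx_coe.2 (map_mem_vtx f.hom (Delta.mk_unit_mem (k := k) (i := ⟨i, ha⟩) v)))
  exact congrArg Subtype.val h0

/-- By the lemma of Schur, an endomorphism acts by a scalar on the generating vertex space `V`. -/
theorem Delta.exists_eq_algebraMap_smul [IsAlgClosed k] {i : J n} {V : Type u} [AddCommGroup V]
    [Module k V] [Module (GroupAlg k i) V] [IsScalarTower k (GroupAlg k i) V] [FiniteDimensional k V]
    [IsSimpleModule (GroupAlg k i) V] (f : Delta k i V →ₗ[CoverAlgebra k n] Delta k i V) :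
    ∃ r : k, ∀ x, f x = algebraMap k (CoverAlgebra k n) r • x := by
  let φ : V →ₗ[GroupAlg k i] V :=
    (vtxEquiv k i V).symm.toLinearMap.comp ((vtxMap i f).comp (vtxEquiv k i V).toLinearMap)
  obtain ⟨r, hr⟩ := (IsSimpleModule.algebraMap_end_bijective_of_isAlgClosed k).2 φ
  refine ⟨r, fun x => ?_⟩
  have h : ∀ v, f (mk (unit k i) v) = algebraMap k (CoverAlgebra k n) r • mk (unit k i) v := by
    intro v
    have h1 : vtxEquiv k i V (r • v) = vtxMap i f (vtxEquiv k i V v) :=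
      (congrArg (vtxEquiv k i V) (LinearMap.congr_fun hr v)).trans (LinearEquiv.apply_symm_apply _ _)
    have h2 : (mk (unit k i) (r • v) : Delta k i V) = f (mk (unit k i) v) := congrArg Subtype.val h1
    rw [← h2, smul_mk, ← mk_smul_left, Algebra.algebraMap_eq_smul_one, smul_mul_assoc, one_mul]
  induction x using Delta.induction with
  | h0 => rw [map_zero, smul_zero]
  | hadd x y hx hy => rw [map_add, smul_add, hx, hy]
  | h m d v _ =>
    rw [mk_eq_smul, map_smul, h, smul_smul, smul_smul, Algebra.commutes]

theorem nontrivial_deltaBar (a : LabelC k n) : Nontrivial (deltaBar k n a) := by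
  have := isSimpleModule_simpleC a
  have : Nontrivial (deltaBar k n a ⧸ Module.jacobson (CoverAlgebra k n) (deltaBar k n a)) :=
    IsSimpleModule.nontrivial (CoverAlgebra k n) (simpleC k n a)
  exact (Submodule.mkQ_surjective (Module.jacobson (CoverAlgebra k n) (deltaBar k n a))).nontrivial

theorem bijective_algebraMap_end_deltaBar [IsAlgClosed k] (a : LabelC k n) :
    Function.Bijective (algebraMap k (End (deltaBar k n a))) := by
  have := nontrivial_deltaBar a
  have : Nontrivial (End (deltaBar k n a)) := by
    obtain ⟨x, hx⟩ := exists_ne (0 : deltaBar k n a)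
    exact ⟨1, 0, fun h => hx (LinearMap.congr_fun (congrArg ModuleCat.Hom.hom h) x)⟩
  refine ⟨(algebraMap k (End (deltaBar k n a))).injective, fun f => ?_⟩
  obtain ⟨⟨i, q⟩, ha⟩ := a
  have := isSimpleModule_quotient q
  obtain ⟨r, hr⟩ := Delta.exists_eq_algebraMap_smul (k := k) (i := ⟨i, ha⟩)
    (V := GroupAlg k i ⧸ q.out.1) f.hom
  exact ⟨r, ModuleCat.hom_ext (LinearMap.ext fun x => (hr x).symm)⟩

/-- The kernel of the projective cover of `deltaBar k n a` is generated by vertex spaces that vanish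
in `deltaBar k n b`. -/
theorem subsingleton_ext_deltaBar (hss : ∀ l : J n, IsSemisimpleRing (GroupAlg k l))
    {a b : LabelC k n} (h : ¬ a < b) :
    Subsingleton (Abelian.Ext (deltaBar k n a) (deltaBar k n b) 1) := by
  have hsize : a.1.size ≤ b.1.size := not_lt.1 fun h' => h (LabelC.lt_iff.2 h')
  obtain ⟨P, π, q, h1, h2, h3, -⟩ := exists_projectiveCover hss a
  have hP := h1.projective
  let f : ModuleCat.of (CoverAlgebra k n) (LinearMap.ker q.hom) ⟶ P :=
    ModuleCat.ofHom (Submodule.subtype _)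
  have w : f ≫ q = 0 := by
    ext x
    exact x.2
  have hT : (ShortComplex.mk f q w).ShortExact :=
    { exact := (ShortComplex.moduleCat_exact_iff _).2 fun x hx => ⟨⟨x, hx⟩, rfl⟩
      mono_f := (ModuleCat.mono_iff_injective _).2 (Submodule.injective_subtype _)
      epi_g := (ModuleCat.epi_iff_surjective _).2 h2 }
  refine subsingleton_ext_one hT fun g => ⟨0, ?_⟩
  rw [Limits.comp_zero]
  refine ModuleCat.hom_ext (LinearMap.ext fun x => ?_)
  have hx : x ∈ below k n a.1.size (LinearMap.ker q.hom) := h3 ▸ Submodule.mem_top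
  have hle : below k n a.1.size (LinearMap.ker q.hom) ≤ LinearMap.ker g.hom := by
    refine below_le fun m hm y hy => ?_
    obtain ⟨⟨l, r⟩, hb⟩ := b
    exact Delta.eq_zero_of_lt (k := k) (i := ⟨l, hb⟩) (V := GroupAlg k l ⧸ r.out.1)
      (hm.trans_le hsize) (map_mem_vtx g.hom hy)
  exact (LinearMap.mem_ker.1 (hle hx)).symm

/-! ### The cover and the Schur algebra -/

/-- Projective modules are good, hence have standard filtrations. -/
theorem isDeltaFiltered_of_projective (hss : ∀ l : J n, IsSemisimpleRing (GroupAlg k l))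
    (Q : ModuleCat.{u} (CoverAlgebra k n)) (hQ : Projective Q) (hf : Module.Finite (CoverAlgebra k n) Q) :
    IsDeltaFiltered (deltaBar k n) Q := by
  have : Module.Projective (CoverAlgebra k n) Q := (IsProjective.iff_projective _).2 hQ
  exact ((IsGood.of_projective Q).isFilteredBy hss (below_eq_top n.lt_succ_self)).imp
    fun Y ⟨b, _, e⟩ => ⟨b, e⟩

theorem isOneCover_deltaBar (hn : Odd n ∨ Even n ∧ 6 ≤ n)
    (hss : ∀ l : J n, IsSemisimpleRing (GroupAlg k l)) : IsOneCover k n (deltaBar k n) where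
  corner_injective := corner_injective
  corner_range := corner_range
  projective P Q _ _ hQ hf := bijective_map (coverAdjunction k n)
    (((isDeltaFiltered_of_projective hss Q hQ hf).isClosedTo hn).mono one_le_two) P
  faithful M _ _ hN _ hi := bijective_mapExtAddHom_coverFunctor (hN.isClosedTo hn) M hi

theorem coverFunctor_map_algebraMap (X : ModuleCat.{u} (CoverAlgebra k n)) (r : k) :
    (coverFunctor k n).map (X := X) (Y := X) (algebraMap k (End X) r) =
      algebraMap k (End ((coverFunctor k n).obj X)) r :=
  ModuleCat.hom_ext (LinearMap.ext fun m =>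
    Subtype.ext (algebraMap_smul_fixed k n X r m).symm)

/-- The right adjoint of the cover functor preserves standard filtrations: it is left exact, and
right exact on the relevant sequences since the standard modules are closed. -/
theorem isDeltaFiltered_coverAdjoint (hn : Odd n ∨ Even n ∧ 6 ≤ n)
    {Y : ModuleCat.{u} (BrauerAlgebra k n)}
    (hY : IsDeltaFiltered (fun a => (coverFunctor k n).obj (deltaBar k n a)) Y) :
    IsDeltaFiltered (deltaBar k n) ((coverAdjoint k n).obj Y) := by
  let adj := coverAdjunction k n
  have : (coverAdjoint k n).Additive := adj.right_adjoint_additive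
  have : Limits.PreservesLimitsOfSize.{0, 0} (coverAdjoint k n) := adj.rightAdjoint_preservesLimits
  induction hY with
  | zero h => exact .zero ((coverAdjoint k n).map_isZero h)
  | @extend Y' Y Y'' f g w hfg _ h'' ih =>
    obtain ⟨b, ⟨e⟩⟩ := h''
    have hepi : Epi ((coverAdjoint k n).map g) :=
      epi_map_rightAdjoint adj hfg (ih.isClosedTo hn) (asIso (adj.counit.app Y')).symm
    have hm := hfg.mono_f
    have hT : ((ShortComplex.mk f g w).map (coverAdjoint k n)).ShortExact :=
      { exact := hfg.exact.map_of_mono_of_preservesKernel _ hm inferInstance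
        mono_f := (coverAdjoint k n).map_mono f
        epi_g := hepi }
    have := isIso_unit adj ((isClosedTo_deltaBar hn b).mono one_le_two)
    exact .extend _ _ _ hT ih
      ⟨b, ⟨(coverAdjoint k n).mapIso e ≪≫ (asIso (adj.unit.app (deltaBar k n b))).symm⟩⟩

theorem isSchurAlgebra_deltaBar [IsAlgClosed k] (hn : Odd n ∨ Even n ∧ 6 ≤ n)
    (hss : ∀ l : J n, IsSemisimpleRing (GroupAlg k l)) : IsSchurAlgebra k n (deltaBar k n) where
  standardSystem :=
    { endo := fun a => by
        have h1 := bijective_map (coverAdjunction k n)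
          ((isClosedTo_deltaBar hn a).mono one_le_two) (deltaBar k n a)
        have h2 := h1.comp (bijective_algebraMap_end_deltaBar a)
        exact (funext fun r => coverFunctor_map_algebraMap (deltaBar k n a) r) ▸ h2
      hom := fun a b h => by
        have := deltaBar_hom_subsingleton h
        exact (bijective_map (coverAdjunction k n)
          ((isClosedTo_deltaBar hn b).mono one_le_two) (deltaBar k n a)).2.subsingleton
      ext := fun a b h => by
        have := subsingleton_ext_deltaBar hss h
        exact (bijective_mapExtAddHom_coverFunctor (isClosedTo_deltaBar hn b)
          (deltaBar k n a) le_rfl).2.subsingleton }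
  image M hM := hM.map _ fun Y ⟨a, ⟨e⟩⟩ => ⟨a, ⟨(coverFunctor k n).mapIso e⟩⟩
  fullyFaithful M N _ hN :=
    bijective_map (coverAdjunction k n) ((hN.isClosedTo hn).mono one_le_two) M
  essSurj Y hY := ⟨(coverAdjoint k n).obj Y, isDeltaFiltered_coverAdjoint hn hY,
    ⟨asIso ((coverAdjunction k n).counit.app Y)⟩⟩
  exact _ h₁ h₂ h₃ := ⟨fun h => h.map_of_exact _, shortExact_of_map (coverAdjunction k n)
    (h₁.isClosedTo hn) (h₂.isClosedTo hn) (h₃.isClosedTo hn)⟩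

end

end Periplectic

open Periplectic

theorem mainTheorem4 {k : Type u} [Field k] [IsAlgClosed k] (p : ℕ) [CharP k p] (n : ℕ)
    (hn : 2 ≤ n) :
    (Odd n →
      (∃ e : MoritaEquivalence k (CoverAlgebra k n) (BrauerAlgebra k n),
        Nonempty (e.eqv.functor ≅ coverFunctor k n)) ∧
      (p ∉ Set.Icc 2 n → IsQuasiHereditary (simpleA k n) (deltaA k n))) ∧
    (Even n → n ≠ 2 → n ≠ 4 →
      ∀ M N : ModuleCat.{u} (CoverAlgebra k n),
        IsSummandFiltered (deltaBarSum k n) M → IsSummandFiltered (deltaBarSum k n) N →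
          ∀ i ≤ 1, Function.Bijective ((coverFunctor k n).mapExtAddHom M N i)) ∧
    (n ≠ 2 → n ≠ 4 → p ∉ Set.Icc 2 n →
      IsQuasiHereditary (simpleC k n) (deltaBar k n) ∧
      IsOneCover k n (deltaBar k n) ∧
      IsSchurAlgebra k n (deltaBar k n)) := by
  refine ⟨fun ho => ⟨exists_moritaEquivalence k ho, fun hp =>
    isQuasiHereditary_simpleA ho (isSemisimpleRing_groupAlg p hp)⟩, fun he h2 h4 M N _ hN i hi => ?_,
    fun h2 h4 hp => ?_⟩
  · have h6 : 6 ≤ n := by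
      obtain ⟨m, rfl⟩ := he
      omega
    exact bijective_mapExtAddHom_coverFunctor (hN.isClosedTo (Or.inr ⟨he, h6⟩)) M hi
  · have h : Odd n ∨ Even n ∧ 6 ≤ n := by
      rcases Nat.even_or_odd n with he | ho
      · refine Or.inr ⟨he, ?_⟩
        obtain ⟨m, rfl⟩ := he
        omega
      · exact Or.inl ho
    have hss := isSemisimpleRing_groupAlg (k := k) p hp
    exact ⟨isQuasiHereditary_simpleC hss, isOneCover_deltaBar h hss, isSchurAlgebra_deltaBar h hss⟩
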